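/- Model of computation: a word RAM, i.e. a fixed finite program with finitely many registers and random-access arrays of words; copying, addition, truncated subtraction, reading or writing an array entry, and comparing two words cost one step each. All graphs are finite and simple. A graph $G$ with $n$ vertices and $m$ edges is given by adjacency lists, together with an integer $k$; a $k$-colouring of $G$ is a map $\phi:V(G)\to\{1,\dots,k\}$ with $\phi(u)\ne\phi(v)$ for every edge $uv$. Theorem. There is an algorithm (one program, using words of $O(\log(n+m+k))$ bits) with the following property. For all integers $k\ge 1$ and $p\ge 0$, and every graph $G$ with $n\ge 1$ vertices and $m$ edges that has at most $p$ vertices of degree more than $k$, the algorithm, given $G$ and $k$, outputs a $k$-colouring of $G$ or determines that no such colouring exists, in time $\min\{k^p,p^p\}\cdot O(n+m)$, where $0^0=1$ and the constant in $O(\cdot)$ is absolute. Consequently, the problem "given a graph $G$ and an integer $k\ge 0$, is $G$ $k$-colourable?", where $k$ is part of the input, is fixed-parameter tractable when parameterized by the number $q$ of vertices of $G$ of degree more than $k$: it can be decided in at most $f(q)\cdot \ell^{c}$ steps, where $f:\mathbb{N}\to\mathbb{N}$ is computable, $c$ is a constant, and $\ell = n+m+\log k$ is, up to a polynomial, the length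 of the input (with $\log k$ the number of binary digits of $k$, and $1$ added so that $\ell\geq 1$), using words of $O(\log(f(q)\cdot(n+m+k)))$ bits. -/

import Mathlib

namespace WordRAM

/-! ### The machine model

A word RAM with a fixed, finite program, given with structured control flow. The program uses
finitely many registers and finitely many random-access arrays of words. Every elementary
instruction and every evaluation of a test costs one step. A word holds a natural number less
than the bound `B`; an instruction that would write a number that does not fit into a word has
no execution. The only arithmetic is addition and truncated subtraction. -/

/-- Contents of the registers and of the arrays: `vars x` is register `x`, and `arrs a i` is
entry `i` of array `a`. -/
structure State where
  vars : ℕ → ℕ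
  arrs : ℕ → ℕ → ℕ

/-- The state after writing `v` into register `x`. -/
def State.setVar (s : State) (x v : ℕ) : State :=
  { s with vars := Function.update s.vars x v }

/-- The state after writing `v` into entry `i` of array `a`. -/
def State.setArr (s : State) (a i v : ℕ) : State :=
  { s with arrs := Function.update s.arrs a (Function.update (s.arrs a) i v) }

/-- An operand: a constant or a register. -/
inductive Operand where
  | const (c : ℕ)
  | var (x : ℕ)

/-- The value of an operand. -/
def Operand.val (s : State) : Operand → ℕ
  | .const c => c
  | .var x => s.vars x

/-- Comparisons of two operands. -/
inductive Test where
  | eq (o₁ o₂ : Operand)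
  | ne (o₁ o₂ : Operand)
  | lt (o₁ o₂ : Operand)
  | le (o₁ o₂ : Operand)

/-- The truth of a comparison in a state. -/
def Test.Holds (s : State) : Test → Prop
  | .eq o₁ o₂ => o₁.val s = o₂.val s
  | .ne o₁ o₂ => o₁.val s ≠ o₂.val s
  | .lt o₁ o₂ => o₁.val s < o₂.val s
  | .le o₁ o₂ => o₁.val s ≤ o₂.val s

/-- Programs. -/
inductive Prog where
  /-- do nothing -/
  | skip
  /-- `x := o` -/
  | set (x : ℕ) (o : Operand)
  /-- `x := o₁ + o₂` -/
  | add (x : ℕ) (o₁ o₂ : Operand)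
  /-- `x := o₁ - o₂`, or `0` if `o₁ < o₂` -/
  | sub (x : ℕ) (o₁ o₂ : Operand)
  /-- `x := a[i]` -/
  | load (x a : ℕ) (i : Operand)
  /-- `a[i] := o` -/
  | store (a : ℕ) (i o : Operand)
  /-- sequential composition -/
  | seq (P Q : Prog)
  /-- if `b` then `P` else `Q` -/
  | branch (b : Test) (P Q : Prog)
  /-- while `b` do `P` -/
  | loop (b : Test) (P : Prog)

/-- `Runs B P s t s'`: with words that hold the numbers less than `B`, the program `P`, started in
state `s`, halts in state `s'` after exactly `t` steps. -/
inductive Runs (B : ℕ) : Prog → State → ℕ → State → Prop where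
  | skip (s : State) : Runs B .skip s 1 s
  | set (s : State) (x : ℕ) (o : Operand) (h : o.val s < B) :
      Runs B (.set x o) s 1 (s.setVar x (o.val s))
  | add (s : State) (x : ℕ) (o₁ o₂ : Operand) (h : o₁.val s + o₂.val s < B) :
      Runs B (.add x o₁ o₂) s 1 (s.setVar x (o₁.val s + o₂.val s))
  | sub (s : State) (x : ℕ) (o₁ o₂ : Operand) (h : o₁.val s - o₂.val s < B) :
      Runs B (.sub x o₁ o₂) s 1 (s.setVar x (o₁.val s - o₂.val s))
  | load (s : State) (x a : ℕ) (i : Operand) (h : s.arrs a (i.val s) < B) :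
      Runs B (.load x a i) s 1 (s.setVar x (s.arrs a (i.val s)))
  | store (s : State) (a : ℕ) (i o : Operand) (h : o.val s < B) :
      Runs B (.store a i o) s 1 (s.setArr a (i.val s) (o.val s))
  | seq {P Q : Prog} {s s' s'' : State} {t t' : ℕ}
      (h : Runs B P s t s') (h' : Runs B Q s' t' s'') :
      Runs B (.seq P Q) s (t + t') s''
  | branch_true {b : Test} {P Q : Prog} {s s' : State} {t : ℕ}
      (hb : b.Holds s) (h : Runs B P s t s') :
      Runs B (.branch b P Q) s (t + 1) s'
  | branch_false {b : Test} {P Q : Prog} {s s' : State} {t : ℕ}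
      (hb : ¬ b.Holds s) (h : Runs B Q s t s') :
      Runs B (.branch b P Q) s (t + 1) s'
  | loop_true {b : Test} {P : Prog} {s s' s'' : State} {t t' : ℕ}
      (hb : b.Holds s) (h : Runs B P s t s') (h' : Runs B (.loop b P) s' t' s'') :
      Runs B (.loop b P) s (t + t' + 1) s''
  | loop_false {b : Test} {P : Prog} {s : State} (hb : ¬ b.Holds s) :
      Runs B (.loop b P) s 1 s

/-! ### Inputs and outputs -/

/-- `IsInput G k s`: the initial state `s` presents the graph `G` on the vertices `0, …, n - 1` by
adjacency lists, together with the number `k`. Registers `0` and `1` hold `n` and `k`. The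
neighbours of the vertex `v` are listed, each exactly once and in an arbitrary order, in the
entries `j` of array `1` with `off v ≤ j < off (v + 1)`, where `off` is array `0` and `off 0 = 0`.
Everything else is `0`. -/
structure IsInput {n : ℕ} (G : SimpleGraph (Fin n)) (k : ℕ) (s : State) : Prop where
  order : s.vars 0 = n
  colours : s.vars 1 = k
  vars_rest : ∀ x, 2 ≤ x → s.vars x = 0
  off_zero : s.arrs 0 0 = 0
  off_mono : ∀ v : Fin n, s.arrs 0 (v : ℕ) ≤ s.arrs 0 ((v : ℕ) + 1)
  off_rest : ∀ j, n < j → s.arrs 0 j = 0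
  nbrs : ∀ v : Fin n, Set.BijOn (s.arrs 1)
    (Set.Ico (s.arrs 0 (v : ℕ)) (s.arrs 0 ((v : ℕ) + 1)))
    ((fun w : Fin n => (w : ℕ)) '' G.neighborSet v)
  nbrs_rest : ∀ j, s.arrs 0 n ≤ j → s.arrs 1 j = 0
  arrs_rest : ∀ a, 2 ≤ a → ∀ j, s.arrs a j = 0

/-- `OutputsColouring G k s`: in the final state `s`, either register `0` holds `1` and array `0`
holds a proper colouring of `G` with the colours `1, …, k`, or register `0` holds `0` and `G` has
no such colouring. -/
def OutputsColouring {n : ℕ} (G : SimpleGraph (Fin n)) (k : ℕ) (s : State) : Prop :=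
  (s.vars 0 = 1 ∧ ∃ φ : G.Coloring (Fin k), ∀ v : Fin n, s.arrs 0 (v : ℕ) = (φ v : ℕ) + 1) ∨
    (s.vars 0 = 0 ∧ ¬ G.Colorable k)

end WordRAM

open scoped Classical in
/-- The number `m` of edges. -/
noncomputable def numEdges {n : ℕ} (G : SimpleGraph (Fin n)) : ℕ :=
  G.edgeFinset.card

open scoped Classical in
/-- The number of vertices of degree more than `k`. -/
noncomputable def numBigVertices {n : ℕ} (G : SimpleGraph (Fin n)) (k : ℕ) : ℕ :=
  (Finset.univ.filter fun v : Fin n => k < G.degree v).card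

/-- Fixed-parameter tractability of the decision problem `Q`, whose instances are the pairs of a
finite graph and a natural number `k` (written in binary), with the parameter `κ`: some program
decides every instance in at most `f (κ) * (length of the instance) ^ c` steps, where `f` is
computable and `c` is constant. The words have `O(log (f (κ) * (n + m + k)))` bits. -/
def IsFPT (Q : ∀ n : ℕ, SimpleGraph (Fin n) → ℕ → Prop)
    (κ : ∀ n : ℕ, SimpleGraph (Fin n) → ℕ → ℕ) : Prop :=
  ∃ (P : WordRAM.Prog) (f : ℕ → ℕ) (c : ℕ), Computable f ∧
    ∀ (n : ℕ) (G : SimpleGraph (Fin n)) (k : ℕ) (s : WordRAM.State), WordRAM.IsInput G k s →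
      ∃ (t : ℕ) (s' : WordRAM.State),
        WordRAM.Runs (f (κ n G k) * (n + numEdges G + k + 2) ^ c) P s t s' ∧
        t ≤ f (κ n G k) * (n + numEdges G + Nat.size k + 1) ^ c ∧
        ((s'.vars 0 = 1 ∧ Q n G k) ∨ (s'.vars 0 = 0 ∧ ¬ Q n G k))

/-!
# Colouring graphs with few vertices of degree more than `k`

Call a vertex large if its degree is more than `k`, and let `q` be the number of large vertices. The
program `solve` runs through colourings of the large vertices, and decides for each of them in
linear time whether it extends to the whole graph. By permuting colours, only the colours up to
`min k q` need to be tried on the large vertices (`exists_colours_le`), hence at most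
`min k q ^ q` trials are made (`search_spec`).

**A trial** (`trial_spec`). An uncoloured vertex `v` has degree at most `k`, so the number of
colours which are not used around `v` is at least the number of its uncoloured neighbours. If the
inequality is strict, `v` has *slack* (`Net.Slack`), and then its whole component in the graph of
uncoloured vertices can be coloured: take the vertices greedily in the reverse order of a
breadth-first search from `v`; each of them has an uncoloured neighbour at its turn, except `v`,
which has slack (`flood_spec`). Components without slack are treated as in the characterization of
degree-choosable graphs by Borodin and by Erdős, Rubin and Taylor. They are components of
the graph of small vertices, and the blocks of that graph are computed once, by Tarjan's
depth-first search (`Net.Dfs.Ok`, `Net.Dfs.Closing.leafBlock`, `dfsAll_spec`), in an order in which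
each block is a leaf block when its turn comes. For a leaf block that is attached at `x`
(`blockStep_spec`):

* If all its vertices `v ≠ x` have the same available colours, and their number is that of the
  uncoloured neighbours in a cycle or in a complete graph, then these vertices are coloured
  greedily. This leaves the extendability of the colouring unchanged or gives slack to `x`
  (`Net.LeafBlock.ext`).
* Otherwise the whole component can be coloured (`solveBlock_spec`). Colour everything outside the
  block first, going towards it. If the available colours differ at two vertices of the block, then
  they differ at two neighbours, and a colour that is used around only one of them, given to the
  other one, creates slack (`slack_of_differ`); a block stays connected when a vertex is removed.
  If they do not differ, consider the vertex `z` of the block which was discovered last: all its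
  neighbours in the block lie on the path of the search tree that leads from `z` to the low
  point of `z`, and this path closes to a cycle. Repeat the argument with the vertices of that
  cycle. If it fails again, then the cycle is the whole component, all degrees in it are equal, and
  it is neither complete nor a plain cycle. Then it contains two vertices which are not adjacent
  but have a common neighbour. They get the same colour, which creates slack (`brooks_spec`).

If the root of a component of small vertices is still uncoloured after all blocks, then, as it has
no slack, all `k` colours are used around it, and the trial fails (`blocks_spec`).

**Running time.** `wp B P s Q` says that `P`, run from `s` with numbers below `B`, ends after `t`
steps in a state `s'` with `Q t s'`. The time of a trial is charged to the vertices that get a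
colour: `Net.wt A` counts the vertices of `A` and their adjacency-list entries, and most time bounds
have the form `t + c * wt (uncoloured at the end) ≤ c * wt (uncoloured at the start)`. To compare
the available colours of two vertices takes `O(k)` steps, which is affordable since an uncoloured
vertex without slack has degree exactly `k`. The tables of used colours and of adjacency have `n * (n + 1)` entries, which are
not gone through: they are zero at first, and each trial cleans only what the last one has written.
-/

namespace WordRAM

/-! ### Reasoning about programs -/

/-- Started in `s`, the program `P` halts after some number `t` of steps in a state `s'` with
`Q t s'`: a total-correctness predicate transformer that also counts steps. -/
def wp (B : ℕ) (P : Prog) (s : State) (Q : ℕ → State → Prop) : Prop :=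
  ∃ t s', Runs B P s t s' ∧ Q t s'

theorem wp_skip {B : ℕ} {s : State} {Q : ℕ → State → Prop} :
    wp B .skip s Q ↔ Q 1 s := by
  constructor
  · rintro ⟨t, s', hr, hq⟩; cases hr; exact hq
  · exact fun h => ⟨_, _, .skip s, h⟩

theorem wp_set {B x : ℕ} {o : Operand} {s : State} {Q : ℕ → State → Prop} :
    wp B (.set x o) s Q ↔ o.val s < B ∧ Q 1 (s.setVar x (o.val s)) := by
  constructor
  · rintro ⟨t, s', hr, hq⟩; cases hr; exact ⟨by assumption, hq⟩
  · exact fun h => ⟨_, _, .set s x o h.1, h.2⟩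

theorem wp_add {B x : ℕ} {o p : Operand} {s : State} {Q : ℕ → State → Prop} :
    wp B (.add x o p) s Q ↔
      o.val s + p.val s < B ∧ Q 1 (s.setVar x (o.val s + p.val s)) := by
  constructor
  · rintro ⟨t, s', hr, hq⟩; cases hr; exact ⟨by assumption, hq⟩
  · exact fun h => ⟨_, _, .add s x o p h.1, h.2⟩

theorem wp_sub {B x : ℕ} {o p : Operand} {s : State} {Q : ℕ → State → Prop} :
    wp B (.sub x o p) s Q ↔
      o.val s - p.val s < B ∧ Q 1 (s.setVar x (o.val s - p.val s)) := by
  constructor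
  · rintro ⟨t, s', hr, hq⟩; cases hr; exact ⟨by assumption, hq⟩
  · exact fun h => ⟨_, _, .sub s x o p h.1, h.2⟩

theorem wp_load {B x a : ℕ} {o : Operand} {s : State} {Q : ℕ → State → Prop} :
    wp B (.load x a o) s Q ↔
      s.arrs a (o.val s) < B ∧ Q 1 (s.setVar x (s.arrs a (o.val s))) := by
  constructor
  · rintro ⟨t, s', hr, hq⟩; cases hr; exact ⟨by assumption, hq⟩
  · exact fun h => ⟨_, _, .load s x a o h.1, h.2⟩

theorem wp_store {B a : ℕ} {o p : Operand} {s : State} {Q : ℕ → State → Prop} :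
    wp B (.store a o p) s Q ↔ p.val s < B ∧ Q 1 (s.setArr a (o.val s) (p.val s)) := by
  constructor
  · rintro ⟨t, s', hr, hq⟩; cases hr; exact ⟨by assumption, hq⟩
  · exact fun h => ⟨_, _, .store s a o p h.1, h.2⟩

theorem wp_seq {B : ℕ} {P R : Prog} {s : State} {Q : ℕ → State → Prop} :
    wp B (.seq P R) s Q ↔ wp B P s fun t s' => wp B R s' fun t' s'' => Q (t + t') s'' := by
  constructor
  · rintro ⟨t, s', hr, hq⟩
    cases hr with
    | seq h h' => exact ⟨_, _, h, _, _, h', hq⟩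
  · rintro ⟨t, s', h, t', s'', h', hq⟩
    exact ⟨_, _, .seq h h', hq⟩

theorem wp_branch {B : ℕ} {b : Test} {P R : Prog} {s : State} {Q : ℕ → State → Prop} :
    wp B (.branch b P R) s Q ↔
      (b.Holds s → wp B P s fun t s' => Q (t + 1) s') ∧
      (¬ b.Holds s → wp B R s fun t s' => Q (t + 1) s') := by
  constructor
  · rintro ⟨t, s', hr, hq⟩
    cases hr with
    | branch_true hb h => exact ⟨fun _ => ⟨_, _, h, hq⟩, fun hn => absurd hb hn⟩
    | branch_false hb h => exact ⟨fun hn => absurd hn hb, fun _ => ⟨_, _, h, hq⟩⟩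
  · rintro ⟨h, h'⟩
    by_cases hb : b.Holds s
    · obtain ⟨t, s', hr, hq⟩ := h hb
      exact ⟨_, _, .branch_true hb hr, hq⟩
    · obtain ⟨t, s', hr, hq⟩ := h' hb
      exact ⟨_, _, .branch_false hb hr, hq⟩

@[simp] theorem val_const (s : State) (c : ℕ) : (Operand.const c).val s = c := rfl
@[simp] theorem val_var (s : State) (x : ℕ) : (Operand.var x).val s = s.vars x := rfl
@[simp] theorem holds_eq (s : State) (o p : Operand) :
    (Test.eq o p).Holds s ↔ o.val s = p.val s := Iff.rfl
@[simp] theorem holds_ne (s : State) (o p : Operand) :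
    (Test.ne o p).Holds s ↔ o.val s ≠ p.val s := Iff.rfl
@[simp] theorem holds_lt (s : State) (o p : Operand) :
    (Test.lt o p).Holds s ↔ o.val s < p.val s := Iff.rfl
@[simp] theorem holds_le (s : State) (o p : Operand) :
    (Test.le o p).Holds s ↔ o.val s ≤ p.val s := Iff.rfl

@[simp] theorem setVar_vars (s : State) (x v y : ℕ) :
    (s.setVar x v).vars y = if y = x then v else s.vars y := by
  simp [State.setVar, Function.update_apply]
@[simp] theorem setVar_arrs (s : State) (x v : ℕ) : (s.setVar x v).arrs = s.arrs := rfl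
@[simp] theorem setArr_vars (s : State) (a i v : ℕ) : (s.setArr a i v).vars = s.vars := rfl
@[simp] theorem setArr_arrs (s : State) (a i v b : ℕ) :
    (s.setArr a i v).arrs b = if b = a then Function.update (s.arrs a) i v else s.arrs b := by
  simp only [State.setArr, Function.update_apply]

/-- Whether the text of the program has an instruction that writes register `x`. -/
def Prog.writesVar (x : ℕ) : Prog → Bool
  | .skip => false
  | .set y _ => x == y
  | .add y _ _ => x == y
  | .sub y _ _ => x == y
  | .load y _ _ => x == y
  | .store _ _ _ => false
  | .seq P Q => P.writesVar x || Q.writesVar x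
  | .branch _ P Q => P.writesVar x || Q.writesVar x
  | .loop _ P => P.writesVar x

/-- Whether the text of the program has an instruction that writes array `a`. -/
def Prog.writesArr (a : ℕ) : Prog → Bool
  | .skip => false
  | .set _ _ => false
  | .add _ _ _ => false
  | .sub _ _ _ => false
  | .load _ _ _ => false
  | .store b _ _ => a == b
  | .seq P Q => P.writesArr a || Q.writesArr a
  | .branch _ P Q => P.writesArr a || Q.writesArr a
  | .loop _ P => P.writesArr a

theorem Runs.vars_eq {B : ℕ} {P : Prog} {s s' : State} {t : ℕ} (h : Runs B P s t s') {x : ℕ}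
    (hx : P.writesVar x = false) : s'.vars x = s.vars x := by
  induction h with
  | skip => rfl
  | set s y o h => simp_all [Prog.writesVar]
  | add s y o p h => simp_all [Prog.writesVar]
  | sub s y o p h => simp_all [Prog.writesVar]
  | load s y a i h => simp_all [Prog.writesVar]
  | store => rfl
  | seq _ _ ih ih' => simp_all [Prog.writesVar]
  | branch_true _ _ ih => simp_all [Prog.writesVar]
  | branch_false _ _ ih => simp_all [Prog.writesVar]
  | loop_true _ _ _ ih ih' => simp_all [Prog.writesVar]
  | loop_false => rfl

theorem Runs.arrs_eq {B : ℕ} {P : Prog} {s s' : State} {t : ℕ} (h : Runs B P s t s') {a : ℕ}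
    (ha : P.writesArr a = false) : s'.arrs a = s.arrs a := by
  induction h with
  | store s b i o h => simp_all [Prog.writesArr]
  | seq _ _ ih ih' => simp_all [Prog.writesArr]
  | branch_true _ _ ih => simp_all [Prog.writesArr]
  | branch_false _ _ ih => simp_all [Prog.writesArr]
  | loop_true _ _ _ ih ih' => simp_all [Prog.writesArr]
  | _ => rfl

/-- What the text of `P` alone guarantees about a run from `s` to `s'`: the registers and the
arrays that `P` does not write are the same. -/
structure Frame (P : Prog) (s s' : State) : Prop where
  v : ∀ x, P.writesVar x = false → s'.vars x = s.vars x
  a : ∀ a, P.writesArr a = false → s'.arrs a = s.arrs a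

theorem Runs.frame {B : ℕ} {P : Prog} {s s' : State} {t : ℕ} (h : Runs B P s t s') :
    Frame P s s' :=
  ⟨fun _ => h.vars_eq, fun _ => h.arrs_eq⟩

theorem Frame.var {P : Prog} {s s' : State} {x a : ℕ} (h : Frame P s s')
    (hx : P.writesVar x = false := by rfl) (ha : s.vars x = a := by simp [*]) : s'.vars x = a :=
  (h.v x hx).trans ha

theorem Frame.arr {P : Prog} {s s' : State} {a : ℕ} {f : ℕ → ℕ} (h : Frame P s s')
    (hx : P.writesArr a = false := by rfl) (hf : s.arrs a = f := by simp [*]) : s'.arrs a = f :=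
  (h.a a hx).trans hf

/-- The consequence rule. What `P` does not write is known to be unchanged. -/
theorem wp_mono {B : ℕ} {P : Prog} {s : State} {Q Q' : ℕ → State → Prop} (h : wp B P s Q)
    (hQ : ∀ t s', Frame P s s' → Q t s' → Q' t s') : wp B P s Q' := by
  obtain ⟨t, s', hr, hq⟩ := h
  exact ⟨t, s', hr, hQ t s' hr.frame hq⟩

/-- The rule for loops. The invariant `I c s` carries a number `c` of credits, with which each
iteration pays for its steps; this bounds the running time and proves termination. -/
theorem wp_loop {B : ℕ} {b : Test} {P : Prog} (I : ℕ → State → Prop) {s : State}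
    (hstep : ∀ c s', I c s' → Frame P s s' → b.Holds s' →
      wp B P s' fun t s'' => ∃ c', I c' s'' ∧ c' + t + 1 ≤ c)
    {c : ℕ} (h : I c s) {Q : ℕ → State → Prop}
    (hQ : ∀ t s' c', I c' s' → Frame P s s' → ¬ b.Holds s' → c' + t ≤ c + 1 → Q t s') :
    wp B (.loop b P) s Q := by
  have key : ∀ c s', I c s' → Frame P s s' → ∃ t s'', Runs B (.loop b P) s' t s'' ∧
      ∃ c', I c' s'' ∧ Frame P s s'' ∧ ¬ b.Holds s'' ∧ c' + t ≤ c + 1 := by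
    intro c
    induction c using Nat.strong_induction_on with
    | _ c ih =>
      intro s' hs hf
      by_cases hb : b.Holds s'
      · obtain ⟨t, s₁, hr, c', hI, hc⟩ := hstep c s' hs hf hb
        have hf' := hr.frame
        obtain ⟨t', s₂, hr', c'', hI', hfr, hb', hc'⟩ := ih c' (by omega) s₁ hI
          ⟨fun x hx => (hf'.v x hx).trans (hf.v x hx), fun a ha => (hf'.a a ha).trans (hf.a a ha)⟩
        exact ⟨_, _, .loop_true hb hr hr', c'', hI', hfr, hb', by omega⟩
      · exact ⟨1, s', .loop_false hb, c, hs, hf, hb, le_rfl⟩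
  obtain ⟨t, s', hr, c', hI, hf, hb, hc⟩ := key c s h ⟨fun _ _ => rfl, fun _ _ => rfl⟩
  exact ⟨t, s', hr, hQ t s' c' hI hf hb hc⟩

/-- The rule for loops that count up to `N`. The number of credits is a function `c` of the
counter. -/
theorem wp_for {B x : ℕ} {o : Operand} {P : Prog} {s : State} {Q : ℕ → State → Prop}
    (I : ℕ → State → Prop) (c : ℕ → ℕ) (a : ℕ) {N : ℕ} (ha : s.vars x = a) (haN : a ≤ N)
    (hN : ∀ s', Frame P s s' → o.val s' = N) (h : I a s)
    (hstep : ∀ i s', a ≤ i → i < N → s'.vars x = i → I i s' → Frame P s s' →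
      wp B P s' fun t s'' => s''.vars x = i + 1 ∧ I (i + 1) s'' ∧ t + 1 + c (i + 1) ≤ c i)
    (hQ : ∀ t s', s'.vars x = N → I N s' → Frame P s s' → t + c N ≤ c a + 1 → Q t s') :
    wp B (.loop (.lt (.var x) o) P) s Q := by
  refine wp_loop (fun c' s' => ∃ i, a ≤ i ∧ i ≤ N ∧ s'.vars x = i ∧ I i s' ∧ c' = c i) ?_
    ⟨a, le_rfl, haN, ha, h, rfl⟩ ?_
  · rintro _ s' ⟨i, hai, -, hi, h', rfl⟩ hf hb
    have hb' : s'.vars x < o.val s' := hb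
    rw [hN s' hf, hi] at hb'
    exact wp_mono (hstep i s' hai hb' hi h' hf) fun t s'' _ ⟨h1, h2, h3⟩ =>
      ⟨_, ⟨i + 1, by omega, hb', h1, h2, rfl⟩, by omega⟩
  · rintro t s' _ ⟨i, -, hiN, hi, h', rfl⟩ hf hb hc
    have hb' : ¬ s'.vars x < o.val s' := hb
    rw [hN s' hf, hi] at hb'
    obtain rfl : i = N := by omega
    exact hQ t s' hi h' hf (by omega)

/-- Larger words do no harm. -/
theorem Runs.mono {B B' : ℕ} (hB : B ≤ B') {P : Prog} {s s' : State} {t : ℕ}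
    (h : Runs B P s t s') : Runs B' P s t s' := by
  induction h with
  | skip s => exact .skip s
  | set s y o h => exact .set s y o (h.trans_le hB)
  | add s y o p h => exact .add s y o p (h.trans_le hB)
  | sub s y o p h => exact .sub s y o p (h.trans_le hB)
  | load s y a i h => exact .load s y a i (h.trans_le hB)
  | store s a i o h => exact .store s a i o (h.trans_le hB)
  | seq _ _ ih ih' => exact .seq ih ih'
  | branch_true hb _ ih => exact .branch_true hb ih
  | branch_false hb _ ih => exact .branch_false hb ih
  | loop_true hb _ _ ih ih' => exact .loop_true hb ih ih'
  | loop_false hb => exact .loop_false hb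

end WordRAM

/-! ### Adjacency lists and partial colourings -/

/-- Adjacency lists of a graph on the vertices `0, …, n - 1`: the neighbours of `v` are the
entries `j` of `nb` with `off v ≤ j < off (v + 1)`. -/
structure Net where
  n : ℕ
  off : ℕ → ℕ
  nb : ℕ → ℕ
  off_zero : off 0 = 0
  mono : ∀ v < n, off v ≤ off (v + 1)
  out : ∀ v, n ≤ v → off (v + 1) = 0
  inj : ∀ v < n, ∀ i j, off v ≤ i → i < off (v + 1) → off v ≤ j → j < off (v + 1) →
    nb i = nb j → i = j
  lt : ∀ v < n, ∀ j, off v ≤ j → j < off (v + 1) → nb j < n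
  symm : ∀ v < n, ∀ j, off v ≤ j → j < off (v + 1) →
    ∃ i, off (nb j) ≤ i ∧ i < off (nb j + 1) ∧ nb i = v
  irrefl : ∀ v < n, ∀ j, off v ≤ j → j < off (v + 1) → nb j ≠ v

namespace Net

variable (g : Net)

/-- The neighbourhood of `v`; it is empty if `v` is not a vertex. -/
def N (v : ℕ) : Finset ℕ := (Finset.Ico (g.off v) (g.off (v + 1))).image g.nb

/-- The degree of `v`. -/
def deg (v : ℕ) : ℕ := g.off (v + 1) - g.off v

variable {g}

theorem mem_N {v w : ℕ} : w ∈ g.N v ↔ ∃ j, g.off v ≤ j ∧ j < g.off (v + 1) ∧ g.nb j = w := by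
  simp [N, and_assoc]

theorem N_lt_left {v w : ℕ} (h : w ∈ g.N v) : v < g.n := by
  obtain ⟨j, h1, h2, -⟩ := mem_N.1 h
  by_contra hv
  have := g.out v (by omega)
  omega

theorem N_lt {v w : ℕ} (h : w ∈ g.N v) : w < g.n := by
  have hv := N_lt_left h
  obtain ⟨j, h1, h2, rfl⟩ := mem_N.1 h
  exact g.lt v hv j h1 h2

theorem N_symm {v w : ℕ} (h : w ∈ g.N v) : v ∈ g.N w := by
  have hv := N_lt_left h
  obtain ⟨j, h1, h2, rfl⟩ := mem_N.1 h
  exact mem_N.2 (g.symm v hv j h1 h2)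

theorem N_ne {v w : ℕ} (h : w ∈ g.N v) : w ≠ v := by
  have hv := N_lt_left h
  obtain ⟨j, h1, h2, rfl⟩ := mem_N.1 h
  exact g.irrefl v hv j h1 h2

theorem card_N (v : ℕ) : (g.N v).card = g.deg v := by
  rw [N, Finset.card_image_of_injOn, Nat.card_Ico, deg]
  intro i hi j hj hij
  simp only [Finset.coe_Ico, Set.mem_Ico] at hi hj
  have hv : v < g.n := by
    by_contra hv
    have := g.out v (by omega)
    omega
  exact g.inj v hv i j hi.1 hi.2 hj.1 hj.2 hij

theorem off_le {u v : ℕ} (h : u ≤ v) (hv : v ≤ g.n) : g.off u ≤ g.off v := by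
  induction v, h using Nat.le_induction with
  | base => rfl
  | succ v huv ih => exact (ih (by omega)).trans (g.mono v (by omega))

theorem sum_deg (m : ℕ) (hm : m ≤ g.n) : ∑ v ∈ Finset.range m, g.deg v = g.off m := by
  induction m with
  | zero => simp [g.off_zero]
  | succ m ih =>
    rw [Finset.sum_range_succ, ih (by omega), deg]
    have := g.mono m (by omega)
    omega

theorem deg_lt {v : ℕ} (hv : v < g.n) : g.deg v < g.n := by
  rw [← card_N]
  have : g.N v ⊆ (Finset.range g.n).erase v := fun w hw =>
    Finset.mem_erase.2 ⟨N_ne hw, Finset.mem_range.2 (N_lt hw)⟩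
  have := Finset.card_le_card this
  rw [Finset.card_erase_of_mem (Finset.mem_range.2 hv), Finset.card_range] at this
  omega

variable (g)

/-- The weight of a set of vertices: the cost, up to a constant factor, of going through these
vertices and their adjacency lists once. -/
def wt (A : Finset ℕ) : ℕ := ∑ v ∈ A, (g.deg v + 1)

/-- The uncoloured vertices; a partial colouring is a function that is `0` there. -/
def unc (col : ℕ → ℕ) : Finset ℕ := (Finset.range g.n).filter (col · = 0)

/-- The colours on the neighbours of `v`. -/
def used (col : ℕ → ℕ) (v : ℕ) : Finset ℕ := ((g.N v).image col).erase 0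

/-- The number of coloured neighbours of `v`. -/
def done (col : ℕ → ℕ) (v : ℕ) : ℕ := ((g.N v).filter (col · ≠ 0)).card

/-- The vertex `v` has more available colours than uncoloured neighbours. -/
def Slack (k : ℕ) (col : ℕ → ℕ) (v : ℕ) : Prop :=
  (g.used col v).card + g.deg v < k + g.done col v

/-- `col` is a proper partial colouring with the colours `1, …, k`, and every vertex of degree
more than `k` is coloured. -/
structure Good (k : ℕ) (col : ℕ → ℕ) : Prop where
  proper : ∀ u v, v ∈ g.N u → col u ≠ 0 → col u ≠ col v
  le : ∀ v < g.n, col v ≤ k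
  le_n : ∀ v < g.n, col v ≤ g.n
  small : ∀ v < g.n, col v = 0 → g.deg v ≤ k

/-- The partial colouring `col` extends to a proper `k`-colouring. -/
def Ext (k : ℕ) (col : ℕ → ℕ) : Prop :=
  ∃ ψ : ℕ → ℕ, (∀ v < g.n, 1 ≤ ψ v ∧ ψ v ≤ k) ∧ (∀ u v, v ∈ g.N u → ψ u ≠ ψ v) ∧
    ∀ v < g.n, col v ≠ 0 → ψ v = col v

/-- `col'` extends `col`, and all neighbours of the vertices which are new in `col'` are coloured
in `col'`. -/
structure Closes (col col' : ℕ → ℕ) : Prop where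
  keep : ∀ v < g.n, col v ≠ 0 → col' v = col v
  closed : ∀ v < g.n, col v = 0 → col' v ≠ 0 → ∀ w ∈ g.N v, col' w ≠ 0

/-- The vertices of `A` are connected to each other inside `A`, seen from `w ∈ A`: a set that
contains `w` and is closed under taking neighbours inside `A` contains `A`. -/
def Conn (A : Set ℕ) (w : ℕ) : Prop :=
  ∀ T : Set ℕ, w ∈ T → (∀ v ∈ T, v ∈ A → ∀ v' ∈ g.N v, v' ∈ A → v' ∈ T) → A ⊆ T

variable {g} {k : ℕ} {col col' : ℕ → ℕ} {u v w c : ℕ}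

theorem mem_unc : v ∈ g.unc col ↔ v < g.n ∧ col v = 0 := by simp [unc]

theorem mem_used : c ∈ g.used col v ↔ c ≠ 0 ∧ ∃ w ∈ g.N v, col w = c := by simp [used]

theorem wt_mono {A A' : Finset ℕ} (h : A ⊆ A') : g.wt A ≤ g.wt A' :=
  Finset.sum_le_sum_of_subset h

theorem wt_union_le (A A' : Finset ℕ) : g.wt (A ∪ A') ≤ g.wt A + g.wt A' := by
  rw [wt, wt, wt, ← Finset.sum_union_inter]
  omega

theorem wt_insert {A : Finset ℕ} (h : v ∉ A) : g.wt (insert v A) = g.deg v + 1 + g.wt A := by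
  rw [wt, Finset.sum_insert h, wt]

theorem wt_erase {A : Finset ℕ} (h : v ∈ A) : g.wt (A.erase v) + (g.deg v + 1) = g.wt A :=
  Finset.sum_erase_add _ _ h

theorem wt_sdiff {A A' : Finset ℕ} (h : A' ⊆ A) : g.wt (A \ A') + g.wt A' = g.wt A :=
  Finset.sum_sdiff h

theorem card_le_wt (A : Finset ℕ) : A.card ≤ g.wt A := by
  rw [wt, Finset.card_eq_sum_ones]
  exact Finset.sum_le_sum fun v _ => by omega

theorem wt_range : g.wt (Finset.range g.n) = g.off g.n + g.n := by
  rw [wt, Finset.sum_add_distrib, sum_deg _ le_rfl]; simp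

theorem used_card_le (col : ℕ → ℕ) (v : ℕ) : (g.used col v).card ≤ g.done col v := by
  have : g.used col v = ((g.N v).filter (col · ≠ 0)).image col := by
    ext c; simp only [used, Finset.mem_erase, Finset.mem_image, Finset.mem_filter]
    constructor
    · rintro ⟨h, w, hw, rfl⟩; exact ⟨w, ⟨hw, h⟩, rfl⟩
    · rintro ⟨w, ⟨hw, h⟩, rfl⟩; exact ⟨h, w, hw, rfl⟩
  rw [this]
  exact Finset.card_image_le

theorem done_le (col : ℕ → ℕ) (v : ℕ) : g.done col v ≤ g.deg v := by
  rw [← card_N]; exact Finset.card_filter_le _ _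

theorem done_add (col : ℕ → ℕ) (v : ℕ) :
    g.done col v + ((g.N v).filter (col · = 0)).card = g.deg v := by
  rw [← card_N, done, add_comm]
  exact Finset.card_filter_add_card_filter_not _

theorem done_lt (hw : w ∈ g.N v) (h : col w = 0) : g.done col v < g.deg v := by
  have := done_add (g := g) col v
  have : 0 < ((g.N v).filter (col · = 0)).card :=
    Finset.card_pos.2 ⟨w, Finset.mem_filter.2 ⟨hw, h⟩⟩
  omega

theorem used_update (hv : col v = 0) (hc : c ≠ 0) (w : ℕ) :
    g.used (Function.update col v c) w =
      if v ∈ g.N w then insert c (g.used col w) else g.used col w := by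
  ext d
  split_ifs with h
  · simp only [Finset.mem_insert, mem_used]
    constructor
    · rintro ⟨hd, x, hx, rfl⟩
      by_cases hxv : x = v
      · left; simp [hxv]
      · right; exact ⟨hd, x, hx, by simp [hxv]⟩
    · rintro (rfl | ⟨hd, x, hx, rfl⟩)
      · exact ⟨hc, v, h, by simp⟩
      · refine ⟨hd, x, hx, ?_⟩
        have : x ≠ v := by rintro rfl; exact hd hv
        simp [this]
  · simp only [mem_used]
    refine and_congr_right fun _ => exists_congr fun x => and_congr_right fun hx => ?_
    have : x ≠ v := by rintro rfl; exact h hx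
    simp [this]

theorem done_update (hv : col v = 0) (hc : c ≠ 0) (w : ℕ) :
    g.done (Function.update col v c) w =
      if v ∈ g.N w then g.done col w + 1 else g.done col w := by
  split_ifs with h
  · have : (g.N w).filter (Function.update col v c · ≠ 0) =
        insert v ((g.N w).filter (col · ≠ 0)) := by
      ext x
      simp only [Finset.mem_filter, Finset.mem_insert, Function.update_apply]
      by_cases hx : x = v
      · simp [hx, h, hc]
      · simp [hx]
    rw [done, this, Finset.card_insert_of_notMem (by simp [hv]), done]
  · rw [done, done]
    congr 1
    refine Finset.filter_congr fun x hx => ?_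
    have : x ≠ v := by rintro rfl; exact h hx
    simp [this]

theorem used_congr (h : ∀ w ∈ g.N v, col' w = col w) : g.used col' v = g.used col v := by
  rw [used, used, Finset.image_congr (fun w hw => h w hw)]

theorem done_congr (h : ∀ w ∈ g.N v, col' w = col w) : g.done col' v = g.done col v := by
  rw [done, done, Finset.filter_congr (fun w hw => by rw [h w hw])]

theorem slack_congr (h : ∀ w ∈ g.N v, col' w = col w) :
    g.Slack k col' v ↔ g.Slack k col v := by
  rw [Slack, Slack, used_congr h, done_congr h]

/-- Colouring another vertex preserves slack. -/
theorem Slack.update (h : g.Slack k col w) (hv : col v = 0) (hc : c ≠ 0) :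
    g.Slack k (Function.update col v c) w := by
  rw [Slack, used_update hv hc, done_update hv hc] at *
  split_ifs
  · have := Finset.card_insert_le c (g.used col w)
    omega
  · exact h

theorem Slack.used_lt (h : g.Slack k col v) : (g.used col v).card < k := by
  have := done_le (g := g) col v
  rw [Slack] at h; omega

theorem Good.used_lt (h : g.Good k col) (hv : col v = 0) (hw : w ∈ g.N v) (hw' : col w = 0) :
    (g.used col v).card < k := by
  have := h.small v (N_lt_left hw) hv
  have := done_lt hw hw'
  have := used_card_le (g := g) col v
  omega

/-- Two neighbours of the same colour create slack. -/
theorem slack_of_dup (hdeg : g.deg w ≤ k) (hu : u ∈ g.N w) (hv : v ∈ g.N w) (huv : u ≠ v)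
    (h : col u = col v) (h0 : col u ≠ 0) : g.Slack k col w := by
  have : (g.used col w).card < g.done col w := by
    have e : g.used col w = (((g.N w).filter (col · ≠ 0)).erase u).image col := by
      ext c
      simp only [mem_used, Finset.mem_image, Finset.mem_erase, Finset.mem_filter]
      constructor
      · rintro ⟨hc, x, hx, rfl⟩
        by_cases hxu : x = u
        · exact ⟨v, ⟨huv.symm, hv, h ▸ h0⟩, by rw [hxu, h]⟩
        · exact ⟨x, ⟨hxu, hx, hc⟩, rfl⟩
      · rintro ⟨x, ⟨-, hx, hx0⟩, rfl⟩
        exact ⟨hx0, x, hx, rfl⟩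
    rw [e, done]
    refine Finset.card_image_le.trans_lt ?_
    exact Finset.card_erase_lt_of_mem (Finset.mem_filter.2 ⟨hu, h0⟩)
  rw [Slack]; omega

theorem not_slack (h : ¬ g.Slack k col v) (hdeg : g.deg v ≤ k) :
    g.deg v = k ∧ (g.used col v).card = g.done col v := by
  have := used_card_le (g := g) col v
  rw [Slack] at h; omega

theorem Good.used_subset (h : g.Good k col) (v : ℕ) : g.used col v ⊆ Finset.Icc 1 k := by
  intro c hc
  obtain ⟨h0, w, hw, rfl⟩ := mem_used.1 hc
  have := h.le w (N_lt hw)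
  simp; omega

theorem Good.used_eq (h : g.Good k col) {u v : ℕ}
    (huv : ∀ c, 1 ≤ c → c ≤ k → (c ∈ g.used col u ↔ c ∈ g.used col v)) :
    g.used col u = g.used col v := by
  ext c
  constructor <;> intro hc <;> have := Finset.mem_Icc.1 (h.used_subset _ hc)
  exacts [(huv c this.1 this.2).1 hc, (huv c this.1 this.2).2 hc]

theorem Good.update (h : g.Good k col) (hv : col v = 0) (hc : c ∉ g.used col v) (h0 : c ≠ 0)
    (hck : c ≤ k) (hcn : c ≤ g.n) : g.Good k (Function.update col v c) := by
  have aux : ∀ w ∈ g.N v, col w ≠ c := fun w hw e => hc (mem_used.2 ⟨h0, w, hw, e⟩)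
  refine ⟨?_, ?_, ?_, ?_⟩
  · intro a b hab ha
    have hne := N_ne hab
    by_cases hav : a = v
    · subst hav
      have := aux b hab
      simp [hne]; exact this.symm
    · by_cases hbv : b = v
      · subst hbv
        have := aux a (N_symm hab)
        simpa [hav] using this
      · simp only [ne_eq, hav, not_false_eq_true, Function.update_of_ne, hbv] at ha ⊢
        exact h.proper a b hab ha
  · intro a ha
    by_cases hav : a = v
    · simp [hav, hck]
    · simpa [hav] using h.le a ha
  · intro a ha
    by_cases hav : a = v
    · simp [hav, hcn]
    · simpa [hav] using h.le_n a ha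
  · intro a ha h1
    by_cases hav : a = v
    · simp [hav, h0] at h1
    · exact h.small a ha (by simpa [hav] using h1)

theorem unc_update (h0 : c ≠ 0) :
    g.unc (Function.update col v c) = (g.unc col).erase v := by
  ext w
  simp only [mem_unc, Finset.mem_erase]
  by_cases hw : w = v
  · simp [hw, h0]
  · simp [hw]

theorem wt_unc_update (hv : v < g.n) (hv0 : col v = 0) (h0 : c ≠ 0) :
    g.wt (g.unc (Function.update col v c)) + (g.deg v + 1) = g.wt (g.unc col) := by
  rw [unc_update h0, wt_erase (mem_unc.2 ⟨hv, hv0⟩)]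

theorem Closes.refl (col : ℕ → ℕ) : g.Closes col col :=
  ⟨fun _ _ _ => rfl, fun _ _ h h' => absurd h h'⟩

theorem Closes.trans {col'' : ℕ → ℕ} (h : g.Closes col col') (h' : g.Closes col' col'') :
    g.Closes col col'' := by
  refine ⟨fun v hv h0 => ?_, fun v hv h0 h1 w hw => ?_⟩
  · rw [h'.keep v hv (by rwa [h.keep v hv h0]), h.keep v hv h0]
  · by_cases hv' : col' v = 0
    · exact h'.closed v hv hv' h1 w hw
    · have := h.closed v hv h0 hv' w hw
      rwa [h'.keep w (N_lt hw) this]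

/-- Colouring whole components of the uncoloured part does not affect extendability. -/
theorem Closes.ext (h : g.Closes col col') (hg : g.Good k col') (he : g.Ext k col) :
    g.Ext k col' := by
  obtain ⟨ψ, h1, h2, h3⟩ := he
  refine ⟨fun v => if col v = 0 ∧ col' v ≠ 0 then col' v else ψ v, ?_, ?_, ?_⟩
  · intro v hv
    dsimp only
    split_ifs with h'
    · exact ⟨by omega, hg.le v hv⟩
    · exact h1 v hv
  · intro u v huv
    have hv := N_lt huv
    have key : ∀ a b, b ∈ g.N a → (col a = 0 ∧ col' a ≠ 0) →
        (if col b = 0 ∧ col' b ≠ 0 then col' b else ψ b) = col' b := by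
      intro a b hab ha
      split_ifs with hb
      · rfl
      · have hb' := h.closed a (N_lt_left hab) ha.1 ha.2 b hab
        have hb0 : col b ≠ 0 := fun e => hb ⟨e, hb'⟩
        rw [h3 b (N_lt hab) hb0, h.keep b (N_lt hab) hb0]
    dsimp only
    by_cases hu' : col u = 0 ∧ col' u ≠ 0
    · rw [key u v huv hu', if_pos hu']
      exact hg.proper u v huv hu'.2
    · by_cases hv' : col v = 0 ∧ col' v ≠ 0
      · rw [key v u (N_symm huv) hv', if_pos hv']
        exact (hg.proper v u (N_symm huv) hv'.2).symm
      · rw [if_neg hu', if_neg hv']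
        exact h2 u v huv
  · intro v hv h'
    dsimp only
    split_ifs with h''
    · rfl
    · by_cases h0 : col v = 0
      · exact absurd ⟨h0, h'⟩ h''
      · rw [h3 v hv h0, h.keep v hv h0]

/-- To see that `A` is connected from `w`, it is enough to show that every vertex of `A` leads
to some fixed vertex `x`. -/
theorem conn_of_reach {A : Set ℕ} {x : ℕ} (hw : w ∈ A)
    (h : ∀ T : Set ℕ, ∀ v ∈ A, v ∈ T →
      (∀ v ∈ T, v ∈ A → ∀ v' ∈ g.N v, v' ∈ A → v' ∈ T) → x ∈ T) : g.Conn A w := by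
  intro T hwT hT v hv
  have hx := h T w hw hwT hT
  by_contra hvT
  refine h Tᶜ v hv hvT (fun a ha haA b hab hbA hb => ?_) hx
  exact ha (hT b hb hbA a (N_symm hab) haA)

end Net

namespace WordRAM

/-! ### The data of the algorithm -/

infixr:60 " ;; " => Prog.seq

/-! Arrays: `aOff` and `aNb` hold the adjacency lists, `aBase` and `aAdj` the further tables of
`Static`, `aCol` the partial colouring, `aTab`, `aUsed` and `aDone` the tables of `Rep`, `aBig` and
`aDig` the large vertices and their colours in the present trial, `aQ`, `aIn` and `aPar` a queue
with flags and parents, and `aStk`, `aIdx`, `aLow` and `aPtr` the data of depth-first search. -/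

notation "aOff" => 0
notation "aNb" => 1
notation "aBase" => 2
notation "aAdj" => 3
notation "aCol" => 4
notation "aTab" => 5
notation "aUsed" => 6
notation "aDone" => 7
notation "aBig" => 8
notation "aDig" => 9
notation "aQ" => 10
notation "aIn" => 11
notation "aStk" => 12
notation "aIdx" => 13
notation "aPar" => 14
notation "aLow" => 15
notation "aPtr" => 16

/-- All numbers that occur in a computation on `g` and `k` are smaller than this. -/
def bound (g : Net) (k : ℕ) : ℕ := (g.n + 2) ^ 2 + g.off g.n + k + 10

/-- The data that do not change: the input, the table `v ↦ v * (n + 1)` of the starting points of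
the rows of two-dimensional arrays with rows of length `n + 1`, and the adjacency matrix. -/
structure Static (g : Net) (k : ℕ) (s : State) : Prop where
  vn : s.vars 0 = g.n
  vk : s.vars 1 = k
  off : s.arrs aOff = g.off
  nb : s.arrs aNb = g.nb
  base : ∀ v < g.n, s.arrs aBase v = v * (g.n + 1)
  adj : ∀ u < g.n, ∀ v < g.n, s.arrs aAdj (u * (g.n + 1) + v) = if v ∈ g.N u then 1 else 0

/-- The derived data about the partial colouring in array `aCol` are correct: for every vertex a
table of the colours on its neighbours, their number, and the number of coloured neighbours. -/
structure Rep (g : Net) (s : State) : Prop where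
  tab : ∀ v < g.n, ∀ c, 1 ≤ c → c ≤ g.n →
    s.arrs aTab (v * (g.n + 1) + c) = if c ∈ g.used (s.arrs aCol) v then 1 else 0
  used : ∀ v < g.n, s.arrs aUsed v = (g.used (s.arrs aCol) v).card
  done : ∀ v < g.n, s.arrs aDone v = g.done (s.arrs aCol) v

/-- The program leaves the static data alone. -/
def Prog.safe (P : Prog) : Bool :=
  !(P.writesVar 0 || P.writesVar 1 || P.writesArr 0 || P.writesArr 1 || P.writesArr 2 ||
    P.writesArr 3)

/-- The program leaves the partial colouring and its derived data alone. -/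
def Prog.pure (P : Prog) : Bool :=
  !(P.writesArr 4 || P.writesArr 5 || P.writesArr 6 || P.writesArr 7)

variable {g : Net} {k B : ℕ} {s s' : State} {P : Prog}

theorem Static.of_eq (h : Static g k s) (v0 : s'.vars 0 = s.vars 0 := by rfl)
    (v1 : s'.vars 1 = s.vars 1 := by rfl) (a0 : s'.arrs 0 = s.arrs 0 := by rfl)
    (a1 : s'.arrs 1 = s.arrs 1 := by rfl) (a2 : s'.arrs 2 = s.arrs 2 := by rfl)
    (a3 : s'.arrs 3 = s.arrs 3 := by rfl) : Static g k s' :=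
  ⟨v0.trans h.vn, v1.trans h.vk, a0.trans h.off, a1.trans h.nb, by rw [a2]; exact h.base,
    by rw [a3]; exact h.adj⟩

theorem Static.frame (h : Static g k s) (hf : Frame P s s') (hP : P.safe = true := by rfl) :
    Static g k s' := by
  simp only [Prog.safe, Bool.not_eq_true', Bool.or_eq_false_iff] at hP
  obtain ⟨⟨⟨⟨⟨h0, h1⟩, h2⟩, h3⟩, h4⟩, h5⟩ := hP
  exact h.of_eq (hf.v _ h0) (hf.v _ h1) (hf.a _ h2) (hf.a _ h3) (hf.a _ h4) (hf.a _ h5)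

theorem Rep.of_eq (h : Rep g s) (h4 : s'.arrs 4 = s.arrs 4 := by rfl)
    (h5 : s'.arrs 5 = s.arrs 5 := by rfl) (h6 : s'.arrs 6 = s.arrs 6 := by rfl)
    (h7 : s'.arrs 7 = s.arrs 7 := by rfl) : Rep g s' :=
  ⟨by rw [h4, h5]; exact h.tab, by rw [h4, h6]; exact h.used, by rw [h4, h7]; exact h.done⟩

theorem Rep.frame (h : Rep g s) (hf : Frame P s s') (hP : P.pure = true := by rfl) :
    Rep g s' := by
  simp only [Prog.pure, Bool.not_eq_true', Bool.or_eq_false_iff] at hP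
  obtain ⟨⟨⟨h4, h5⟩, h6⟩, h7⟩ := hP
  exact h.of_eq (hf.a _ h4) (hf.a _ h5) (hf.a _ h6) (hf.a _ h7)

section bounds

theorem lt_bound {x : ℕ} (hB : bound g k ≤ B) (hx : x ≤ 2 * g.n + k + g.off g.n + 5) : x < B := by
  unfold bound at hB
  nlinarith

theorem row_lt {u v n : ℕ} (hu : u < n) (hv : v ≤ n) : u * (n + 1) + v < (n + 2) ^ 2 := by
  nlinarith

theorem row_lt_bound {u v : ℕ} (hB : bound g k ≤ B) (hu : u < g.n) (hv : v ≤ g.n) :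
    u * (g.n + 1) + v < B := by
  have := row_lt hu hv
  unfold bound at hB
  omega

theorem off_le_n {v : ℕ} (hv : v ≤ g.n) : g.off v ≤ g.off g.n := Net.off_le hv le_rfl

theorem row_inj {n u v a b : ℕ} (ha : a ≤ n) (hb : b ≤ n)
    (h : u * (n + 1) + a = v * (n + 1) + b) : u = v ∧ a = b := by
  have h1 : (u * (n + 1) + a) / (n + 1) = u := by
    rw [add_comm, Nat.add_mul_div_right _ _ (by omega), Nat.div_eq_of_lt (by omega), zero_add]
  have h2 : (v * (n + 1) + b) / (n + 1) = v := by
    rw [add_comm, Nat.add_mul_div_right _ _ (by omega), Nat.div_eq_of_lt (by omega), zero_add]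
  have h3 : u = v := by rw [← h1, h, h2]
  subst h3
  exact ⟨rfl, by omega⟩

end bounds

/-! Rules for one instruction in front of a program or at its end; the value that is written is
given in simplified form, so that the terms for the states stay small. -/

section step

variable {B x a : ℕ} {o p : Operand} {P : Prog} {s : State} {Q : ℕ → State → Prop}

theorem step_set (v : ℕ) (h : wp B P (s.setVar x v) fun t s' => Q (1 + t) s')
    (hb : v < B := by
      first | omega | exact lt_bound ‹_› (by first | omega | split_ifs <;> omega))
    (hv : o.val s = v := by simp [*]) :
    wp B (.seq (.set x o) P) s Q := by
  subst hv; exact wp_seq.2 (wp_set.2 ⟨hb, h⟩)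

theorem step_add (v : ℕ) (h : wp B P (s.setVar x v) fun t s' => Q (1 + t) s')
    (hb : v < B := by
      first | omega | exact lt_bound ‹_› (by first | omega | split_ifs <;> omega))
    (hv : o.val s + p.val s = v := by simp [*]) :
    wp B (.seq (.add x o p) P) s Q := by
  subst hv; exact wp_seq.2 (wp_add.2 ⟨hb, h⟩)

theorem step_sub (v : ℕ) (h : wp B P (s.setVar x v) fun t s' => Q (1 + t) s')
    (hb : v < B := by
      first | omega | exact lt_bound ‹_› (by first | omega | split_ifs <;> omega))
    (hv : o.val s - p.val s = v := by simp [*]) :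
    wp B (.seq (.sub x o p) P) s Q := by
  subst hv; exact wp_seq.2 (wp_sub.2 ⟨hb, h⟩)

theorem step_load (v : ℕ) (h : wp B P (s.setVar x v) fun t s' => Q (1 + t) s')
    (hb : v < B := by
      first | omega | exact lt_bound ‹_› (by first | omega | split_ifs <;> omega))
    (hv : s.arrs a (o.val s) = v := by simp [*]) :
    wp B (.seq (.load x a o) P) s Q := by
  subst hv; exact wp_seq.2 (wp_load.2 ⟨hb, h⟩)

theorem step_store (i v : ℕ) (h : wp B P (s.setArr a i v) fun t s' => Q (1 + t) s')
    (hb : v < B := by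
      first | omega | exact lt_bound ‹_› (by first | omega | split_ifs <;> omega))
    (hi : o.val s = i := by simp [*]) (hv : p.val s = v := by simp [*]) :
    wp B (.seq (.store a o p) P) s Q := by
  subst hv; subst hi; exact wp_seq.2 (wp_store.2 ⟨hb, h⟩)

theorem end_set (v : ℕ) (h : Q 1 (s.setVar x v))
    (hb : v < B := by
      first | omega | exact lt_bound ‹_› (by first | omega | split_ifs <;> omega))
    (hv : o.val s = v := by simp [*]) :
    wp B (.set x o) s Q := by
  subst hv; exact wp_set.2 ⟨hb, h⟩

theorem end_add (v : ℕ) (h : Q 1 (s.setVar x v))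
    (hb : v < B := by
      first | omega | exact lt_bound ‹_› (by first | omega | split_ifs <;> omega))
    (hv : o.val s + p.val s = v := by simp [*]) :
    wp B (.add x o p) s Q := by
  subst hv; exact wp_add.2 ⟨hb, h⟩

theorem end_load (v : ℕ) (h : Q 1 (s.setVar x v))
    (hb : v < B := by
      first | omega | exact lt_bound ‹_› (by first | omega | split_ifs <;> omega))
    (hv : s.arrs a (o.val s) = v := by simp [*]) :
    wp B (.load x a o) s Q := by
  subst hv; exact wp_load.2 ⟨hb, h⟩

theorem end_store (i v : ℕ) (h : Q 1 (s.setArr a i v))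
    (hb : v < B := by
      first | omega | exact lt_bound ‹_› (by first | omega | split_ifs <;> omega))
    (hi : o.val s = i := by simp [*]) (hv : p.val s = v := by simp [*]) :
    wp B (.store a o p) s Q := by
  subst hv; subst hi; exact wp_store.2 ⟨hb, h⟩

theorem step_min {y a b : ℕ} (hx : s.vars x = a) (hy : s.vars y = b)
    (h : wp B P (s.setVar y (min a b)) fun t s' => Q (2 + t) s')
    (hb : a < B := by exact lt_bound ‹_› (by omega)) :
    wp B (.seq (.branch (.lt (.var x) (.var y)) (.set y (.var x)) .skip) P) s Q := by
  subst hx hy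
  refine wp_seq.2 (wp_branch.2 ⟨fun (hlt : s.vars x < s.vars y) => wp_set.2 ⟨hb, ?_⟩,
    fun (hlt : ¬ s.vars x < s.vars y) => wp_skip.2 ?_⟩)
  · rwa [min_eq_left hlt.le] at h
  · rwa [min_eq_right (not_lt.1 hlt), State.setVar, Function.update_eq_self] at h

end step

/-! ### Colouring a vertex -/

/-- Gives the vertex in register 10 the colour in register 11. -/
def assign : Prog :=
  .store aCol (.var 10) (.var 11) ;;
  .load 12 aOff (.var 10) ;;
  .add 13 (.var 10) (.const 1) ;;
  .load 13 aOff (.var 13) ;;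
  .loop (.lt (.var 12) (.var 13))
    (.load 14 aNb (.var 12) ;;
     .load 15 aDone (.var 14) ;;
     .add 15 (.var 15) (.const 1) ;;
     .store aDone (.var 14) (.var 15) ;;
     .load 15 aBase (.var 14) ;;
     .add 15 (.var 15) (.var 11) ;;
     .load 16 aTab (.var 15) ;;
     .branch (.eq (.var 16) (.const 0))
       (.store aTab (.var 15) (.const 1) ;;
        .load 16 aUsed (.var 14) ;;
        .add 16 (.var 16) (.const 1) ;;
        .store aUsed (.var 14) (.var 16))
       .skip ;;
     .add 12 (.var 12) (.const 1))

theorem assign_spec (hB : bound g k ≤ B) (hs : Static g k s) (hr : Rep g s) {v c : ℕ}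
    (hv : s.vars 10 = v) (hc : s.vars 11 = c) (hvn : v < g.n) (hv0 : s.arrs aCol v = 0)
    (h1 : 1 ≤ c) (hcn : c ≤ g.n) :
    wp B assign s fun t s' => Rep g s' ∧ s'.arrs aCol = Function.update (s.arrs aCol) v c ∧
      t ≤ 20 * (g.deg v + 1) := by
  have hmono := g.mono v hvn
  have hoff1 := off_le_n (g := g) (v := v + 1) (by omega)
  have hn := hs.off
  refine step_store v c ?_
  refine step_load (g.off v) ?_
  refine step_add (v + 1) ?_
  refine step_load (g.off (v + 1)) ?_
  set col := s.arrs aCol with hcol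
  let M (j : ℕ) : Finset ℕ := (Finset.Ico (g.off v) j).image g.nb
  have hM0 : M (g.off v) = ∅ := by simp [M]
  have hM1 : ∀ w, w ∈ M (g.off (v + 1)) ↔ v ∈ g.N w := fun w =>
    ⟨fun h => Net.N_symm h, fun h => Net.N_symm h⟩
  have hMs : ∀ j, g.off v ≤ j → M (j + 1) = insert (g.nb j) (M j) := fun j hj => by
    simp only [M]; rw [← Finset.insert_Ico_right_eq_Ico_add_one hj, Finset.image_insert]
  have hMn : ∀ j, g.off v ≤ j → j < g.off (v + 1) → g.nb j ∉ M j := fun j h1 h2 h => by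
    simp only [M, Finset.mem_image, Finset.mem_Ico] at h
    obtain ⟨i, ⟨hi1, hi2⟩, hi⟩ := h
    have := g.inj v hvn i j hi1 (by omega) h1 h2 hi
    omega
  refine wp_for (fun j s' => s'.arrs aCol = Function.update col v c ∧
      (∀ w < g.n, ∀ d, 1 ≤ d → d ≤ g.n → s'.arrs aTab (w * (g.n + 1) + d) =
        if d ∈ g.used col w ∨ d = c ∧ w ∈ M j then 1 else 0) ∧
      (∀ w < g.n, s'.arrs aUsed w =
        (if w ∈ M j then insert c (g.used col w) else g.used col w).card) ∧
      (∀ w < g.n, s'.arrs aDone w = if w ∈ M j then g.done col w + 1 else g.done col w))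
    (fun j => 15 * (g.off (v + 1) - j)) (g.off v) rfl hmono (fun s' hf => hf.v 13 rfl)
    ⟨by simp [hcol], fun w hw d h1 h2 => by simpa [hM0] using hr.tab w hw d h1 h2,
      fun w hw => by simpa [hM0] using hr.used w hw,
      fun w hw => by simpa [hM0] using hr.done w hw⟩ ?_ ?_
  · rintro j s' hj1 hb e12 ⟨e4, ht, hu, hd⟩ hf
    have f10 : s'.vars 10 = v := hf.var
    have f11 : s'.vars 11 = c := hf.var
    have f1 : s'.arrs 1 = g.nb := (hf.a 1 rfl).trans (by simp [hs.nb])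
    have f2 : ∀ w < g.n, s'.arrs 2 w = w * (g.n + 1) := fun w hw =>
      (congrFun ((hf.a 2 rfl).trans (by simp)) w).trans (hs.base w hw)
    obtain ⟨w, hw⟩ : ∃ w, w = g.nb j := ⟨_, rfl⟩
    have hwn : w < g.n := hw ▸ g.lt v hvn j hj1 hb
    have hwM : w ∉ M j := hw ▸ hMn j hj1 hb
    have hMs' : M (j + 1) = insert w (M j) := hw ▸ hMs j hj1
    have hdn := (Net.done_le (g := g) col w).trans_lt (Net.deg_lt hwn)
    have hun := (Net.used_card_le (g := g) col w).trans_lt hdn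
    have hrow := row_lt_bound hB hwn hcn
    have hdw := hd w hwn
    have huw := hu w hwn
    have htw := ht w hwn c h1 hcn
    simp only [hwM, if_false, and_false, or_false] at hdw huw htw
    refine step_load w ?_
    refine step_load (g.done col w) (hv := by simp [hdw]) ?_
    refine step_add (g.done col w + 1) ?_
    refine step_store w (g.done col w + 1) ?_
    refine step_load (w * (g.n + 1)) (hv := by simp [f2 w hwn]) ?_
    refine step_add (w * (g.n + 1) + c) ?_
    refine step_load (if c ∈ g.used col w then 1 else 0) (hv := by simp [htw]) ?_
    have hd' : ∀ w' < g.n, Function.update (s'.arrs 7) w (g.done col w + 1) w' =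
        if w' ∈ M (j + 1) then g.done col w' + 1 else g.done col w' := by
      intro w' hw'
      by_cases h : w' = w
      · subst h; simp [hMs']
      · simp [h, hMs', hd w' hw']
    refine wp_seq.2 (wp_branch.2 ⟨fun hb' => ?_, fun hb' => ?_⟩)
    · have hcu : c ∉ g.used col w := by
        intro h; simp [h] at hb'
      refine step_store (w * (g.n + 1) + c) 1 ?_
      refine step_load ((g.used col w).card) (hv := by simp [huw]) ?_
      refine step_add ((g.used col w).card + 1) ?_
      refine end_store w ((g.used col w).card + 1) ?_
      refine end_add (j + 1) ⟨by simp, ⟨by simp [e4], ?_, ?_, by simpa using hd'⟩, by omega⟩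
      · intro w' hw' d hd1 hd2
        simp only [setVar_arrs, setArr_arrs, reduceIte, Nat.reduceEqDiff]
        by_cases h : w' = w ∧ d = c
        · obtain ⟨rfl, rfl⟩ := h
          simp [hMs']
        · have : w' * (g.n + 1) + d ≠ w * (g.n + 1) + c := fun e => h (row_inj hd2 hcn e)
          rw [Function.update_of_ne this, ht w' hw' d hd1 hd2]
          congr 1
          simp only [hMs', Finset.mem_insert, eq_iff_iff]
          exact or_congr_right ⟨fun h' => ⟨h'.1, .inr h'.2⟩, fun h' => ⟨h'.1, h'.2.resolve_left
            fun e => h ⟨e, h'.1⟩⟩⟩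
      · intro w' hw'
        by_cases h : w' = w
        · subst h; simp [hMs', hcu]
        · simp [h, hMs', hu w' hw']
    · have hcu : c ∈ g.used col w := by
        by_contra h; simp [h] at hb'
      refine wp_skip.2 ?_
      refine end_add (j + 1) ⟨by simp, ⟨by simp [e4], ?_, ?_, by simpa using hd'⟩, by omega⟩
      · intro w' hw' d hd1 hd2
        simp only [setVar_arrs, setArr_arrs, Nat.reduceEqDiff, if_false]
        rw [ht w' hw' d hd1 hd2]
        congr 1
        simp only [hMs', Finset.mem_insert, eq_iff_iff]
        constructor
        · exact Or.imp_right fun h => ⟨h.1, .inr h.2⟩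
        · rintro (h | ⟨rfl, rfl | h⟩)
          exacts [.inl h, .inl hcu, .inr ⟨rfl, h⟩]
      · intro w' hw'
        by_cases h : w' = w
        · subst h; simp [hMs', hcu, huw]
        · simp [h, hMs', hu w' hw']
  · rintro t s' - ⟨e4, ht, hu, hd⟩ hf hcr
    simp only [hM1] at ht hu hd
    refine ⟨⟨?_, ?_, ?_⟩, e4, ?_⟩
    · intro w hw d hd1 hd2
      rw [ht w hw d hd1 hd2, e4, Net.used_update hv0 (by omega)]
      congr 1
      split_ifs with h
      · simp only [Finset.mem_insert, h, and_true, or_comm]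
      · simp [h]
    · intro w hw
      rw [hu w hw, e4, Net.used_update hv0 (by omega)]
    · intro w hw
      rw [hd w hw, e4, Net.done_update hv0 (by omega)]
    · unfold Net.deg; omega

/-- Gives the uncoloured vertex in register 10 its least available colour. -/
def greedy : Prog :=
  .set 11 (.const 1) ;;
  .load 18 aBase (.var 10) ;;
  .add 19 (.var 18) (.const 1) ;;
  .load 19 aTab (.var 19) ;;
  .loop (.eq (.var 19) (.const 1))
    (.add 11 (.var 11) (.const 1) ;;
     .add 19 (.var 18) (.var 11) ;;
     .load 19 aTab (.var 19)) ;;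
  assign

theorem greedy_spec (hB : bound g k ≤ B) (hs : Static g k s) (hr : Rep g s)
    (hg : g.Good k (s.arrs aCol)) {v : ℕ} (hv : s.vars 10 = v) (hvn : v < g.n)
    (hv0 : s.arrs aCol v = 0) (hk : (g.used (s.arrs aCol) v).card < k) :
    wp B greedy s fun t s' => Rep g s' ∧ g.Good k (s'.arrs aCol) ∧
      (∃ c, c ≠ 0 ∧ c ≤ k ∧ c ≤ g.n ∧ c ∉ g.used (s.arrs aCol) v ∧ s'.vars 11 = c ∧
        s'.arrs aCol = Function.update (s.arrs aCol) v c) ∧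
      t ≤ 40 * (g.deg v + 1) := by
  have hdn := Net.deg_lt hvn
  have hud := (Net.used_card_le (g := g) (s.arrs aCol) v).trans (Net.done_le _ _)
  have h1 := hr.tab v hvn 1 le_rfl (by omega)
  refine step_set 1 ?_
  have hb0 := row_lt_bound (v := 0) hB hvn (by omega)
  have hb1 := row_lt_bound (v := 1) hB hvn (by omega)
  refine step_load (v * (g.n + 1)) (hv := by simp [hv, hs.base v hvn]) ?_
  refine step_add (v * (g.n + 1) + 1) ?_
  refine step_load (if 1 ∈ g.used (s.arrs aCol) v then 1 else 0) ?_
  set col := s.arrs aCol with hcol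
  refine wp_seq.2 (wp_loop (fun cr s' => s'.vars 10 = v ∧ s'.vars 18 = v * (g.n + 1) ∧
    ∃ c, s'.vars 11 = c ∧ 1 ≤ c ∧ (∀ d, 1 ≤ d → d < c → d ∈ g.used col v) ∧
      s'.vars 19 = (if c ∈ g.used col v then 1 else 0) ∧ cr + 4 * c = 4 * (g.deg v + 2))
    (c := 4 * (g.deg v + 1)) ?_ ?_ ?_)
  · rintro cr s' ⟨e10, e18, c, e11, hc1, hc, e19, hcr⟩ hf hb
    have f5 : s'.arrs aTab = s.arrs aTab := hf.arr
    have hcu : c ∈ g.used col v := by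
      by_contra h; simp [e19, h] at hb
    have hle : c ≤ (g.used col v).card := by
      have : Finset.Icc 1 c ⊆ g.used col v := fun d hd => by
        rw [Finset.mem_Icc] at hd
        rcases hd.2.lt_or_eq with h | rfl
        exacts [hc d hd.1 h, hcu]
      simpa using Finset.card_le_card this
    have hrow := row_lt_bound (v := c + 1) hB hvn (by omega)
    refine step_add (c + 1) ?_
    refine step_add (v * (g.n + 1) + (c + 1)) ?_
    refine end_load (if c + 1 ∈ g.used col v then 1 else 0)
      (hv := by simp [f5, hr.tab v hvn (c + 1) (by omega) (by omega), hcol]) ?_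
    refine ⟨4 * (g.deg v + 2) - 4 * (c + 1), ⟨by simp [e10], by simp [e18], c + 1, by simp,
      by omega, fun d h1 h2 => ?_, by simp, by omega⟩, by omega⟩
    rcases (Nat.lt_succ_iff.1 h2).lt_or_eq with h | rfl
    exacts [hc d h1 h, hcu]
  · exact ⟨by simp [hv], by simp, 1, by simp, le_rfl, fun d h1 h2 => by omega, by simp, by omega⟩
  · rintro t s' cr ⟨e10, e18, c, e11, hc1, hc, e19, hcr⟩ hf hb ht
    have f4 : s'.arrs aCol = col := hf.arr
    have hcu : c ∉ g.used col v := by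
      intro h; simp [e19, h] at hb
    have hle : c ≤ (g.used col v).card + 1 := by
      have : Finset.Ico 1 c ⊆ g.used col v := fun d hd => by
        rw [Finset.mem_Ico] at hd
        exact hc d hd.1 hd.2
      have := Finset.card_le_card this
      rw [Nat.card_Ico] at this
      omega
    have hs' : Static g k s' := hs.of_eq.frame hf
    have hr' : Rep g s' := hr.of_eq f4 (hf.arr)
      (hf.arr) (hf.arr)
    refine wp_mono (assign_spec hB hs' hr' e10 e11 hvn (by rw [f4, hv0]) hc1 (by omega)) ?_
    rintro t' s'' hf' ⟨hr'', e4, ht'⟩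
    rw [f4] at e4
    refine ⟨hr'', ?_, ⟨c, by omega, by omega, by omega, hcu, ?_, e4⟩, by omega⟩
    · rw [e4]; exact hg.update hv0 hcu (by omega) (by omega) (by omega)
    · rw [hf'.v 11 rfl, e11]


variable {g : Net} {k B : ℕ} {s s' : State} {P : Prog}

/-! ### Breadth-first search and greedy colouring in reverse order -/

/-- The first `e` entries of the queue are distinct uncoloured vertices, and array `aIn` marks
exactly these vertices. -/
structure Queue (g : Net) (s : State) (e : ℕ) : Prop where
  lt : ∀ i < e, s.arrs aQ i < g.n
  unc : ∀ i < e, s.arrs aCol (s.arrs aQ i) = 0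
  inj : ∀ i < e, ∀ j < e, s.arrs aQ i = s.arrs aQ j → i = j
  flag : ∀ v < g.n, s.arrs aIn v = if ∃ i < e, s.arrs aQ i = v then 1 else 0

/-- The set of the first `e` entries of an array. -/
def entries (q : ℕ → ℕ) (e : ℕ) : Finset ℕ := (Finset.range e).image q

theorem mem_entries {q : ℕ → ℕ} {e v : ℕ} : v ∈ entries q e ↔ ∃ i < e, q i = v := by
  simp [entries]

theorem entries_succ (q : ℕ → ℕ) (e : ℕ) : entries q (e + 1) = insert (q e) (entries q e) := by
  simp [entries, Finset.range_add_one]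

theorem Queue.entries_subset {e : ℕ} (h : Queue g s e) :
    entries (s.arrs aQ) e ⊆ g.unc (s.arrs aCol) := fun v hv => by
  obtain ⟨i, hi, rfl⟩ := mem_entries.1 hv
  exact Net.mem_unc.2 ⟨h.lt i hi, h.unc i hi⟩

theorem Queue.notMem {e i : ℕ} (h : Queue g s e) (hi : i < e) :
    s.arrs aQ i ∉ entries (s.arrs aQ) i := fun hm => by
  obtain ⟨j, hj, e'⟩ := mem_entries.1 hm
  have := h.inj j (by omega) i hi e'
  omega

theorem card_entries {q : ℕ → ℕ} {e : ℕ} (h : ∀ i < e, ∀ j < e, q i = q j → i = j) :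
    (entries q e).card = e := by
  rw [entries, Finset.card_image_of_injOn, Finset.card_range]
  intro i hi j hj hij
  exact h i (by simpa using hi) j (by simpa using hj) hij

theorem le_of_injective {q : ℕ → ℕ} {e n : ℕ} (h : ∀ i < e, ∀ j < e, q i = q j → i = j)
    (hn : ∀ i < e, q i < n) : e ≤ n := by
  have := Finset.card_le_card (s := entries q e) (t := Finset.range n) fun v hv => by
    obtain ⟨i, hi, rfl⟩ := mem_entries.1 hv
    exact Finset.mem_range.2 (hn i hi)
  simpa [card_entries h] using this

theorem Queue.le_n {e : ℕ} (h : Queue g s e) : e ≤ g.n := le_of_injective h.inj h.lt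

theorem Queue.of_eq {e : ℕ} (h : Queue g s e) (h4 : s'.arrs 4 = s.arrs 4)
    (h10 : s'.arrs 10 = s.arrs 10) (h11 : s'.arrs 11 = s.arrs 11) : Queue g s' e :=
  ⟨by rw [h10]; exact h.lt, by rw [h4, h10]; exact h.unc, by rw [h10]; exact h.inj,
    by rw [h10, h11]; exact h.flag⟩

/-- The queue after appending an uncoloured vertex that is not in it. -/
theorem Queue.push {e w : ℕ} (h : Queue g s e) (hw : w < g.n) (hw0 : s.arrs aCol w = 0)
    (hnew : s.arrs aIn w = 0) (h4 : s'.arrs 4 = s.arrs 4)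
    (h10 : s'.arrs 10 = Function.update (s.arrs 10) e w)
    (h11 : s'.arrs 11 = Function.update (s.arrs 11) w 1) : Queue g s' (e + 1) := by
  have hq : ∀ i < e, s'.arrs aQ i = s.arrs aQ i := fun i hi => by
    rw [h10, Function.update_of_ne (by omega)]
  have hqe : s'.arrs aQ e = w := by rw [h10]; simp
  have hni : ∀ i < e, s.arrs aQ i ≠ w := fun i hi h' => by
    have := h.flag w hw
    rw [hnew, if_pos ⟨i, hi, h'⟩] at this
    omega
  refine ⟨fun i hi => ?_, fun i hi => ?_, fun i hi j hj hij => ?_, fun v hv => ?_⟩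
  · rcases (Nat.lt_succ_iff.1 hi).lt_or_eq with h' | rfl
    · rw [hq i h']; exact h.lt i h'
    · rwa [hqe]
  · rcases (Nat.lt_succ_iff.1 hi).lt_or_eq with h' | rfl
    · rw [hq i h', h4]; exact h.unc i h'
    · rwa [hqe, h4]
  · rcases (Nat.lt_succ_iff.1 hi).lt_or_eq with h1 | rfl <;>
      rcases (Nat.lt_succ_iff.1 hj).lt_or_eq with h2 | rfl
    · rw [hq i h1, hq j h2] at hij; exact h.inj i h1 j h2 hij
    · rw [hq i h1, hqe] at hij; exact absurd hij (hni i h1)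
    · rw [hq j h2, hqe] at hij; exact absurd hij.symm (hni j h2)
    · rfl
  · have key : (∃ i < e + 1, s'.arrs aQ i = v) ↔ v = w ∨ ∃ i < e, s.arrs aQ i = v := by
      constructor
      · rintro ⟨i, hi, hiv⟩
        rcases (Nat.lt_succ_iff.1 hi).lt_or_eq with h' | rfl
        · right; exact ⟨i, h', by rw [← hq i h', hiv]⟩
        · left; rw [← hiv, hqe]
      · rintro (rfl | ⟨i, hi, hiv⟩)
        · exact ⟨e, by omega, hqe⟩
        · exact ⟨i, by omega, by rw [hq i hi, hiv]⟩
    rw [h11, if_congr key rfl rfl]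
    by_cases hvw : v = w
    · simp [hvw]
    · simp [hvw, h.flag v hv]

/-- Breadth-first search through the uncoloured vertices, from the first entries of the queue;
their number is in register 20. -/
def bfs : Prog :=
  .set 22 (.const 0) ;;
  .set 23 (.var 20) ;;
  .loop (.lt (.var 22) (.var 23))
    (.load 24 aQ (.var 22) ;;
     .load 25 aOff (.var 24) ;;
     .add 26 (.var 24) (.const 1) ;;
     .load 26 aOff (.var 26) ;;
     .loop (.lt (.var 25) (.var 26))
       (.load 27 aNb (.var 25) ;;
        .load 28 aCol (.var 27) ;;
        .load 29 aIn (.var 27) ;;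
        .add 28 (.var 28) (.var 29) ;;
        .branch (.eq (.var 28) (.const 0))
          (.store aQ (.var 23) (.var 27) ;;
           .store aIn (.var 27) (.const 1) ;;
           .add 23 (.var 23) (.const 1))
          .skip ;;
        .add 25 (.var 25) (.const 1)) ;;
     .add 22 (.var 22) (.const 1))

/-- Every entry from `a` on has a neighbour earlier in the queue, and the first `a` entries are
those of `q`. -/
structure Grown (g : Net) (q : ℕ → ℕ) (a : ℕ) (s : State) (e : ℕ) : Prop extends Queue g s e where
  le : a ≤ e
  prefix_eq : ∀ i < a, s.arrs aQ i = q i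
  parent : ∀ i, a ≤ i → i < e → ∃ j < i, s.arrs aQ j ∈ g.N (s.arrs aQ i)

theorem Grown.push {q : ℕ → ℕ} {a e w h : ℕ} (hG : Grown g q a s e) (hw : w < g.n)
    (hw0 : s.arrs aCol w = 0) (hnew : s.arrs aIn w = 0) (hh : h < e) (hadj : w ∈ g.N (s.arrs aQ h))
    (h4 : s'.arrs 4 = s.arrs 4)
    (h10 : s'.arrs 10 = Function.update (s.arrs 10) e w)
    (h11 : s'.arrs 11 = Function.update (s.arrs 11) w 1) : Grown g q a s' (e + 1) := by
  have hq : ∀ i < e, s'.arrs aQ i = s.arrs aQ i := fun i hi => by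
    rw [h10, Function.update_of_ne (by omega)]
  have hqe : s'.arrs aQ e = w := by rw [h10]; simp
  refine ⟨hG.toQueue.push hw hw0 hnew h4 h10 h11, by have := hG.le; omega, fun i hi => ?_,
    fun i hi hi' => ?_⟩
  · have := hG.le
    rw [hq i (by omega), hG.prefix_eq i hi]
  · rcases (Nat.lt_succ_iff.1 hi').lt_or_eq with h' | rfl
    · obtain ⟨j, hj, hjN⟩ := hG.parent i hi h'
      exact ⟨j, hj, by rwa [hq i h', hq j (by omega)]⟩
    · exact ⟨h, hh, by rw [hqe, hq h hh]; exact Net.N_symm hadj⟩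

theorem Grown.of_eq {q : ℕ → ℕ} {a e : ℕ} (h : Grown g q a s e) (h4 : s'.arrs 4 = s.arrs 4)
    (h10 : s'.arrs 10 = s.arrs 10) (h11 : s'.arrs 11 = s.arrs 11) : Grown g q a s' e :=
  ⟨h.toQueue.of_eq h4 h10 h11, h.le, by rw [h10]; exact h.prefix_eq,
    by rw [h10]; exact h.parent⟩

theorem bfs_spec (hB : bound g k ≤ B) (hs : Static g k s) {a : ℕ} (ha : s.vars 20 = a)
    (hg : g.Good k (s.arrs aCol)) (hQ : Queue g s a) :
    wp B bfs s fun t s' => ∃ e, s'.vars 23 = e ∧ Grown g (s.arrs aQ) a s' e ∧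
      (∀ i < e, ∀ w ∈ g.N (s'.arrs aQ i), s.arrs aCol w = 0 → ∃ j < e, s'.arrs aQ j = w) ∧
      t ≤ 20 * g.wt (entries (s'.arrs aQ) e) + 5 := by
  have han := hQ.le_n
  refine step_set 0 ?_
  refine step_set a ?_
  refine wp_loop (fun cr s' => ∃ h e, s'.vars 22 = h ∧ s'.vars 23 = e ∧ h ≤ e ∧
    Grown g (s.arrs aQ) a s' e ∧
    (∀ i < h, ∀ w ∈ g.N (s'.arrs aQ i), s.arrs aCol w = 0 → ∃ j < e, s'.arrs aQ j = w) ∧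
    cr + 20 * g.wt (entries (s'.arrs aQ) h) = 20 * g.wt (g.unc (s.arrs aCol)))
    (c := 20 * g.wt (g.unc (s.arrs aCol))) ?_ ?_ ?_
  · rintro cr s₁ ⟨h, e, e22, e23, hhe, hG, hcl, hcr⟩ hf hb
    have f4 : s₁.arrs aCol = s.arrs aCol := hf.a _ rfl
    have f0 : s₁.arrs aOff = g.off := (hf.a _ rfl).trans hs.off
    have f1 : s₁.arrs aNb = g.nb := (hf.a _ rfl).trans hs.nb
    simp [e22, e23] at hb
    obtain ⟨v, hv⟩ : ∃ v, v = s₁.arrs aQ h := ⟨_, rfl⟩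
    have hvn : v < g.n := hv ▸ hG.lt h hb
    have hmono := g.mono v hvn
    have hoff1 := off_le_n (g := g) (v := v + 1) (by omega)
    have hwt : g.wt (entries (s₁.arrs aQ) (h + 1)) =
        g.deg v + 1 + g.wt (entries (s₁.arrs aQ) h) := by
      rw [entries_succ, Net.wt_insert (hG.notMem hb), hv]
    have hle : g.wt (entries (s₁.arrs aQ) (h + 1)) ≤ g.wt (g.unc (s.arrs aCol)) := by
      refine Net.wt_mono (fun x hx => ?_)
      rw [← f4]
      obtain ⟨i, hi, rfl⟩ := mem_entries.1 hx
      exact hG.entries_subset (mem_entries.2 ⟨i, by omega, rfl⟩)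
    refine step_load v ?_
    refine step_load (g.off v) ?_
    refine step_add (v + 1) ?_
    refine step_load (g.off (v + 1)) ?_
    refine wp_seq.2 (wp_loop (fun cr' s₂ => ∃ e j, s₂.vars 23 = e ∧ s₂.vars 25 = j ∧
      s₂.vars 26 = g.off (v + 1) ∧ s₂.vars 22 = h ∧ h < e ∧ g.off v ≤ j ∧ j ≤ g.off (v + 1) ∧
      (∀ i ≤ h, s₂.arrs aQ i = s₁.arrs aQ i) ∧
      Grown g (s.arrs aQ) a s₂ e ∧
      (∀ i < h, ∀ w ∈ g.N (s₂.arrs aQ i), s.arrs aCol w = 0 → ∃ j < e, s₂.arrs aQ j = w) ∧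
      (∀ i, g.off v ≤ i → i < j → s.arrs aCol (g.nb i) = 0 →
        ∃ j < e, s₂.arrs aQ j = g.nb i) ∧
      cr' = 11 * (g.off (v + 1) - j)) (c := 11 * (g.off (v + 1) - g.off v)) ?_ ?_ ?_)
    · rintro cr' s₂ ⟨e, j, e23, e25, e26, e22, hhe, hj1, hj2, hpre, hG, hcl, hsc, rfl⟩ hf' hb'
      have f4' : s₂.arrs aCol = s.arrs aCol := hf'.arr
      have f1' : s₂.arrs aNb = g.nb := hf'.arr
      simp [e25, e26] at hb'
      obtain ⟨w, hw⟩ : ∃ w, w = g.nb j := ⟨_, rfl⟩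
      have hwn : w < g.n := hw ▸ g.lt v hvn j hj1 hb'
      have hwv : w ∈ g.N v := Net.mem_N.2 ⟨j, hj1, hb', hw.symm⟩
      have hen := hG.le_n
      have hcn := hg.le_n w hwn
      obtain ⟨fl, hfl⟩ : ∃ fl, s₂.arrs aIn w = fl := ⟨_, rfl⟩
      have hfl1 : fl ≤ 1 := by rw [← hfl, hG.flag w hwn]; split_ifs <;> omega
      refine step_load w ?_
      refine step_load (s.arrs aCol w) ?_
      refine step_load fl (hv := by simp [hfl]) ?_
      refine step_add (s.arrs aCol w + fl) ?_
      refine wp_seq.2 (wp_branch.2 ⟨fun hb'' => ?_, fun hb'' => ?_⟩)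
      · simp at hb''
        have hc0 : s.arrs aCol w = 0 := by omega
        have hf0 : s₂.arrs aIn w = 0 := by omega
        refine step_store e w ?_
        refine step_store w 1 ?_
        refine end_add (e + 1) ?_
        refine end_add (j + 1) ?_
        have hvh : w ∈ g.N (s₂.arrs aQ h) := by rw [hpre h le_rfl, ← hv]; exact hwv
        have hmono' : ∀ x, (∃ j < e, s₂.arrs aQ j = x) →
            ∃ j < e + 1, Function.update (s₂.arrs aQ) e w j = x := by
          rintro x ⟨j, hj, rfl⟩
          exact ⟨j, by omega, by rw [Function.update_of_ne (by omega)]⟩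
        refine ⟨11 * (g.off (v + 1) - (j + 1)), ⟨e + 1, j + 1, by simp, by simp, by simp [e26],
          by simp [e22], by omega, by omega, by omega, fun i hi => ?_, ?_, fun i hi x hx hx0 => ?_,
          fun i hi1 hi2 hi0 => ?_, rfl⟩, by omega⟩
        · simp [← hpre i hi, show i ≠ e by omega]
        · exact hG.push hwn (by rw [f4', hc0]) hf0 hhe hvh (by simp) (by simp) (by simp)
        · simp only [setVar_arrs, setArr_arrs, reduceIte, Nat.reduceEqDiff] at hx ⊢
          rw [Function.update_of_ne (by omega)] at hx
          exact hmono' x (hcl i hi x hx hx0)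
        · simp only [setVar_arrs, setArr_arrs, reduceIte, Nat.reduceEqDiff]
          rcases (Nat.lt_succ_iff.1 hi2).lt_or_eq with h' | rfl
          · exact hmono' _ (hsc i hi1 h' hi0)
          · exact ⟨e, by omega, by simp [hw]⟩
      · simp at hb''
        refine wp_skip.2 ?_
        refine end_add (j + 1) ⟨11 * (g.off (v + 1) - (j + 1)), ⟨e, j + 1, by simp [e23], by simp, by simp [e26],
          by simp [e22], hhe, by omega, by omega, hpre, hG.of_eq rfl rfl rfl, hcl,
          fun i hi1 hi2 hi0 => ?_, rfl⟩, by omega⟩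
        rcases (Nat.lt_succ_iff.1 hi2).lt_or_eq with h' | rfl
        · exact hsc i hi1 h' hi0
        · rw [← hw] at hi0 ⊢
          have hfw := hG.flag w hwn
          by_contra hne
          rw [if_neg (show ¬ ∃ j < e, s₂.arrs aQ j = w from hne)] at hfw
          omega
    · exact ⟨e, g.off v, by simp [e23], by simp, by simp, by simp [e22], hb, le_rfl, hmono,
        fun i hi => rfl, hG.of_eq rfl rfl rfl, hcl, fun i h1 h2 => by omega, rfl⟩
    · rintro t s₂ cr' ⟨e, j, e23, e25, e26, e22, hhe, hj1, hj2, hpre, hG, hcl, hsc, rfl⟩ hf' hb' ht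
      have hen := hG.le_n
      simp [e25, e26] at hb'
      obtain rfl : j = g.off (v + 1) := by omega
      have hent : entries (s₂.arrs aQ) (h + 1) = entries (s₁.arrs aQ) (h + 1) := by
        refine Finset.image_congr (fun i hi => hpre i ?_)
        simp at hi; omega
      refine end_add (h + 1) ⟨20 * g.wt (g.unc (s.arrs aCol)) - 20 * g.wt (entries (s₂.arrs aQ) (h + 1)),
        ⟨h + 1, e, by simp, by simp [e23], by omega, hG.of_eq rfl rfl rfl, fun i hi x hx hx0 => ?_,
        ?_⟩, ?_⟩
      · simp only [setVar_arrs] at hx ⊢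
        rcases (Nat.lt_succ_iff.1 hi).lt_or_eq with h' | rfl
        · exact hcl i h' x hx hx0
        · rw [hpre i le_rfl, ← hv] at hx
          obtain ⟨j, hj1, hj2, rfl⟩ := Net.mem_N.1 hx
          exact hsc j hj1 hj2 hx0
      · simp only [setVar_arrs]
        rw [hent]; omega
      · rw [hent, hwt]
        unfold Net.deg
        unfold Net.deg at hwt
        omega
  · exact ⟨0, a, by simp, by simp, by omega, ⟨hQ.of_eq rfl rfl rfl, le_rfl, fun _ _ => rfl,
      fun i h1 h2 => by omega⟩, fun i hi => by omega, by simp [entries, Net.wt]⟩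
  · rintro t s₁ cr ⟨h, e, e22, e23, hhe, hG, hcl, hcr⟩ hf hb ht
    simp [e22, e23] at hb
    obtain rfl : h = e := by omega
    exact ⟨h, e23, hG, hcl, by omega⟩

/-- Colours the entries of the queue from the last one down to the entry whose index is in
register 21, and clears the marks. -/
def unwind : Prog :=
  .loop (.lt (.const 0) (.var 23))
    (.sub 23 (.var 23) (.const 1) ;;
     .load 10 aQ (.var 23) ;;
     .store aIn (.var 10) (.const 0) ;;
     .branch (.le (.var 21) (.var 23)) greedy .skip)

theorem unwind_spec (hB : bound g k ≤ B) (hs : Static g k s) (hr : Rep g s)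
    (hg : g.Good k (s.arrs aCol)) {a b e : ℕ} {q : ℕ → ℕ} (he : s.vars 23 = e)
    (hb : s.vars 21 = b) (hG : Grown g q a s e)
    (hsl : ∀ i, b ≤ i → i < a → g.Slack k (s.arrs aCol) (s.arrs aQ i)) :
    wp B unwind s fun t s' => Rep g s' ∧ g.Good k (s'.arrs aCol) ∧
      (∀ v, (¬ ∃ i, b ≤ i ∧ i < e ∧ s.arrs aQ i = v) → s'.arrs aCol v = s.arrs aCol v) ∧
      (∀ i, b ≤ i → i < e → s'.arrs aCol (s.arrs aQ i) ≠ 0) ∧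
      (∀ v < g.n, s'.arrs aIn v = 0) ∧
      t ≤ 50 * g.wt (entries (s.arrs aQ) e) + 1 := by
  set col := s.arrs aCol with hcol
  set Q := s.arrs aQ with hQ
  refine wp_loop (fun cr s' => ∃ i, s'.vars 23 = i ∧ i ≤ e ∧ Rep g s' ∧ g.Good k (s'.arrs aCol) ∧
      (∀ v, (¬ ∃ j, i ≤ j ∧ b ≤ j ∧ j < e ∧ Q j = v) → s'.arrs aCol v = col v) ∧
      (∀ j, i ≤ j → b ≤ j → j < e → s'.arrs aCol (Q j) ≠ 0) ∧
      (∀ j, b ≤ j → j < a → g.Slack k (s'.arrs aCol) (Q j)) ∧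
      (∀ v < g.n, s'.arrs aIn v = if ∃ j < i, Q j = v then 1 else 0) ∧
      cr = 50 * g.wt (entries Q i)) (c := 50 * g.wt (entries Q e)) ?_ ?_ ?_
  · rintro cr s₁ ⟨i, e23, hie, hr₁, hg₁, hk₁, hn₁, hsl₁, hfl₁, rfl⟩ hf hb'
    have fQ : s₁.arrs aQ = Q := hf.a _ rfl
    have f21 : s₁.vars 21 = b := hf.var
    have hs₁ : Static g k s₁ := hs.frame hf
    simp [e23] at hb'
    obtain ⟨i, rfl⟩ : ∃ i', i = i' + 1 := ⟨i - 1, by omega⟩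
    have hen := hG.le_n
    have hwt : g.wt (entries Q (i + 1)) = g.deg (Q i) + 1 + g.wt (entries Q i) := by
      rw [entries_succ, Net.wt_insert (hG.notMem (by omega))]
    have hvn : Q i < g.n := hG.lt i (by omega)
    have hv0 : col (Q i) = 0 := hG.unc i (by omega)
    have hinj : ∀ j < e, Q j = Q i → j = i := fun j hj h => hG.inj j hj i (by omega) h
    have hfl₂ : ∀ v < g.n, Function.update (s₁.arrs aIn) (Q i) 0 v =
        if ∃ j < i, Q j = v then 1 else 0 := by
      intro v hv
      by_cases h : v = Q i
      · subst h
        have : ¬ ∃ j < i, Q j = Q i := fun ⟨j, hj, h⟩ => by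
          have := hinj j (by omega) h; omega
        simp [this]
      · rw [Function.update_of_ne h, hfl₁ v hv]
        refine if_congr ⟨?_, ?_⟩ rfl rfl
        · rintro ⟨j, hj, rfl⟩
          rcases (Nat.lt_succ_iff.1 hj).lt_or_eq with h' | rfl
          exacts [⟨j, h', rfl⟩, absurd rfl h]
        · rintro ⟨j, hj, rfl⟩
          exact ⟨j, by omega, rfl⟩
    refine step_sub i ?_
    refine step_load (Q i) ?_
    refine step_store (Q i) 0 ?_
    refine wp_branch.2 ⟨fun hbi => ?_, fun hbi => ?_⟩
    · simp [f21] at hbi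
      have hv0' : s₁.arrs aCol (Q i) = 0 := by
        rw [hk₁ _ ?_, hv0]
        rintro ⟨j, hj1, hj2, hj3, hj4⟩
        have := hinj j hj3 hj4; omega
      have hlt : (g.used (s₁.arrs aCol) (Q i)).card < k := by
        rcases lt_or_ge i a with hia | hia
        · exact (hsl₁ i hbi hia).used_lt
        · obtain ⟨j, hj, hjN⟩ := hG.parent i hia (by omega)
          refine hg₁.used_lt hv0' hjN ?_
          rw [hk₁ _ ?_]
          · exact hG.unc j (by omega)
          · rintro ⟨j', hj1, hj2, hj3, hj4⟩
            have := hG.inj j' hj3 j (by omega) hj4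
            omega
      refine wp_mono (greedy_spec (s := ((s₁.setVar 23 i).setVar 10 (Q i)).setArr 11 (Q i) 0)
        (v := Q i) hB hs₁.of_eq
        hr₁.of_eq hg₁ (by simp) hvn hv0' hlt) ?_
      rintro t s₂ hf₂ ⟨hr₂, hg₂, ⟨c, hc0, -, -, -, -, hc⟩, ht⟩
      simp only [setArr_arrs, setVar_arrs, Nat.reduceEqDiff, if_false] at hc
      refine ⟨50 * g.wt (entries Q i), ⟨i, hf₂.var, by omega, hr₂, hg₂,
        fun v hv => ?_, fun j hj1 hj2 hj3 => ?_, fun j hj1 hj2 => ?_, fun v hv => ?_, rfl⟩, by omega⟩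
      · have : v ≠ Q i := by rintro rfl; exact hv ⟨i, le_rfl, hbi, by omega, rfl⟩
        rw [hc, Function.update_of_ne this]
        exact hk₁ v fun ⟨j, h1, h2, h3, h4⟩ => hv ⟨j, by omega, h2, h3, h4⟩
      · rw [hc]
        rcases hj1.lt_or_eq with h | rfl
        · rw [Function.update_of_ne fun e => by have := hinj j hj3 e; omega]
          exact hn₁ j h hj2 hj3
        · simpa using hc0
      · rw [hc]
        exact (hsl₁ j hj1 hj2).update hv0' hc0
      · rw [hf₂.a aIn rfl]
        simpa using hfl₂ v hv
    · simp [f21] at hbi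
      refine wp_skip.2 ⟨50 * g.wt (entries Q i), ⟨i, by simp, by omega,
        hr₁.of_eq, hg₁, fun v hv => ?_, fun j hj1 hj2 hj3 => ?_, hsl₁,
        fun v hv => ?_, rfl⟩, by omega⟩
      · exact hk₁ v fun ⟨j, h1, h2, h3, h4⟩ => hv ⟨j, by omega, h2, h3, h4⟩
      · exact hn₁ j (by omega) hj2 hj3
      · simpa using hfl₂ v hv
  · refine ⟨e, he, le_rfl, hr, hg, fun _ _ => rfl, fun j h1 h2 h3 => by omega, hsl, hG.flag, rfl⟩
  · rintro t s₁ cr ⟨i, e23, hie, hr₁, hg₁, hk₁, hn₁, hsl₁, hfl₁, rfl⟩ hf hb' ht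
    simp [e23] at hb'
    obtain rfl : i = 0 := by omega
    refine ⟨hr₁, hg₁, fun v hv => hk₁ v fun ⟨j, _, h⟩ => hv ⟨j, h⟩,
      fun j h1 h2 => hn₁ j (by omega) h1 h2, fun v hv => ?_, by omega⟩
    rw [hfl₁ v hv, if_neg]
    rintro ⟨j, hj, -⟩; omega

/-- Breadth-first search from the first entries of the queue, whose number is in register 20,
and greedy colouring in reverse order down to the index in register 21. -/
def sweep : Prog := bfs ;; unwind

/-- In reverse breadth-first order every vertex has an uncoloured neighbour at its turn, except
for the first entries of the queue. -/
theorem sweep_spec (hB : bound g k ≤ B) (hs : Static g k s) (hr : Rep g s)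
    (hg : g.Good k (s.arrs aCol)) {a b : ℕ} (ha : s.vars 20 = a)
    (hb : s.vars 21 = b) (hba : b ≤ a) (hQ : Queue g s a)
    (hsl : ∀ i, b ≤ i → i < a → g.Slack k (s.arrs aCol) (s.arrs aQ i)) :
    wp B sweep s fun t s' => Rep g s' ∧ g.Good k (s'.arrs aCol) ∧
      (∀ v < g.n, s.arrs aCol v ≠ 0 → s'.arrs aCol v = s.arrs aCol v) ∧
      (∀ i < a, s'.arrs aQ i = s.arrs aQ i) ∧
      (∀ i < b, s'.arrs aCol (s.arrs aQ i) = 0) ∧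
      (∀ i, b ≤ i → i < a → s'.arrs aCol (s.arrs aQ i) ≠ 0) ∧
      (∀ v < g.n, s.arrs aCol v = 0 → s'.arrs aCol v ≠ 0 ∨ (∃ i < a, s.arrs aQ i = v) →
        ∀ w ∈ g.N v, s'.arrs aCol w ≠ 0 ∨ ∃ i < b, s.arrs aQ i = w) ∧
      (∀ v < g.n, s'.arrs aIn v = 0) ∧
      t + 70 * g.wt (g.unc (s'.arrs aCol)) ≤
        70 * g.wt (g.unc (s.arrs aCol)) + 70 * g.wt (entries (s.arrs aQ) b) + 10 := by
  refine wp_seq.2 (wp_mono (bfs_spec hB hs ha hg hQ) ?_)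
  rintro t₁ s₁ hf₁ ⟨e, he, hG, hcl, ht₁⟩
  have f4 : s₁.arrs aCol = s.arrs aCol := hf₁.a _ rfl
  have hae := hG.le
  refine wp_mono (unwind_spec hB (hs.frame hf₁) (hr.frame hf₁) (by rw [f4]; exact hg) he
    ((hf₁.v _ rfl).trans hb) hG ?_) ?_
  · intro i h1 h2
    rw [f4, hG.prefix_eq i h2]
    exact hsl i h1 h2
  rintro t₂ s₂ hf₂ ⟨hr₂, hg₂, hk₂, hn₂, hfl₂, ht₂⟩
  have fQ : s₂.arrs aQ = s₁.arrs aQ := hf₂.a _ rfl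
  rw [f4] at hk₂
  have hQ0 : ∀ i < e, s.arrs aCol (s₁.arrs aQ i) = 0 := fun i hi => by
    rw [← f4]; exact hG.unc i hi
  refine ⟨hr₂, hg₂, fun v hv h0 => hk₂ v ?_, fun i hi => by rw [fQ, hG.prefix_eq i hi],
    fun i hi => ?_, fun i h1 h2 => ?_, fun v hv h0 h1 w hw => ?_, hfl₂, ?_⟩
  · rintro ⟨i, -, h2, rfl⟩
    exact h0 (hQ0 i h2)
  · rw [hk₂]
    · exact hQ.unc i (by omega)
    · rintro ⟨j, h1, h2, h3⟩
      rw [← hG.prefix_eq i (by omega)] at h3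
      have := hG.inj j h2 i (by omega) h3
      omega
  · rw [← hG.prefix_eq i h2]
    exact hn₂ i h1 (by omega)
  · have hvQ : ∃ i < e, s₁.arrs aQ i = v := by
      rcases h1 with h1 | ⟨i, hi, h1⟩
      · by_contra hne
        refine h1 ((hk₂ v ?_).trans h0)
        rintro ⟨i, -, h2, h3⟩
        exact hne ⟨i, h2, h3⟩
      · exact ⟨i, by omega, by rw [hG.prefix_eq i hi, h1]⟩
    obtain ⟨i, hi, rfl⟩ := hvQ
    by_cases hw0 : s.arrs aCol w = 0
    · obtain ⟨j, hj, rfl⟩ := hcl i hi w hw hw0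
      rcases lt_or_ge j b with h | h
      · right; exact ⟨j, h, by rw [hG.prefix_eq j (by omega)]⟩
      · left; exact hn₂ j h hj
    · left
      rw [hk₂ w]
      · exact hw0
      · rintro ⟨j, -, h2, rfl⟩
        exact hw0 (hQ0 j h2)
  · have hsub : entries (s₁.arrs aQ) e ⊆
        (g.unc (s.arrs aCol) \ g.unc (s₂.arrs aCol)) ∪ entries (s.arrs aQ) b := by
      intro v hv
      obtain ⟨i, hi, rfl⟩ := mem_entries.1 hv
      rcases lt_or_ge i b with h | h
      · exact Finset.mem_union_right _
          (mem_entries.2 ⟨i, h, by rw [hG.prefix_eq i (by omega)]⟩)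
      · refine Finset.mem_union_left _ (Finset.mem_sdiff.2 ⟨?_, ?_⟩)
        · exact Net.mem_unc.2 ⟨hG.lt i hi, hQ0 i hi⟩
        · intro h'
          exact hn₂ i h hi (Net.mem_unc.1 h').2
    have hsub' : g.unc (s₂.arrs aCol) ⊆ g.unc (s.arrs aCol) := by
      intro v hv
      rw [Net.mem_unc] at hv ⊢
      refine ⟨hv.1, ?_⟩
      by_contra h
      have : s₂.arrs aCol v = s.arrs aCol v := hk₂ v (by
        rintro ⟨j, -, h2, rfl⟩
        exact h (hQ0 j h2))
      exact h (this ▸ hv.2)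
    have h1 := (Net.wt_mono (g := g) hsub).trans (Net.wt_union_le _ _)
    have h2 := Net.wt_sdiff (g := g) hsub'
    omega

end WordRAM

namespace Net

variable {g : Net} {k : ℕ} {col col' col'' : ℕ → ℕ} {W : Set ℕ}

/-- Like `Net.Closes`, but the neighbours of the new vertices may also be in `W`. -/
structure ClosesOff (g : Net) (W : Set ℕ) (col col' : ℕ → ℕ) : Prop where
  keep : ∀ v < g.n, col v ≠ 0 → col' v = col v
  closed : ∀ v < g.n, col v = 0 → col' v ≠ 0 → ∀ w ∈ g.N v, col' w ≠ 0 ∨ w ∈ W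

theorem ClosesOff.trans (h : g.ClosesOff W col col') (h' : g.ClosesOff W col' col'') :
    g.ClosesOff W col col'' := by
  refine ⟨fun v hv h0 => ?_, fun v hv h0 h1 w hw => ?_⟩
  · rw [h'.keep v hv (by rwa [h.keep v hv h0]), h.keep v hv h0]
  · by_cases hv' : col' v = 0
    · exact h'.closed v hv hv' h1 w hw
    · refine (h.closed v hv h0 hv' w hw).imp_left fun h2 => ?_
      rwa [h'.keep w (N_lt hw) h2]

theorem Closes.off (h : g.Closes col col') : g.ClosesOff W col col' :=
  ⟨h.keep, fun v hv h0 h1 w hw => .inl (h.closed v hv h0 h1 w hw)⟩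

theorem ClosesOff.closes (h : g.ClosesOff W col col') (hW : ∀ v ∈ W, col' v ≠ 0) :
    g.Closes col col' :=
  ⟨h.keep, fun v hv h0 h1 w hw => (h.closed v hv h0 h1 w hw).elim id (hW w)⟩

theorem ClosesOff.unc_subset (h : g.ClosesOff W col col') : g.unc col' ⊆ g.unc col := by
  intro v hv
  rw [mem_unc] at hv ⊢
  refine ⟨hv.1, ?_⟩
  by_contra h0
  exact h0 ((h.keep v hv.1 h0).symm.trans hv.2)

/-- `W` is a set of uncoloured vertices with no uncoloured neighbours outside `W`. -/
structure Part (g : Net) (col : ℕ → ℕ) (W : Set ℕ) : Prop where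
  lt : ∀ v ∈ W, v < g.n
  unc : ∀ v ∈ W, col v = 0
  nbr : ∀ v ∈ W, ∀ w ∈ g.N v, col w = 0 → w ∈ W

theorem Part.update (hW : g.Part col W) {u c : ℕ} (hu : u ∈ W) :
    g.ClosesOff W col (Function.update col u c) := by
  refine ⟨fun v _ h => ?_, fun v _ h0 h1 w hw => ?_⟩
  · have : v ≠ u := by rintro rfl; exact h (hW.unc v hu)
    simp [this]
  · have : v = u := by
      by_contra h; simp [h] at h1; exact h1 h0
    subst this
    have hne := N_ne hw
    by_cases hw0 : col w = 0
    · exact .inr (hW.nbr v hu w hw hw0)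
    · left; simpa [hne] using hw0

/-- If one vertex of a connected set of uncoloured vertices gets coloured in a closed extension,
then so does the whole set. -/
theorem Closes.conn (h : g.Closes col col') {A : Set ℕ} {w : ℕ} (hA : g.Conn A w)
    (hlt : ∀ v ∈ A, v < g.n) (h0 : ∀ v ∈ A, col v = 0) (hw : col' w ≠ 0) :
    ∀ v ∈ A, col' v ≠ 0 :=
  hA {v | col' v ≠ 0} hw fun v hv hvA v' hv' _ => h.closed v (hlt v hvA) (h0 v hvA) hv v' hv'

end Net

namespace WordRAM

variable {g : Net} {k B : ℕ} {s s' : State} {P : Prog}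

/-- Greedy colouring of the uncoloured component of the vertex in register 40. -/
def flood : Prog :=
  .store aQ (.const 0) (.var 40) ;;
  .store aIn (.var 40) (.const 1) ;;
  .set 20 (.const 1) ;;
  .set 21 (.const 0) ;;
  sweep

/-- A vertex with slack can be coloured last in its uncoloured component. -/
theorem flood_spec (hB : bound g k ≤ B) (hs : Static g k s) (hr : Rep g s)
    (hg : g.Good k (s.arrs aCol)) (hin : ∀ v < g.n, s.arrs aIn v = 0) {v : ℕ}
    (hv : s.vars 40 = v) (hvn : v < g.n) (hv0 : s.arrs aCol v = 0)
    (hsl : g.Slack k (s.arrs aCol) v) :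
    wp B flood s fun t s' => Rep g s' ∧ g.Good k (s'.arrs aCol) ∧
      g.Closes (s.arrs aCol) (s'.arrs aCol) ∧ s'.arrs aCol v ≠ 0 ∧
      (∀ v < g.n, s'.arrs aIn v = 0) ∧
      t + 90 * g.wt (g.unc (s'.arrs aCol)) ≤ 90 * g.wt (g.unc (s.arrs aCol)) := by
  refine step_store 0 v ?_
  refine step_store v 1 ?_
  refine step_set 1 ?_
  refine step_set 0 ?_
  refine wp_mono (sweep_spec (s := ((((s.setArr aQ 0 v).setArr aIn v 1).setVar 20 1).setVar 21 0))
    (a := 1) (b := 0) hB hs.of_eq hr.of_eq hg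
    (by simp) (by simp) (by omega) ⟨?_, ?_, ?_, ?_⟩ ?_) ?_
  · intro i hi
    obtain rfl : i = 0 := by omega
    simpa using hvn
  · intro i hi
    obtain rfl : i = 0 := by omega
    simpa using hv0
  · intro i hi j hj _; omega
  · intro w hw
    by_cases h : w = v
    · subst h; simp
    · simp [h, hin w hw, Ne.symm h]
  · intro i _ hi
    obtain rfl : i = 0 := by omega
    simpa using hsl
  rintro t s₁ hf ⟨hr₁, hg₁, hk, -, -, hn, hcl, hin₁, ht⟩
  simp only [setVar_arrs, setArr_arrs, Nat.reduceEqDiff, if_false] at hk hn hcl ht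
  have hv1 : s₁.arrs aCol v ≠ 0 := by simpa using hn 0 le_rfl (by omega)
  have hC : g.Closes (s.arrs aCol) (s₁.arrs aCol) :=
    ⟨hk, fun w hw h0 h1 x hx => by simpa using hcl w hw h0 (.inl h1) x hx⟩
  refine ⟨hr₁, hg₁, hC, hv1, hin₁, ?_⟩
  have hlt : g.wt (g.unc (s₁.arrs aCol)) + 1 ≤ g.wt (g.unc (s.arrs aCol)) := by
    rw [← Net.wt_sdiff (hC.off (W := ∅)).unc_subset, add_comm]
    refine Nat.add_le_add_right ?_ _
    refine (Finset.card_pos.2 ⟨v, ?_⟩).trans_le (Net.card_le_wt _)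
    simp [Net.mem_unc, hvn, hv0, hv1]
  simp [entries, Net.wt] at ht hlt ⊢
  omega

/-- Register 42 becomes `1` or `0` according as the vertex in register 41 has slack or not. -/
def slackTest : Prog :=
  .load 43 aOff (.var 41) ;;
  .add 44 (.var 41) (.const 1) ;;
  .load 44 aOff (.var 44) ;;
  .sub 44 (.var 44) (.var 43) ;;
  .load 43 aUsed (.var 41) ;;
  .add 44 (.var 43) (.var 44) ;;
  .load 43 aDone (.var 41) ;;
  .add 43 (.var 1) (.var 43) ;;
  .set 42 (.const 0) ;;
  .branch (.lt (.var 44) (.var 43)) (.set 42 (.const 1)) .skip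

theorem slackTest_spec (hB : bound g k ≤ B) (hs : Static g k s) (hr : Rep g s) {v : ℕ}
    (hv : s.vars 41 = v) (hvn : v < g.n) :
    wp B slackTest s fun t s' =>
      (s'.vars 42 = 1 ∧ g.Slack k (s.arrs aCol) v ∨ s'.vars 42 = 0 ∧ ¬ g.Slack k (s.arrs aCol) v) ∧
      t ≤ 12 := by
  have hmono := g.mono v hvn
  have hoff1 := off_le_n (g := g) (v := v + 1) (by omega)
  have hdn := Net.done_le (g := g) (s.arrs aCol) v
  have hun := Net.used_card_le (g := g) (s.arrs aCol) v
  have hde := Net.deg_lt hvn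
  refine step_load (g.off v) (hv := by simp [hv, hs.off]) ?_
  refine step_add (v + 1) ?_
  refine step_load (g.off (v + 1)) (hv := by simp [hs.off]) ?_
  refine step_sub (g.deg v) (hv := by simp [Net.deg]) ?_
  refine step_load ((g.used (s.arrs aCol) v).card) (hv := by simp [hv, hr.used v hvn]) ?_
  refine step_add ((g.used (s.arrs aCol) v).card + g.deg v) ?_
  refine step_load (g.done (s.arrs aCol) v) (hv := by simp [hv, hr.done v hvn]) ?_
  refine step_add (k + g.done (s.arrs aCol) v) (hv := by simp [hs.vk]) ?_
  refine step_set 0 ?_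
  refine wp_branch.2 ⟨fun hb => ?_, fun hb => ?_⟩
  · simp at hb
    exact end_set 1 ⟨.inl ⟨by simp, hb⟩, by omega⟩
  · simp at hb
    exact wp_skip.2 ⟨.inr ⟨by simp, not_lt.2 hb⟩, by omega⟩


variable {g : Net} {k B : ℕ} {s s' : State} {P : Prog}

/-! ### Looking for slack and for different lists of available colours -/

/-- Looks for a vertex with slack among the first entries of the queue, whose number is in
register 45. If there is one, it goes to register 40 and register 46 becomes `1`. -/
def findSlack : Prog :=
  .set 46 (.const 0) ;;
  .set 47 (.const 0) ;;
  .loop (.lt (.var 47) (.var 45))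
    (.load 41 aQ (.var 47) ;;
     slackTest ;;
     .branch (.eq (.var 42) (.const 1)) (.set 46 (.const 1) ;; .set 40 (.var 41)) .skip ;;
     .add 47 (.var 47) (.const 1))

theorem findSlack_spec (hB : bound g k ≤ B) (hs : Static g k s) (hr : Rep g s) {a : ℕ}
    (ha : s.vars 45 = a) (han : a ≤ g.n) (hq : ∀ i < a, s.arrs aQ i < g.n) :
    wp B findSlack s fun t s' =>
      (s'.vars 46 = 1 ∧ (∃ i < a, s.arrs aQ i = s'.vars 40 ∧ g.Slack k (s.arrs aCol) (s'.vars 40)) ∨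
        s'.vars 46 = 0 ∧ ∀ i < a, ¬ g.Slack k (s.arrs aCol) (s.arrs aQ i)) ∧
      t ≤ 18 * a + 5 := by
  refine step_set 0 ?_
  refine step_set 0 ?_
  refine wp_for (fun i s' =>
      (s'.vars 46 = 1 ∧ (∃ i < a, s.arrs aQ i = s'.vars 40 ∧ g.Slack k (s.arrs aCol) (s'.vars 40)) ∨
        s'.vars 46 = 0 ∧ ∀ j < i, ¬ g.Slack k (s.arrs aCol) (s.arrs aQ j)))
    (fun i => 18 * (a - i)) 0 rfl (Nat.zero_le _) (fun s' hf => (hf.v _ rfl).trans ha)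
    (.inr ⟨by simp, fun j hj => by omega⟩) ?_ fun t s₁ _ h _ ht => ⟨h, by omega⟩
  · rintro i s₁ - hb e47 h hf
    have f4 : s₁.arrs aCol = s.arrs aCol := hf.a _ rfl
    have fQ : s₁.arrs aQ = s.arrs aQ := hf.a _ rfl
    have hs₁ : Static g k s₁ := hs.of_eq.frame hf
    have hr₁ : Rep g s₁ := hr.of_eq.frame hf
    have hvn := hq i hb
    refine step_load (s.arrs aQ i) ?_
    refine wp_seq.2 (wp_mono (slackTest_spec (s := s₁.setVar 41 (s.arrs aQ i)) hB
      hs₁.of_eq hr₁.of_eq (by simp) hvn) ?_)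
    rintro t s₂ hf₂ ⟨h42, ht⟩
    have e47' : s₂.vars 47 = i := hf₂.var
    have e41' : s₂.vars 41 = s.arrs aQ i := hf₂.var
    have e46' : s₂.vars 46 = s₁.vars 46 := hf₂.var
    have e40' : s₂.vars 40 = s₁.vars 40 := hf₂.var
    simp only [setVar_arrs, f4] at h42
    refine wp_seq.2 (wp_branch.2 ⟨fun hb' => ?_, fun hb' => ?_⟩)
    · simp at hb'
      have hsl : g.Slack k (s.arrs aCol) (s.arrs aQ i) := by
        rcases h42 with h42 | h42
        · exact h42.2
        · omega
      refine step_set 1 ?_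
      refine end_set (s.arrs aQ i) ?_
      exact end_add (i + 1) ⟨by simp, .inl ⟨by simp, i, hb, by simp, by simpa using hsl⟩, by omega⟩
    · simp at hb'
      have hsl : ¬ g.Slack k (s.arrs aCol) (s.arrs aQ i) := by
        rcases h42 with h42 | h42
        · omega
        · exact h42.2
      refine wp_skip.2 (end_add (i + 1) ⟨by simp, ?_, by omega⟩)
      simp only [setVar_vars, Nat.reduceEqDiff, if_false, e46', e40']
      refine h.imp_right fun h => ⟨h.1, fun j hj => ?_⟩
      rcases (Nat.lt_succ_iff.1 hj).lt_or_eq with h' | rfl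
      exacts [h.2 j h', hsl]

/-- Compares the colours around two vertices, whose rows in `aTab` begin at the positions in the
registers 50 and 51. Register 58 becomes a colour at which they differ, or `0`. -/
def compare : Prog :=
  .set 58 (.const 0) ;;
  .set 52 (.const 0) ;;
  .loop (.lt (.var 52) (.var 1))
    (.add 52 (.var 52) (.const 1) ;;
     .add 53 (.var 50) (.var 52) ;;
     .load 53 aTab (.var 53) ;;
     .add 54 (.var 51) (.var 52) ;;
     .load 54 aTab (.var 54) ;;
     .branch (.eq (.var 53) (.var 54)) .skip (.set 58 (.var 52)))

theorem compare_spec (hB : bound g k ≤ B) (hs : Static g k s) (hr : Rep g s) (hkn : k ≤ g.n)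
    {u w : ℕ} (hu : u < g.n) (hw : w < g.n) (e50 : s.vars 50 = u * (g.n + 1))
    (e51 : s.vars 51 = w * (g.n + 1)) :
    wp B compare s fun t s' =>
      (s'.vars 58 = 0 ∧ (∀ c, 1 ≤ c → c ≤ k →
          (c ∈ g.used (s.arrs aCol) u ↔ c ∈ g.used (s.arrs aCol) w)) ∨
        1 ≤ s'.vars 58 ∧ s'.vars 58 ≤ k ∧
          ¬ (s'.vars 58 ∈ g.used (s.arrs aCol) u ↔ s'.vars 58 ∈ g.used (s.arrs aCol) w)) ∧
      t ≤ 8 * k + 3 := by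
  refine step_set 0 ?_
  refine step_set 0 ?_
  set col := s.arrs aCol
  refine wp_for (fun i s' => s'.vars 58 = 0 ∧ (∀ c, 1 ≤ c → c ≤ i →
      (c ∈ g.used col u ↔ c ∈ g.used col w)) ∨ 1 ≤ s'.vars 58 ∧ s'.vars 58 ≤ k ∧
      ¬ (s'.vars 58 ∈ g.used col u ↔ s'.vars 58 ∈ g.used col w)) (fun i => 8 * (k - i)) 0 rfl
    (Nat.zero_le _) (fun s' hf => (hf.v _ rfl).trans hs.vk)
    (.inl ⟨by simp, fun c h1 h2 => by omega⟩) ?_ fun t s' _ h _ ht => ⟨h, by omega⟩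
  rintro i s₁ - hi e52 h hf
  have f50 : s₁.vars 50 = u * (g.n + 1) := hf.var
  have f51 : s₁.vars 51 = w * (g.n + 1) := hf.var
  have f5 : s₁.arrs aTab = s.arrs aTab := hf.arr
  have h1 := row_lt_bound hB hu (hi.le.trans hkn)
  have h1 := row_lt_bound hB hu (hi.trans_le hkn : i + 1 ≤ g.n)
  have h2 := row_lt_bound hB hw (hi.trans_le hkn : i + 1 ≤ g.n)
  refine step_add (i + 1) ?_
  refine step_add (u * (g.n + 1) + (i + 1)) ?_
  refine step_load (if i + 1 ∈ g.used col u then 1 else 0)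
    (hv := by simp [f5, hr.tab _ hu (i + 1) (by omega) (by omega), col]) ?_
  refine step_add (w * (g.n + 1) + (i + 1)) ?_
  refine step_load (if i + 1 ∈ g.used col w then 1 else 0)
    (hv := by simp [f5, hr.tab _ hw (i + 1) (by omega) (by omega), col]) ?_
  refine wp_branch.2 ⟨fun hb => ?_, fun hb => ?_⟩
  · have hiff : i + 1 ∈ g.used col u ↔ i + 1 ∈ g.used col w := by
      by_cases h1 : i + 1 ∈ g.used col u <;> by_cases h2 : i + 1 ∈ g.used col w <;>
        simp [h1, h2] at hb ⊢
    refine wp_skip.2 ⟨by simp, h.imp (fun h => ⟨by simp [h.1], fun c hc1 hc2 => ?_⟩)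
      (by simpa using ·), by omega⟩
    rcases hc2.lt_or_eq with h' | rfl
    exacts [h.2 c hc1 (by omega), hiff]
  · exact end_set (i + 1) ⟨by simp, .inr ⟨by simp, by simpa using hi, fun h => hb (by
      simp at h; simp [h])⟩, by omega⟩

/-- Looks for a vertex `v` among the first entries of the queue, whose number is in register 45,
and a colour which is available at just one of `v` and `par v`. If there are such, they go to
the registers 55, 56 and 57, and register 46 becomes `1`. -/
def findPair : Prog :=
  .set 46 (.const 0) ;;
  .set 47 (.const 0) ;;
  .loop (.lt (.var 47) (.var 45))
    (.load 48 aQ (.var 47) ;;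
     .load 49 aPar (.var 48) ;;
     .load 50 aBase (.var 48) ;;
     .load 51 aBase (.var 49) ;;
     compare ;;
     .branch (.eq (.var 58) (.const 0)) .skip
       (.set 46 (.const 1) ;; .set 55 (.var 48) ;; .set 56 (.var 49) ;; .set 57 (.var 58)) ;;
     .add 47 (.var 47) (.const 1))

/-- The colour in register 57 is used around just one of the vertices in the registers
55 and 56. -/
def Differ (g : Net) (k : ℕ) (col q par : ℕ → ℕ) (a : ℕ) (s : State) : Prop :=
  (∃ i < a, q i = s.vars 55) ∧ s.vars 56 = par (s.vars 55) ∧ 1 ≤ s.vars 57 ∧ s.vars 57 ≤ k ∧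
    ¬ (s.vars 57 ∈ g.used col (s.vars 55) ↔ s.vars 57 ∈ g.used col (s.vars 56))

theorem findPair_spec (hB : bound g k ≤ B) (hs : Static g k s) (hr : Rep g s) {a : ℕ}
    (ha : s.vars 45 = a) (han : a ≤ g.n) (hkn : k ≤ g.n) (hq : ∀ i < a, s.arrs aQ i < g.n)
    (hp : ∀ i < a, s.arrs aPar (s.arrs aQ i) < g.n) :
    wp B findPair s fun t s' =>
      (s'.vars 46 = 1 ∧ Differ g k (s.arrs aCol) (s.arrs aQ) (s.arrs aPar) a s' ∨
        s'.vars 46 = 0 ∧ ∀ i < a, ∀ c, 1 ≤ c → c ≤ k → (c ∈ g.used (s.arrs aCol) (s.arrs aQ i) ↔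
          c ∈ g.used (s.arrs aCol) (s.arrs aPar (s.arrs aQ i)))) ∧
      t ≤ 12 * (k + 1) * a + 5 := by
  refine step_set 0 ?_
  refine step_set 0 ?_
  set col := s.arrs aCol with hcol
  set q := s.arrs aQ with hqd
  set par := s.arrs aPar with hpar
  refine wp_for (fun i s' => s'.vars 46 = 1 ∧ Differ g k col q par a s' ∨
      s'.vars 46 = 0 ∧ ∀ j < i, ∀ c, 1 ≤ c → c ≤ k →
        (c ∈ g.used col (q j) ↔ c ∈ g.used col (par (q j)))) (fun i => 12 * (k + 1) * (a - i)) 0 rfl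
    (Nat.zero_le _) (fun s' hf => (hf.v _ rfl).trans ha)
    (.inr ⟨by simp, fun j hj => by omega⟩) ?_ fun t s₁ _ h _ ht => ⟨h, by simp at ht; omega⟩
  rintro i s₁ - hb e47 h hf
  have fQ : s₁.arrs aQ = q := hf.arr
  have fP : s₁.arrs aPar = par := hf.arr
  have f4 : s₁.arrs aCol = col := hf.arr
  have hs₁ : Static g k s₁ := hs.of_eq.frame hf
  have hr₁ : Rep g s₁ := hr.of_eq.frame hf
  have hvn := hq i hb
  have hpn := hp i hb
  have hr0 := row_lt_bound hB hvn (Nat.zero_le _)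
  have hp0 := row_lt_bound hB hpn (Nat.zero_le _)
  refine step_load (q i) ?_
  refine step_load (par (q i)) ?_
  refine step_load (q i * (g.n + 1)) (hv := by simp [hs₁.base _ hvn]) ?_
  refine step_load (par (q i) * (g.n + 1)) (hv := by simp [hs₁.base _ hpn]) ?_
  refine wp_seq.2 (wp_mono (compare_spec (s := (((s₁.setVar 48 (q i)).setVar 49
    (par (q i))).setVar 50 (q i * (g.n + 1))).setVar 51 (par (q i) * (g.n + 1))) hB hs₁.of_eq
    hr₁.of_eq hkn hvn hpn (by simp) (by simp)) ?_)
  rintro t s₂ hf₂ ⟨hc, ht⟩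
  simp only [setVar_arrs, f4] at hc
  have e46 : s₂.vars 46 = s₁.vars 46 := hf₂.var
  have e47 : s₂.vars 47 = i := hf₂.var
  have e48 : s₂.vars 48 = q i := hf₂.var
  have e49 : s₂.vars 49 = par (q i) := hf₂.var
  have e55 : s₂.vars 55 = s₁.vars 55 := hf₂.var
  have e56 : s₂.vars 56 = s₁.vars 56 := hf₂.var
  have e57 : s₂.vars 57 = s₁.vars 57 := hf₂.var
  have hcr : 12 * (k + 1) * (a - i) = 12 * (k + 1) * (a - (i + 1)) + 12 * (k + 1) := by
    rw [← Nat.mul_succ]; congr 1; omega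
  refine wp_seq.2 (wp_branch.2 ⟨fun hb' => wp_skip.2 ?_, fun hb' => ?_⟩) <;> simp at hb'
  · refine end_add (i + 1) ⟨by simp, h.imp (fun h => ⟨by simp [e46, h.1],
      by simpa [Differ, e55, e56, e57] using h.2⟩) fun h => ⟨by simp [e46, h.1], fun j hj => ?_⟩,
      by omega⟩
    rcases (Nat.lt_succ_iff.1 hj).lt_or_eq with h' | rfl
    exacts [h.2 j h', (hc.resolve_right (by omega)).2]
  · obtain ⟨h1, hk, hne⟩ := hc.resolve_left (by omega)
    refine step_set 1 ?_
    refine step_set (q i) ?_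
    refine step_set (par (q i)) ?_
    refine end_set (s₂.vars 58) ?_
    exact end_add (i + 1) ⟨by simp, .inl ⟨by simp, ⟨i, hb, by simp⟩, by simp, by simpa using h1,
      by simpa using hk, by simpa using hne⟩, by omega⟩

/-- Let the first entries of the queue, whose number is in register 45, list a set `W` of
uncoloured vertices. If some vertex of `W` has slack, or some available colours differ at `v` and
`par v`, this colours `W` and sets register 46 to `1`. -/
def finish : Prog :=
  findSlack ;;
  .branch (.eq (.var 46) (.const 1)) flood
    (findPair ;;
     .branch (.eq (.var 46) (.const 1))
       (.load 50 aBase (.var 55) ;;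
        .add 50 (.var 50) (.var 57) ;;
        .load 50 aTab (.var 50) ;;
        .branch (.eq (.var 50) (.const 1))
          (.set 10 (.var 56) ;; .set 40 (.var 55))
          (.set 10 (.var 55) ;; .set 40 (.var 56)) ;;
        .set 11 (.var 57) ;;
        assign ;;
        flood)
       .skip)

/-- The first `a` entries of the queue list `W`, and `W` is connected and has no cut vertex. In
addition `par` maps every vertex of `W` to itself or to a neighbour in `W`. -/
structure Block (g : Net) (s : State) (a : ℕ) (W : Set ℕ) : Prop extends
    Net.Part g (s.arrs aCol) W where
  mem : ∀ v, v ∈ W ↔ ∃ i < a, s.arrs aQ i = v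
  inj : ∀ i < a, ∀ j < a, s.arrs aQ i = s.arrs aQ j → i = j
  par : ∀ v ∈ W, s.arrs aPar v ∈ W ∧ (s.arrs aPar v = v ∨ s.arrs aPar v ∈ g.N v)
  conn : ∀ w ∈ W, g.Conn W w
  conn_diff : ∀ u ∈ W, ∀ w ∈ W, u ≠ w → g.Conn (W \ {u}) w

theorem Block.sum_entries {a : ℕ} {W : Set ℕ} (hW : Block g s a W) (f : ℕ → ℕ) :
    ∑ v ∈ entries (s.arrs aQ) a, f v = ∑ i ∈ Finset.range a, f (s.arrs aQ i) := by
  rw [entries, Finset.sum_image]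
  intro i hi j hj hij
  exact hW.inj i (by simpa using hi) j (by simpa using hj) hij

theorem Block.le_n {a : ℕ} {W : Set ℕ} (hW : Block g s a W) : a ≤ g.n :=
  le_of_injective hW.inj fun i hi => hW.lt _ ((hW.mem _).2 ⟨i, hi, rfl⟩)

/-- Two colours for neighbours: if `c` is used around `w` but not around the uncoloured neighbour
`u` of `w`, then colouring `u` with `c` gives `w` slack. -/
theorem slack_of_differ {col : ℕ → ℕ} (hg : g.Good k col) {u w c : ℕ} (huw : u ∈ g.N w)
    (hu0 : col u = 0) (hw0 : col w = 0) (hc : c ∈ g.used col w) :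
    g.Slack k (Function.update col u c) w := by
  obtain ⟨hc0, x, hx, rfl⟩ := Net.mem_used.1 hc
  have hxu : x ≠ u := by rintro rfl; exact hc0 hu0
  exact Net.slack_of_dup (hg.small w (Net.N_lt_left huw) hw0) hx huw hxu (by simp [hxu])
    (by simpa [hxu] using hc0)

theorem finish_spec (hB : bound g k ≤ B) (hs : Static g k s) (hr : Rep g s)
    (hg : g.Good k (s.arrs aCol)) (hin : ∀ v < g.n, s.arrs aIn v = 0) {a : ℕ} {W : Set ℕ}
    (ha : s.vars 45 = a) (ha0 : 0 < a) (hW : Block g s a W) :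
    wp B finish s fun t s' => Rep g s' ∧ g.Good k (s'.arrs aCol) ∧
      (∀ v < g.n, s'.arrs aIn v = 0) ∧
      (s'.vars 46 = 1 ∧ g.Closes (s.arrs aCol) (s'.arrs aCol) ∧ (∀ v ∈ W, s'.arrs aCol v ≠ 0) ∨
        s'.vars 46 = 0 ∧ s'.arrs aCol = s.arrs aCol ∧ s'.arrs aQ = s.arrs aQ ∧
        (∀ v ∈ W, ¬ g.Slack k (s.arrs aCol) v) ∧
        ∀ v ∈ W, g.used (s.arrs aCol) (s.arrs aPar v) = g.used (s.arrs aCol) v) ∧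
      t + 90 * g.wt (g.unc (s'.arrs aCol)) ≤
        90 * g.wt (g.unc (s.arrs aCol)) + 40 * g.wt (entries (s.arrs aQ) a) + 30 := by
  have han := hW.le_n
  have hqW : ∀ i < a, s.arrs aQ i ∈ W := fun i hi => (hW.mem _).2 ⟨i, hi, rfl⟩
  have hqn : ∀ i < a, s.arrs aQ i < g.n := fun i hi => hW.lt _ (hqW i hi)
  have hwa : a ≤ g.wt (entries (s.arrs aQ) a) :=
    (card_entries hW.inj).symm.trans_le (Net.card_le_wt _)
  refine wp_seq.2 (wp_mono (findSlack_spec hB hs hr ha han hqn) ?_)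
  rintro t₁ s₁ hf₁ ⟨h46, ht₁⟩
  have hs₁ : Static g k s₁ := hs.frame hf₁
  have hr₁ : Rep g s₁ := hr.frame hf₁
  have f4 : s₁.arrs aCol = s.arrs aCol := hf₁.a _ rfl
  have f11 : s₁.arrs aIn = s.arrs aIn := hf₁.a _ rfl
  refine wp_branch.2 ⟨fun hb => ?_, fun hb => ?_⟩
  · simp at hb
    rcases h46 with ⟨-, i, hi, hv, hsl⟩ | ⟨h, -⟩
    swap; · omega
    have hvW := hqW i hi
    rw [hv] at hvW
    refine wp_mono (flood_spec hB hs₁ hr₁ (by rw [f4]; exact hg) (by rw [f11]; exact hin) rfl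
      (hW.lt _ hvW) (by rw [f4]; exact hW.unc _ hvW) (by rw [f4]; exact hsl)) ?_
    rintro t₂ s₂ hf₂ ⟨hr₂, hg₂, hC, hv₂, hin₂, ht₂⟩
    rw [f4] at hC ht₂
    exact ⟨hr₂, hg₂, hin₂, .inl ⟨(hf₂.v _ rfl).trans hb, hC,
      hC.conn (hW.conn _ hvW) hW.lt hW.unc hv₂⟩, by omega⟩
  · simp at hb
    rcases h46 with ⟨h, -⟩ | ⟨h46, hns⟩
    · omega
    have fQ : s₁.arrs aQ = s.arrs aQ := hf₁.a _ rfl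
    have fP : s₁.arrs aPar = s.arrs aPar := hf₁.a _ rfl
    have hns' : ∀ v ∈ W, ¬ g.Slack k (s.arrs aCol) v := fun v hv => by
      obtain ⟨i, hi, rfl⟩ := (hW.mem v).1 hv
      exact hns i hi
    have hdeg : ∀ v ∈ W, g.deg v = k := fun v hv =>
      (Net.not_slack (hns' v hv) (hg.small v (hW.lt v hv) (hW.unc v hv))).1
    have hkn : k ≤ g.n := by
      have := hdeg _ (hqW 0 ha0)
      have := Net.deg_lt (hqn 0 ha0)
      omega
    have hwk : (k + 1) * a = g.wt (entries (s.arrs aQ) a) := by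
      rw [Net.wt, hW.sum_entries, Finset.sum_congr rfl (g := fun _ => k + 1)
        fun i hi => by rw [hdeg _ (hqW i (Finset.mem_range.1 hi))]]
      simp [mul_comm]
    refine wp_seq.2 (wp_mono (findPair_spec (a := a) hB hs₁ hr₁ ((hf₁.v _ rfl).trans ha) han hkn
      (by rw [fQ]; exact hqn) (by rw [fQ, fP]; exact fun i hi => hW.lt _ (hW.par _ (hqW i hi)).1)) ?_)
    rintro t₂ s₂ hf₂ ⟨h46₂, ht₂⟩
    rw [mul_assoc, hwk] at ht₂
    rw [f4, fQ, fP] at h46₂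
    have hs₂ : Static g k s₂ := hs₁.frame hf₂
    have hr₂ : Rep g s₂ := hr₁.frame hf₂
    have f4₂ : s₂.arrs aCol = s.arrs aCol := hf₂.arr
    have f11₂ : s₂.arrs aIn = s.arrs aIn := hf₂.arr
    refine wp_branch.2 ⟨fun hb₂ => ?_, fun hb₂ => ?_⟩
    · simp at hb₂
      rcases h46₂ with ⟨-, hd⟩ | ⟨h, -⟩
      swap; · omega
      obtain ⟨⟨i, hi, hv⟩, hp, hc1, hck, hne⟩ := hd
      obtain ⟨v, hvd⟩ : ∃ v, s₂.vars 55 = v := ⟨_, rfl⟩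
      obtain ⟨p, hpd⟩ : ∃ p, s₂.vars 56 = p := ⟨_, rfl⟩
      obtain ⟨c, hcd⟩ : ∃ c, s₂.vars 57 = c := ⟨_, rfl⟩
      rw [hvd] at hv hp hne
      rw [hpd] at hp hne
      rw [hcd] at hc1 hck hne
      have hvW : v ∈ W := hv ▸ hqW i hi
      have hpW : p ∈ W := hp ▸ (hW.par v hvW).1
      have hpv : p ∈ g.N v := by
        rcases (hW.par v hvW).2 with h | h
        · rw [← hp] at h; rw [h] at hne; exact absurd Iff.rfl hne
        · rwa [hp]
      have hrow := row_lt_bound (v := c) hB (hW.lt v hvW) (by omega)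
      have hrow0 := row_lt_bound (v := 0) hB (hW.lt v hvW) (by omega)
      have hvn := hW.lt v hvW
      have hpn := hW.lt p hpW
      refine step_load (v * (g.n + 1)) (hv := by simp [hvd, hs₂.base v hvn]) ?_
      refine step_add (v * (g.n + 1) + c) ?_
      refine step_load (if c ∈ g.used (s.arrs aCol) v then 1 else 0)
        (hv := by simp [hr₂.tab v hvn c hc1 (by omega), f4₂]) ?_
      -- the colouring step is the same for the two roles that `v` and `p` can play
      have key : ∀ u w s₃, s₃.vars 10 = u → s₃.vars 40 = w → s₃.arrs = s₂.arrs →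
          Static g k s₃ → s₃.vars 46 = 1 → s₃.vars 57 = c → u ∈ W → w ∈ W → u ∈ g.N w →
          c ∉ g.used (s.arrs aCol) u → c ∈ g.used (s.arrs aCol) w →
          wp B (.set 11 (.var 57) ;; assign ;; flood) s₃ fun t s' => Rep g s' ∧
            g.Good k (s'.arrs aCol) ∧ (∀ v < g.n, s'.arrs aIn v = 0) ∧ s'.vars 46 = 1 ∧
            g.Closes (s.arrs aCol) (s'.arrs aCol) ∧ (∀ v ∈ W, s'.arrs aCol v ≠ 0) ∧
            t + 90 * g.wt (g.unc (s'.arrs aCol)) ≤ 90 * g.wt (g.unc (s.arrs aCol)) + 1 := by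
        intro u w s₃ e10 e40 fa hs₃ f46 f57 huW hwW huw hcu hcw
        have f4₃ : s₃.arrs aCol = s.arrs aCol := (congrFun fa _).trans f4₂
        have hr₃ : Rep g s₃ := hr₂.of_eq (congrFun fa _) (congrFun fa _) (congrFun fa _)
          (congrFun fa _)
        have hun := hW.lt u huW
        have hu0 := hW.unc u huW
        have hwu : w ≠ u := (Net.N_ne huw).symm
        refine step_set c ?_
        refine wp_seq.2 (wp_mono (assign_spec (s := s₃.setVar 11 c) (v := u) (c := c) hB
          hs₃.of_eq hr₃.of_eq (by simp [e10]) (by simp) hun (by simp [f4₃, hu0]) hc1 (by omega)) ?_)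
        rintro t₄ s₄ hf₄ ⟨hr₄, h4, ht₄⟩
        simp only [setVar_arrs, f4₃] at h4
        refine wp_mono (flood_spec (v := w) hB (hs₃.of_eq.frame hf₄) hr₄ ?_ ?_ hf₄.var (hW.lt w hwW) ?_ ?_) ?_
        · rw [h4]; exact hg.update hu0 hcu (by omega) hck (by omega)
        · rw [hf₄.a 11 rfl, setVar_arrs, fa, f11₂]; exact hin
        · rw [h4, Function.update_of_ne hwu]; exact hW.unc w hwW
        · rw [h4]; exact slack_of_differ hg huw hu0 (hW.unc w hwW) hcw
        rintro t₅ s₅ hf₅ ⟨hr₅, hg₅, hC, hw₅, hin₅, ht₅⟩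
        rw [h4] at hC ht₅
        have hall : ∀ x ∈ W, s₅.arrs aCol x ≠ 0 := by
          intro x hx
          by_cases hxu : x = u
          · subst hxu
            rw [hC.keep x hun (by simp; omega)]
            simp; omega
          · refine hC.conn (hW.conn_diff u huW w hwW hwu.symm) (fun y hy => hW.lt y hy.1)
              (fun y hy => ?_) hw₅ x ⟨hx, hxu⟩
            rw [Function.update_of_ne hy.2]
            exact hW.unc y hy.1
        have hwt := Net.wt_unc_update (g := g) hun hu0 (show c ≠ 0 by omega)
        refine ⟨hr₅, hg₅, hin₅, ?_, ((hW.update huW).trans hC.off).closes hall, hall, by omega⟩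
        rw [hf₅.v 46 rfl, hf₄.v 46 rfl]
        simp [f46]
      refine wp_seq.2 (wp_branch.2 ⟨fun hb₃ => ?_, fun hb₃ => ?_⟩)
      · have hcv : c ∈ g.used (s.arrs aCol) v := by
          by_contra h; simp [h] at hb₃
        refine step_set p ?_
        refine end_set v ?_
        refine wp_mono (key p v _ (by simp) (by simp) rfl hs₂.of_eq (by simp [hb₂]) (by simp [hcd])
          hpW hvW hpv
          (fun h => hne (by simp [hcv, h])) hcv) ?_
        rintro t₄ s₄ - ⟨h1, h2, h3, h4, h5, h6, h7⟩
        exact ⟨h1, h2, h3, .inl ⟨h4, h5, h6⟩, by omega⟩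
      · have hcv : c ∉ g.used (s.arrs aCol) v := by
          intro h; simp [h] at hb₃
        refine step_set v ?_
        refine end_set p ?_
        refine wp_mono (key v p _ (by simp) (by simp) rfl hs₂.of_eq (by simp [hb₂]) (by simp [hcd])
          hvW hpW
          (Net.N_symm hpv) hcv (by_contra fun h => hne (by simp [hcv, h]))) ?_
        rintro t₄ s₄ - ⟨h1, h2, h3, h4, h5, h6, h7⟩
        exact ⟨h1, h2, h3, .inl ⟨h4, h5, h6⟩, by omega⟩
    · simp at hb₂
      rcases h46₂ with ⟨h, -⟩ | ⟨h46₂, hu⟩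
      · omega
      refine wp_skip.2 ⟨hr₂, by rw [f4₂]; exact hg, by rw [f11₂]; exact hin,
        .inr ⟨h46₂, f4₂, (hf₂.a _ rfl).trans fQ, hns', fun v hv => ?_⟩, by rw [f4₂]; omega⟩
      obtain ⟨i, hi, rfl⟩ := (hW.mem v).1 hv
      exact (hg.used_eq (hu i hi)).symm

end WordRAM

namespace Net

/-! ### Cycles -/

variable {g : Net} {k : ℕ} {col : ℕ → ℕ}

/-- The vertices `q 0, …, q (a - 1)` form a cycle in this order. -/
structure Cycle (g : Net) (q : ℕ → ℕ) (a : ℕ) : Prop where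
  pos : 0 < a
  adj : ∀ i, i + 1 < a → q (i + 1) ∈ g.N (q i)
  inj : ∀ i < a, ∀ j < a, q i = q j → i = j
  close : q 0 ∈ g.N (q (a - 1))

/-- Moving along a stretch of the cycle which stays inside `A`. -/
theorem Cycle.segment {q : ℕ → ℕ} {a : ℕ} (h : g.Cycle q a) {A T : Set ℕ}
    (hT : ∀ v ∈ T, v ∈ A → ∀ v' ∈ g.N v, v' ∈ A → v' ∈ T) {i j : ℕ} (hij : i ≤ j) (hj : j < a)
    (hA : ∀ l, i ≤ l → l ≤ j → q l ∈ A) : q i ∈ T ↔ q j ∈ T := by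
  induction j, hij using Nat.le_induction with
  | base => rfl
  | succ j hij ih =>
    rw [ih (by omega) fun l h1 h2 => hA l h1 (by omega)]
    have h1 := hA j hij (by omega)
    have h2 := hA (j + 1) (by omega) le_rfl
    exact ⟨fun h' => hT _ h' h1 _ (h.adj j hj) h2, fun h' => hT _ h' h2 _ (N_symm (h.adj j hj)) h1⟩

theorem Cycle.conn {q : ℕ → ℕ} {a : ℕ} (h : g.Cycle q a) {W : Set ℕ}
    (hW : ∀ v, v ∈ W ↔ ∃ i < a, q i = v) {w : ℕ} (hw : w ∈ W) : g.Conn W w := by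
  refine conn_of_reach (x := q 0) hw fun T v hv hvT hT => ?_
  obtain ⟨i, hi, rfl⟩ := (hW v).1 hv
  exact (h.segment hT (Nat.zero_le i) hi fun l _ hl => (hW _).2 ⟨l, by omega, rfl⟩).2 hvT

theorem Cycle.conn_diff {q : ℕ → ℕ} {a : ℕ} (h : g.Cycle q a) {W : Set ℕ}
    (hW : ∀ v, v ∈ W ↔ ∃ i < a, q i = v) {u w : ℕ} (hu : u ∈ W) (hw : w ∈ W) (huw : u ≠ w) :
    g.Conn (W \ {u}) w := by
  obtain ⟨j, hj, rfl⟩ := (hW u).1 hu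
  have hA : ∀ l < a, l ≠ j → q l ∈ W \ {q j} := fun l hl hlj =>
    ⟨(hW _).2 ⟨l, hl, rfl⟩, fun e => hlj (h.inj l hl j hj e)⟩
  have hi : ∀ v ∈ W \ {q j}, ∃ i < a, i ≠ j ∧ q i = v := by
    rintro v ⟨hv, hvj⟩
    obtain ⟨i, hi, rfl⟩ := (hW v).1 hv
    exact ⟨i, hi, fun e => hvj (by rw [e]; rfl), rfl⟩
  refine conn_of_reach (x := q (if j = 0 then 1 else 0)) ⟨hw, huw.symm⟩ fun T v hv hvT hT => ?_
  obtain ⟨i, hia, hij, rfl⟩ := hi v hv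
  split_ifs with hj0
  · exact (h.segment hT (by omega) hia fun l _ _ => hA l (by omega) (by omega)).2 hvT
  · rcases lt_or_gt_of_ne hij with hlt | hlt
    · exact (h.segment hT (Nat.zero_le i) hia fun l _ _ => hA l (by omega) (by omega)).2 hvT
    · refine hT (q (a - 1)) ?_ (hA _ (by omega) (by omega)) _ h.close (hA _ (by omega) (by omega))
      exact (h.segment hT (by omega : i ≤ a - 1) (by omega) fun l _ _ =>
        hA l (by omega) (by omega)).1 hvT

theorem Cycle.mem_diff_pair {q : ℕ → ℕ} {a : ℕ} (h : g.Cycle q a) {W : Set ℕ}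
    (hW : ∀ v, v ∈ W ↔ ∃ i < a, q i = v) {s t : ℕ} (hs : s < a) (ht : t < a) {v : ℕ} :
    v ∈ W \ {q s, q t} ↔ ∃ i < a, i ≠ s ∧ i ≠ t ∧ q i = v := by
  simp only [Set.mem_sdiff, hW, Set.mem_insert_iff, Set.mem_singleton_iff, not_or]
  constructor
  · rintro ⟨⟨i, hi, rfl⟩, h1, h2⟩
    exact ⟨i, hi, fun e => h1 (by rw [e]), fun e => h2 (by rw [e]), rfl⟩
  · rintro ⟨i, hi, h1, h2, rfl⟩
    exact ⟨⟨i, hi, rfl⟩, fun e => h1 (h.inj i hi s hs e), fun e => h2 (h.inj i hi t ht e)⟩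

/-- Removing two vertices at distance two on the cycle does not disconnect it if the vertex
between them has a further neighbour. -/
theorem Cycle.conn_diff_near {q : ℕ → ℕ} {a : ℕ} (h : g.Cycle q a) {W : Set ℕ}
    (hW : ∀ v, v ∈ W ↔ ∃ i < a, q i = v) {t m : ℕ} (ht : t + 2 < a) (hm : m < a)
    (hmt : m < t ∨ t + 2 < m) (hy : q m ∈ g.N (q (t + 1))) :
    g.Conn (W \ {q t, q (t + 2)}) (q (t + 1)) := by
  have hA := fun v => h.mem_diff_pair hW (s := t) (t := t + 2) (by omega) ht (v := v)
  have hA' : ∀ l < a, l ≠ t → l ≠ t + 2 → q l ∈ W \ {q t, q (t + 2)} :=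
    fun l h1 h2 h3 => (hA _).2 ⟨l, h1, h2, h3, rfl⟩
  refine conn_of_reach (x := q m) (hA' _ (by omega) (by omega) (by omega)) fun T v hv hvT hT => ?_
  obtain ⟨i, hia, hi1, hi2, rfl⟩ := (hA v).1 hv
  by_cases hi3 : i = t + 1
  · subst hi3
    exact hT _ hvT hv _ hy (hA' m hm (by omega) (by omega))
  have hlow : ∀ l < t, q l ∈ T ↔ q 0 ∈ T := fun l hl =>
    (h.segment hT (Nat.zero_le l) (by omega) fun x _ _ => hA' x (by omega) (by omega)
      (by omega)).symm
  have hhigh : ∀ l, t + 2 < l → l < a → (q l ∈ T ↔ q (a - 1) ∈ T) := fun l hl hla =>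
    h.segment hT (by omega) (by omega) fun x _ _ => hA' x (by omega) (by omega) (by omega)
  have hcl : 0 < t → t + 2 < a - 1 → (q 0 ∈ T ↔ q (a - 1) ∈ T) := fun h0 h1 => by
    have e0 := hA' 0 (by omega) (by omega) (by omega)
    have e1 := hA' (a - 1) (by omega) (by omega) (by omega)
    exact ⟨fun h' => hT _ h' e0 _ (N_symm h.close) e1, fun h' => hT _ h' e1 _ h.close e0⟩
  rcases hmt with hmt | hmt
  · rw [hlow m hmt]
    rcases lt_or_gt_of_ne hi1 with hit | hit
    · exact (hlow i hit).1 hvT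
    · exact (hcl (by omega) (by omega)).2 ((hhigh i (by omega) hia).1 hvT)
  · rw [hhigh m hmt hm]
    rcases lt_or_gt_of_ne hi1 with hit | hit
    · exact (hcl (by omega) (by omega)).1 ((hlow i hit).1 hvT)
    · exact (hhigh i (by omega) hia).1 hvT

/-- If vertices at distance two along the path `q 0, …, q (a - 1)` are adjacent, then removing
`q 0` and another vertex of the cycle leaves it connected. -/
theorem Cycle.conn_diff_far {q : ℕ → ℕ} {a : ℕ} (h : g.Cycle q a) {W : Set ℕ}
    (hW : ∀ v, v ∈ W ↔ ∃ i < a, q i = v) {t : ℕ} (ht : 2 ≤ t) (hta : t + 1 < a)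
    (hsq : ∀ i, i + 2 < a → q (i + 2) ∈ g.N (q i)) :
    g.Conn (W \ {q 0, q t}) (q (t - 1)) := by
  have hA := fun v => h.mem_diff_pair hW (s := 0) (t := t) h.pos (by omega) (v := v)
  have hA' : ∀ l < a, l ≠ 0 → l ≠ t → q l ∈ W \ {q 0, q t} :=
    fun l h1 h2 h3 => (hA _).2 ⟨l, h1, h2, h3, rfl⟩
  refine conn_of_reach (x := q (t - 1)) (hA' _ (by omega) (by omega) (by omega))
    fun T v hv hvT hT => ?_
  obtain ⟨i, hia, hi1, hi2, rfl⟩ := (hA v).1 hv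
  rcases lt_or_gt_of_ne hi2 with hit | hit
  · exact (h.segment hT (by omega : i ≤ t - 1) (by omega) fun x _ _ =>
      hA' x (by omega) (by omega) (by omega)).1 hvT
  · have h1 : q (t + 1) ∈ T := (h.segment hT (by omega : t + 1 ≤ i) hia fun x _ _ =>
      hA' x (by omega) (by omega) (by omega)).2 hvT
    have := hsq (t - 1) (by omega)
    rw [show t - 1 + 2 = t + 1 by omega] at this
    exact hT _ h1 (hA' _ (by omega) (by omega) (by omega)) _ (N_symm this)
      (hA' _ (by omega) (by omega) (by omega))

/-- The uncoloured neighbours of `v`. -/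
def uncN (g : Net) (col : ℕ → ℕ) (v : ℕ) : Finset ℕ := (g.N v).filter (col · = 0)

theorem mem_uncN {v w : ℕ} : w ∈ g.uncN col v ↔ w ∈ g.N v ∧ col w = 0 := by simp [uncN]

theorem card_uncN {v : ℕ} (h : ¬ g.Slack k col v) (hdeg : g.deg v ≤ k) :
    (g.uncN col v).card + (g.used col v).card = k := by
  have h1 := not_slack h hdeg
  have h2 := done_add (g := g) col v
  rw [uncN]; omega

end Net

namespace WordRAM

variable {g : Net} {k B : ℕ} {s s' : State} {P : Prog}

/-! ### The case of equal lists, as in Brooks' theorem -/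

/-- Finds, in the cycle listed by the first entries of the queue (their number is in
register 45), two vertices which are not adjacent, and a common neighbour of them; they go to the
registers 55, 56 and 57. -/
def findCherry : Prog :=
  .set 46 (.const 0) ;;
  .set 47 (.const 0) ;;
  .set 60 (.const 2) ;;
  .loop (.lt (.var 60) (.var 45))
    (.load 61 aQ (.var 47) ;;
     .load 63 aQ (.var 60) ;;
     .load 62 aBase (.var 61) ;;
     .add 62 (.var 62) (.var 63) ;;
     .load 62 aAdj (.var 62) ;;
     .add 47 (.var 47) (.const 1) ;;
     .add 60 (.var 60) (.const 1) ;;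
     .branch (.eq (.var 62) (.const 0))
       (.set 46 (.const 1) ;; .set 55 (.var 61) ;; .set 56 (.var 63) ;; .load 57 aQ (.var 47))
       .skip) ;;
  .branch (.eq (.var 46) (.const 0))
    (.load 55 aQ (.const 0) ;;
     .load 62 aBase (.var 55) ;;
     .load 57 aQ (.const 0) ;;
     .set 47 (.const 1) ;;
     .load 56 aQ (.const 1) ;;
     .add 63 (.var 62) (.var 56) ;;
     .load 63 aAdj (.var 63) ;;
     .loop (.eq (.var 63) (.const 1))
       (.set 57 (.var 56) ;;
        .add 47 (.var 47) (.const 1) ;;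
        .load 56 aQ (.var 47) ;;
        .add 63 (.var 62) (.var 56) ;;
        .load 63 aAdj (.var 63)))
    .skip

theorem findCherry_spec (hB : bound g k ≤ B) (hs : Static g k s) {a : ℕ}
    (ha : s.vars 45 = a) (han : a ≤ g.n) (ha3 : 3 ≤ a) (hq : ∀ i < a, s.arrs aQ i < g.n)
    (hne : ∃ t, 1 ≤ t ∧ t < a ∧ s.arrs aQ t ∉ g.N (s.arrs aQ 0)) :
    wp B findCherry s fun t s' =>
      ((∃ t, t + 2 < a ∧ s.arrs aQ (t + 2) ∉ g.N (s.arrs aQ t) ∧ s'.vars 55 = s.arrs aQ t ∧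
        s'.vars 56 = s.arrs aQ (t + 2) ∧ s'.vars 57 = s.arrs aQ (t + 1)) ∨
       (∀ t, t + 2 < a → s.arrs aQ (t + 2) ∈ g.N (s.arrs aQ t)) ∧
        ∃ t, 1 ≤ t ∧ t < a ∧ s.arrs aQ t ∉ g.N (s.arrs aQ 0) ∧
          (∀ i, 1 ≤ i → i < t → s.arrs aQ i ∈ g.N (s.arrs aQ 0)) ∧ s'.vars 55 = s.arrs aQ 0 ∧
          s'.vars 56 = s.arrs aQ t ∧ s'.vars 57 = s.arrs aQ (t - 1)) ∧
      t ≤ 20 * a + 20 := by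
  set q := s.arrs aQ with hqd
  refine step_set 0 ?_
  refine step_set 0 ?_
  refine step_set 2 ?_
  refine wp_seq.2 (wp_for (fun i s' => ∃ t, i = t + 2 ∧ s'.vars 47 = t ∧ ((s'.vars 46 = 1 ∧
    ∃ t, t + 2 < a ∧ q (t + 2) ∉ g.N (q t) ∧
      s'.vars 55 = q t ∧ s'.vars 56 = q (t + 2) ∧ s'.vars 57 = q (t + 1)) ∨
      s'.vars 46 = 0 ∧ ∀ i < t, q (i + 2) ∈ g.N (q i))) (fun i => 14 * (a - i)) 2 rfl (by omega)
    (fun s' hf => (hf.v _ rfl).trans ha)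
    ⟨0, rfl, by simp, .inr ⟨by simp, fun i hi => by omega⟩⟩ ?_ ?_)
  · rintro _ s₁ - hb e60 ⟨t, rfl, e47, h⟩ hf
    have fQ : s₁.arrs aQ = q := hf.arr
    have f2 : s₁.arrs aBase = s.arrs aBase := hf.arr
    have f3 : s₁.arrs aAdj = s.arrs aAdj := hf.arr
    have h0 := hq t (by omega)
    have h1 := hq (t + 1) (by omega)
    have h2 := hq (t + 2) hb
    have hr0 := row_lt_bound (v := 0) hB h0 (by omega)
    have hr2 := row_lt_bound hB h0 h2.le
    refine step_load (q t) ?_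
    refine step_load (q (t + 2)) ?_
    refine step_load (q t * (g.n + 1)) (hv := by simp [f2, hs.base _ h0]) ?_
    refine step_add (q t * (g.n + 1) + q (t + 2)) ?_
    refine step_load (if q (t + 2) ∈ g.N (q t) then 1 else 0)
      (hv := by simp [f3, hs.adj _ h0 _ h2]) ?_
    refine step_add (t + 1) (hv := by simp [e47]) ?_
    refine step_add (t + 3) ?_
    refine wp_branch.2 ⟨fun hb' => ?_, fun hb' => ?_⟩
    · have hno : q (t + 2) ∉ g.N (q t) := fun h => by simp [h] at hb'
      refine step_set 1 ?_
      refine step_set (q t) ?_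
      refine step_set (q (t + 2)) ?_
      exact end_load (q (t + 1)) ⟨by simp, ⟨t + 1, rfl, by simp, .inl ⟨by simp, t, hb, hno, by simp, by simp, by simp⟩⟩,
        by omega⟩
    · have hyes : q (t + 2) ∈ g.N (q t) := by_contra fun h => by simp [h] at hb'
      refine wp_skip.2 ⟨by simp, ⟨t + 1, rfl, by simp, ?_⟩, by omega⟩
      simp only [setVar_vars, Nat.reduceEqDiff, if_false]
      refine h.imp_right fun h => ⟨h.1, fun i hi => ?_⟩
      rcases (Nat.lt_succ_iff.1 hi).lt_or_eq with h' | rfl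
      exacts [h.2 i h', hyes]
  · rintro t₁ s₁ - ⟨t, hta, e47, h⟩ hf ht₁
    have fQ : s₁.arrs aQ = q := hf.arr
    have f2 : s₁.arrs aBase = s.arrs aBase := hf.arr
    have f3 : s₁.arrs aAdj = s.arrs aAdj := hf.arr
    refine wp_branch.2 ⟨fun hb' => ?_, fun hb' => ?_⟩
    swap
    · simp at hb'
      rcases h with ⟨-, h⟩ | ⟨h, -⟩
      · exact wp_skip.2 ⟨.inl h, by omega⟩
      · omega
    simp at hb'
    rcases h with ⟨h, -⟩ | ⟨-, h⟩
    · omega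
    have hsq : ∀ t, t + 2 < a → q (t + 2) ∈ g.N (q t) := fun i hi => h i (by omega)
    have h0 := hq 0 (by omega)
    have h1 := hq 1 (by omega)
    have hrow := fun v (hv : v < g.n) => row_lt_bound hB h0 hv.le
    have hr0 := row_lt_bound (v := 0) hB h0 (by omega)
    have hr1 := hrow _ h1
    refine step_load (q 0) ?_
    refine step_load (q 0 * (g.n + 1)) (hv := by simp [f2, hs.base _ h0]) ?_
    refine step_load (q 0) ?_
    refine step_set 1 ?_
    refine step_load (q 1) ?_
    refine step_add (q 0 * (g.n + 1) + q 1) ?_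
    refine step_load (if q 1 ∈ g.N (q 0) then 1 else 0)
      (hv := by simp [f3, hs.adj _ h0 _ h1]) ?_
    refine wp_loop (fun cr s' => ∃ t, s'.vars 47 = t ∧ 1 ≤ t ∧ t < a ∧ s'.vars 55 = q 0 ∧
      s'.vars 56 = q t ∧ s'.vars 57 = q (t - 1) ∧ s'.vars 62 = q 0 * (g.n + 1) ∧
      s'.vars 63 = (if q t ∈ g.N (q 0) then 1 else 0) ∧
      (∀ i, 1 ≤ i → i < t → q i ∈ g.N (q 0)) ∧ cr = 6 * (a - t)) (c := 6 * (a - 1)) ?_ ?_ ?_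
    · rintro cr s₂ ⟨t, e47, ht1, hta, e55, e56, e57, e62, e63, hall, rfl⟩ hf' hb''
      have fQ' : s₂.arrs aQ = q := hf'.arr
      have f3' : s₂.arrs aAdj = s.arrs aAdj := hf'.arr
      have hyes : q t ∈ g.N (q 0) := by_contra fun h => by simp [e63, h] at hb''
      have hlt : t + 1 < a := by
        obtain ⟨i, hi1, hi2, hi3⟩ := hne
        by_contra hcon
        rcases (by omega : i < t ∨ i = t) with h' | rfl
        · exact hi3 (hall i hi1 h')
        · exact hi3 hyes
      have ht' := hq (t + 1) hlt
      have htn := hq t hta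
      have hrt := hrow _ ht'
      refine step_set (q t) ?_
      refine step_add (t + 1) ?_
      refine step_load (q (t + 1)) ?_
      refine step_add (q 0 * (g.n + 1) + q (t + 1)) ?_
      refine end_load (if q (t + 1) ∈ g.N (q 0) then 1 else 0)
        (hv := by simp [f3', hs.adj _ h0 _ ht']) ?_
      refine ⟨6 * (a - (t + 1)), ⟨t + 1, by simp, by omega, hlt, by simp [e55], by simp, by simp,
        by simp [e62], by simp, fun i hi1 hi2 => ?_, rfl⟩, by omega⟩
      rcases (Nat.lt_succ_iff.1 hi2).lt_or_eq with h' | rfl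
      exacts [hall i hi1 h', hyes]
    · exact ⟨1, by simp, le_rfl, by omega, by simp, by simp, by simp, by simp, by simp,
        fun i h1 h2 => by omega, rfl⟩
    · rintro t₂ s₂ cr ⟨t, e47, ht1, hta, e55, e56, e57, e62, e63, hall, rfl⟩ hf' hb'' ht₂
      have hno : q t ∉ g.N (q 0) := fun h => by simp [e63, h] at hb''
      exact ⟨.inr ⟨hsq, t, ht1, hta, hno, hall, e55, e56, e57⟩, by omega⟩

/-- Colours a block with a spanning cycle in which all vertices have the same available colours:
two vertices which are not adjacent but have a common neighbour get the same colour, and this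
gives slack to the common neighbour. -/
def brooks : Prog :=
  findCherry ;;
  .set 10 (.var 55) ;;
  greedy ;;
  .set 10 (.var 56) ;;
  assign ;;
  .set 40 (.var 57) ;;
  flood

theorem brooks_spec (hB : bound g k ≤ B) (hs : Static g k s) (hr : Rep g s)
    (hg : g.Good k (s.arrs aCol)) (hin : ∀ v < g.n, s.arrs aIn v = 0) {a : ℕ} {W : Set ℕ}
    (ha : s.vars 45 = a) (hP : g.Part (s.arrs aCol) W)
    (hW : ∀ v, v ∈ W ↔ ∃ i < a, s.arrs aQ i = v) (hC : g.Cycle (s.arrs aQ) a)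
    (hns : ∀ v ∈ W, ¬ g.Slack k (s.arrs aCol) v)
    (hun : ∀ v ∈ W, g.used (s.arrs aCol) v = g.used (s.arrs aCol) (s.arrs aQ 0))
    (h3 : (g.used (s.arrs aCol) (s.arrs aQ 0)).card + 3 ≤ k)
    (hcl : (g.used (s.arrs aCol) (s.arrs aQ 0)).card + a ≠ k + 1) :
    wp B brooks s fun t s' => Rep g s' ∧ g.Good k (s'.arrs aCol) ∧
      (∀ v < g.n, s'.arrs aIn v = 0) ∧ g.Closes (s.arrs aCol) (s'.arrs aCol) ∧
      (∀ v ∈ W, s'.arrs aCol v ≠ 0) ∧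
      t + 90 * g.wt (g.unc (s'.arrs aCol)) ≤ 90 * g.wt (g.unc (s.arrs aCol)) + 20 * a + 30 := by
  set q := s.arrs aQ with hq
  set col := s.arrs aCol with hcol
  have hqW : ∀ i < a, q i ∈ W := fun i hi => (hW _).2 ⟨i, hi, rfl⟩
  have hqn : ∀ i < a, q i < g.n := fun i hi => hP.lt _ (hqW i hi)
  have hpos := hC.pos
  -- all vertices of the cycle have the same number of uncoloured neighbours
  have hdeg : ∀ v ∈ W, (g.uncN col v).card + (g.used col (q 0)).card = k := fun v hv => by
    rw [← hun v hv]
    exact Net.card_uncN (hns v hv) (hg.small v (hP.lt v hv) (hP.unc v hv))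
  have himg : ((Finset.range a).image q).card = a := by
    rw [Finset.card_image_of_injOn, Finset.card_range]
    intro i hi j hj hij
    exact hC.inj i (by simpa using hi) j (by simpa using hj) hij
  have hsub : ∀ v ∈ W, g.uncN col v ⊆ ((Finset.range a).image q).erase v := fun v hv w hw => by
    obtain ⟨hw1, hw2⟩ := Net.mem_uncN.1 hw
    obtain ⟨i, hi, hiw⟩ := (hW w).1 (hP.nbr v hv w hw1 hw2)
    exact Finset.mem_erase.2 ⟨Net.N_ne hw1, Finset.mem_image.2 ⟨i, Finset.mem_range.2 hi, hiw⟩⟩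
  have hcard : ∀ v ∈ W, (((Finset.range a).image q).erase v).card = a - 1 := fun v hv => by
    obtain ⟨i, hi, hiv⟩ := (hW v).1 hv
    rw [Finset.card_erase_of_mem (Finset.mem_image.2 ⟨i, Finset.mem_range.2 hi, hiv⟩), himg]
  have h0W := hqW 0 hpos
  have hle := Finset.card_le_card (hsub _ h0W)
  rw [hcard _ h0W] at hle
  have hd0 := hdeg _ h0W
  have hne : ∃ t, 1 ≤ t ∧ t < a ∧ q t ∉ g.N (q 0) := by
    by_contra! hall
    have : ((Finset.range a).image q).erase (q 0) ⊆ g.uncN col (q 0) := by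
      intro w hw
      obtain ⟨h1, h2⟩ := Finset.mem_erase.1 hw
      obtain ⟨i, hi, rfl⟩ := Finset.mem_image.1 h2
      rw [Finset.mem_range] at hi
      have hi0 : i ≠ 0 := by rintro rfl; exact h1 rfl
      exact Net.mem_uncN.2 ⟨hall i (by omega) hi, hP.unc _ (hqW i hi)⟩
    have := Finset.card_le_card this
    rw [hcard _ h0W] at this
    omega
  have han : a ≤ g.n := by
    have : (Finset.range a).image q ⊆ Finset.range g.n := fun v hv => by
      obtain ⟨i, hi, rfl⟩ := Finset.mem_image.1 hv
      exact Finset.mem_range.2 (hqn i (Finset.mem_range.1 hi))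
    have := Finset.card_le_card this
    simpa [himg] using this
  refine wp_seq.2 (wp_mono (findCherry_spec hB hs ha han (by omega) hqn hne) ?_)
  rintro t₁ s₁ hf₁ ⟨hch, ht₁⟩
  have hcherry : ∃ u v w, s₁.vars 55 = u ∧ s₁.vars 56 = v ∧ s₁.vars 57 = w ∧ u ∈ W ∧ v ∈ W ∧
      w ∈ W ∧ u ≠ v ∧ v ∉ g.N u ∧ u ∈ g.N w ∧ v ∈ g.N w ∧ g.Conn (W \ {u, v}) w := by
    rcases hch with ⟨t, hta, hno, e55, e56, e57⟩ | ⟨hsq, t, ht1, hta, hno, hall, e55, e56, e57⟩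
    · refine ⟨_, _, _, e55, e56, e57, hqW _ (by omega), hqW _ hta, hqW _ (by omega), ?_, hno,
        Net.N_symm (hC.adj t (by omega)), hC.adj (t + 1) hta, ?_⟩
      · intro e
        have := hC.inj t (by omega) (t + 2) hta e
        omega
      · have hw := hdeg _ (hqW (t + 1) (by omega))
        have : 0 < ((g.uncN col (q (t + 1)) \ {q t, q (t + 2)})).card := by
          have h1 := Finset.le_card_sdiff {q t, q (t + 2)} (g.uncN col (q (t + 1)))
          have h2 := Finset.card_le_two (a := q t) (b := q (t + 2))
          omega
        obtain ⟨y, hy⟩ := Finset.card_pos.1 this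
        obtain ⟨hy1, hy2⟩ := Finset.mem_sdiff.1 hy
        obtain ⟨hy3, hy4⟩ := Net.mem_uncN.1 hy1
        obtain ⟨m, hm, rfl⟩ := (hW y).1 (hP.nbr _ (hqW _ (by omega)) y hy3 hy4)
        have hm1 : m ≠ t := by rintro rfl; exact hy2 (by simp)
        have hm2 : m ≠ t + 2 := by rintro rfl; exact hy2 (by simp)
        have hm3 : m ≠ t + 1 := by rintro rfl; exact Net.N_ne hy3 rfl
        exact hC.conn_diff_near hW hta hm (by omega) hy3
    · have hadj1 := hC.adj 0
      have ht2 : t ≠ 1 := by rintro rfl; exact hno (hC.adj 0 hta)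
      have ht3 : t ≠ 2 := by rintro rfl; exact hno (hsq 0 hta)
      have ht4 : t ≠ a - 1 := by rintro rfl; exact hno (Net.N_symm hC.close)
      refine ⟨_, _, _, e55, e56, e57, h0W, hqW _ hta, hqW _ (by omega), ?_, hno,
        Net.N_symm (hall (t - 1) (by omega) (by omega)), ?_,
        hC.conn_diff_far hW (by omega) (by omega) hsq⟩
      · intro e
        have := hC.inj 0 hpos t hta e
        omega
      · have := hC.adj (t - 1) (by omega)
        rwa [show t - 1 + 1 = t by omega] at this
  obtain ⟨u, v, w, e55, e56, e57, huW, hvW, hwW, huv, hnadj, huw, hvw, hconn⟩ := hcherry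
  have hs₁ : Static g k s₁ := hs.frame hf₁
  have hr₁ : Rep g s₁ := hr.frame hf₁
  have f4 : s₁.arrs aCol = col := hf₁.a _ rfl
  have hun' := hP.lt u huW
  have hvn := hP.lt v hvW
  have hwn := hP.lt w hwW
  have hu0 := hP.unc u huW
  have hv0 := hP.unc v hvW
  have hw0 := hP.unc w hwW
  have hwu : w ≠ u := (Net.N_ne huw).symm
  have hwv : w ≠ v := (Net.N_ne hvw).symm
  refine step_set u ?_
  refine wp_seq.2 (wp_mono (greedy_spec (s := s₁.setVar 10 u) (v := u) hB
    hs₁.of_eq hr₁.of_eq (by simpa [f4] using hg)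
    (by simp) hun' (by simp [f4, hu0]) ?_) ?_)
  · simp only [setVar_arrs, f4]
    rw [hun u huW]
    omega
  rintro t₂ s₂ hf₂ ⟨hr₂, hg₂, ⟨c, hc0, hck, hcn, hcu, e11, e4⟩, ht₂⟩
  simp only [setVar_arrs, f4] at hcu e4
  have hs₂ : Static g k s₂ := hs₁.of_eq.frame hf₂
  have e56₂ : s₂.vars 56 = v := hf₂.var
  have e57₂ : s₂.vars 57 = w := hf₂.var
  have hv0₂ : s₂.arrs aCol v = 0 := by rw [e4, Function.update_of_ne huv.symm, hv0]
  refine step_set v ?_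
  refine wp_seq.2 (wp_mono (assign_spec (s := s₂.setVar 10 v) (v := v) (c := c) hB
    hs₂.of_eq hr₂.of_eq (by simp) (by simp [e11]) hvn
    (by simp [hv0₂]) (by omega) hcn) ?_)
  rintro t₃ s₃ hf₃ ⟨hr₃, e4₃, ht₃⟩
  simp only [setVar_arrs] at e4₃
  have hs₃ : Static g k s₃ := hs₂.of_eq.frame hf₃
  have hcv : c ∉ g.used (s₂.arrs aCol) v := by
    rw [e4, Net.used_update hu0 hc0, if_neg fun h => hnadj (Net.N_symm h), hun v hvW, ← hun u huW]
    exact hcu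
  have hg₃ : g.Good k (s₃.arrs aCol) := by
    rw [e4₃]; exact hg₂.update hv0₂ hcv hc0 hck hcn
  have hw3 : s₃.arrs aCol w = 0 := by
    rw [e4₃, Function.update_of_ne hwv, e4, Function.update_of_ne hwu, hw0]
  have hu3 : s₃.arrs aCol u = c := by
    rw [e4₃, Function.update_of_ne huv, e4, Function.update_self]
  have hv3 : s₃.arrs aCol v = c := by
    rw [e4₃, Function.update_self]
  refine step_set w (hv := by simp [(hf₃.v 57 rfl).trans, e57₂]) ?_
  refine wp_mono (flood_spec (s := s₃.setVar 40 w) (v := w) hB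
    hs₃.of_eq hr₃.of_eq hg₃ ?_ (by simp) hwn
    (by simpa using hw3) ?_) ?_
  · rw [setVar_arrs, hf₃.a aIn rfl, setVar_arrs, hf₂.a aIn rfl, setVar_arrs, hf₁.a aIn rfl]
    exact hin
  · exact Net.slack_of_dup (hg.small w hwn hw0) huw hvw huv (by simp [hu3, hv3])
      (by simp [hu3, hc0])
  rintro t₄ s₄ hf₄ ⟨hr₄, hg₄, hC₄, hw₄, hin₄, ht₄⟩
  simp only [setVar_arrs] at hC₄ ht₄
  have hall : ∀ x ∈ W, s₄.arrs aCol x ≠ 0 := by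
    intro x hx
    by_cases hxu : x = u
    · subst hxu; rw [hC₄.keep x hun' (by rw [hu3]; exact hc0), hu3]; exact hc0
    by_cases hxv : x = v
    · subst hxv; rw [hC₄.keep x hvn (by rw [hv3]; exact hc0), hv3]; exact hc0
    refine hC₄.conn hconn (fun y hy => hP.lt y hy.1) (fun y hy => ?_) hw₄ x ⟨hx, by simp [hxu, hxv]⟩
    have hy' : y ≠ u ∧ y ≠ v := by simpa using hy.2
    rw [e4₃, Function.update_of_ne hy'.2, e4, Function.update_of_ne hy'.1, hP.unc y hy.1]
  have hoff : g.ClosesOff W col (s₃.arrs aCol) := by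
    rw [e4₃]
    refine ⟨fun x hx hx0 => ?_, fun x hx h0 h1 y hy => ?_⟩
    · have h1 : x ≠ u := by rintro rfl; exact hx0 hu0
      have h2 : x ≠ v := by rintro rfl; exact hx0 hv0
      rw [Function.update_of_ne h2, e4, Function.update_of_ne h1]
    · have hxW : x ∈ W := by
        by_contra hxW
        have h3 : x ≠ u := by rintro rfl; exact hxW huW
        have h4 : x ≠ v := by rintro rfl; exact hxW hvW
        rw [Function.update_of_ne h4, e4, Function.update_of_ne h3] at h1
        exact h1 h0
      by_cases hy0 : col y = 0
      · exact .inr (hP.nbr x hxW y hy hy0)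
      · left
        have h3 : y ≠ u := by rintro rfl; exact hy0 hu0
        have h4 : y ≠ v := by rintro rfl; exact hy0 hv0
        rwa [Function.update_of_ne h4, e4, Function.update_of_ne h3]
  have hwt1 := Net.wt_unc_update (g := g) hun' hu0 hc0
  have hwt2 := Net.wt_unc_update (g := g) hvn hv0₂ hc0
  rw [← e4] at hwt1
  rw [← e4₃] at hwt2
  exact ⟨hr₄, hg₄, hin₄, (hoff.trans hC₄.off).closes hall, hall, by omega⟩

end WordRAM

namespace Net

variable {g : Net} {k : ℕ} {col col₁ col₂ : ℕ → ℕ}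

/-! ### Leaf blocks -/

/-- The set that consists of `x` and of the entries `i, …, j - 1` of the list `ord`. -/
def blockSet (ord : ℕ → ℕ) (i j x : ℕ) : Set ℕ := {v | v = x ∨ ∃ l, i ≤ l ∧ l < j ∧ ord l = v}

/-- The entries `i, …, j - 1` of the list `ord` are, together with `x`, the vertices of a block
that depth-first search has found below `x`. The map `tree` gives parents in the search tree. The
first entry `ord i` was discovered last; the path from it towards the root, up to
the vertex with index `low (ord i)`, contains all its neighbours in the block, and the end of this
path is one of them. -/
structure LeafBlock (g : Net) (tree idx low ord : ℕ → ℕ) (i j x : ℕ) : Prop where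
  lt : i < j
  inj : ∀ l l', i ≤ l → l < j → i ≤ l' → l' < j → ord l = ord l' → l = l'
  ne : ∀ l, i ≤ l → l < j → ord l ≠ x
  last : tree (ord (j - 1)) = x
  up : ∀ l, i ≤ l → l + 1 < j → ∃ l', l < l' ∧ l' < j ∧ tree (ord l) = ord l'
  adj : ∀ l, i ≤ l → l < j → tree (ord l) ∈ g.N (ord l)
  conn : ∀ w ∈ blockSet ord i j x, g.Conn (blockSet ord i j x) w
  conn_diff : ∀ u ∈ blockSet ord i j x, ∀ w ∈ blockSet ord i j x, u ≠ w →
    g.Conn (blockSet ord i j x \ {u}) w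
  chain : ∃ a, (∀ t ≤ a, tree^[t] (ord i) ∈ blockSet ord i j x) ∧
    (∀ t < a, low (ord i) < idx (tree^[t] (ord i))) ∧ idx (tree^[a] (ord i)) = low (ord i) ∧
    (∀ t < a, tree^[t + 1] (ord i) ∈ g.N (tree^[t] (ord i))) ∧ tree^[a] (ord i) ∈ g.N (ord i) ∧
    (∀ w ∈ g.N (ord i), w ∈ blockSet ord i j x → ∃ t ≤ a, tree^[t] (ord i) = w) ∧
    ∀ t ≤ a, ∀ t' ≤ a, tree^[t] (ord i) = tree^[t'] (ord i) → t = t'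

variable {tree idx low ord : ℕ → ℕ} {i j x : ℕ}

theorem mem_blockSet_self : x ∈ blockSet ord i j x := .inl rfl

theorem mem_blockSet_ord {l : ℕ} (h1 : i ≤ l) (h2 : l < j) : ord l ∈ blockSet ord i j x :=
  .inr ⟨l, h1, h2, rfl⟩

theorem LeafBlock.lt_n (h : g.LeafBlock tree idx low ord i j x) {v : ℕ}
    (hv : v ∈ blockSet ord i j x) : v < g.n := by
  rcases hv with rfl | ⟨l, h1, h2, rfl⟩
  · rw [← h.last]
    exact N_lt (h.adj (j - 1) (by have := h.lt; omega) (by have := h.lt; omega))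
  · exact N_lt_left (h.adj l h1 h2)

theorem LeafBlock.tree_mem (h : g.LeafBlock tree idx low ord i j x) {l : ℕ} (h1 : i ≤ l)
    (h2 : l < j) : tree (ord l) = x ∨ ∃ l', l < l' ∧ l' < j ∧ tree (ord l) = ord l' := by
  rcases Nat.lt_or_ge (l + 1) j with h' | h'
  · exact .inr (h.up l h1 h')
  · obtain rfl : l = j - 1 := by omega
    exact .inl h.last

theorem LeafBlock.tree_mem_blockSet (h : g.LeafBlock tree idx low ord i j x) {l : ℕ} (h1 : i ≤ l)
    (h2 : l < j) : tree (ord l) ∈ blockSet ord i j x := by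
  rcases h.tree_mem h1 h2 with e | ⟨l', h3, h4, e⟩
  · exact .inl e
  · exact .inr ⟨l', by omega, h4, e.symm⟩

/-- A property that passes from the parent to the child holds in the whole block if it holds
for `x`. -/
theorem LeafBlock.induct (h : g.LeafBlock tree idx low ord i j x) {p : ℕ → Prop} (hx : p x)
    (hp : ∀ l, i ≤ l → l < j → p (tree (ord l)) → p (ord l)) :
    ∀ v ∈ blockSet ord i j x, p v := by
  have key : ∀ m l, j - l = m → i ≤ l → l < j → p (ord l) := by
    intro m
    induction m using Nat.strong_induction_on with
    | _ m ih =>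
      intro l hm h1 h2
      refine hp l h1 h2 ?_
      rcases h.tree_mem h1 h2 with e | ⟨l', h3, h4, e⟩
      · rwa [e]
      · rw [e]; exact ih (j - l') (by omega) l' rfl (by omega) h4
  rintro v (rfl | ⟨l, h1, h2, rfl⟩)
  exacts [hx, key _ l rfl h1 h2]

theorem LeafBlock.exists_ne (h : g.LeafBlock tree idx low ord i j x) (hij : i + 1 < j) :
    ∃ u ∈ blockSet ord i j x, u ≠ tree (ord i) ∧ u ≠ ord i := by
  by_cases hx : tree (ord i) = x
  · refine ⟨ord (i + 1), mem_blockSet_ord (by omega) hij, ?_, ?_⟩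
    · rw [hx]; exact h.ne _ (by omega) hij
    · intro e
      have := h.inj _ _ (by omega) hij le_rfl h.lt e
      omega
  · exact ⟨x, mem_blockSet_self, Ne.symm hx, (h.ne _ le_rfl h.lt).symm⟩

/-- In a block with more than two vertices, every vertex has neighbours other than a given
one. -/
theorem LeafBlock.second_nbr (h : g.LeafBlock tree idx low ord i j x) {v u w : ℕ}
    (hv : v ∈ blockSet ord i j x) (hu : u ∈ blockSet ord i j x) (hw : w ∈ blockSet ord i j x)
    (hvu : v ≠ u) (hwu : w ≠ u) (hwv : w ≠ v) :
    ∃ u' ∈ g.N v, u' ∈ blockSet ord i j x ∧ u' ≠ u := by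
  by_contra! hcon
  have := h.conn_diff u hu v hv hvu.symm {v} rfl (fun a ha _ b hb hbB => by
    obtain rfl : a = v := ha
    exact absurd (hcon b hb hbB.1) hbB.2) ⟨hw, hwu⟩
  exact hwv this

/-- Let all vertices of `A` have the same used colours and no slack, both before and after all
vertices outside `C ⊆ A` have been coloured. If all neighbours in `A` of one vertex of `C` are
in `C`, then this holds for all vertices of `C`, since the number of uncoloured neighbours cannot
have changed. -/
theorem closed_of_uniform {A C : Set ℕ} {z : ℕ} (hg₁ : g.Good k col₁) (hA : g.Part col₁ A)
    (hC : g.Part col₂ C) (hCA : C ⊆ A) (hg₂ : g.Good k col₂) (hcl : g.ClosesOff C col₁ col₂)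
    (hns₁ : ∀ v ∈ A, ¬ g.Slack k col₁ v) (hns₂ : ∀ v ∈ C, ¬ g.Slack k col₂ v)
    (hun₁ : ∀ v ∈ A, g.used col₁ v = g.used col₁ z)
    (hun₂ : ∀ v ∈ C, g.used col₂ v = g.used col₂ z)
    (hz : ∀ w ∈ g.N z, w ∈ A → w ∈ C) (hzC : z ∈ C) :
    g.used col₂ z = g.used col₁ z ∧ ∀ v ∈ C, ∀ w ∈ g.N v, w ∈ A → w ∈ C := by
  have hzu : g.used col₂ z = g.used col₁ z := used_congr fun w hw => by
    by_cases h0 : col₁ w = 0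
    · rw [h0, hC.unc w (hz w hw (hA.nbr z (hCA hzC) w hw h0))]
    · exact hcl.keep w (N_lt hw) h0
  refine ⟨hzu, fun v hv w hw hwA => ?_⟩
  have h1 := card_uncN (hns₁ v (hCA hv)) (hg₁.small v (hA.lt v (hCA hv)) (hA.unc v (hCA hv)))
  have h2 := card_uncN (hns₂ v hv) (hg₂.small v (hC.lt v hv) (hC.unc v hv))
  rw [hun₁ v (hCA hv)] at h1
  rw [hun₂ v hv, hzu] at h2
  have hsub : g.uncN col₂ v ⊆ g.uncN col₁ v := fun y hy => by
    rw [mem_uncN] at hy ⊢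
    exact ⟨hy.1, (mem_unc.1 (hcl.unc_subset (mem_unc.2 ⟨N_lt hy.1, hy.2⟩))).2⟩
  have heq := Finset.eq_of_subset_of_card_le hsub (by omega)
  have hw1 : w ∈ g.uncN col₁ v := mem_uncN.2 ⟨hw, hA.unc w hwA⟩
  rw [← heq, mem_uncN] at hw1
  exact hC.nbr v hv w hw hw1.2

end Net

namespace WordRAM

variable {g : Net} {k B : ℕ} {s s' : State} {P : Prog}

notation "aOrd" => 17
notation "aBeg" => 18
notation "aTree" => 19

/-- Colours everything around the set that is listed in the queue, whose length is in
register 20, and then tries to colour the set itself. -/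
def settle : Prog :=
  .set 21 (.var 20) ;;
  .set 45 (.var 20) ;;
  sweep ;;
  finish

theorem settle_spec (hB : bound g k ≤ B) (hs : Static g k s) (hr : Rep g s)
    (hg : g.Good k (s.arrs aCol)) {a : ℕ} {W : Set ℕ} (ha : s.vars 20 = a) (ha0 : 0 < a)
    (hQ : Queue g s a) (hmem : ∀ v, v ∈ W ↔ ∃ i < a, s.arrs aQ i = v)
    (hpar : ∀ v ∈ W, s.arrs aPar v ∈ W ∧ (s.arrs aPar v = v ∨ s.arrs aPar v ∈ g.N v))
    (hconn : ∀ w ∈ W, g.Conn W w)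
    (hdiff : ∀ u ∈ W, ∀ w ∈ W, u ≠ w → g.Conn (W \ {u}) w) :
    wp B settle s fun t s' => Rep g s' ∧ g.Good k (s'.arrs aCol) ∧
      (∀ v < g.n, s'.arrs aIn v = 0) ∧
      (s'.vars 46 = 1 ∧ g.Closes (s.arrs aCol) (s'.arrs aCol) ∧ (∀ v ∈ W, s'.arrs aCol v ≠ 0) ∨
        s'.vars 46 = 0 ∧ s'.vars 45 = a ∧ g.ClosesOff W (s.arrs aCol) (s'.arrs aCol) ∧
        g.Part (s'.arrs aCol) W ∧ (∀ i < a, s'.arrs aQ i = s.arrs aQ i) ∧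
        (∀ v ∈ W, ¬ g.Slack k (s'.arrs aCol) v) ∧
        ∀ v ∈ W, g.used (s'.arrs aCol) (s.arrs aPar v) = g.used (s'.arrs aCol) v) ∧
      t + 90 * g.wt (g.unc (s'.arrs aCol)) ≤
        90 * g.wt (g.unc (s.arrs aCol)) + 110 * g.wt (entries (s.arrs aQ) a) + 50 := by
  have han := hQ.le_n
  refine step_set a ?_
  refine step_set a ?_
  refine wp_seq.2 (wp_mono (sweep_spec (s := (s.setVar 21 a).setVar 45 a) (a := a) (b := a) hB
    hs.of_eq hr.of_eq hg (by simp [ha]) (by simp)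
    le_rfl (hQ.of_eq rfl rfl rfl) (fun i h1 h2 => by omega)) ?_)
  rintro t₁ s₁ hf₁ ⟨hr₁, hg₁, hk₁, hq₁, hz₁, -, hcl₁, hin₁, ht₁⟩
  simp only [setVar_arrs] at hk₁ hq₁ hz₁ hcl₁ ht₁
  have hC₁ : g.ClosesOff W (s.arrs aCol) (s₁.arrs aCol) :=
    ⟨hk₁, fun v hv h0 h1 w hw => (hcl₁ v hv h0 (.inl h1) w hw).imp_right fun h => (hmem w).2 h⟩
  have hWn : ∀ v ∈ W, v < g.n := fun v hv => by
    obtain ⟨i, hi, rfl⟩ := (hmem v).1 hv; exact hQ.lt i hi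
  have hW0 : ∀ v ∈ W, s.arrs aCol v = 0 := fun v hv => by
    obtain ⟨i, hi, rfl⟩ := (hmem v).1 hv; exact hQ.unc i hi
  have hP₁ : g.Part (s₁.arrs aCol) W := by
    refine ⟨hWn, fun v hv => ?_, fun v hv w hw h0 => ?_⟩
    · obtain ⟨i, hi, rfl⟩ := (hmem v).1 hv; exact hz₁ i hi
    · rcases hcl₁ v (hWn v hv) (hW0 v hv) (.inr ((hmem v).1 hv)) w hw with h | h
      · exact absurd h0 h
      · exact (hmem w).2 h
  have fP : s₁.arrs aPar = s.arrs aPar := hf₁.a _ rfl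
  have hmem₁ : ∀ v, v ∈ W ↔ ∃ i < a, s₁.arrs aQ i = v := fun v => by
    rw [hmem]
    exact exists_congr fun i => and_congr_right fun hi => by rw [hq₁ i hi]
  have hBl : Block g s₁ a W := by
    refine ⟨hP₁, hmem₁, fun i hi j hj hij => ?_, by rw [fP]; exact hpar, hconn, hdiff⟩
    rw [hq₁ i hi, hq₁ j hj] at hij
    exact hQ.inj i hi j hj hij
  have hent : entries (s₁.arrs aQ) a = entries (s.arrs aQ) a := by
    ext v
    rw [mem_entries, mem_entries, ← hmem, ← hmem₁]
  have e45 : s₁.vars 45 = a := hf₁.var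
  refine wp_mono (finish_spec hB (hs.of_eq (hf₁.v 0 rfl) (hf₁.v 1 rfl) (hf₁.a 0 rfl) (hf₁.a 1 rfl)
    (hf₁.a 2 rfl) (hf₁.a 3 rfl)) hr₁ hg₁ hin₁ e45 ha0 hBl) ?_
  rintro t₂ s₂ hf₂ ⟨hr₂, hg₂, hin₂, h, ht₂⟩
  rw [hent] at ht₂
  have hle := Net.wt_mono (g := g) hC₁.unc_subset
  refine ⟨hr₂, hg₂, hin₂, h.imp (fun h => ⟨h.1, (hC₁.trans h.2.1.off).closes h.2.2, h.2.2⟩)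
    fun h => ⟨h.1, (hf₂.v _ rfl).trans e45, ?_, ?_, fun i hi => ?_, ?_, ?_⟩, by omega⟩
  · rw [h.2.1]; exact hC₁
  · rw [h.2.1]; exact hP₁
  · rw [h.2.2.1, hq₁ i hi]
  · rw [h.2.1]; exact h.2.2.2.1
  · rw [h.2.1, ← fP]; exact h.2.2.2.2

/-- Fills the queue with the block that consists of the vertex in register 66 and of the entries of
`aOrd` between the positions in the registers 64 and 65. -/
def queueBlock : Prog :=
  .store aQ (.const 0) (.var 66) ;;
  .store aIn (.var 66) (.const 1) ;;
  .store aPar (.var 66) (.var 66) ;;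
  .set 20 (.const 1) ;;
  .set 67 (.var 64) ;;
  .loop (.lt (.var 67) (.var 65))
    (.load 68 aOrd (.var 67) ;;
     .load 70 aTree (.var 68) ;;
     .store aQ (.var 20) (.var 68) ;;
     .store aIn (.var 68) (.const 1) ;;
     .store aPar (.var 68) (.var 70) ;;
     .add 20 (.var 20) (.const 1) ;;
     .add 67 (.var 67) (.const 1))

theorem queue_nil (hin : ∀ v < g.n, s.arrs aIn v = 0) : Queue g s 0 :=
  ⟨fun i hi => by omega, fun i hi => by omega, fun i hi => by omega, fun v hv => by simp [hin v hv]⟩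

theorem Queue.flag_zero {e w : ℕ} (h : Queue g s e) (hw : w < g.n)
    (hne : ∀ i < e, s.arrs aQ i ≠ w) : s.arrs aIn w = 0 := by
  rw [h.flag w hw, if_neg]
  rintro ⟨i, hi, hiw⟩
  exact hne i hi hiw

theorem queueBlock_spec (hB : bound g k ≤ B) (hin : ∀ v < g.n, s.arrs aIn v = 0) {i j x : ℕ}
    {idx low : ℕ → ℕ} (e64 : s.vars 64 = i) (e65 : s.vars 65 = j) (e66 : s.vars 66 = x)
    (hL : g.LeafBlock (s.arrs aTree) idx low (s.arrs aOrd) i j x) (hj : j ≤ g.n)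
    (h0 : ∀ v ∈ Net.blockSet (s.arrs aOrd) i j x, s.arrs aCol v = 0) :
    wp B queueBlock s fun t s' => s'.vars 20 = j - i + 1 ∧ Queue g s' (j - i + 1) ∧
      (∀ v, v ∈ Net.blockSet (s.arrs aOrd) i j x ↔ ∃ l < j - i + 1, s'.arrs aQ l = v) ∧
      s'.arrs aPar x = x ∧
      (∀ l, i ≤ l → l < j → s'.arrs aPar (s.arrs aOrd l) = s.arrs aTree (s.arrs aOrd l)) ∧
      t ≤ 10 * (j - i + 1) := by
  have hij := hL.lt
  have hxn : x < g.n := hL.lt_n Net.mem_blockSet_self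
  have hx0 := h0 x Net.mem_blockSet_self
  refine step_store 0 x ?_
  refine step_store x 1 ?_
  refine step_store x x ?_
  refine step_set 1 ?_
  refine step_set i ?_
  set ord := s.arrs aOrd with hord
  set tree := s.arrs aTree with htree
  refine wp_for (fun l s' => ∃ m, l = i + m ∧ s'.vars 20 = m + 1 ∧
    Queue g s' (m + 1) ∧ s'.arrs aQ 0 = x ∧ (∀ l < m, s'.arrs aQ (l + 1) = ord (i + l)) ∧
    s'.arrs aPar x = x ∧ (∀ l < m, s'.arrs aPar (ord (i + l)) = tree (ord (i + l))))
    (fun l => 8 * (j - l)) i (by simp) hij.le (fun s' hf => (hf.v _ rfl).trans e65)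
    ⟨0, rfl, by simp, (queue_nil hin).push hxn hx0 (hin x hxn) (by simp)
      (by simp) (by simp), by simp, fun l hl => by omega, by simp, fun l hl => by omega⟩ ?_ ?_
  · rintro _ s₁ - hb e67 ⟨m, rfl, e20, hQ, hq0, hq, hp0, hp⟩ hf
    have f4 : s₁.arrs aCol = s.arrs aCol := hf.arr
    have fO : s₁.arrs aOrd = ord := hf.arr
    have fT : s₁.arrs aTree = tree := hf.arr
    have hmem : ord (i + m) ∈ Net.blockSet ord i j x := Net.mem_blockSet_ord (by omega) hb
    have hvn := hL.lt_n hmem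
    have htn := Net.N_lt (hL.adj (i + m) (by omega) hb)
    have hne := hL.ne (i + m) (by omega) hb
    refine step_load (ord (i + m)) ?_
    refine step_load (tree (ord (i + m))) ?_
    refine step_store (m + 1) (ord (i + m)) ?_
    refine step_store (ord (i + m)) 1 ?_
    refine step_store (ord (i + m)) (tree (ord (i + m))) ?_
    refine step_add (m + 2) ?_
    refine end_add (i + m + 1) ⟨by simp, ⟨m + 1, by ring, by simp, ?_, ?_, ?_, ?_, ?_⟩, by omega⟩
    · refine hQ.push (w := ord (i + m)) hvn (by rw [f4]; exact h0 _ hmem)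
        (hQ.flag_zero hvn fun l hl => ?_) (by simp) (by simp) (by simp)
      rcases l with _ | l
      · rw [hq0]; exact hne.symm
      · rw [hq l (by omega)]
        intro e
        have := hL.inj _ _ (by omega) (by omega) (by omega) hb e
        omega
    · simp [hq0]
    · intro l hl
      rcases (Nat.lt_succ_iff.1 hl).lt_or_eq with h' | rfl
      · simp [hq l h', h'.ne]
      · simp
    · simp [hp0, hne.symm]
    · intro l hl
      rcases (Nat.lt_succ_iff.1 hl).lt_or_eq with h' | rfl
      · have : ord (i + l) ≠ ord (i + m) := fun e => by
          have := hL.inj _ _ (by omega) (by omega) (by omega) hb e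
          omega
        simp [hp l h', this]
      · simp
  · rintro t s₁ - ⟨m, hm, e20, hQ, hq0, hq, hp0, hp⟩ hf ht
    obtain rfl : m = j - i := by omega
    refine ⟨e20, hQ, fun v => ⟨?_, ?_⟩, hp0, fun l h1 h2 => ?_, by omega⟩
    · rintro (rfl | ⟨l, h1, h2, rfl⟩)
      · exact ⟨0, by omega, hq0⟩
      · exact ⟨l - i + 1, by omega, by rw [hq _ (by omega)]; congr 1; omega⟩
    · rintro ⟨l, hl, rfl⟩
      rcases l with _ | l
      · rw [hq0]; exact Net.mem_blockSet_self
      · rw [hq l (by omega)]; exact Net.mem_blockSet_ord (by omega) (by omega)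
    · have := hp (l - i) (by omega)
      rwa [show i + (l - i) = l by omega] at this

/-- Fills the queue with the path in the search tree from the entry of `aOrd` at the position in
register 64 to its neighbour with the smallest index. -/
def queueChain : Prog :=
  .load 68 aOrd (.var 64) ;;
  .load 67 aLow (.var 68) ;;
  .load 69 aIdx (.var 68) ;;
  .set 20 (.const 0) ;;
  .loop (.lt (.var 67) (.var 69))
    (.load 70 aTree (.var 68) ;;
     .store aQ (.var 20) (.var 68) ;;
     .store aIn (.var 68) (.const 1) ;;
     .store aPar (.var 68) (.var 70) ;;
     .set 68 (.var 70) ;;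
     .load 69 aIdx (.var 68) ;;
     .add 20 (.var 20) (.const 1)) ;;
  .store aQ (.var 20) (.var 68) ;;
  .store aIn (.var 68) (.const 1) ;;
  .store aPar (.var 68) (.var 68) ;;
  .add 20 (.var 20) (.const 1)

theorem queueChain_spec (hB : bound g k ≤ B) (hin : ∀ v < g.n, s.arrs aIn v = 0) {i z a : ℕ}
    {tree : ℕ → ℕ} (htree : s.arrs aTree = tree)
    (e64 : s.vars 64 = i) (hz : s.arrs aOrd i = z) (hidx : ∀ v, s.arrs aIdx v ≤ g.n + 1)
    (hlt : ∀ t ≤ a, tree^[t] z < g.n) (h0 : ∀ t ≤ a, s.arrs aCol (tree^[t] z) = 0)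
    (hlow : ∀ t < a, s.arrs aLow z < s.arrs aIdx (tree^[t] z))
    (hend : s.arrs aIdx (tree^[a] z) = s.arrs aLow z)
    (hinj : ∀ t ≤ a, ∀ t' ≤ a, tree^[t] z = tree^[t'] z → t = t') :
    wp B queueChain s fun t s' => s'.vars 20 = a + 1 ∧ Queue g s' (a + 1) ∧
      (∀ t ≤ a, s'.arrs aQ t = tree^[t] z) ∧
      (∀ t < a, s'.arrs aPar (tree^[t] z) = tree^[t + 1] z) ∧
      s'.arrs aPar (tree^[a] z) = tree^[a] z ∧ t ≤ 10 * (a + 1) := by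
  have hzn : z < g.n := hlt 0 (by omega)
  have hlow' : s.arrs aLow z ≤ g.n + 1 := hend ▸ hidx _
  refine step_load z ?_
  refine step_load (s.arrs aLow z) ?_
  refine step_load (s.arrs aIdx z) ?_ (lt_bound hB (by have := hidx z; omega))
  refine step_set 0 ?_
  refine wp_seq.2 (wp_loop (fun cr s' => ∃ m, m ≤ a ∧ s'.vars 20 = m ∧ s'.vars 68 = tree^[m] z ∧
    s'.vars 67 = s.arrs aLow z ∧ s'.vars 69 = s.arrs aIdx (tree^[m] z) ∧
    Queue g s' m ∧ (∀ t < m, s'.arrs aQ t = tree^[t] z) ∧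
    (∀ t < m, s'.arrs aPar (tree^[t] z) = tree^[t + 1] z) ∧ cr + 8 * m = 8 * a)
    (c := 8 * a) ?_ ?_ ?_)
  · rintro cr s₁ ⟨m, hma, e20, e68, e67, e69, hQ, hq, hp, hcr⟩ hf hb
    have f4 : s₁.arrs aCol = s.arrs aCol := hf.arr
    have fI : s₁.arrs aIdx = s.arrs aIdx := hf.arr
    have fT : s₁.arrs aTree = tree := hf.arr
    simp [e67, e69] at hb
    have hm : m < a := by
      rcases hma.lt_or_eq with h | rfl
      exacts [h, by omega]
    have hvn := hlt m hma
    have htn := hlt (m + 1) hm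
    have hes : tree (tree^[m] z) = tree^[m + 1] z := (Function.iterate_succ_apply' tree m z).symm
    have han : m < g.n + 1 := by have := hQ.le_n; omega
    refine step_load (tree^[m + 1] z) ?_
    refine step_store m (tree^[m] z) ?_
    refine step_store (tree^[m] z) 1 ?_
    refine step_store (tree^[m] z) (tree^[m + 1] z) ?_
    refine step_set (tree^[m + 1] z) ?_
    refine step_load (s.arrs aIdx (tree^[m + 1] z)) ?_ (lt_bound hB (by have := hidx (tree^[m + 1] z); omega))
    refine end_add (m + 1) ⟨8 * a - 8 * (m + 1), ⟨m + 1, hm, by simp, by simp, by simp [e67], by simp, ?_, ?_, ?_,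
      by omega⟩, by omega⟩
    · refine hQ.push (w := tree^[m] z) hvn (by rw [f4]; exact h0 m hma)
        (hQ.flag_zero hvn fun l hl => ?_) (by simp) (by simp) (by simp)
      rw [hq l hl]
      intro e
      have := hinj l (by omega) m hma e
      omega
    · intro l hl
      rcases (Nat.lt_succ_iff.1 hl).lt_or_eq with h' | rfl
      · simp [hq l h', h'.ne]
      · simp
    · intro l hl
      rcases (Nat.lt_succ_iff.1 hl).lt_or_eq with h' | rfl
      · have : tree^[l] z ≠ tree^[m] z := fun e => by
          have := hinj l (by omega) m hma e
          omega
        simp only [setVar_arrs, setArr_arrs]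
        simp [hp l h', this]
      · simp
  · exact ⟨0, by omega, by simp, by simp, by simp, by simp,
      (queue_nil hin).of_eq rfl rfl rfl, fun l hl => by omega, fun l hl => by omega, by simp⟩
  · rintro t s₁ cr ⟨m, hma, e20, e68, e67, e69, hQ, hq, hp, hcr⟩ hf hb ht
    have f4 : s₁.arrs aCol = s.arrs aCol := hf.arr
    simp only [holds_lt, val_var, e67, e69] at hb
    obtain rfl : m = a := by
      rcases hma.lt_or_eq with h | rfl
      · exact absurd (hlow m h) hb
      · rfl
    have hvn := hlt m le_rfl
    have han := hQ.le_n
    have hne : ∀ l < m, tree^[l] z ≠ tree^[m] z := fun l hl e => by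
      have := hinj l (by omega) m hma e
      omega
    refine step_store m (tree^[m] z) ?_
    refine step_store (tree^[m] z) 1 ?_
    refine step_store (tree^[m] z) (tree^[m] z) ?_
    refine end_add (m + 1) ⟨by simp, ?_, ?_, ?_, by simp, by omega⟩
    · refine hQ.push (w := tree^[m] z) hvn (by rw [f4]; exact h0 m hma)
        (hQ.flag_zero hvn fun l hl => ?_) (by simp) (by simp) (by simp)
      rw [hq l hl]; exact hne l hl
    · intro l hl
      rcases hl.lt_or_eq with h' | rfl
      · simp [hq l h', h'.ne]
      · simp
    · intro l hl
      simp only [setVar_arrs, setArr_arrs]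
      simp [hp l hl, hne l hl]

/-- Colours the block which is given by the registers 64, 65 and 66 as for `queueBlock`, together
with its uncoloured component. -/
def solveBlock : Prog :=
  queueBlock ;;
  settle ;;
  .branch (.eq (.var 46) (.const 0))
    (queueChain ;;
     settle ;;
     .branch (.eq (.var 46) (.const 0)) brooks .skip)
    .skip

/-- A block of the graph of uncoloured vertices can be coloured unless the available colours at
all vertices other than `x` are the same and the block is a cycle or a complete graph. -/
theorem solveBlock_spec (hB : bound g k ≤ B) (hs : Static g k s) (hr : Rep g s)
    (hg : g.Good k (s.arrs aCol)) (hin : ∀ v < g.n, s.arrs aIn v = 0) {i j x : ℕ}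
    (e64 : s.vars 64 = i) (e65 : s.vars 65 = j) (e66 : s.vars 66 = x)
    (hL : g.LeafBlock (s.arrs aTree) (s.arrs aIdx) (s.arrs aLow) (s.arrs aOrd) i j x)
    (hj : j ≤ g.n) (hidx : ∀ v, s.arrs aIdx v ≤ g.n + 1)
    (h0 : ∀ v ∈ Net.blockSet (s.arrs aOrd) i j x, s.arrs aCol v = 0)
    (hnbr : ∀ l, i ≤ l → l < j → ∀ w ∈ g.N (s.arrs aOrd l), s.arrs aCol w = 0 →
      w ∈ Net.blockSet (s.arrs aOrd) i j x)
    (hbad : (∀ l, i ≤ l → l < j → g.used (s.arrs aCol) (s.arrs aOrd l) =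
        g.used (s.arrs aCol) (s.arrs aOrd i)) →
      (g.used (s.arrs aCol) (s.arrs aOrd i)).card + 2 ≠ k ∧
      (g.used (s.arrs aCol) (s.arrs aOrd i)).card + (j - i) ≠ k) :
    wp B solveBlock s fun t s' => Rep g s' ∧ g.Good k (s'.arrs aCol) ∧
      (∀ v < g.n, s'.arrs aIn v = 0) ∧ g.Closes (s.arrs aCol) (s'.arrs aCol) ∧
      (∀ v ∈ Net.blockSet (s.arrs aOrd) i j x, s'.arrs aCol v ≠ 0) ∧
      t + 500 * g.wt (g.unc (s'.arrs aCol)) ≤ 500 * g.wt (g.unc (s.arrs aCol)) := by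
  have hij := hL.lt
  obtain ⟨A, hA⟩ : ∃ A, A = Net.blockSet (s.arrs aOrd) i j x := ⟨_, rfl⟩
  refine wp_seq.2 (wp_mono (queueBlock_spec hB hin e64 e65 e66 hL hj h0) ?_)
  rintro t₁ s₁ hf₁ ⟨e20, hQ, hmem, hpx, hp, ht₁⟩
  set ord := s.arrs aOrd with hord
  set tree := s.arrs aTree with htree
  set col := s.arrs aCol with hcol
  have f4 : s₁.arrs aCol = col := hf₁.a _ rfl
  have hAn : ∀ v ∈ A, v < g.n := fun v hv => hL.lt_n (hA ▸ hv)
  -- the vertices of the block pay for everything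
  obtain ⟨E, hE⟩ : ∃ E, E = entries (s₁.arrs aQ) (j - i + 1) := ⟨_, rfl⟩
  have hEA : ∀ v, v ∈ E ↔ v ∈ A := fun v => by rw [hE, mem_entries, hA, hmem]
  have hEcard : E.card = j - i + 1 := by rw [hE, card_entries hQ.inj]
  have hEwt : j - i + 1 ≤ g.wt E := hEcard ▸ Net.card_le_wt E
  have hpay : ∀ col', g.Closes col col' → (∀ v ∈ A, col' v ≠ 0) →
      g.wt (g.unc col') + g.wt E ≤ g.wt (g.unc col) := fun col' hC hall => by
    rw [← Net.wt_sdiff (hC.off (W := ∅)).unc_subset, add_comm]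
    refine Nat.add_le_add_right (Net.wt_mono fun v hv => ?_) _
    rw [hEA] at hv
    exact Finset.mem_sdiff.2 ⟨Net.mem_unc.2 ⟨hAn v hv, h0 v (hA ▸ hv)⟩,
      fun h => hall v hv (Net.mem_unc.1 h).2⟩
  have hs₁ : Static g k s₁ := hs.frame hf₁
  refine wp_seq.2 (wp_mono (settle_spec (W := A) hB hs₁ (hr.frame hf₁) (by rw [f4]; exact hg)
    e20 (by omega) hQ (by rw [hA]; exact hmem) ?_ (by rw [hA]; exact hL.conn)
    (by rw [hA]; exact hL.conn_diff)) ?_)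
  · rw [hA]
    rintro v (rfl | ⟨l, h1, h2, rfl⟩)
    · rw [hpx]; exact ⟨Net.mem_blockSet_self, .inl rfl⟩
    · rw [hp l h1 h2]
      exact ⟨hL.tree_mem_blockSet h1 h2, .inr (hL.adj l h1 h2)⟩
  rintro t₂ s₂ hf₂ ⟨hr₂, hg₂, hin₂, h, ht₂⟩
  rw [← hE, f4] at ht₂
  rw [f4] at h
  refine wp_branch.2 ⟨fun hb => ?_, fun hb => ?_⟩
  swap
  · simp at hb
    rcases h with ⟨-, hC, hall⟩ | ⟨h, -⟩
    swap; · omega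
    have := hpay _ hC hall
    exact wp_skip.2 ⟨hr₂, hg₂, hin₂, hC, hA ▸ hall, by omega⟩
  simp at hb
  rcases h with ⟨h, -⟩ | ⟨-, -, hC₁, hP₁, -, hns₁, hun₁⟩
  · omega
  have hs₂ : Static g k s₂ := hs₁.frame hf₂
  have fT : s₂.arrs aTree = tree := (hf₂.a _ rfl).trans (hf₁.a _ rfl)
  have fO : s₂.arrs aOrd = ord := (hf₂.a _ rfl).trans (hf₁.a _ rfl)
  have fI : s₂.arrs aIdx = s.arrs aIdx := (hf₂.a _ rfl).trans (hf₁.a _ rfl)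
  have fL : s₂.arrs aLow = s.arrs aLow := (hf₂.a _ rfl).trans (hf₁.a _ rfl)
  obtain ⟨z, hz⟩ : ∃ z, z = ord i := ⟨_, rfl⟩
  set col₁ := s₂.arrs aCol with hcol₁
  -- the available colours are the same in the whole block
  have hzA : z ∈ A := by rw [hz, hA]; exact Net.mem_blockSet_ord le_rfl hij
  have hunx : ∀ v ∈ A, g.used col₁ v = g.used col₁ x := by
    rw [hA]
    refine hL.induct rfl fun l h1 h2 e => ?_
    rw [← hun₁ (ord l) (by rw [hA]; exact Net.mem_blockSet_ord h1 h2), hp l h1 h2]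
    exact e
  have hunz : ∀ v ∈ A, g.used col₁ v = g.used col₁ z := fun v hv =>
    (hunx v hv).trans (hunx z hzA).symm
  have hsame : ∀ l, i ≤ l → l < j → g.used col₁ (ord l) = g.used col (ord l) := fun l h1 h2 =>
    Net.used_congr fun w hw => by
      by_cases hw0 : col w = 0
      · rw [hw0]; exact hP₁.unc w (hA ▸ hnbr l h1 h2 w hw hw0)
      · exact hC₁.keep w (Net.N_lt hw) hw0
  have hbad' := hbad fun l h1 h2 => by
    have hl : ord l ∈ A := hA ▸ Net.mem_blockSet_ord h1 h2
    rw [← hsame l h1 h2, ← hsame i le_rfl hij, hunz _ hl, ← hz]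
  rw [← hsame i le_rfl hij, ← hz] at hbad'
  have huncz := Net.card_uncN (hns₁ z hzA) (hg₂.small z (hAn z hzA) (hP₁.unc z hzA))
  have htz : tree z ∈ g.uncN col₁ z ∧ tree z ∈ A := by
    have h1 : tree z ∈ A := by
      rw [hA, hz]; exact hL.tree_mem_blockSet le_rfl hij
    exact ⟨Net.mem_uncN.2 ⟨by rw [hz]; exact hL.adj i le_rfl hij, hP₁.unc _ h1⟩, h1⟩
  have hd3 : (g.used col₁ z).card + 3 ≤ k := by
    have hpos : 0 < (g.uncN col₁ z).card := Finset.card_pos.2 ⟨_, htz.1⟩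
    have hne1 : (g.uncN col₁ z).card ≠ 1 := by
      intro h1
      have hj' : i + 1 < j := by
        by_contra hcon
        have : j - i = 1 := by omega
        rw [this] at hbad'
        omega
      obtain ⟨u, huA, hu1, hu2⟩ := hL.exists_ne hj'
      obtain ⟨u', hu'N, hu'A, hu'⟩ := hL.second_nbr (hA ▸ hzA) (hA ▸ htz.2) huA
        (Net.N_ne (Net.mem_uncN.1 htz.1).1).symm (by rw [hz]; exact hu1) (by rw [hz]; exact hu2)
      obtain ⟨y, hy⟩ := Finset.card_eq_one.1 h1
      have e1 := htz.1
      have e2 : u' ∈ g.uncN col₁ z := Net.mem_uncN.2 ⟨hu'N, hP₁.unc _ (hA ▸ hu'A)⟩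
      rw [hy, Finset.mem_singleton] at e1 e2
      exact hu' (e2.trans e1.symm)
    omega
  -- the path
  obtain ⟨a, hcA, hclow, hcend, hstep, hcadj, hcall, hcinj⟩ := hL.chain
  rw [← hz] at hcA hclow hcend hstep hcadj hcall hcinj
  rw [← hA] at hcA hcall
  refine wp_seq.2 (wp_mono (queueChain_spec (i := i) (z := z) (a := a) hB hin₂ fT
    (by rw [hf₂.v 64 rfl, hf₁.v 64 rfl, e64]) (by rw [fO, hz]) (by rw [fI]; exact hidx)
    (fun t ht => hAn _ (hcA t ht)) (fun t ht => hP₁.unc _ (hcA t ht)) (by rw [fI, fL]; exact hclow)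
    (by rw [fI, fL]; exact hcend) hcinj) ?_)
  rintro t₃ s₃ hf₃ ⟨e20₃, hQ₃, hq₃, hp₃, hpa₃, ht₃⟩
  have f4₃ : s₃.arrs aCol = col₁ := hf₃.a _ rfl
  have hs₃ : Static g k s₃ := hs₂.frame hf₃
  obtain ⟨C, hC⟩ : ∃ C : Set ℕ, C = {v | ∃ t ≤ a, tree^[t] z = v} := ⟨_, rfl⟩
  have hCmem : ∀ v, v ∈ C ↔ ∃ t ≤ a, tree^[t] z = v := fun v => by rw [hC]; rfl
  have hmem₃ : ∀ v, v ∈ C ↔ ∃ t < a + 1, s₃.arrs aQ t = v := fun v => by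
    rw [hCmem]
    constructor
    · rintro ⟨t, ht, e⟩; exact ⟨t, by omega, by rw [hq₃ t ht, e]⟩
    · rintro ⟨t, ht, e⟩; exact ⟨t, by omega, by rw [← hq₃ t (by omega), e]⟩
  have hCA : C ⊆ A := fun v hv => by
    obtain ⟨t, ht, rfl⟩ := (hCmem v).1 hv; exact hcA t ht
  have hcyc : ∀ q : ℕ → ℕ, (∀ t ≤ a, q t = tree^[t] z) → g.Cycle q (a + 1) := fun q hq => by
    refine ⟨by omega, fun t ht => ?_, fun t ht t' ht' e => ?_, ?_⟩
    · rw [hq t (by omega), hq (t + 1) (by omega)]; exact hstep t (by omega)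
    · rw [hq t (by omega), hq t' (by omega)] at e
      exact hcinj t (by omega) t' (by omega) e
    · rw [hq 0 (by omega), hq (a + 1 - 1) (by omega)]
      exact Net.N_symm hcadj
  have hcyc₃ := hcyc _ hq₃
  refine wp_seq.2 (wp_mono (settle_spec (W := C) hB hs₃ (hr₂.frame hf₃) (by rw [f4₃]; exact hg₂)
    e20₃ (by omega) hQ₃ hmem₃ ?_ (fun w hw => hcyc₃.conn hmem₃ hw)
    (fun u hu w hw huw => hcyc₃.conn_diff hmem₃ hu hw huw)) ?_)
  · intro v hv
    obtain ⟨t, ht, rfl⟩ := (hCmem v).1 hv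
    rcases ht.lt_or_eq with h | rfl
    · rw [hp₃ t h]; exact ⟨(hCmem _).2 ⟨t + 1, h, rfl⟩, .inr (hstep t h)⟩
    · rw [hpa₃]; exact ⟨hv, .inl rfl⟩
  rintro t₄ s₄ hf₄ ⟨hr₄, hg₄, hin₄, h, ht₄⟩
  rw [f4₃] at h ht₄
  have hE₃ : g.wt (entries (s₃.arrs aQ) (a + 1)) ≤ g.wt E := Net.wt_mono fun v hv => by
    rw [mem_entries, ← hmem₃] at hv
    exact (hEA v).2 (hCA hv)
  have haE : a + 1 ≤ g.wt E :=
    ((card_entries hQ₃.inj).symm.trans_le (Net.card_le_wt _)).trans hE₃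
  have hAconn := hL.conn z (hA ▸ hzA)
  rw [← hA] at hAconn
  refine wp_branch.2 ⟨fun hb' => ?_, fun hb' => ?_⟩
  swap
  · simp at hb'
    rcases h with ⟨-, hC₂, hall⟩ | ⟨h, -⟩
    swap; · omega
    have hall' := hC₂.conn hAconn hAn hP₁.unc (hall z ((hCmem z).2 ⟨0, by omega, rfl⟩))
    have hCl := (hC₁.trans hC₂.off).closes hall'
    have := hpay _ hCl hall'
    exact wp_skip.2 ⟨hr₄, hg₄, hin₄, hCl, hA ▸ hall', by omega⟩
  simp at hb'
  rcases h with ⟨h, -⟩ | ⟨-, e45, hC₂, hP₂, hq₄, hns₂, hun₂⟩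
  · omega
  have hzC : z ∈ C := (hCmem z).2 ⟨0, by omega, rfl⟩
  have hq₄' : ∀ t ≤ a, s₄.arrs aQ t = tree^[t] z := fun t ht => by
    rw [hq₄ t (by omega), hq₃ t ht]
  have hun₂' : ∀ v ∈ C, g.used (s₄.arrs aCol) v = g.used (s₄.arrs aCol) z := by
    intro v hv
    obtain ⟨t, ht, rfl⟩ := (hCmem v).1 hv
    clear hv
    induction t with
    | zero => rfl
    | succ t ih =>
      rw [← ih (by omega), ← hp₃ t (by omega)]
      exact hun₂ _ ((hCmem _).2 ⟨t, by omega, rfl⟩)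
  obtain ⟨hzu, hclosed⟩ := Net.closed_of_uniform hg₂ hP₁ hP₂ hCA hg₄ hC₂ hns₁ hns₂ hunz hun₂'
    (fun w hw hwA => (hCmem w).2 (hcall w hw hwA)) hzC
  have hAC : A = C := Set.Subset.antisymm
    (hAconn C hzC fun v hv _ v' hv' hv'A => hclosed v hv v' hv' hv'A) hCA
  have haj : a + 1 = j - i + 1 := by
    rw [← hEcard]
    have : E = entries (s₃.arrs aQ) (a + 1) := by
      ext v
      rw [hEA, hAC, mem_entries, hmem₃]
    rw [this, card_entries hQ₃.inj]
  have hs₄ : Static g k s₄ := hs₃.frame hf₄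
  have hq0 : s₄.arrs aQ 0 = z := hq₄' 0 (by omega)
  refine wp_mono (brooks_spec (W := C) hB hs₄ hr₄ hg₄ hin₄ e45 hP₂ (fun v => ?_)
    (hcyc _ hq₄') hns₂ (by rw [hq0]; exact hun₂') (by rw [hq0, hzu]; exact hd3)
    (by rw [hq0, hzu]; omega)) ?_
  · rw [hmem₃]
    exact exists_congr fun t => and_congr_right fun ht => by rw [hq₄ t ht]
  rintro t₅ s₅ hf₅ ⟨hr₅, hg₅, hin₅, hC₃, hall, ht₅⟩
  rw [← hAC] at hall
  have hCl : g.Closes col (s₅.arrs aCol) :=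
    (hC₁.trans ((hAC ▸ hC₂ : g.ClosesOff A col₁ (s₄.arrs aCol)).trans hC₃.off)).closes hall
  have := hpay _ hCl hall
  exact ⟨hr₅, hg₅, hin₅, hCl, hA ▸ hall, by omega⟩

end WordRAM

namespace Net

variable {g : Net} {k : ℕ} {col col' ψ : ℕ → ℕ} {tree idx low ord : ℕ → ℕ} {i j x : ℕ}

/-! ### Blocks that are coloured greedily -/

/-- A colouring `ψ` that extends `col` is changed to `col'` on a set `I`. -/
theorem ext_glue {I : Set ℕ} (hψ : ∀ v < g.n, 1 ≤ ψ v ∧ ψ v ≤ k)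
    (hprop : ∀ u v, v ∈ g.N u → ψ u ≠ ψ v) (hext : ∀ v < g.n, col v ≠ 0 → ψ v = col v)
    (hg : g.Good k col') (hk : ∀ v, v ∉ I → col' v = col v) (hI : ∀ v ∈ I, col' v ≠ 0)
    (hnbr : ∀ v ∈ I, ∀ w ∈ g.N v, col w = 0 → w ∈ I ∨ w = x)
    (hx : ∀ v ∈ I, x ∈ g.N v → ψ x ≠ col' v) : g.Ext k col' := by
  classical
  refine ⟨fun v => if v ∈ I then col' v else ψ v, fun v hv => ?_, fun u v huv => ?_,
    fun v hv h0 => ?_⟩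
  · dsimp only
    split_ifs with h
    · exact ⟨by have := hI v h; omega, hg.le v hv⟩
    · exact hψ v hv
  · have key : ∀ a b, b ∈ g.N a → a ∈ I → b ∉ I → col' a ≠ ψ b := by
      intro a b hab ha hb
      by_cases hb0 : col b = 0
      · obtain rfl := (hnbr a ha b hab hb0).resolve_left hb
        exact (hx a ha hab).symm
      · rw [hext b (N_lt hab) hb0, ← hk b hb]
        exact hg.proper a b hab (hI a ha)
    dsimp only
    split_ifs with hu hv hv
    · exact hg.proper u v huv (hI u hu)
    · exact key u v huv hu hv
    · exact (key v u (N_symm huv) hv hu).symm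
    · exact hprop u v huv
  · dsimp only
    split_ifs with h
    · rfl
    · rw [hk v h] at h0 ⊢
      exact hext v hv h0

/-- If the available colours at the vertices `v ≠ x` of a leaf block are the same and the block is a
cycle or complete, then the vertices `v ≠ x` can be coloured greedily in any order: either this does
not affect the extendability of the colouring, or it creates slack at `x`. -/
theorem LeafBlock.ext (h : g.LeafBlock tree idx low ord i j x) (hg : g.Good k col)
    (hg' : g.Good k col') (h0 : ∀ v ∈ blockSet ord i j x, col v = 0)
    (hnbr : ∀ l, i ≤ l → l < j → ∀ w ∈ g.N (ord l), col w = 0 → w ∈ blockSet ord i j x)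
    (hns : ∀ l, i ≤ l → l < j → ¬ g.Slack k col (ord l))
    (hun : ∀ l, i ≤ l → l < j → g.used col (ord l) = g.used col (ord i))
    (hd : (g.used col (ord i)).card + 2 = k ∨ (g.used col (ord i)).card + (j - i) = k)
    (hk : ∀ v, (∀ l, i ≤ l → l < j → ord l ≠ v) → col' v = col v)
    (hI : ∀ l, i ≤ l → l < j → col' (ord l) ≠ 0) (hx : ¬ g.Slack k col' x)
    (he : g.Ext k col) : g.Ext k col' := by
  have hij := h.lt
  obtain ⟨ψ, hψ, hprop, hext⟩ := he
  obtain ⟨I, hIdef⟩ : ∃ I : Set ℕ, I = {v | ∃ l, i ≤ l ∧ l < j ∧ ord l = v} := ⟨_, rfl⟩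
  have hImem : ∀ v, v ∈ I ↔ ∃ l, i ≤ l ∧ l < j ∧ ord l = v := fun v => by rw [hIdef]; rfl
  have hIB : ∀ v, v ∈ I → v ∈ blockSet ord i j x := fun v hv => .inr ((hImem v).1 hv)
  have hxI : x ∉ I := fun hv => by
    obtain ⟨l, h1, h2, e⟩ := (hImem x).1 hv
    exact h.ne l h1 h2 e
  have hBI : ∀ v ∈ blockSet ord i j x, v ≠ x → v ∈ I := fun v hv hvx =>
    (hImem v).2 (hv.resolve_left hvx)
  have hIn : ∀ v ∈ I, v < g.n := fun v hv => h.lt_n (hIB v hv)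
  have hk' : ∀ v, v ∉ I → col' v = col v := fun v hv =>
    hk v fun l h1 h2 e => hv ((hImem v).2 ⟨l, h1, h2, e⟩)
  have hI' : ∀ v ∈ I, col' v ≠ 0 := fun v hv => by
    obtain ⟨l, h1, h2, rfl⟩ := (hImem v).1 hv; exact hI l h1 h2
  have hnbr' : ∀ v ∈ I, ∀ w ∈ g.N v, col w = 0 → w ∈ blockSet ord i j x := fun v hv => by
    obtain ⟨l, h1, h2, rfl⟩ := (hImem v).1 hv; exact hnbr l h1 h2
  have hnbr'' : ∀ v ∈ I, ∀ w ∈ g.N v, col w = 0 → w ∈ I ∨ w = x := fun v hv w hw hw0 => by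
    by_cases hwx : w = x
    · exact .inr hwx
    · exact .inl (hBI w (hnbr' v hv w hw hw0) hwx)
  refine ext_glue hψ hprop hext hg' hk' hI' hnbr'' ?_
  -- the set of available colours
  obtain ⟨U, hU⟩ : ∃ U, U = g.used col (ord i) := ⟨_, rfl⟩
  rw [← hU] at hd hun
  have hUsub : U ⊆ Finset.Icc 1 k := hU ▸ hg.used_subset _
  obtain ⟨L, hL⟩ : ∃ L, L = Finset.Icc 1 k \ U := ⟨_, rfl⟩
  have hLcard : L.card + U.card = k := by
    have := Finset.card_sdiff_add_card_eq_card hUsub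
    rwa [Nat.card_Icc, Nat.add_sub_cancel, ← hL] at this
  have hcolour : ∀ θ : ℕ → ℕ, (∀ v < g.n, 1 ≤ θ v ∧ θ v ≤ k) → (∀ v < g.n, col v ≠ 0 → θ v = col v) →
      ∀ v ∈ I, (∀ w ∈ g.N v, θ v ≠ θ w) → θ v ∈ L := by
    intro θ h1 h2 v hv h3
    rw [hL, Finset.mem_sdiff, Finset.mem_Icc]
    refine ⟨h1 v (hIn v hv), fun hu => ?_⟩
    obtain ⟨l, hl1, hl2, rfl⟩ := (hImem v).1 hv
    rw [← hun l hl1 hl2] at hu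
    obtain ⟨hc, w, hw, e⟩ := mem_used.1 hu
    refine h3 w hw ?_
    rw [← e]
    exact (h2 w (N_lt hw) (by omega)).symm
  have hψL : ∀ v ∈ I, ψ v ∈ L := fun v hv => hcolour ψ hψ hext v hv (hprop v)
  have hcL : ∀ v ∈ I, col' v ∈ L := fun v hv => by
    rw [hL, Finset.mem_sdiff, Finset.mem_Icc]
    refine ⟨⟨by have := hI' v hv; omega, hg'.le v (hIn v hv)⟩, fun hu => ?_⟩
    obtain ⟨l, hl1, hl2, rfl⟩ := (hImem v).1 hv
    rw [← hun l hl1 hl2] at hu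
    obtain ⟨hc, w, hw, e⟩ := mem_used.1 hu
    refine hg'.proper _ w hw (hI l hl1 hl2) ?_
    rw [← e, hk' w fun hwI => ?_]
    exact hc (e ▸ h0 w (hIB w hwI))
  have hdeg : ∀ v ∈ I, (g.uncN col v).card = L.card := fun v hv => by
    obtain ⟨l, hl1, hl2, rfl⟩ := (hImem v).1 hv
    have := card_uncN (hns l hl1 hl2) (hg.small _ (hIn _ hv) (h0 _ (hIB _ hv)))
    rw [hun l hl1 hl2] at this
    omega
  obtain ⟨E, hE⟩ : ∃ E, E = (Finset.Ico i j).image ord := ⟨_, rfl⟩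
  have hEI : ∀ v, v ∈ E ↔ v ∈ I := fun v => by rw [hE, hImem]; simp [and_assoc]
  have hEcard : E.card = j - i := by
    rw [hE, Finset.card_image_of_injOn, Nat.card_Ico]
    intro l hl l' hl' e
    simp only [Finset.coe_Ico, Set.mem_Ico] at hl hl'
    exact h.inj l l' hl.1 hl.2 hl'.1 hl'.2 e
  have hsub : ∀ v ∈ I, g.uncN col v ⊆ (insert x E).erase v := fun v hv w hw => by
    obtain ⟨hw1, hw2⟩ := mem_uncN.1 hw
    rw [Finset.mem_erase, Finset.mem_insert, hEI]
    exact ⟨N_ne hw1, (hnbr'' v hv w hw1 hw2).symm⟩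
  have hcard : ∀ v ∈ I, ((insert x E).erase v).card = j - i := fun v hv => by
    rw [Finset.card_erase_of_mem (Finset.mem_insert_of_mem ((hEI v).2 hv)),
      Finset.card_insert_of_notMem fun hx => hxI ((hEI x).1 hx), hEcard]
    omega
  have hzI : ord i ∈ I := (hImem _).2 ⟨i, le_rfl, hij, rfl⟩
  rcases hd with hd | hd
  swap
  · -- a complete graph: the vertices other than `x` use all available colours
    intro v hv _ e
    have hall : ∀ u ∈ I, ∀ w ∈ I, w ≠ u → w ∈ g.N u := fun u hu w hw hwu => by
      have := Finset.eq_of_subset_of_card_le (hsub u hu) (by rw [hcard u hu, hdeg u hu]; omega)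
      have hm : w ∈ (insert x E).erase u :=
        Finset.mem_erase.2 ⟨hwu, Finset.mem_insert_of_mem ((hEI w).2 hw)⟩
      rw [← this] at hm
      exact (mem_uncN.1 hm).1
    have hallx : ∀ u ∈ I, x ∈ g.N u := fun u hu => by
      have := Finset.eq_of_subset_of_card_le (hsub u hu) (by rw [hcard u hu, hdeg u hu]; omega)
      have hm : x ∈ (insert x E).erase u :=
        Finset.mem_erase.2 ⟨fun e => hxI (e ▸ hu), Finset.mem_insert_self _ _⟩
      rw [← this] at hm
      exact (mem_uncN.1 hm).1
    have himg : E.image ψ = L := by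
      refine Finset.eq_of_subset_of_card_le (fun c hc => ?_) ?_
      · obtain ⟨u, hu, rfl⟩ := Finset.mem_image.1 hc
        exact hψL u ((hEI u).1 hu)
      · rw [Finset.card_image_of_injOn, hEcard]
        · omega
        · intro u hu w hw e
          by_contra hne
          exact hprop u w (hall u ((hEI u).1 hu) w ((hEI w).1 hw) (Ne.symm hne)) e
    have hm := hcL v hv
    rw [← himg, Finset.mem_image] at hm
    obtain ⟨u, hu, e'⟩ := hm
    exact hprop u x (hallx u ((hEI u).1 hu)) (e'.trans e.symm)
  · -- two available colours: there are just two colourings, which differ by an exchange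
    obtain ⟨p, q, hpq, hLpq⟩ := Finset.card_eq_two.1 (show L.card = 2 by omega)
    have hconn := h.conn_diff x mem_blockSet_self _ (hIB _ hzI) (fun e => hxI (e ▸ hzI))
    have hdiff : blockSet ord i j x \ {x} = I := by
      ext v
      exact ⟨fun hv => hBI v hv.1 hv.2, fun hv => ⟨hIB v hv, fun e => hxI (e ▸ hv)⟩⟩
    rw [hdiff] at hconn
    have hL2 : ∀ v ∈ I, (ψ v = p ∨ ψ v = q) ∧ (col' v = p ∨ col' v = q) := fun v hv => by
      have h1 := hψL v hv
      have h2 := hcL v hv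
      rw [hLpq] at h1 h2
      simpa using And.intro h1 h2
    have hiff : ∀ v ∈ I, ∀ w ∈ I, w ∈ g.N v → (ψ v = col' v ↔ ψ w = col' w) := by
      intro v hv w hw hvw
      have h1 := hL2 v hv
      have h2 := hL2 w hw
      have h3 := hprop v w hvw
      have h4 := hg'.proper v w hvw (hI' v hv)
      omega
    by_cases hz : ψ (ord i) = col' (ord i)
    · have hall := hconn {v | ψ v = col' v} hz fun v hv hvI w hw hwI =>
        (hiff v hvI w hwI hw).1 hv
      intro v hv hxv
      rw [← hall hv]
      exact (hprop v x hxv).symm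
    · have hall := hconn {v | ψ v ≠ col' v} hz fun v hv hvI w hw hwI e =>
        hv ((hiff v hvI w hwI hw).2 e)
      intro v hv hxv e
      have hj2 : i + 1 < j := by
        by_contra hcon
        have h1 := Finset.card_le_card (hsub _ hzI)
        rw [hcard _ hzI, hdeg _ hzI] at h1
        omega
      obtain ⟨w, hw, hwv⟩ : ∃ w ∈ I, w ≠ v := by
        by_cases hvi : v = ord i
        · refine ⟨ord (i + 1), (hImem _).2 ⟨i + 1, by omega, hj2, rfl⟩, fun e => ?_⟩
          rw [hvi] at e
          have := h.inj _ _ (by omega) hj2 le_rfl hij e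
          omega
        · exact ⟨_, hzI, Ne.symm hvi⟩
      obtain ⟨v', hv'N, hv'B, hv'v⟩ := h.second_nbr mem_blockSet_self (hIB v hv) (hIB w hw)
        (fun e => hxI (e ▸ hv)) hwv (fun e => hxI (e ▸ hw))
      have hv'I := hBI v' hv'B (N_ne hv'N)
      have hx0 : col' x = 0 := (hk' x hxI).trans (h0 x mem_blockSet_self)
      have hne : col' v' ≠ col' v := fun e' => hx (slack_of_dup
        (hg'.small x (N_lt hxv) hx0) hv'N (N_symm hxv) hv'v e' (hI' v' hv'I))
      have h1 := hL2 v hv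
      have h2 := hL2 v' hv'I
      have h3 : ψ v' ≠ col' v' := hall hv'I
      have h4 := hprop x v' hv'N
      omega

end Net

namespace WordRAM

variable {g : Net} {k B : ℕ} {s s' : State} {P : Prog}

/-- Register 46 becomes `1` or `0` according as all entries of `aOrd` between the positions in the
registers 64 and 65 have the same available colours, and their number is 2 or the number of the
entries, or not. -/
def checkBlock : Prog :=
  .load 50 aOrd (.var 64) ;;
  .load 71 aUsed (.var 50) ;;
  .load 50 aBase (.var 50) ;;
  .set 46 (.const 1) ;;
  .set 47 (.var 64) ;;
  .loop (.lt (.var 47) (.var 65))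
    (.load 48 aOrd (.var 47) ;;
     .load 51 aBase (.var 48) ;;
     compare ;;
     .branch (.eq (.var 58) (.const 0)) .skip (.set 46 (.const 0)) ;;
     .add 47 (.var 47) (.const 1)) ;;
  .add 53 (.var 71) (.const 2) ;;
  .sub 54 (.var 65) (.var 64) ;;
  .add 54 (.var 71) (.var 54) ;;
  .branch (.eq (.var 53) (.var 1)) .skip
    (.branch (.eq (.var 54) (.var 1)) .skip (.set 46 (.const 0)))

theorem checkBlock_spec (hB : bound g k ≤ B) (hs : Static g k s) (hr : Rep g s)
    (hg : g.Good k (s.arrs aCol)) {i j : ℕ} (e64 : s.vars 64 = i) (e65 : s.vars 65 = j)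
    (hij : i < j) (hj : j ≤ g.n) (hkn : k ≤ g.n)
    (hn : ∀ l, i ≤ l → l < j → s.arrs aOrd l < g.n) :
    wp B checkBlock s fun t s' =>
      (s'.vars 46 = 1 ∧ (∀ l, i ≤ l → l < j → g.used (s.arrs aCol) (s.arrs aOrd l) =
          g.used (s.arrs aCol) (s.arrs aOrd i)) ∧
          ((g.used (s.arrs aCol) (s.arrs aOrd i)).card + 2 = k ∨
            (g.used (s.arrs aCol) (s.arrs aOrd i)).card + (j - i) = k) ∨
        s'.vars 46 = 0 ∧ ((∀ l, i ≤ l → l < j → g.used (s.arrs aCol) (s.arrs aOrd l) =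
          g.used (s.arrs aCol) (s.arrs aOrd i)) →
          (g.used (s.arrs aCol) (s.arrs aOrd i)).card + 2 ≠ k ∧
          (g.used (s.arrs aCol) (s.arrs aOrd i)).card + (j - i) ≠ k)) ∧
      t ≤ 12 * (k + 1) * (j - i) + 15 := by
  set col := s.arrs aCol with hcol
  set ord := s.arrs aOrd with hord
  have hzn := hn i le_rfl hij
  have huz : (g.used col (ord i)).card ≤ g.n :=
    ((Net.used_card_le (g := g) col (ord i)).trans (Net.done_le _ _)).trans (Net.deg_lt hzn).le
  have hz0 := row_lt_bound hB hzn (Nat.zero_le _)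
  refine step_load (ord i) ?_
  refine step_load (g.used col (ord i)).card (hv := by simp [hr.used _ hzn, hcol]) ?_
  refine step_load (ord i * (g.n + 1)) (hv := by simp [hs.base _ hzn]) ?_
  refine step_set 1 ?_
  refine step_set i ?_
  refine wp_seq.2 (wp_for (fun m s' => 
      s'.vars 46 = 0 ∧ (∃ l, i ≤ l ∧ l < j ∧ g.used col (ord l) ≠ g.used col (ord i)) ∨
        s'.vars 46 = 1 ∧ ∀ l, i ≤ l → l < m → g.used col (ord l) = g.used col (ord i))
      (fun m => 12 * (k + 1) * (j - m)) i (by simp) hij.le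
      (fun s' hf => (hf.v _ rfl).trans e65) (.inr ⟨by simp, fun l h1 h2 => by omega⟩) ?_ ?_)
  · rintro m s₁ him hb e47 h hf
    have fO : s₁.arrs aOrd = ord := hf.arr
    have f4 : s₁.arrs aCol = col := hf.arr
    have f50 : s₁.vars 50 = ord i * (g.n + 1) := hf.var
    have hs₁ : Static g k s₁ := hs.of_eq.frame hf
    have hr₁ : Rep g s₁ := hr.of_eq.frame hf
    have hvn := hn m him hb
    have hv0 := row_lt_bound hB hvn (Nat.zero_le _)
    refine step_load (ord m) ?_
    refine step_load (ord m * (g.n + 1)) (hv := by simp [hs₁.base _ hvn]) ?_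
    refine wp_seq.2 (wp_mono (compare_spec (s := (s₁.setVar 48 (ord m)).setVar 51
      (ord m * (g.n + 1))) hB hs₁.of_eq hr₁.of_eq hkn hzn hvn (by simp [f50]) (by simp)) ?_)
    rintro t s₂ hf₂ ⟨hc, ht⟩
    simp only [setVar_arrs, f4] at hc
    have e46 : s₂.vars 46 = s₁.vars 46 := hf₂.var
    have e47 : s₂.vars 47 = m := hf₂.var
    have hcr : 12 * (k + 1) * (j - m) = 12 * (k + 1) * (j - (m + 1)) + 12 * (k + 1) := by
      rw [← Nat.mul_succ]; congr 1; omega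
    refine wp_seq.2 (wp_branch.2 ⟨fun hb' => wp_skip.2 ?_, fun hb' => ?_⟩) <;> simp at hb'
    · refine end_add (m + 1) ⟨by simp, h.imp (fun h => ⟨by simp [e46, h.1], h.2⟩) fun h =>
        ⟨by simp [e46, h.1], fun l h1 h2 => ?_⟩, by omega⟩
      rcases (Nat.lt_succ_iff.1 h2).lt_or_eq with h' | rfl
      · exact h.2 l h1 h'
      · exact (hg.used_eq (hc.resolve_right (by omega)).2).symm
    · obtain ⟨-, -, hne⟩ := hc.resolve_left (by omega)
      refine end_set 0 (end_add (m + 1) ⟨by simp, .inl ⟨by simp, m, him, hb, fun h => hne ?_⟩,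
        by omega⟩)
      rw [h]
  · rintro t s₁ - h hf ht
    have f1 : s₁.vars 1 = k := (hf.v _ rfl).trans (by simp [hs.vk])
    have f64 : s₁.vars 64 = i := hf.var
    have f65 : s₁.vars 65 = j := hf.var
    have f71 : s₁.vars 71 = (g.used col (ord i)).card := hf.var
    refine step_add ((g.used col (ord i)).card + 2) ?_
    refine step_sub (j - i) ?_
    refine step_add ((g.used col (ord i)).card + (j - i)) ?_
    have hno : (∃ l, i ≤ l ∧ l < j ∧ g.used col (ord l) ≠ g.used col (ord i)) →
        (∀ l, i ≤ l → l < j → g.used col (ord l) = g.used col (ord i)) →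
        (g.used col (ord i)).card + 2 ≠ k ∧ (g.used col (ord i)).card + (j - i) ≠ k :=
      fun ⟨l, h1, h2, h3⟩ h4 => absurd (h4 l h1 h2) h3
    refine wp_branch.2 ⟨fun hb₁ => ?_, fun hb₁ => ?_⟩
    · simp [f1] at hb₁
      refine wp_skip.2 ⟨?_, by omega⟩
      rcases h with h | h
      · exact .inr ⟨by simp [h.1], hno h.2⟩
      · exact .inl ⟨by simp [h.1], h.2, .inl hb₁⟩
    · simp [f1] at hb₁
      refine wp_branch.2 ⟨fun hb₂ => ?_, fun hb₂ => ?_⟩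
      · simp [f1] at hb₂
        refine wp_skip.2 ⟨?_, by omega⟩
        rcases h with h | h
        · exact .inr ⟨by simp [h.1], hno h.2⟩
        · exact .inl ⟨by simp [h.1], h.2, .inr hb₂⟩
      · simp [f1] at hb₂
        exact end_set 0 ⟨.inr ⟨by simp, fun _ => ⟨hb₁, hb₂⟩⟩, by omega⟩

/-- Colours the entries of `aOrd` between the positions in the registers 64 and 65 greedily. -/
def peel : Prog :=
  .set 67 (.var 64) ;;
  .loop (.lt (.var 67) (.var 65))
    (.load 10 aOrd (.var 67) ;;
     greedy ;;
     .add 67 (.var 67) (.const 1))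

theorem peel_spec (hB : bound g k ≤ B) (hs : Static g k s) (hr : Rep g s)
    (hg : g.Good k (s.arrs aCol)) {i j x : ℕ} {tree idx low : ℕ → ℕ} (e64 : s.vars 64 = i)
    (e65 : s.vars 65 = j) (hL : g.LeafBlock tree idx low (s.arrs aOrd) i j x) (hj : j ≤ g.n)
    (h0 : ∀ v ∈ Net.blockSet (s.arrs aOrd) i j x, s.arrs aCol v = 0) :
    wp B peel s fun t s' => Rep g s' ∧ g.Good k (s'.arrs aCol) ∧
      (∀ v, (∀ l, i ≤ l → l < j → s.arrs aOrd l ≠ v) → s'.arrs aCol v = s.arrs aCol v) ∧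
      (∀ l, i ≤ l → l < j → s'.arrs aCol (s.arrs aOrd l) ≠ 0) ∧
      t + 50 * g.wt (g.unc (s'.arrs aCol)) ≤ 50 * g.wt (g.unc (s.arrs aCol)) + 5 := by
  set col := s.arrs aCol with hcol
  set ord := s.arrs aOrd with hord
  have hij := hL.lt
  refine step_set i ?_
  refine wp_loop (fun cr s' => Rep g s' ∧ g.Good k (s'.arrs aCol) ∧ ∃ m, s'.vars 67 = m ∧ i ≤ m ∧
    m ≤ j ∧ (∀ v, (∀ l, i ≤ l → l < m → ord l ≠ v) → s'.arrs aCol v = col v) ∧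
    (∀ l, i ≤ l → l < m → s'.arrs aCol (ord l) ≠ 0) ∧
    cr = 50 * g.wt (g.unc (s'.arrs aCol))) (c := 50 * g.wt (g.unc col)) ?_ ?_ ?_
  · rintro cr s₁ ⟨hr₁, hg₁, m, e67, him, hmj, hk, hn, rfl⟩ hf hb
    have f65 : s₁.vars 65 = j := hf.var
    have fO : s₁.arrs aOrd = ord := hf.arr
    have hs₁ : Static g k s₁ := hs.of_eq.frame hf
    simp [e67, f65] at hb
    have hB' : ord m ∈ Net.blockSet ord i j x := Net.mem_blockSet_ord him hb
    have hvn := hL.lt_n hB'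
    have hv0 : s₁.arrs aCol (ord m) = 0 := by
      rw [hk _ fun l h1 h2 e => ?_, h0 _ hB']
      have := hL.inj l m h1 (by omega) him hb e
      omega
    have ht0 : s₁.arrs aCol (tree (ord m)) = 0 := by
      rcases hL.tree_mem him hb with e | ⟨l', h3, h4, e⟩
      · rw [e, hk _ fun l h1 h2 => hL.ne l h1 (by omega), h0 _ Net.mem_blockSet_self]
      · rw [e, hk _ fun l h1 h2 e' => ?_, h0 _ (Net.mem_blockSet_ord (by omega) h4)]
        have := hL.inj l l' h1 (by omega) (by omega) h4 e'
        omega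
    refine step_load (ord m) ?_
    refine wp_seq.2 (wp_mono (greedy_spec (s := s₁.setVar 10 (ord m)) (v := ord m) hB
      hs₁.of_eq hr₁.of_eq hg₁ (by simp) hvn
      (by simpa using hv0) (hg₁.used_lt hv0 (hL.adj m him hb) ht0)) ?_)
    rintro t s₂ hf₂ ⟨hr₂, hg₂, ⟨c, hc0, -, -, -, -, e4⟩, ht⟩
    simp only [setVar_arrs] at e4
    have e67₂ : s₂.vars 67 = m := hf₂.var
    refine end_add (m + 1) ?_
    have hwt := Net.wt_unc_update (g := g) hvn hv0 hc0
    rw [← e4] at hwt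
    refine ⟨_, ⟨hr₂.of_eq, hg₂, m + 1, by simp, by omega, by omega, ?_, ?_, rfl⟩, ?_⟩
    · intro v hv
      have h1 := hv m him (by omega)
      simp only [setVar_arrs]
      rw [e4, Function.update_of_ne h1.symm]
      exact hk v fun l h2 h3 => hv l h2 (by omega)
    · intro l h1 h2
      simp only [setVar_arrs]
      rw [e4]
      rcases (Nat.lt_succ_iff.1 h2).lt_or_eq with h' | rfl
      · have : ord l ≠ ord m := fun e => by
          have := hL.inj l m h1 (by omega) him hb e
          omega
        rw [Function.update_of_ne this]
        exact hn l h1 h'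
      · simpa using hc0
    · simp only [setVar_arrs]; omega
  · exact ⟨hr.of_eq, hg, i, by simp, le_rfl, hij.le, fun v _ => rfl,
      fun l h1 h2 => by omega, rfl⟩
  · rintro t s₁ cr ⟨hr₁, hg₁, m, e67, him, hmj, hk, hn, rfl⟩ hf hb ht
    have f65 : s₁.vars 65 = j := hf.var
    simp [e67, f65] at hb
    obtain rfl : m = j := by omega
    exact ⟨hr₁, hg₁, hk, hn, by omega⟩

/-- Treats the block which is given by the registers 64, 65 and 66 as for `queueBlock`. -/
def blockStep : Prog :=
  checkBlock ;;
  .branch (.eq (.var 46) (.const 1))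
    (peel ;;
     .set 41 (.var 66) ;;
     slackTest ;;
     .branch (.eq (.var 42) (.const 1)) (.set 40 (.var 66) ;; flood) .skip)
    solveBlock

theorem blockStep_spec (hB : bound g k ≤ B) (hs : Static g k s) (hr : Rep g s)
    (hg : g.Good k (s.arrs aCol)) (hin : ∀ v < g.n, s.arrs aIn v = 0) {i j x : ℕ}
    (e64 : s.vars 64 = i) (e65 : s.vars 65 = j) (e66 : s.vars 66 = x)
    (hL : g.LeafBlock (s.arrs aTree) (s.arrs aIdx) (s.arrs aLow) (s.arrs aOrd) i j x)
    (hj : j ≤ g.n) (hidx : ∀ v, s.arrs aIdx v ≤ g.n + 1)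
    (h0 : ∀ v ∈ Net.blockSet (s.arrs aOrd) i j x, s.arrs aCol v = 0)
    (hnbr : ∀ l, i ≤ l → l < j → ∀ w ∈ g.N (s.arrs aOrd l), s.arrs aCol w = 0 →
      w ∈ Net.blockSet (s.arrs aOrd) i j x)
    (hns : ∀ l, i ≤ l → l < j → ¬ g.Slack k (s.arrs aCol) (s.arrs aOrd l)) :
    wp B blockStep s fun t s' => Rep g s' ∧ g.Good k (s'.arrs aCol) ∧
      (∀ v < g.n, s'.arrs aIn v = 0) ∧
      (∀ l, i ≤ l → l < j → s'.arrs aCol (s.arrs aOrd l) ≠ 0) ∧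
      (g.Closes (s.arrs aCol) (s'.arrs aCol) ∨
        (∀ v, (∀ l, i ≤ l → l < j → s.arrs aOrd l ≠ v) → s'.arrs aCol v = s.arrs aCol v) ∧
        ¬ g.Slack k (s'.arrs aCol) x ∧ (g.Ext k (s.arrs aCol) → g.Ext k (s'.arrs aCol))) ∧
      t + 600 * g.wt (g.unc (s'.arrs aCol)) ≤ 600 * g.wt (g.unc (s.arrs aCol)) := by
  set col := s.arrs aCol with hcol
  set ord := s.arrs aOrd with hord
  have hij := hL.lt
  have hmemB : ∀ l, i ≤ l → l < j → ord l ∈ Net.blockSet ord i j x := fun l h1 h2 =>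
    Net.mem_blockSet_ord h1 h2
  have hln : ∀ l, i ≤ l → l < j → ord l < g.n := fun l h1 h2 => hL.lt_n (hmemB l h1 h2)
  have hdeg : ∀ l, i ≤ l → l < j → g.deg (ord l) = k := fun l h1 h2 =>
    (Net.not_slack (hns l h1 h2) (hg.small _ (hln l h1 h2) (h0 _ (hmemB l h1 h2)))).1
  have hkn : k ≤ g.n := by
    have := hdeg i le_rfl hij
    have := Net.deg_lt (hln i le_rfl hij)
    omega
  have hpay : ∀ col' : ℕ → ℕ, g.unc col' ⊆ g.unc col → (∀ l, i ≤ l → l < j → col' (ord l) ≠ 0) →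
      g.wt (g.unc col') + (k + 1) * (j - i) ≤ g.wt (g.unc col) := fun col' hC hall => by
    have hE : g.wt ((Finset.Ico i j).image ord) = (k + 1) * (j - i) := by
      rw [Net.wt, Finset.sum_image, Finset.sum_congr rfl (g := fun _ => k + 1)]
      · simp [mul_comm]
      · intro l hl
        rw [Finset.mem_Ico] at hl
        rw [hdeg l hl.1 hl.2]
      · intro l hl l' hl' e
        simp only [Finset.coe_Ico, Set.mem_Ico] at hl hl'
        exact hL.inj l l' hl.1 hl.2 hl'.1 hl'.2 e
    rw [← Net.wt_sdiff hC, ← hE, add_comm]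
    refine Nat.add_le_add_right (Net.wt_mono fun v hv => ?_) _
    obtain ⟨l, hl, rfl⟩ := Finset.mem_image.1 hv
    rw [Finset.mem_Ico] at hl
    exact Finset.mem_sdiff.2 ⟨Net.mem_unc.2 ⟨hln l hl.1 hl.2, h0 _ (hmemB l hl.1 hl.2)⟩,
      fun h => hall l hl.1 hl.2 (Net.mem_unc.1 h).2⟩
  have hpos : 1 ≤ (k + 1) * (j - i) := Nat.mul_pos (by omega) (by omega)
  refine wp_seq.2 (wp_mono (checkBlock_spec hB hs hr hg e64 e65 hij hj hkn hln) ?_)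
  rintro t₁ s₁ hf₁ ⟨h46, ht₁⟩
  rw [mul_assoc] at ht₁
  have hs₁ : Static g k s₁ := hs.frame hf₁
  have hr₁ : Rep g s₁ := hr.frame hf₁
  have f4 : s₁.arrs aCol = col := hf₁.a _ rfl
  have fO : s₁.arrs aOrd = ord := hf₁.a _ rfl
  have fN : s₁.arrs aIn = s.arrs aIn := hf₁.a _ rfl
  have f64 : s₁.vars 64 = i := hf₁.var
  have f65 : s₁.vars 65 = j := hf₁.var
  have f66 : s₁.vars 66 = x := hf₁.var
  have hxn := hL.lt_n Net.mem_blockSet_self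
  refine wp_branch.2 ⟨fun hb => ?_, fun hb => ?_⟩
  · simp at hb
    rcases h46 with ⟨-, hun, hd⟩ | ⟨h, -⟩
    swap; · omega
    refine wp_seq.2 (wp_mono (peel_spec (s := s₁) hB hs₁ hr₁ (by rw [f4]; exact hg) f64 f65
      (by rw [fO]; exact hL) hj (by rw [fO, f4]; exact h0)) ?_)
    rintro t₂ s₂ hf₂ ⟨hr₂, hg₂, hk₂, hn₂, ht₂⟩
    rw [fO] at hk₂ hn₂
    rw [f4] at hk₂ ht₂
    have hs₂ : Static g k s₂ := hs₁.frame hf₂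
    have f66₂ : s₂.vars 66 = x := hf₂.var
    have hsub₂ : g.unc (s₂.arrs aCol) ⊆ g.unc col := fun v hv => by
      rw [Net.mem_unc] at hv ⊢
      refine ⟨hv.1, ?_⟩
      rw [← hk₂ v fun l h1 h2 e => hn₂ l h1 h2 (e ▸ hv.2)]
      exact hv.2
    have hpay₂ := hpay _ hsub₂ hn₂
    refine step_set x ?_
    refine wp_seq.2 (wp_mono (slackTest_spec (s := s₂.setVar 41 x) (v := x) hB
      hs₂.of_eq hr₂.of_eq (by simp) hxn) ?_)
    rintro t₃ s₃ hf₃ ⟨h42, ht₃⟩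
    simp only [setVar_arrs] at h42
    have f4₃ : s₃.arrs aCol = s₂.arrs aCol := hf₃.a _ rfl
    have hs₃ : Static g k s₃ := hs₂.of_eq.frame hf₃
    have hr₃ : Rep g s₃ := hr₂.of_eq.frame hf₃
    have fN₃ : s₃.arrs aIn = s.arrs aIn := by
      rw [hf₃.a aIn rfl, setVar_arrs, hf₂.a aIn rfl, fN]
    have hx0 : s₂.arrs aCol x = 0 := by
      rw [hk₂ x hL.ne, h0 x Net.mem_blockSet_self]
    refine wp_branch.2 ⟨fun hb₃ => ?_, fun hb₃ => ?_⟩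
    · simp at hb₃
      rcases h42 with ⟨-, hsl⟩ | ⟨h, -⟩
      swap; · omega
      have f66₃ : s₃.vars 66 = x := hf₃.var
      refine step_set x ?_
      refine wp_mono (flood_spec (s := s₃.setVar 40 x) (v := x) hB
        hs₃.of_eq hr₃.of_eq (by simpa [f4₃] using hg₂)
        (by rw [setVar_arrs, fN₃]; exact hin) (by simp) hxn (by simp [f4₃, hx0])
        (by simpa [f4₃] using hsl)) ?_
      rintro t₄ s₄ hf₄ ⟨hr₄, hg₄, hC₄, hx₄, hin₄, ht₄⟩
      simp only [setVar_arrs, f4₃] at hC₄ ht₄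
      have hn₄ : ∀ l, i ≤ l → l < j → s₄.arrs aCol (ord l) ≠ 0 := fun l h1 h2 => by
        rw [hC₄.keep _ (hln l h1 h2) (hn₂ l h1 h2)]
        exact hn₂ l h1 h2
      have hoff : g.ClosesOff (Net.blockSet ord i j x) col (s₂.arrs aCol) := by
        refine ⟨fun v hv hv0 => hk₂ v fun l h1 h2 e => ?_, fun v hv hv0 hv1 w hw => ?_⟩
        · exact hv0 (e ▸ h0 _ (hmemB l h1 h2))
        · obtain ⟨l, h1, h2, rfl⟩ : ∃ l, i ≤ l ∧ l < j ∧ ord l = v := by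
            by_contra! hcon
            exact hv1 ((hk₂ v hcon).trans hv0)
          by_cases hw0 : col w = 0
          · exact .inr (hnbr l h1 h2 w hw hw0)
          · left
            rwa [hk₂ w fun l h1 h2 e => hw0 (e ▸ h0 _ (hmemB l h1 h2))]
      have hCl : g.Closes col (s₄.arrs aCol) := (hoff.trans hC₄.off).closes fun v hv => by
        rcases hv with rfl | ⟨l, h1, h2, rfl⟩
        exacts [hx₄, hn₄ l h1 h2]
      exact ⟨hr₄, hg₄, hin₄, hn₄, .inl hCl, by omega⟩
    · simp at hb₃
      rcases h42 with ⟨h, -⟩ | ⟨-, hsl⟩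
      · omega
      refine wp_skip.2 ⟨hr₃, by rw [f4₃]; exact hg₂, by rw [fN₃]; exact hin,
        by rw [f4₃]; exact hn₂, .inr ⟨by rw [f4₃]; exact hk₂, by rw [f4₃]; exact hsl, ?_⟩,
        by rw [f4₃]; omega⟩
      rw [f4₃]
      exact hL.ext hg hg₂ h0 hnbr hns hun hd hk₂ hn₂ hsl
  · simp at hb
    rcases h46 with ⟨h, -⟩ | ⟨-, hbad⟩
    · omega
    have fT : s₁.arrs aTree = s.arrs aTree := hf₁.a _ rfl
    have fI : s₁.arrs aIdx = s.arrs aIdx := hf₁.a _ rfl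
    have fL : s₁.arrs aLow = s.arrs aLow := hf₁.a _ rfl
    refine wp_mono (solveBlock_spec (s := s₁) hB hs₁ hr₁ (by rw [f4]; exact hg)
      (by rw [fN]; exact hin) f64 f65 f66 (by rw [fT, fI, fL, fO]; exact hL) hj
      (by rw [fI]; exact hidx) (by rw [fO, f4]; exact h0) (by rw [fO, f4]; exact hnbr)
      (by rw [fO, f4]; exact hbad)) ?_
    rintro t₂ s₂ hf₂ ⟨hr₂, hg₂, hin₂, hC₂, hall₂, ht₂⟩
    rw [f4] at hC₂ ht₂
    rw [fO] at hall₂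
    have hn₂ : ∀ l, i ≤ l → l < j → s₂.arrs aCol (ord l) ≠ 0 := fun l h1 h2 =>
      hall₂ _ (hmemB l h1 h2)
    have := hpay _ (hC₂.off (W := ∅)).unc_subset hn₂
    exact ⟨hr₂, hg₂, hin₂, hn₂, .inl hC₂, by omega⟩

end WordRAM

namespace Net

variable {g : Net} {k : ℕ} {col col' : ℕ → ℕ}

/-! ### Block decompositions -/

theorem Closes.slack_iff (h : g.Closes col col') {v : ℕ} (h0 : col' v = 0) :
    g.Slack k col' v ↔ g.Slack k col v := by
  refine slack_congr fun w hw => ?_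
  by_cases hw0 : col w = 0
  · by_contra hne
    have := h.closed w (N_lt hw) hw0 (by rwa [hw0] at hne) v (N_symm hw)
    exact this h0
  · exact h.keep w (N_lt hw) hw0

theorem Closes.unc (h : g.Closes col col') {v : ℕ} (hv : v < g.n) (h0 : col' v = 0) : col v = 0 :=
  (mem_unc.1 ((h.off (W := ∅)).unc_subset (mem_unc.2 ⟨hv, h0⟩))).2

theorem Closes.adj (h : g.Closes col col') {v w : ℕ} (hw : w ∈ g.N v) (hvw : col v = 0 ↔ col w = 0) :
    col' v = 0 ↔ col' w = 0 := by
  have key : ∀ v w, w ∈ g.N v → (col v = 0 ↔ col w = 0) → col' v = 0 → col' w = 0 := by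
    intro v w hw hvw h0
    by_contra h1
    have hw0 := hvw.1 (h.unc (N_lt_left hw) h0)
    exact h.closed w (N_lt hw) hw0 h1 v (N_symm hw) h0
  exact ⟨key v w hw hvw, key w v (N_symm hw) hvw.symm⟩

/-- The block decomposition of the subgraph which is induced on `H`, for a depth-first search
forest with parents `tree`; the roots are their own parents. The list `ord` of the vertices of `H`
is cut at the positions `beg 0 = 0 < beg 1 < ⋯ < beg m`. Each part is either a root, whose
neighbours all come earlier in the list, or it is, together with the parent of its last vertex, a
leaf block of what remains of the graph when the earlier parts have been removed. -/
structure Decomp (g : Net) (H : ℕ → Prop) (tree idx low ord beg : ℕ → ℕ) (m : ℕ) : Prop where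
  beg_zero : beg 0 = 0
  beg_lt : ∀ b < m, beg b < beg (b + 1)
  lt : ∀ v, H v → v < g.n
  inj : ∀ l < beg m, ∀ l' < beg m, ord l = ord l' → l = l'
  mem : ∀ l < beg m, H (ord l)
  cover : ∀ v, H v → ∃ l < beg m, ord l = v
  tree_later : ∀ l < beg m, ∀ l' < l, tree (ord l) ≠ ord l'
  tree_adj : ∀ v, H v → tree v = v ∨ tree v ∈ g.N v
  tree_mem : ∀ v, H v → H (tree v)
  idx_le : ∀ v, idx v ≤ g.n + 1
  root : ∀ b < m, tree (ord (beg (b + 1) - 1)) = ord (beg (b + 1) - 1) → beg (b + 1) = beg b + 1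
  root_nbr : ∀ b < m, tree (ord (beg (b + 1) - 1)) = ord (beg (b + 1) - 1) →
    ∀ w ∈ g.N (ord (beg b)), H w → ∃ l < beg b, ord l = w
  block : ∀ b < m, tree (ord (beg (b + 1) - 1)) ≠ ord (beg (b + 1) - 1) →
    g.LeafBlock tree idx low ord (beg b) (beg (b + 1)) (tree (ord (beg (b + 1) - 1)))
  block_nbr : ∀ b < m, tree (ord (beg (b + 1) - 1)) ≠ ord (beg (b + 1) - 1) →
    ∀ l, beg b ≤ l → l < beg (b + 1) → ∀ w ∈ g.N (ord l), H w →
      w ∈ blockSet ord (beg b) (beg (b + 1)) (tree (ord (beg (b + 1) - 1))) ∨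
      ∃ l' < beg b, ord l' = w

variable {H : ℕ → Prop} {tree idx low ord beg : ℕ → ℕ} {m : ℕ}

theorem Decomp.beg_mono (h : g.Decomp H tree idx low ord beg m) {b b' : ℕ} (hb : b ≤ b')
    (hm : b' ≤ m) : beg b ≤ beg b' := by
  induction b', hb using Nat.le_induction with
  | base => rfl
  | succ b' hb ih => exact (ih (by omega)).trans (h.beg_lt b' (by omega)).le

theorem Decomp.le_beg (h : g.Decomp H tree idx low ord beg m) {b : ℕ} (hb : b ≤ m) : b ≤ beg b := by
  induction b with
  | zero => omega
  | succ b ih =>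
    have := ih (by omega)
    have := h.beg_lt b (by omega)
    omega

theorem Decomp.beg_le_n (h : g.Decomp H tree idx low ord beg m) : beg m ≤ g.n := by
  have h1 : ((Finset.range (beg m)).image ord).card = beg m := by
    rw [Finset.card_image_of_injOn, Finset.card_range]
    intro i hi j hj hij
    exact h.inj i (by simpa using hi) j (by simpa using hj) hij
  have h2 : (Finset.range (beg m)).image ord ⊆ Finset.range g.n := fun v hv => by
    obtain ⟨i, hi, rfl⟩ := Finset.mem_image.1 hv
    exact Finset.mem_range.2 (h.lt _ (h.mem i (Finset.mem_range.1 hi)))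
  have := Finset.card_le_card h2
  simpa [h1] using this

end Net

namespace WordRAM

variable {g : Net} {k B : ℕ} {s s' : State} {P : Prog}

/-- Goes through all vertices and colours the uncoloured components of those with slack. -/
def slackPass : Prog :=
  .set 33 (.const 0) ;;
  .loop (.lt (.var 33) (.var 0))
    (.load 34 aCol (.var 33) ;;
     .branch (.eq (.var 34) (.const 0))
       (.set 41 (.var 33) ;;
        slackTest ;;
        .branch (.eq (.var 42) (.const 1)) (.set 40 (.var 33) ;; flood) .skip)
       .skip ;;
     .add 33 (.var 33) (.const 1))

theorem slackPass_spec (hB : bound g k ≤ B) (hs : Static g k s) (hr : Rep g s)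
    (hg : g.Good k (s.arrs aCol)) (hin : ∀ v < g.n, s.arrs aIn v = 0) :
    wp B slackPass s fun t s' => Rep g s' ∧ g.Good k (s'.arrs aCol) ∧
      (∀ v < g.n, s'.arrs aIn v = 0) ∧ g.Closes (s.arrs aCol) (s'.arrs aCol) ∧
      (∀ v < g.n, s'.arrs aCol v = 0 → ¬ g.Slack k (s'.arrs aCol) v) ∧
      t + 90 * g.wt (g.unc (s'.arrs aCol)) ≤ 90 * g.wt (g.unc (s.arrs aCol)) + 30 * g.n + 10 := by
  refine step_set 0 ?_
  refine wp_loop (fun cr s' => Rep g s' ∧ g.Good k (s'.arrs aCol) ∧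
    (∀ v < g.n, s'.arrs aIn v = 0) ∧ g.Closes (s.arrs aCol) (s'.arrs aCol) ∧
    ∃ m, s'.vars 33 = m ∧ m ≤ g.n ∧
      (∀ v < m, s'.arrs aCol v = 0 → ¬ g.Slack k (s'.arrs aCol) v) ∧
      cr = 90 * g.wt (g.unc (s'.arrs aCol)) + 30 * (g.n - m))
    (c := 90 * g.wt (g.unc (s.arrs aCol)) + 30 * g.n) ?_ ?_ ?_
  · rintro cr s₁ ⟨hr₁, hg₁, hin₁, hC₁, m, e33, hmn, hns, rfl⟩ hf hb
    have hs₁ : Static g k s₁ := hs.of_eq.frame hf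
    simp [e33, hs₁.vn] at hb
    have hcm := hg₁.le_n m hb
    refine step_load (s₁.arrs aCol m) ?_
    refine wp_seq.2 (wp_branch.2 ⟨fun hb' => ?_, fun hb' => ?_⟩)
    · simp at hb'
      refine step_set m ?_
      refine wp_seq.2 (wp_mono (slackTest_spec (s := (s₁.setVar 34 (s₁.arrs aCol m)).setVar 41 m) (v := m) hB
        hs₁.of_eq hr₁.of_eq (by simp) hb) ?_)
      rintro t₂ s₂ hf₂ ⟨h42, ht₂⟩
      simp only [setVar_arrs] at h42
      have f4 : s₂.arrs aCol = s₁.arrs aCol := hf₂.arr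
      have fN : s₂.arrs aIn = s₁.arrs aIn := hf₂.arr
      have e33₂ : s₂.vars 33 = m := hf₂.var
      have hs₂ : Static g k s₂ := hs₁.of_eq.frame hf₂
      have hr₂ : Rep g s₂ := hr₁.of_eq.frame hf₂
      refine wp_branch.2 ⟨fun hb₂ => ?_, fun hb₂ => ?_⟩
      · simp at hb₂
        rcases h42 with ⟨-, hsl⟩ | ⟨h, -⟩
        swap; · omega
        refine step_set m ?_
        refine wp_mono (flood_spec (s := s₂.setVar 40 m) (v := m) hB
          hs₂.of_eq hr₂.of_eq (by simpa [f4] using hg₁)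
          (by rw [setVar_arrs, fN]; exact hin₁) (by simp) hb (by simp [f4, hb'])
          (by simpa [f4] using hsl)) ?_
        rintro t₃ s₃ hf₃ ⟨hr₃, hg₃, hC₃, hv₃, hin₃, ht₃⟩
        simp only [setVar_arrs, f4] at hC₃ ht₃
        have e33₃ : s₃.vars 33 = m := hf₃.var
        refine end_add (m + 1) ⟨_, ⟨hr₃.of_eq, hg₃, hin₃, hC₁.trans hC₃, m + 1, by simp, by omega,
          fun v hv hv0 => ?_, rfl⟩, ?_⟩
        · simp only [setVar_arrs] at hv0 ⊢
          rw [hC₃.slack_iff hv0]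
          rcases (Nat.lt_succ_iff.1 hv).lt_or_eq with h | rfl
          · exact hns v h (hC₃.unc (by omega) hv0)
          · exact absurd hv0 hv₃
        · simp only [setVar_arrs]; omega
      · simp at hb₂
        rcases h42 with ⟨h, -⟩ | ⟨-, hsl⟩
        · omega
        refine wp_skip.2 (end_add (m + 1) ?_)
        refine ⟨_, ⟨hr₂.of_eq, ?_, ?_, ?_, m + 1, by simp, by omega,
          fun v hv hv0 => ?_, rfl⟩, ?_⟩
        · simpa [f4] using hg₁
        · simpa [fN] using hin₁
        · simpa [f4] using hC₁
        · simp only [setVar_arrs, f4] at hv0 ⊢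
          rcases (Nat.lt_succ_iff.1 hv).lt_or_eq with h | rfl
          exacts [hns v h hv0, hsl]
        · simp only [setVar_arrs, f4]; omega
    · simp at hb'
      refine wp_skip.2 (end_add (m + 1) ?_)
      refine ⟨_, ⟨hr₁.of_eq, hg₁, hin₁, hC₁, m + 1, by simp, by omega,
          fun v hv hv0 => ?_, rfl⟩, ?_⟩
      · simp only [setVar_arrs] at hv0 ⊢
        rcases (Nat.lt_succ_iff.1 hv).lt_or_eq with h | rfl
        exacts [hns v h hv0, absurd hv0 hb']
      · simp only [setVar_arrs]; omega
  · exact ⟨hr.of_eq, hg, hin, Net.Closes.refl _, 0, by simp, by omega,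
      fun v hv => by omega, by simp⟩
  · rintro t s₁ cr ⟨hr₁, hg₁, hin₁, hC₁, m, e33, hmn, hns, rfl⟩ hf hb ht
    have f0 : s₁.vars 0 = g.n := (hf.v _ rfl).trans (by simp [hs.vn])
    simp [e33, f0] at hb
    obtain rfl : m = g.n := by omega
    exact ⟨hr₁, hg₁, hin₁, hC₁, hns, by omega⟩

/-- Goes through the parts of the block decomposition, whose number is in register 31. Register
32 becomes `0` if there is no colouring. -/
def blocks : Prog :=
  .set 33 (.const 0) ;;
  .loop (.lt (.var 33) (.var 31))
    (.load 64 aBeg (.var 33) ;;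
     .add 33 (.var 33) (.const 1) ;;
     .load 65 aBeg (.var 33) ;;
     .sub 34 (.var 65) (.const 1) ;;
     .load 34 aOrd (.var 34) ;;
     .load 66 aTree (.var 34) ;;
     .load 35 aOrd (.var 64) ;;
     .load 35 aCol (.var 35) ;;
     .branch (.eq (.var 35) (.const 0))
       (.branch (.eq (.var 34) (.var 66))
         (.set 32 (.const 0) ;; .set 33 (.var 31))
         blockStep)
       .skip)

/-- What is known in front of part `b` of the block decomposition. -/
structure Stage (g : Net) (k : ℕ) (H : ℕ → Prop) (tree ord beg : ℕ → ℕ) (col : ℕ → ℕ) (b : ℕ) :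
    Prop where
  tight : ∀ v < g.n, col v = 0 → ¬ g.Slack k col v
  done : ∀ l < beg b, col (ord l) ≠ 0
  alike : ∀ v, H v → (∀ l < beg b, ord l ≠ v) → (col v = 0 ↔ col (tree v) = 0)

theorem blocks_spec (hB : bound g k ≤ B) (hs : Static g k s) (hr : Rep g s)
    (hg : g.Good k (s.arrs aCol)) (hin : ∀ v < g.n, s.arrs aIn v = 0) {H : ℕ → Prop} {m : ℕ}
    (hH : ∀ v < g.n, g.deg v ≤ k → H v) (e31 : s.vars 31 = m) (e32 : s.vars 32 = 1)
    (hD : g.Decomp H (s.arrs aTree) (s.arrs aIdx) (s.arrs aLow) (s.arrs aOrd) (s.arrs aBeg) m)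
    (hS : Stage g k H (s.arrs aTree) (s.arrs aOrd) (s.arrs aBeg) (s.arrs aCol) 0) :
    wp B blocks s fun t s' => Rep g s' ∧ g.Good k (s'.arrs aCol) ∧
      (∀ v < g.n, s'.arrs aIn v = 0) ∧
      (s'.vars 32 = 1 ∧ (∀ v < g.n, s'.arrs aCol v ≠ 0) ∨
        s'.vars 32 = 0 ∧ ¬ g.Ext k (s.arrs aCol)) ∧
      t ≤ 600 * g.wt (g.unc (s.arrs aCol)) + 20 * g.n + 10 := by
  set tree := s.arrs aTree with htree
  set ord := s.arrs aOrd with hord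
  set beg := s.arrs aBeg with hbeg
  have hmn := (hD.le_beg le_rfl).trans hD.beg_le_n
  refine step_set 0 ?_
  refine wp_loop (fun cr s' => Rep g s' ∧ g.Good k (s'.arrs aCol) ∧
    (∀ v < g.n, s'.arrs aIn v = 0) ∧ ∃ b, s'.vars 33 = b ∧ b ≤ m ∧
    (s'.vars 32 = 1 ∧ Stage g k H tree ord beg (s'.arrs aCol) b ∧
      (g.Ext k (s.arrs aCol) → g.Ext k (s'.arrs aCol)) ∨
      s'.vars 32 = 0 ∧ b = m ∧ ¬ g.Ext k (s.arrs aCol)) ∧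
    cr = 600 * g.wt (g.unc (s'.arrs aCol)) + 20 * (m - b))
    (c := 600 * g.wt (g.unc (s.arrs aCol)) + 20 * m) ?_ ?_ ?_
  · rintro cr s₁ ⟨hr₁, hg₁, hin₁, b, e33, hbm, h, rfl⟩ hf hb
    have hs₁ : Static g k s₁ := hs.of_eq.frame hf
    have fT : s₁.arrs aTree = tree := hf.a _ rfl
    have fO : s₁.arrs aOrd = ord := hf.a _ rfl
    have fB : s₁.arrs aBeg = beg := hf.a _ rfl
    have f31 : s₁.vars 31 = m := hf.var
    simp [e33, f31] at hb
    rcases h with ⟨e32₁, hS₁, hE₁⟩ | ⟨-, h, -⟩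
    swap; · omega
    set col := s₁.arrs aCol with hcol
    have hb1 := hD.beg_lt b hb
    have hb2 := (hD.beg_mono (b := b + 1) hb le_rfl)
    have hbn := hD.beg_le_n
    obtain ⟨y, hy⟩ : ∃ y, y = ord (beg (b + 1) - 1) := ⟨_, rfl⟩
    have hyH : H y := hy ▸ hD.mem _ (by omega)
    have hyn := hD.lt y hyH
    have hxH := hD.tree_mem y hyH
    have hxn := hD.lt _ hxH
    have hzH := hD.mem (beg b) (by omega)
    have hzn := hD.lt _ hzH
    have hzc := hg₁.le_n _ hzn
    refine step_load (beg b) ?_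
    refine step_add (b + 1) ?_
    refine step_load (beg (b + 1)) ?_
    refine step_sub (beg (b + 1) - 1) ?_
    refine step_load y ?_
    refine step_load (tree y) ?_
    refine step_load (ord (beg b)) ?_
    refine step_load (col (ord (beg b))) ?_
    rw [hy] at hyn
    have hlater : ∀ l, beg b ≤ l → l < beg (b + 1) → ∀ l' < beg b, ord l' ≠ ord l :=
      fun l h1 h2 l' h3 e => by
        have := hD.inj l' (by omega) l (by omega) e
        omega
    -- all vertices of the part are coloured if the first one is, and conversely
    have halike : tree y ≠ y → ∀ v ∈ Net.blockSet ord (beg b) (beg (b + 1)) (tree y),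
        (col v = 0 ↔ col (tree y) = 0) := fun hne => by
      rw [hy] at hne ⊢
      refine (hD.block b hb hne).induct Iff.rfl fun l h1 h2 h3 => ?_
      rw [← h3]
      exact hS₁.alike _ (hD.mem l (by omega)) (hlater l h1 h2)
    refine wp_branch.2 ⟨fun hb₁ => ?_, fun hb₁ => ?_⟩
    · simp at hb₁
      refine wp_branch.2 ⟨fun hb₂ => ?_, fun hb₂ => ?_⟩
      · simp at hb₂
        refine step_set 0 ?_
        refine end_set m ⟨_, ⟨hr₁.of_eq, hg₁, hin₁, m, by simp, le_rfl,
          .inr ⟨by simp, rfl, fun hE => ?_⟩, rfl⟩, by simp only [setVar_arrs, ← hcol]; omega⟩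
        have hroot := hD.root b hb (by rw [← hy]; exact hb₂.symm)
        have hnb := hD.root_nbr b hb (by rw [← hy]; exact hb₂.symm)
        obtain ⟨ψ, h1, h2, h3⟩ := hE₁ hE
        obtain ⟨r, hr⟩ : ∃ r, r = ord (beg b) := ⟨_, rfl⟩
        rw [← hr] at hb₁ hnb hzn
        have htight := Net.not_slack (hS₁.tight r hzn hb₁) (hg₁.small r hzn hb₁)
        have hall : ∀ w ∈ g.N r, col w ≠ 0 := fun w hw hw0 => by
          obtain ⟨l, hl, rfl⟩ := hnb w hw (hH w (Net.N_lt hw) (hg₁.small w (Net.N_lt hw) hw0))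
          exact hS₁.done l hl hw0
        have hdone : g.done col r = g.deg r := by
          have := Net.done_add (g := g) col r
          rw [Finset.filter_false_of_mem hall] at this
          simpa using this
        have heq : g.used col r = Finset.Icc 1 k :=
          Finset.eq_of_subset_of_card_le (hg₁.used_subset r) (by
            rw [Nat.card_Icc, htight.2, hdone, htight.1]; omega)
        have hψ : ψ r ∈ g.used col r := by
          rw [heq, Finset.mem_Icc]; exact h1 r hzn
        obtain ⟨hc, w, hw, e⟩ := Net.mem_used.1 hψ
        exact h2 r w hw (by rw [← e]; exact (h3 w (Net.N_lt hw) (hall w hw)).symm)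
      · simp at hb₂
        have hne : tree y ≠ y := fun e => hb₂ e.symm
        have hL := hD.block b hb (by rw [← hy]; exact hne)
        have hnb := hD.block_nbr b hb (by rw [← hy]; exact hne)
        rw [← hy] at hL hnb
        have hx0 : col (tree y) = 0 :=
          (halike hne _ (Net.mem_blockSet_ord le_rfl hb1)).1 hb₁
        have h0 : ∀ v ∈ Net.blockSet ord (beg b) (beg (b + 1)) (tree y), col v = 0 :=
          fun v hv => (halike hne v hv).2 hx0
        refine wp_mono (blockStep_spec (s := ((((((((s₁.setVar 64 (beg b)).setVar 33 (b + 1)).setVar 65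
          (beg (b + 1))).setVar 34 (beg (b + 1) - 1)).setVar 34 y).setVar 66 (tree y)).setVar 35
          (ord (beg b))).setVar 35 (col (ord (beg b)))))
          (i := beg b) (j := beg (b + 1)) (x := tree y) hB
          hs₁.of_eq
          hr₁.of_eq hg₁ hin₁ (by simp) (by simp) (by simp) ?_ (by omega) ?_ ?_ ?_ ?_) ?_
        · simpa only [setVar_arrs, fT, fO, hf.a aIdx rfl, hf.a aLow rfl] using hL
        · simpa only [setVar_arrs, hf.a aIdx rfl] using hD.idx_le
        · simpa only [setVar_arrs, fO] using h0
        · simp only [setVar_arrs, fO]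
          intro l h1 h2 w hw hw0
          refine (hnb l h1 h2 w hw (hH w (Net.N_lt hw) (hg₁.small w (Net.N_lt hw) hw0))).resolve_right
            ?_
          rintro ⟨l', h3, rfl⟩
          exact hS₁.done l' h3 hw0
        · simp only [setVar_arrs, fO]
          intro l h1 h2
          exact hS₁.tight _ (hL.lt_n (Net.mem_blockSet_ord h1 h2)) (h0 _ (Net.mem_blockSet_ord h1 h2))
        rintro t₂ s₂ hf₂ ⟨hr₂, hg₂, hin₂, hn₂, hcase, ht₂⟩
        simp only [setVar_arrs, fO] at hn₂ hcase ht₂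
        have e33₂ : s₂.vars 33 = b + 1 := hf₂.var
        have e32₂ : s₂.vars 32 = 1 := hf₂.var
        refine ⟨_, ⟨hr₂, hg₂, hin₂, b + 1, e33₂, hb, .inl ⟨e32₂, ?_, ?_⟩, rfl⟩, by rw [← hcol] at ht₂; omega⟩
        · rcases hcase with hC | ⟨hk, hx, -⟩
          · refine ⟨fun v hv hv0 => ?_, fun l hl => ?_, fun v hv hvl => ?_⟩
            · rw [hC.slack_iff hv0]; exact hS₁.tight v hv (hC.unc hv hv0)
            · rcases Nat.lt_or_ge l (beg b) with h | h
              · have := hS₁.done l h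
                rwa [hC.keep _ (hD.lt _ (hD.mem l (by omega))) this]
              · exact hn₂ l h hl
            · rcases hD.tree_adj v hv with e | e
              · rw [e]
              · exact hC.adj e (hS₁.alike v hv fun l hl => hvl l (by omega))
          · refine ⟨fun v hv hv0 => ?_, fun l hl => ?_, fun v hv hvl => ?_⟩
            · by_cases hvx : v = tree y
              · rw [hvx]; exact hx
              have hvl : ∀ l, beg b ≤ l → l < beg (b + 1) → ord l ≠ v :=
                fun l h1 h2 e => hn₂ l h1 h2 (e ▸ hv0)
              have hv0' : col v = 0 := (hk v hvl).symm.trans hv0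
              rw [Net.slack_congr (col := col)]
              · exact hS₁.tight v hv hv0'
              · intro w hw
                refine hk w fun l h1 h2 e => ?_
                rcases hnb l h1 h2 v (e ▸ Net.N_symm hw) (hH v hv (hg₁.small v hv hv0')) with h | h
                · rcases h with h | ⟨l', h3, h4, e'⟩
                  exacts [hvx h, hvl l' h3 h4 e']
                · obtain ⟨l', h3, e'⟩ := h
                  exact hS₁.done l' h3 (e' ▸ hv0')
            · rcases Nat.lt_or_ge l (beg b) with h | h
              · rw [hk _ fun l' h1 h2 e => hlater l' h1 h2 l h e.symm]
                exact hS₁.done l h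
              · exact hn₂ l h hl
            · rw [hk v fun l h1 h2 => hvl l h2, hk (tree v) fun l h1 h2 e => ?_]
              · exact hS₁.alike v hv fun l hl => hvl l (by omega)
              · obtain ⟨lv, hlv, rfl⟩ := hD.cover v hv
                have : beg (b + 1) ≤ lv := by
                  by_contra hcon
                  exact hvl lv (by omega) rfl
                exact hD.tree_later lv hlv l (by omega) e.symm
        · rcases hcase with hC | ⟨-, -, hE⟩
          · exact fun h => hC.ext hg₂ (hE₁ h)
          · exact fun h => hE (hE₁ h)
    · simp at hb₁
      refine wp_skip.2 ⟨_, ⟨hr₁.of_eq, hg₁, hin₁, b + 1, by simp, hb,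
        .inl ⟨by simp [e32₁], ⟨hS₁.tight, fun l hl => ?_, fun v hv hvl => hS₁.alike v hv
          fun l hl => hvl l (by omega)⟩, hE₁⟩, rfl⟩, by simp only [setVar_arrs, ← hcol]; omega⟩
      rcases Nat.lt_or_ge l (beg b) with h | h
      · exact hS₁.done l h
      · simp only [setVar_arrs]
        by_cases hroot : tree y = y
        · have := hD.root b hb (by rw [← hy]; exact hroot)
          obtain rfl : l = beg b := by omega
          exact hb₁
        · rw [Ne, halike hroot _ (Net.mem_blockSet_ord h hl),
            ← halike hroot _ (Net.mem_blockSet_ord le_rfl hb1)]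
          exact hb₁
  · exact ⟨hr.of_eq, hg, hin, 0, by simp, by omega, .inl ⟨by simp [e32], hS, id⟩,
      by simp⟩
  · rintro t s₁ cr ⟨hr₁, hg₁, hin₁, b, e33, hbm, h, rfl⟩ hf hb ht
    have f31 : s₁.vars 31 = m := hf.var
    simp [e33, f31] at hb
    obtain rfl : b = m := by omega
    refine ⟨hr₁, hg₁, hin₁, ?_, by omega⟩
    rcases h with ⟨e, hS₁, -⟩ | ⟨e, -, h⟩
    · refine .inl ⟨e, fun v hv hv0 => ?_⟩
      obtain ⟨l, hl, rfl⟩ := hD.cover v (hH v hv (hg₁.small v hv hv0))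
      exact hS₁.done l hl hv0
    · exact .inr ⟨e, h⟩


variable {g : Net} {k B : ℕ} {s s' : State} {P : Prog}

/-! ### One trial -/

theorem used_eq_empty {col : ℕ → ℕ} (h : ∀ v < g.n, col v = 0) (v : ℕ) : g.used col v = ∅ := by
  ext c
  simp only [Net.mem_used, Finset.notMem_empty, iff_false, not_and, not_exists]
  rintro hc w hw rfl
  exact hc (h w (Net.N_lt hw))

theorem done_eq_zero {col : ℕ → ℕ} (h : ∀ v < g.n, col v = 0) (v : ℕ) : g.done col v = 0 := by
  rw [Net.done, Finset.card_eq_zero, Finset.filter_eq_empty_iff]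
  exact fun w hw => not_not.2 (h w (Net.N_lt hw))

/-- Makes all vertices uncoloured. The table of used colours is cleaned with the help of the
old colours, since it is too large to go through all of it. -/
def reset : Prog :=
  .set 33 (.const 0) ;;
  .loop (.lt (.var 33) (.var 0))
    (.load 34 aCol (.var 33) ;;
     .store aUsed (.var 33) (.const 0) ;;
     .store aDone (.var 33) (.const 0) ;;
     .load 35 aOff (.var 33) ;;
     .add 36 (.var 33) (.const 1) ;;
     .load 36 aOff (.var 36) ;;
     .loop (.lt (.var 35) (.var 36))
       (.load 37 aNb (.var 35) ;;
        .load 37 aBase (.var 37) ;;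
        .add 37 (.var 37) (.var 34) ;;
        .store aTab (.var 37) (.const 0) ;;
        .add 35 (.var 35) (.const 1)) ;;
     .store aCol (.var 33) (.const 0) ;;
     .add 33 (.var 33) (.const 1))

theorem reset_spec (hB : bound g k ≤ B) (hs : Static g k s) (hr : Rep g s)
    (hc : ∀ v < g.n, s.arrs aCol v ≤ g.n) :
    wp B reset s fun t s' => Rep g s' ∧ (∀ v < g.n, s'.arrs aCol v = 0) ∧
      t ≤ 20 * (g.off g.n + g.n) + 10 := by
  set col := s.arrs aCol with hcol
  refine step_set 0 ?_
  refine wp_for (fun m s' => (∀ v < g.n, m ≤ v → s'.arrs aCol v = col v) ∧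
    (∀ v < m, s'.arrs aCol v = 0) ∧
    (∀ v < m, s'.arrs aUsed v = 0) ∧ (∀ v < m, s'.arrs aDone v = 0) ∧
    (∀ v < g.n, ∀ c, 1 ≤ c → c ≤ g.n → s'.arrs aTab (v * (g.n + 1) + c) = 0 ∨
      ∃ w ∈ g.N v, m ≤ w ∧ col w = c))
    (fun m => 12 * (g.n - m) + 6 * (g.off g.n - g.off m)) 0 rfl (Nat.zero_le _)
    (fun s' hf => (hf.v 0 rfl).trans hs.vn) ⟨fun v _ _ => by simp [hcol], fun v hv => by omega,
      fun v hv => by omega, fun v hv => by omega, fun v hv c h1 h2 => ?_⟩ ?_ ?_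
  · simp only [setVar_arrs]
    rw [hr.tab v hv c h1 h2]
    split_ifs with h
    · obtain ⟨-, w, hw, e⟩ := Net.mem_used.1 h
      exact .inr ⟨w, hw, by omega, e⟩
    · exact .inl rfl
  · rintro m s₁ - hb e33 ⟨hc1, hc0, hu, hd, ht⟩ hf
    have fO : s₁.arrs aOff = g.off := (hf.a _ rfl).trans (by simp [hs.off])
    have fN : s₁.arrs aNb = g.nb := (hf.a _ rfl).trans (by simp [hs.nb])
    have fB : s₁.arrs aBase = s.arrs aBase := hf.a _ rfl
    have hmono := g.mono m hb
    have hoff1 := off_le_n (g := g) (v := m + 1) (by omega)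
    have hcm := hc m hb
    refine step_load (col m) ?_
    refine step_store m 0 ?_
    refine step_store m 0 ?_
    refine step_load (g.off m) ?_
    refine step_add (m + 1) ?_
    refine step_load (g.off (m + 1)) ?_
    refine wp_seq.2 (wp_for (fun j s' =>
      ∀ v < g.n, ∀ c, 1 ≤ c → c ≤ g.n → s'.arrs aTab (v * (g.n + 1) + c) = 0 ∨
        ∃ w ∈ g.N v, col w = c ∧ (m + 1 ≤ w ∨ w = m ∧ ∃ j', j ≤ j' ∧ j' < g.off (m + 1) ∧
          g.nb j' = v)) (fun j => 6 * (g.off (m + 1) - j)) (g.off m) rfl hmono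
      (fun s' hf => hf.v 36 rfl) (fun v hv c h1 h2 => ?_) ?_ ?_)
    · refine (ht v hv c h1 h2).imp (fun h => by simpa using h) ?_
      rintro ⟨w, hw, h, hwc⟩
      refine ⟨w, hw, hwc, ?_⟩
      rcases h.lt_or_eq with h | rfl
      · exact .inl h
      · exact .inr ⟨rfl, (Net.mem_N.1 (Net.N_symm hw))⟩
    · rintro j s₂ hj1 hb' e35 ht hf'
      have e34 : s₂.vars 34 = col m := hf'.var
      have fN' : s₂.arrs aNb = g.nb := hf'.arr
      have fB' : s₂.arrs aBase = s.arrs aBase := hf'.arr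
      obtain ⟨u, hu⟩ : ∃ u, u = g.nb j := ⟨_, rfl⟩
      have hun : u < g.n := hu ▸ g.lt m hb j hj1 hb'
      have hrow := row_lt_bound hB hun hcm
      refine step_load u ?_
      refine step_load (u * (g.n + 1)) (hv := by simp [fB', hs.base u hun]) ?_
      refine step_add (u * (g.n + 1) + col m) ?_
      refine step_store (u * (g.n + 1) + col m) 0 ?_
      refine end_add (j + 1) ⟨by simp, fun v hv c h1 h2 => ?_, by omega⟩
      by_cases hvc : v = u ∧ c = col m
      · left; simp [hvc.1, hvc.2]
      · have hne : v * (g.n + 1) + c ≠ u * (g.n + 1) + col m := fun e => hvc (row_inj h2 hcm e)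
        refine (ht v hv c h1 h2).imp (fun h => by simpa [hne] using h) ?_
        rintro ⟨w, hw, hwc, h⟩
        refine ⟨w, hw, hwc, h.imp_right ?_⟩
        rintro ⟨hwm, j', h1, h2, h3⟩
        refine ⟨hwm, j', ?_, h2, h3⟩
        rcases h1.lt_or_eq with h | rfl
        · exact h
        · exact absurd ⟨h3.symm.trans hu.symm, by rw [← hwc, hwm]⟩ hvc
    · rintro t s₂ - ht' hf' hcr'
      have e33' : s₂.vars 33 = m := hf'.var
      have f4 : s₂.arrs aCol = s₁.arrs aCol := hf'.arr
      have f6 : s₂.arrs aUsed = Function.update (s₁.arrs aUsed) m 0 := hf'.arr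
      have f7 : s₂.arrs aDone = Function.update (s₁.arrs aDone) m 0 := hf'.arr
      refine step_store m 0 ?_
      refine end_add (m + 1) ?_
      have hz : ∀ f : ℕ → ℕ, (∀ v < m, f v = 0) → ∀ v < m + 1, Function.update f m 0 v = 0 := by
        intro f h v hv
        rcases (Nat.lt_succ_iff.1 hv).lt_or_eq with h' | rfl
        · rw [Function.update_of_ne h'.ne, h v h']
        · simp
      refine ⟨by simp, ⟨fun v hv h => ?_, ?_, ?_, ?_, fun v hv c h1 h2 => ?_⟩, by omega⟩
      · have : v ≠ m := by omega
        simp [this, f4, hc1 v hv (by omega)]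
      · simpa [f4] using hz _ hc0
      · simpa [f6] using hz _ hu
      · simpa [f7] using hz _ hd
      · refine (ht' v hv c h1 h2).imp (fun h => by simpa using h) ?_
        rintro ⟨w, hw, hwc, h | ⟨-, j', h1, h2, -⟩⟩
        · exact ⟨w, hw, h, hwc⟩
        · omega
  · rintro t s₁ - ⟨-, hc0, hu, hd, ht⟩ hf hcr'
    refine ⟨⟨fun v hv c h1 h2 => ?_, fun v hv => ?_, fun v hv => ?_⟩, hc0, by omega⟩
    · rw [used_eq_empty hc0]
      rcases ht v hv c h1 h2 with h | ⟨w, hw, h, -⟩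
      · simpa using h
      · have := Net.N_lt hw; omega
    · rw [used_eq_empty hc0, hu v hv]; rfl
    · rw [done_eq_zero hc0, hd v hv]

/-- Gives the vertices of large degree, whose number is in register 30, the colours in array `aDig`.
Register 32 becomes `0` if this is not a proper colouring. -/
def assignBig : Prog :=
  .set 32 (.const 1) ;;
  .set 33 (.const 0) ;;
  .loop (.lt (.var 33) (.var 30))
    (.load 10 aBig (.var 33) ;;
     .load 11 aDig (.var 33) ;;
     .load 34 aBase (.var 10) ;;
     .add 34 (.var 34) (.var 11) ;;
     .load 34 aTab (.var 34) ;;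
     .branch (.eq (.var 34) (.const 0))
       (assign ;; .add 33 (.var 33) (.const 1))
       (.set 32 (.const 0) ;; .set 33 (.var 30)))

theorem assignBig_spec (hB : bound g k ≤ B) (hs : Static g k s) (hr : Rep g s)
    (h0 : ∀ v < g.n, s.arrs aCol v = 0) {q : ℕ} (e30 : s.vars 30 = q) (hqn : q ≤ g.n)
    (hbig : ∀ v < g.n, (∃ l < q, s.arrs aBig l = v) ∨ g.deg v ≤ k)
    (hlt : ∀ l < q, s.arrs aBig l < g.n)
    (hinj : ∀ l < q, ∀ l' < q, s.arrs aBig l = s.arrs aBig l' → l = l')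
    (hdig : ∀ l < q, 1 ≤ s.arrs aDig l ∧ s.arrs aDig l ≤ k ∧ s.arrs aDig l ≤ g.n) :
    wp B assignBig s fun t s' => Rep g s' ∧ (∀ v < g.n, s'.arrs aCol v ≤ g.n) ∧
      (s'.vars 32 = 1 ∧ g.Good k (s'.arrs aCol) ∧
        (∀ l < q, s'.arrs aCol (s.arrs aBig l) = s.arrs aDig l) ∧
        (∀ v < g.n, (∀ l < q, s.arrs aBig l ≠ v) → s'.arrs aCol v = 0) ∨
       s'.vars 32 = 0 ∧ ∃ l < q, ∃ l' < q, s.arrs aBig l' ∈ g.N (s.arrs aBig l) ∧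
        s.arrs aDig l = s.arrs aDig l') ∧
      t ≤ 60 * (g.off g.n + g.n) + 10 := by
  set big := s.arrs aBig with hbigd
  set dig := s.arrs aDig with hdigd
  refine step_set 1 ?_
  refine step_set 0 ?_
  refine wp_loop (fun cr s' => Rep g s' ∧ (∀ v < g.n, s'.arrs aCol v ≤ g.n) ∧ ∃ m, s'.vars 33 = m ∧
    m ≤ q ∧ (s'.vars 32 = 1 ∧
      (∀ u v, v ∈ g.N u → s'.arrs aCol u ≠ 0 → s'.arrs aCol u ≠ s'.arrs aCol v) ∧
      (∀ l < m, s'.arrs aCol (big l) = dig l) ∧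
      (∀ v < g.n, (∀ l < m, big l ≠ v) → s'.arrs aCol v = 0) ∨
     s'.vars 32 = 0 ∧ m = q ∧ ∃ l < q, ∃ l' < q, big l' ∈ g.N (big l) ∧ dig l = dig l') ∧
    cr = 40 * g.wt (g.unc (s'.arrs aCol)) + 20 * (q - m))
    (c := 40 * g.wt (g.unc (s.arrs aCol)) + 20 * q) ?_ ?_ ?_
  · rintro cr s₁ ⟨hr₁, hn₁, m, e33, hmq, h, rfl⟩ hf hb
    have hs₁ : Static g k s₁ := hs.of_eq.frame hf
    have f30 : s₁.vars 30 = q := hf.var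
    have fB : s₁.arrs aBig = big := hf.arr
    have fD : s₁.arrs aDig = dig := hf.arr
    simp [e33, f30] at hb
    rcases h with ⟨e32, hp, hd, hz⟩ | ⟨-, h, -⟩
    swap; · omega
    have hvn := hlt m hb
    obtain ⟨hd1, hdk, hdn⟩ := hdig m hb
    have hv0 : s₁.arrs aCol (big m) = 0 := hz _ hvn fun l hl e => by
      have := hinj l (by omega) m hb e
      omega
    have hrow := row_lt_bound hB hvn hdn
    refine step_load (big m) ?_
    refine step_load (dig m) ?_
    refine step_load (big m * (g.n + 1)) (hv := by simp [hs₁.base _ hvn]) ?_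
    refine step_add (big m * (g.n + 1) + dig m) ?_
    refine step_load (if dig m ∈ g.used (s₁.arrs aCol) (big m) then 1 else 0)
      (hv := by simp [hr₁.tab _ hvn _ hd1 hdn]) ?_
    have hwt1 : g.deg (big m) + 1 ≤ g.wt (g.unc (s₁.arrs aCol)) := by
      have := Net.wt_erase (g := g) (Net.mem_unc.2 ⟨hvn, hv0⟩)
      omega
    refine wp_branch.2 ⟨fun hb' => ?_, fun hb' => ?_⟩
    · have hfree : dig m ∉ g.used (s₁.arrs aCol) (big m) := fun h => by simp [h] at hb'
      refine wp_seq.2 (wp_mono (assign_spec (s := ((((s₁.setVar 10 (big m)).setVar 11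
        (dig m)).setVar 34 (big m * (g.n + 1))).setVar 34 (big m * (g.n + 1) + dig m)).setVar 34
        (if dig m ∈ g.used (s₁.arrs aCol) (big m) then 1 else 0)) (v := big m) (c := dig m) hB
        hs₁.of_eq hr₁.of_eq (by simp) (by simp) hvn
        (by simpa using hv0) hd1 hdn) ?_)
      rintro t₂ s₂ hf₂ ⟨hr₂, h4, ht₂⟩
      simp only [setVar_arrs] at h4
      have e33₂ : s₂.vars 33 = m := hf₂.var
      have e32₂ : s₂.vars 32 = 1 := hf₂.var
      refine end_add (m + 1) ?_
      have hwt := Net.wt_unc_update (g := g) hvn hv0 (show dig m ≠ 0 by omega)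
      rw [← h4] at hwt
      refine ⟨_, ⟨hr₂.of_eq, ?_, m + 1, by simp, hb, .inl ⟨by simp [e32₂], ?_, ?_, ?_⟩,
        rfl⟩, by simp only [setVar_arrs]; omega⟩
      · intro v hv
        simp only [setVar_arrs, h4, Function.update_apply]
        split_ifs
        exacts [hdn, hn₁ v hv]
      · intro u v huv hu
        simp only [setVar_arrs, h4] at hu ⊢
        have hne := Net.N_ne huv
        have aux : ∀ w ∈ g.N (big m), s₁.arrs aCol w ≠ dig m := fun w hw e =>
          hfree (Net.mem_used.2 ⟨by omega, w, hw, e⟩)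
        by_cases hum : u = big m
        · subst hum
          rw [Function.update_self, Function.update_of_ne hne]
          exact (aux v huv).symm
        · rw [Function.update_of_ne hum] at hu ⊢
          by_cases hvm : v = big m
          · subst hvm
            rw [Function.update_self]
            exact aux u (Net.N_symm huv)
          · rw [Function.update_of_ne hvm]
            exact hp u v huv hu
      · intro l hl
        simp only [setVar_arrs, h4]
        rcases (Nat.lt_succ_iff.1 hl).lt_or_eq with h' | rfl
        · have : big l ≠ big m := fun e => by
            have := hinj l (by omega) m hb e
            omega
          rw [Function.update_of_ne this, hd l h']
        · simp
      · intro v hv hvl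
        simp only [setVar_arrs, h4]
        rw [Function.update_of_ne (hvl m (by omega)).symm]
        exact hz v hv fun l hl => hvl l (by omega)
    · have hused : dig m ∈ g.used (s₁.arrs aCol) (big m) := by_contra fun h => by simp [h] at hb'
      obtain ⟨-, w, hw, e⟩ := Net.mem_used.1 hused
      have hwl : ∃ l < m, big l = w := by
        by_contra! hcon
        have := hz w (Net.N_lt hw) hcon
        omega
      obtain ⟨l, hl, rfl⟩ := hwl
      rw [hd l hl] at e
      refine step_set 0 ?_
      exact end_set q ⟨_, ⟨hr₁.of_eq, hn₁, q, by simp,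
        le_rfl, .inr ⟨by simp, rfl, m, hb, l, by omega, hw, e.symm⟩, rfl⟩,
        by simp only [setVar_arrs]; omega⟩
  · refine ⟨hr.of_eq, fun v hv => by simp [h0 v hv], 0, by simp, by omega,
      .inl ⟨by simp, fun u v huv hu => ?_, fun l hl => by omega, fun v hv _ => h0 v hv⟩, by simp⟩
    exact absurd (h0 u (Net.N_lt_left huv)) hu
  · rintro t s₁ cr ⟨hr₁, hn₁, m, e33, hmq, h, rfl⟩ hf hb ht
    have f30 : s₁.vars 30 = q := hf.var
    simp [e33, f30] at hb
    obtain rfl : m = q := by omega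
    have hwt : g.wt (g.unc (s.arrs aCol)) ≤ g.off g.n + g.n := by
      rw [← Net.wt_range]; exact Net.wt_mono (Finset.filter_subset _ _)
    refine ⟨hr₁, hn₁, ?_, by omega⟩
    refine h.imp (fun h => ⟨h.1, ⟨h.2.1, fun v hv => ?_, hn₁, fun v hv hv0 => ?_⟩, h.2.2⟩)
      fun h => ⟨h.1, h.2.2⟩
    · by_cases hv' : ∃ l < m, big l = v
      · obtain ⟨l, hl, rfl⟩ := hv'
        rw [h.2.2.1 l hl]
        exact (hdig l hl).2.1
      · push Not at hv'
        rw [h.2.2.2 v hv hv']; omega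
    · refine (hbig v hv).resolve_left ?_
      rintro ⟨l, hl, rfl⟩
      rw [h.2.2.1 l hl] at hv0
      have := (hdig l hl).1
      omega

/-- Looks for a colouring that extends the one in array `aDig` of the vertices of large degree.
Register 32 becomes `1` or `0` according as there is one or not. -/
def trial : Prog :=
  reset ;;
  assignBig ;;
  .branch (.eq (.var 32) (.const 1)) (slackPass ;; blocks) .skip

theorem trial_spec (hB : bound g k ≤ B) (hs : Static g k s) (hr : Rep g s)
    (hn : ∀ v < g.n, s.arrs aCol v ≤ g.n) (hin : ∀ v < g.n, s.arrs aIn v = 0) {q m : ℕ}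
    (e30 : s.vars 30 = q) (e31 : s.vars 31 = m) (hqn : q ≤ g.n)
    (hlt : ∀ l < q, s.arrs aBig l < g.n)
    (hinj : ∀ l < q, ∀ l' < q, s.arrs aBig l = s.arrs aBig l' → l = l')
    (hbig : ∀ v < g.n, (∃ l < q, s.arrs aBig l = v) ↔ k < g.deg v)
    (hdig : ∀ l < q, 1 ≤ s.arrs aDig l ∧ s.arrs aDig l ≤ k ∧ s.arrs aDig l ≤ g.n)
    (hD : g.Decomp (fun v => v < g.n ∧ g.deg v ≤ k) (s.arrs aTree) (s.arrs aIdx) (s.arrs aLow)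
      (s.arrs aOrd) (s.arrs aBeg) m) :
    wp B trial s fun t s' => Rep g s' ∧ (∀ v < g.n, s'.arrs aCol v ≤ g.n) ∧
      (∀ v < g.n, s'.arrs aIn v = 0) ∧
      (s'.vars 32 = 1 ∧ g.Good k (s'.arrs aCol) ∧ (∀ v < g.n, s'.arrs aCol v ≠ 0) ∨
       s'.vars 32 = 0 ∧ ¬ ∃ ψ : ℕ → ℕ, (∀ v < g.n, 1 ≤ ψ v ∧ ψ v ≤ k) ∧
        (∀ u v, v ∈ g.N u → ψ u ≠ ψ v) ∧ ∀ l < q, ψ (s.arrs aBig l) = s.arrs aDig l) ∧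
      t ≤ 1000 * (g.off g.n + g.n) + 50 := by
  have hwt : ∀ col, g.wt (g.unc col) ≤ g.off g.n + g.n := fun col => by
    rw [← Net.wt_range]; exact Net.wt_mono (Finset.filter_subset _ _)
  refine wp_seq.2 (wp_mono (reset_spec hB hs hr hn) ?_)
  rintro t₁ s₁ hf₁ ⟨hr₁, h0₁, ht₁⟩
  have hs₁ : Static g k s₁ := hs.frame hf₁
  have fb₁ : s₁.arrs aBig = s.arrs aBig := hf₁.a _ rfl
  have fd₁ : s₁.arrs aDig = s.arrs aDig := hf₁.a _ rfl
  have hbig' : ∀ v < g.n, (∃ l < q, s.arrs aBig l = v) ∨ g.deg v ≤ k := fun v hv => by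
    rw [hbig v hv]; exact lt_or_ge _ _
  refine wp_seq.2 (wp_mono (assignBig_spec (q := q) hB hs₁ hr₁ h0₁ ((hf₁.v _ rfl).trans e30) hqn
    (by rw [fb₁]; exact hbig') (by rw [fb₁]; exact hlt) (by rw [fb₁]; exact hinj)
    (by rw [fd₁]; exact hdig)) ?_)
  rintro t₂ s₂ hf₂ ⟨hr₂, hn₂, h, ht₂⟩
  rw [fb₁, fd₁] at h
  have hs₂ : Static g k s₂ := hs₁.frame hf₂
  have hin₂ : ∀ v < g.n, s₂.arrs aIn v = 0 := by
    rw [hf₂.a aIn rfl, hf₁.a aIn rfl]; exact hin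
  refine wp_branch.2 ⟨fun hb => ?_, fun hb => ?_⟩
  swap
  · simp at hb
    rcases h with ⟨h, -⟩ | ⟨h, l, hl, l', hl', hN, e⟩
    · omega
    refine wp_skip.2 ⟨hr₂, hn₂, hin₂, .inr ⟨h, ?_⟩, by omega⟩
    rintro ⟨ψ, -, h2, h3⟩
    exact h2 _ _ hN (by rw [h3 l hl, h3 l' hl', e])
  simp at hb
  rcases h with ⟨-, hg₂, hc₂, hz₂⟩ | ⟨h, -⟩
  swap; · omega
  refine wp_seq.2 (wp_mono (slackPass_spec hB hs₂ hr₂ hg₂ hin₂) ?_)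
  rintro t₃ s₃ hf₃ ⟨hr₃, hg₃, hin₃, hC₃, hns₃, ht₃⟩
  have hs₃ : Static g k s₃ := hs₂.frame hf₃
  have f31 : s₃.vars 31 = m := by
    rw [hf₃.v 31 rfl, hf₂.v 31 rfl, hf₁.v 31 rfl, e31]
  have f32 : s₃.vars 32 = 1 := hf₃.var
  have fT : s₃.arrs aTree = s.arrs aTree := by rw [hf₃.a aTree rfl, hf₂.a aTree rfl, hf₁.a aTree rfl]
  have fI : s₃.arrs aIdx = s.arrs aIdx := by rw [hf₃.a aIdx rfl, hf₂.a aIdx rfl, hf₁.a aIdx rfl]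
  have fL : s₃.arrs aLow = s.arrs aLow := by rw [hf₃.a aLow rfl, hf₂.a aLow rfl, hf₁.a aLow rfl]
  have fO : s₃.arrs aOrd = s.arrs aOrd := by rw [hf₃.a aOrd rfl, hf₂.a aOrd rfl, hf₁.a aOrd rfl]
  have fB : s₃.arrs aBeg = s.arrs aBeg := by rw [hf₃.a aBeg rfl, hf₂.a aBeg rfl, hf₁.a aBeg rfl]
  have hH0 : ∀ v < g.n, g.deg v ≤ k → s₂.arrs aCol v = 0 := fun v hv hd =>
    hz₂ v hv fun l hl e => by
      have := (hbig v hv).1 ⟨l, hl, e⟩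
      omega
  refine wp_mono (blocks_spec (H := fun v => v < g.n ∧ g.deg v ≤ k) hB hs₃ hr₃ hg₃ hin₃
    (fun v h1 h2 => ⟨h1, h2⟩) f31 f32 (by rw [fT, fI, fL, fO, fB]; exact hD) ?_) ?_
  · rw [fT, fO, fB]
    refine ⟨hns₃, fun l hl => ?_, fun v hv _ => ?_⟩
    · rw [hD.beg_zero] at hl; omega
    · rcases hD.tree_adj v hv with e | e
      · rw [e]
      · have hT := hD.tree_mem v hv
        refine hC₃.adj e ?_
        rw [hH0 v hv.1 hv.2, hH0 _ hT.1 hT.2]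
  rintro t₄ s₄ hf₄ ⟨hr₄, hg₄, hin₄, h, ht₄⟩
  have h1 := hwt (s₂.arrs aCol)
  have h2 := hwt (s₃.arrs aCol)
  refine ⟨hr₄, hg₄.le_n, hin₄, h.imp (fun h => ⟨h.1, hg₄, h.2⟩) fun h => ⟨h.1, ?_⟩, by omega⟩
  rintro ⟨ψ, h1, h2, h3⟩
  refine h.2 (hC₃.ext hg₃ ⟨ψ, h1, h2, fun v hv hv0 => ?_⟩)
  by_cases hv' : ∃ l < q, s.arrs aBig l = v
  · obtain ⟨l, hl, rfl⟩ := hv'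
    rw [h3 l hl, hc₂ l hl]
  · push Not at hv'
    exact absurd (hz₂ v hv hv') hv0

end WordRAM

namespace Net

/-! ### Depth-first search: the invariant -/

/-- The data of a depth-first search: the parents `tree`, the discovery times `idx` (starting with
`1`; `0` means undiscovered), the low points `low`, the positions `ptr` in the adjacency lists, the
stack `stk`, the list `ord` of the vertices which have left the stack and the positions `beg`
where the parts of this list begin, the numbers `cnt` of discovered vertices, `top` of vertices on
the stack and `m` of parts, and the set `path` of the vertices that are being explored. -/
structure Dfs where
  tree : ℕ → ℕ
  idx : ℕ → ℕ
  low : ℕ → ℕ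
  ptr : ℕ → ℕ
  stk : ℕ → ℕ
  ord : ℕ → ℕ
  beg : ℕ → ℕ
  cnt : ℕ
  top : ℕ
  m : ℕ
  path : Set ℕ

/-- The vertex is on the stack. -/
def Dfs.On (d : Dfs) (v : ℕ) : Prop := ∃ i < d.top, d.stk i = v

/-- The vertex has left the stack. -/
def Dfs.Out (d : Dfs) (v : ℕ) : Prop := ∃ l < d.beg d.m, d.ord l = v

/-- The edge from `v` to its neighbour `u` has been looked at from `v`. -/
def Dfs.Scan (d : Dfs) (g : Net) (v u : ℕ) : Prop :=
  u ∈ g.N v ∧ (v ∈ d.path → ∃ j, g.off v ≤ j ∧ j < d.ptr v ∧ g.nb j = u)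

/-- The entries `i, …, j - 1` of `ord` are a part of a block decomposition as in `Net.Decomp`. -/
structure IsPart (g : Net) (H : ℕ → Prop) (tree idx low ord : ℕ → ℕ) (i j : ℕ) : Prop where
  lt : i < j
  root : tree (ord (j - 1)) = ord (j - 1) →
    j = i + 1 ∧ ∀ w ∈ g.N (ord i), H w → ∃ l < i, ord l = w
  block : tree (ord (j - 1)) ≠ ord (j - 1) →
    g.LeafBlock tree idx low ord i j (tree (ord (j - 1))) ∧
    ∀ l, i ≤ l → l < j → ∀ w ∈ g.N (ord l), H w →
      w ∈ blockSet ord i j (tree (ord (j - 1))) ∨ ∃ l' < i, ord l' = w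

/-- The invariant of a depth-first search from the root `r` in the subgraph that is induced
on `H`. The vertices outside `H` have the discovery time `n + 1`. -/
structure Dfs.Ok (d : Dfs) (g : Net) (H : ℕ → Prop) (r : ℕ) : Prop where
  big : ∀ v < g.n, ¬ H v → d.idx v = g.n + 1
  idx_out : ∀ v, g.n ≤ v → d.idx v = 0
  idx_le : ∀ v, H v → d.idx v ≤ d.cnt
  idx_inj : ∀ u v, H u → H v → d.idx u ≠ 0 → d.idx u = d.idx v → u = v
  cnt_eq : {v | H v ∧ d.idx v ≠ 0}.ncard = d.cnt
  on_vis : ∀ v, d.On v → H v ∧ d.idx v ≠ 0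
  sorted : ∀ i j, i < j → j < d.top → d.idx (d.stk i) < d.idx (d.stk j)
  out_vis : ∀ v, d.Out v → H v ∧ d.idx v ≠ 0
  on_or_out : ∀ v, H v → d.idx v ≠ 0 → d.On v ∨ d.Out v
  not_out : ∀ v, d.On v → ¬ d.Out v
  tree_vis : ∀ v, H v → d.idx v ≠ 0 →
    H (d.tree v) ∧ d.idx (d.tree v) ≠ 0 ∧ (d.tree v = v ∨ d.tree v ∈ g.N v)
  tree_on : ∀ v, d.On v → v ≠ r → d.On (d.tree v) ∧ d.idx (d.tree v) < d.idx v
  tree_root : d.On r → d.tree r = r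
  root_path : ∀ v, d.On v → d.On r ∧ r ∈ d.path ∧ d.idx r ≤ d.idx v
  path_on : ∀ p ∈ d.path, d.On p
  path_tree : ∀ p ∈ d.path, p ≠ r → d.tree p ∈ d.path
  path_gap : ∀ p ∈ d.path, ∀ p' ∈ d.path, d.idx p' < d.idx p → d.idx p' ≤ d.idx (d.tree p)
  -- vertices which are discovered after `p` while `p` is explored are descendants of `p`
  descend : ∀ p ∈ d.path, ∀ v, d.On v → d.idx p < d.idx v → d.idx p ≤ d.idx (d.tree v)
  -- if `w` was discovered before `p` and is not an ancestor of `p`, then it was left before `p`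
  -- was discovered
  left : ∀ p ∈ d.path, ∀ w, H w → d.idx w ≠ 0 → w ∉ d.path → d.idx w < d.idx p →
    ∀ u ∈ g.N w, H u → d.idx u ≠ 0 ∧ d.idx u < d.idx p
  finished : ∀ w, H w → d.idx w ≠ 0 → w ∉ d.path → ∀ u ∈ g.N w, H u → d.idx u ≠ 0
  ptr_le : ∀ p ∈ d.path, g.off p ≤ d.ptr p ∧ d.ptr p ≤ g.off (p + 1)
  low_le : ∀ v, d.On v → d.low v ≤ d.idx v ∧ d.idx r ≤ d.low v
  low_scan : ∀ v, d.On v → ∀ u, d.Scan g v u → H u → d.idx u ≠ 0 ∧ d.low v ≤ d.idx u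
  low_tree : ∀ v, d.On v → v ∉ d.path → d.low (d.tree v) ≤ d.low v ∧ d.low v < d.idx (d.tree v)
  low_reach : ∀ v, d.On v → d.low v = d.idx v ∨ (∃ u ∈ g.N v, d.On u ∧ d.idx u = d.low v) ∨
    ∃ u, d.On u ∧ u ∉ d.path ∧ d.tree u = v ∧ d.low u = d.low v
  -- the scanned neighbours of `z` which were discovered earlier are ancestors of `z`
  ancestor : ∀ z, d.On z → ∀ u, d.Scan g z u → H u → d.idx u < d.idx z →
    ∀ v, d.On v → d.idx u < d.idx v → d.idx v ≤ d.idx z → d.idx u ≤ d.idx (d.tree v)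
  beg_zero : d.beg 0 = 0
  ord_inj : ∀ l < d.beg d.m, ∀ l' < d.beg d.m, d.ord l = d.ord l' → l = l'
  tree_later : ∀ l < d.beg d.m, ∀ l' < l, d.tree (d.ord l) ≠ d.ord l'
  beg_le : ∀ b < d.m, d.beg (b + 1) ≤ d.beg d.m
  part : ∀ b < d.m, g.IsPart H d.tree d.idx d.low d.ord (d.beg b) (d.beg (b + 1))

variable {g : Net} {H : ℕ → Prop} {d : Dfs} {r : ℕ}

/-! ### A finished subtree is a leaf block -/

section block

variable {v t : ℕ} {ord' : ℕ → ℕ}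

/-- The situation in which the exploration of `v` ends and a block is found: the low point of `v` is
not below the parent of `v`. -/
structure Dfs.Closing (d : Dfs) (g : Net) (H : ℕ → Prop) (r v : ℕ) : Prop extends d.Ok g H r where
  mem : v ∈ d.path
  max : ∀ p ∈ d.path, d.idx p ≤ d.idx v
  end_ptr : d.ptr v = g.off (v + 1)
  ne_root : v ≠ r
  le_low : d.idx (d.tree v) ≤ d.low v

/-- The vertices on the stack from `v` on. -/
def Dfs.Above (d : Dfs) (v u : ℕ) : Prop := d.On u ∧ d.idx v ≤ d.idx u

theorem Dfs.Ok.eq_of_idx (h : d.Ok g H r) {u v : ℕ} (hu : d.On u) (hv : d.On v)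
    (e : d.idx u = d.idx v) : u = v :=
  h.idx_inj u v (h.on_vis u hu).1 (h.on_vis v hv).1 (h.on_vis u hu).2 e

namespace Dfs.Closing

variable (h : d.Closing g H r v)
include h

theorem on : d.On v := h.path_on v h.mem

theorem above_self : d.Above v v := ⟨h.on, le_rfl⟩

theorem tree_on' {u : ℕ} (hu : d.Above v u) :
    d.On (d.tree u) ∧ d.idx (d.tree u) < d.idx u ∧ d.tree u ∈ g.N u := by
  have hur : u ≠ r := by
    rintro rfl
    have h1 := (h.root_path v h.on).2.2
    exact h.ne_root (h.eq_of_idx h.on hu.1 (by have := hu.2; omega))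
  have h1 := h.tree_on u hu.1 hur
  have h2 := h.on_vis u hu.1
  refine ⟨h1.1, h1.2, (h.tree_vis u h2.1 h2.2).2.2.resolve_left fun e => ?_⟩
  have h3 := h1.2
  rw [e] at h3
  omega

theorem tree_above {u : ℕ} (hu : d.Above v u) (huv : u ≠ v) : d.Above v (d.tree u) := by
  refine ⟨(h.tree_on' hu).1, h.descend v h.mem u hu.1 ?_⟩
  rcases hu.2.lt_or_eq with h' | h'
  · exact h'
  · exact absurd (h.eq_of_idx h.on hu.1 h').symm huv

theorem notMem_path {u : ℕ} (hu : d.Above v u) (huv : u ≠ v) : u ∉ d.path := fun hp =>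
  huv (h.eq_of_idx hu.1 h.on (le_antisymm (h.max u hp) hu.2))

theorem scan {u w : ℕ} (hu : d.Above v u) (hw : w ∈ g.N u) : d.Scan g u w := by
  refine ⟨hw, fun hp => ?_⟩
  obtain rfl : u = v := by
    by_contra huv
    exact h.notMem_path hu huv hp
  rw [h.end_ptr]
  exact mem_N.1 hw

theorem low_above {u : ℕ} (hu : d.Above v u) : d.idx (d.tree v) ≤ d.low u := by
  obtain ⟨i, hi⟩ : ∃ i, i = d.idx u := ⟨_, rfl⟩
  induction i using Nat.strong_induction_on generalizing u with
  | _ i ih =>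
    by_cases huv : u = v
    · rw [huv]; exact h.le_low
    · have h1 := h.low_tree u hu.1 (h.notMem_path hu huv)
      have h2 := ih _ (hi ▸ (h.tree_on' hu).2.1) (h.tree_above hu huv) rfl
      omega

/-- The neighbours of the vertices above `v` are in the block, or have left the stack. -/
theorem nbr {u w : ℕ} (hu : d.Above v u) (hw : w ∈ g.N u) (hHw : H w) :
    w = d.tree v ∨ d.Above v w ∨ d.Out w := by
  have hx := h.tree_on' h.above_self
  have h1 := h.low_scan u hu.1 w (h.scan hu hw) hHw
  have h2 := h.low_above hu
  rcases h.on_or_out w hHw h1.1 with hon | hout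
  swap; · exact .inr (.inr hout)
  by_cases h3 : d.idx v ≤ d.idx w
  · exact .inr (.inl ⟨hon, h3⟩)
  left
  refine h.eq_of_idx hon hx.1 ?_
  by_contra hne
  have hwp : w ∉ d.path := fun hp => by
    have := h.path_gap v h.mem w hp (by omega)
    omega
  have := h.left v h.mem w hHw h1.1 hwp (by omega) u (N_symm hw) (h.on_vis u hu.1).1
  have := hu.2
  omega

theorem mem_blockSet_iff (ht : t < d.top) (htv : d.stk t = v) {b : ℕ}
    (hord : ∀ i < d.top - t, ord' (b + i) = d.stk (d.top - 1 - i)) {u : ℕ} :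
    u ∈ blockSet ord' b (b + (d.top - t)) (d.tree v) ↔ u = d.tree v ∨ d.Above v u := by
  refine or_congr_right ⟨?_, ?_⟩
  · rintro ⟨l, h1, h2, rfl⟩
    have := hord (l - b) (by omega)
    rw [show b + (l - b) = l by omega] at this
    rw [this]
    refine ⟨⟨_, by omega, rfl⟩, ?_⟩
    rcases (show t ≤ d.top - 1 - (l - b) by omega).lt_or_eq with h' | h'
    · rw [← htv]; exact (h.sorted _ _ h' (by omega)).le
    · rw [← h', htv]
  · rintro ⟨⟨i, hi, rfl⟩, h1⟩
    have hti : t ≤ i := by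
      by_contra hcon
      have := h.sorted i t (by omega) ht
      rw [htv] at this
      omega
    refine ⟨b + (d.top - 1 - i), by omega, by omega, ?_⟩
    rw [hord _ (by omega)]
    congr 1
    omega

/-- From every vertex above `v`, a closed set leads to the parent of `v`, even if `u` is not
allowed. -/
theorem reach {A T : Set ℕ} (hA : ∀ w, w = d.tree v ∨ d.Above v w → w ∈ A)
    (hT : ∀ w ∈ T, w ∈ A → ∀ w' ∈ g.N w, w' ∈ A → w' ∈ T) {w : ℕ}
    (hw : w = d.tree v ∨ d.Above v w) (hwT : w ∈ T) : d.tree v ∈ T := by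
  obtain ⟨i, hi⟩ : ∃ i, i = d.idx w := ⟨_, rfl⟩
  induction i using Nat.strong_induction_on generalizing w with
  | _ i ih =>
    rcases hw with rfl | hw
    · exact hwT
    have h1 := h.tree_on' hw
    have h2 : d.tree w = d.tree v ∨ d.Above v (d.tree w) := by
      by_cases hwv : w = v
      · exact .inl (by rw [hwv])
      · exact .inr (h.tree_above hw hwv)
    exact ih _ (hi ▸ h1.2.1) h2 (hT w hwT (hA w (.inr hw)) _ h1.2.2 (hA _ h2)) rfl

/-- Without `u`, one still gets from every vertex below `u` to the parent of `v`. -/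
theorem reach_low {u : ℕ} {T : Set ℕ}
    (hT : ∀ w ∈ T, (w = d.tree v ∨ d.Above v w) → w ≠ u →
      ∀ w' ∈ g.N w, (w' = d.tree v ∨ d.Above v w') → w' ≠ u → w' ∈ T) {w : ℕ}
    (hw : w = d.tree v ∨ d.Above v w) (hwT : w ∈ T) (hwu : d.idx w < d.idx u) : d.tree v ∈ T := by
  obtain ⟨i, hi⟩ : ∃ i, i = d.idx w := ⟨_, rfl⟩
  induction i using Nat.strong_induction_on generalizing w with
  | _ i ih =>
    rcases hw with rfl | hw
    · exact hwT
    have h1 := h.tree_on' hw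
    have h2 : d.tree w = d.tree v ∨ d.Above v (d.tree w) := by
      by_cases hwv : w = v
      · exact .inl (by rw [hwv])
      · exact .inr (h.tree_above hw hwv)
    refine ih _ (hi ▸ h1.2.1) h2 (hT w hwT (.inr hw) ?_ _ h1.2.2 h2 ?_) (by omega) rfl
    · rintro rfl; omega
    · intro e; rw [e] at h1; omega

/-- A vertex with a small low point has a descendant with a neighbour that was discovered
early. -/
theorem reach_desc {u : ℕ} {T : Set ℕ}
    (hT : ∀ w ∈ T, (w = d.tree v ∨ d.Above v w) → w ≠ u →
      ∀ w' ∈ g.N w, (w' = d.tree v ∨ d.Above v w') → w' ≠ u → w' ∈ T) {w : ℕ}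
    (hw : d.Above v w) (hwT : w ∈ T) (hwu : d.idx u < d.idx w) (hlow : d.low w < d.idx u) :
    d.tree v ∈ T := by
  obtain ⟨i, hi⟩ : ∃ i, i = d.cnt - d.idx w := ⟨_, rfl⟩
  induction i using Nat.strong_induction_on generalizing w with
  | _ i ih =>
    have hne : w ≠ u := by rintro rfl; omega
    rcases h.low_reach w hw.1 with h1 | ⟨y, hy, hyon, h1⟩ | ⟨y, hyon, hyp, hyw, h1⟩
    · omega
    · have hyB : y = d.tree v ∨ d.Above v y := by
        rcases h.nbr hw hy (h.on_vis y hyon).1 with h2 | h2 | h2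
        · exact .inl h2
        · exact .inr h2
        · exact absurd h2 (h.not_out y hyon)
      refine h.reach_low hT hyB (hT w hwT (.inr hw) hne y hy hyB ?_) (by omega)
      rintro rfl; omega
    · have hyr : y ≠ r := by
        rintro rfl
        have := (h.root_path w hw.1).2.1
        exact hyp this
      have h2 := h.tree_on y hyon hyr
      rw [hyw] at h2
      have hyA : d.Above v y := ⟨hyon, by have := hw.2; omega⟩
      have h3 := h.tree_on' hyA
      rw [hyw] at h3
      have h4 := h.on_vis y hyon
      have h5 := h.idx_le y h4.1
      refine ih _ ?_ hyA (hT w hwT (.inr hw) hne y (N_symm h3.2.2) (.inr hyA) ?_) (by omega)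
        (by omega) rfl
      · omega
      · rintro rfl; omega

/-- Following parents from `y`, where `y` is between `z` and its ancestor `u`, leads to `u`. -/
theorem walk {z u : ℕ} (hz : d.Above v z) (huz : u ∈ g.N z) (hzu : d.idx u < d.idx z)
    (hu : u = d.tree v ∨ d.Above v u) {y : ℕ} (hy : y = d.tree v ∨ d.Above v y)
    (hy1 : d.idx u ≤ d.idx y) (hy2 : d.idx y ≤ d.idx z) :
    ∃ t, d.tree^[t] y = u ∧ ∀ s < t, d.idx u < d.idx (d.tree^[s] y) ∧
      d.Above v (d.tree^[s] y) := by
  have hx := h.tree_on' h.above_self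
  have huon : d.On u := by
    rcases hu with rfl | hu
    exacts [hx.1, hu.1]
  have hux : d.idx (d.tree v) ≤ d.idx u := by
    rcases hu with rfl | hu
    · exact le_rfl
    · have := hu.2; omega
  obtain ⟨i, hi⟩ : ∃ i, i = d.idx y := ⟨_, rfl⟩
  induction i using Nat.strong_induction_on generalizing y with
  | _ i ih =>
    have hyon : d.On y := by
      rcases hy with rfl | hy
      exacts [hx.1, hy.1]
    rcases hy1.lt_or_eq with h1 | h1
    swap
    · exact ⟨0, h.eq_of_idx hyon huon h1.symm, fun s hs => by omega⟩
    have hyA : d.Above v y := hy.resolve_left (by rintro rfl; omega)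
    have h2 := h.tree_on' hyA
    have h3 := h.ancestor z hz.1 u (h.scan hz huz) (h.on_vis u huon).1 hzu y hyon h1 hy2
    have h4 : d.tree y = d.tree v ∨ d.Above v (d.tree y) := by
      by_cases hyv : y = v
      · exact .inl (by rw [hyv])
      · exact .inr (h.tree_above hyA hyv)
    obtain ⟨t, ht, hs⟩ := ih _ (hi ▸ h2.2.1) h4 h3 (by omega) rfl
    refine ⟨t + 1, by rw [Function.iterate_succ_apply, ht], fun s hst => ?_⟩
    rcases s with _ | s
    · exact ⟨h1, hyA⟩
    · rw [Function.iterate_succ_apply]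
      exact hs s (by omega)

theorem leafBlock (ht : t < d.top) (htv : d.stk t = v) {b : ℕ}
    (hord : ∀ i < d.top - t, ord' (b + i) = d.stk (d.top - 1 - i)) :
    g.LeafBlock d.tree d.idx d.low ord' b (b + (d.top - t)) (d.tree v) := by
  have hx := h.tree_on' h.above_self
  have hmem : ∀ {u}, u ∈ blockSet ord' b (b + (d.top - t)) (d.tree v) ↔
      u = d.tree v ∨ d.Above v u := h.mem_blockSet_iff ht htv hord
  have hord' : ∀ l, b ≤ l → l < b + (d.top - t) → ord' l = d.stk (d.top - 1 - (l - b)) :=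
    fun l h1 h2 => by
      rw [← hord (l - b) (by omega)]; congr 1; omega
  have hstk : ∀ i j, i < d.top → j < d.top → d.stk i = d.stk j → i = j := fun i j hi hj e => by
    rcases lt_trichotomy i j with h' | h' | h'
    · have := h.sorted i j h' hj; rw [e] at this; omega
    · exact h'
    · have := h.sorted j i h' hi; rw [e] at this; omega
  have habove : ∀ l, b ≤ l → l < b + (d.top - t) → d.Above v (ord' l) := fun l h1 h2 => by
    refine (hmem.1 (mem_blockSet_ord h1 h2)).resolve_left fun e => ?_
    have h3 := hord' l h1 h2
    rw [e] at h3
    have h4 := hx.2.1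
    rw [h3] at h4
    rcases (show t ≤ d.top - 1 - (l - b) by omega).lt_or_eq with h' | h'
    · have := h.sorted _ _ h' (by omega)
      rw [htv] at this; omega
    · rw [← h', htv] at h4; omega
  have hb0 : b < b + (d.top - t) := by omega
  have hadj : ∀ l, b ≤ l → l < b + (d.top - t) → d.tree (ord' l) ∈ g.N (ord' l) :=
    fun l h1 h2 => (h.tree_on' (habove l h1 h2)).2.2
  refine ⟨hb0, fun l l' h1 h2 h3 h4 e => ?_, fun l h1 h2 e => ?_, ?_, fun l h1 h2 => ?_, hadj,
    fun w hw => ?_, fun u hu w hw huw => ?_, ?_⟩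
  · rw [hord' l h1 h2, hord' l' h3 h4] at e
    have := hstk _ _ (by omega) (by omega) e
    omega
  · have := (habove l h1 h2).2
    rw [e] at this
    have := hx.2.1
    omega
  · rw [hord' _ (by omega) (by omega), ← htv]
    congr 2
    omega
  · have hne : ord' l ≠ v := by
      rw [hord' l h1 (by omega), ← htv]
      intro e
      have := hstk _ _ (by omega) ht e
      omega
    have hA := habove l h1 (by omega)
    have h3 := h.tree_above hA hne
    have h4 := (h.tree_on' hA).2.1
    obtain ⟨l', h5, h6, e⟩ := (hmem.2 (.inr h3)).resolve_left fun e => by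
      rw [e] at h3
      have := h3.2
      have := hx.2.1
      omega
    refine ⟨l', ?_, h6, e.symm⟩
    rw [← e, hord' l h1 (by omega), hord' l' h5 h6] at h4
    by_contra hcon
    rcases (show d.top - 1 - (l - b) ≤ d.top - 1 - (l' - b) by omega).lt_or_eq with h' | h'
    · have := h.sorted _ _ h' (by omega); omega
    · rw [h'] at h4; omega
  · exact conn_of_reach hw fun T a ha haT hT =>
      h.reach (fun w hw => hmem.2 hw) hT (hmem.1 ha) haT
  · -- removing `u`
    have hu' := hmem.1 hu
    by_cases hux : u = d.tree v
    · -- everything is a descendant of `v`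
      refine conn_of_reach (x := v) ⟨hw, huw.symm⟩ fun T a ha haT hT => ?_
      have haA : d.Above v a := (hmem.1 ha.1).resolve_left fun e => ha.2 (e.trans hux.symm)
      clear ha hw
      obtain ⟨i, hi⟩ : ∃ i, i = d.idx a := ⟨_, rfl⟩
      induction i using Nat.strong_induction_on generalizing a with
      | _ i ih =>
        by_cases hav : a = v
        · rwa [← hav]
        have h1 := h.tree_on' haA
        have h2 := h.tree_above haA hav
        have hne : ∀ y, d.Above v y → y ∈ blockSet ord' b (b + (d.top - t)) (d.tree v) \ {u} :=
          fun y hy => ⟨hmem.2 (.inr hy), fun e => by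
            have h3 := hy.2
            rw [show y = u from e, hux] at h3
            have := hx.2.1
            omega⟩
        exact ih _ (hi ▸ h1.2.1) _ (hT a haT (hne a haA) _ h1.2.2 (hne _ h2)) h2 rfl
    · have huA : d.Above v u := hu'.resolve_left hux
      refine conn_of_reach (x := d.tree v) ⟨hw, huw.symm⟩ fun T a ha haT hT => ?_
      have hT' : ∀ w ∈ T, (w = d.tree v ∨ d.Above v w) → w ≠ u →
          ∀ w' ∈ g.N w, (w' = d.tree v ∨ d.Above v w') → w' ≠ u → w' ∈ T :=
        fun w h1 h2 h3 w' h4 h5 h6 => hT w h1 ⟨hmem.2 h2, h3⟩ w' h4 ⟨hmem.2 h5, h6⟩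
      have ha1 := hmem.1 ha.1
      have ha2 : a ≠ u := ha.2
      clear ha
      obtain ⟨i, hi⟩ : ∃ i, i = d.idx a := ⟨_, rfl⟩
      induction i using Nat.strong_induction_on generalizing a with
      | _ i ih =>
        rcases lt_or_ge (d.idx a) (d.idx u) with h1 | h1
        · exact h.reach_low hT' ha1 haT h1
        have haA : d.Above v a := ha1.resolve_left fun e => by
          rw [e] at h1
          have := huA.2
          have := hx.2.1
          omega
        have hlt : d.idx u < d.idx a := by
          rcases h1.lt_or_eq with h2 | h2
          · exact h2
          · exact absurd (h.eq_of_idx huA.1 haA.1 h2).symm ha2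
        have hav : a ≠ v := by
          rintro rfl
          have := huA.2
          omega
        have h2 := h.tree_on' haA
        have h3 := h.tree_above haA hav
        by_cases hau : d.tree a = u
        · have h4 := h.low_tree a haA.1 (h.notMem_path haA hav)
          rw [hau] at h4
          exact h.reach_desc hT' haA haT hlt h4.2
        · exact ih _ (hi ▸ h2.2.1) _ (hT' a haT (.inr haA) ha2 _ h2.2.2 (.inr h3) hau) (.inr h3)
            hau rfl
  · -- the path from the last vertex
    obtain ⟨z, hz⟩ : ∃ z, z = ord' b := ⟨_, rfl⟩
    have hzs : z = d.stk (d.top - 1) := by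
      rw [hz, hord' b le_rfl hb0]; congr 1; omega
    have hzA : d.Above v z := hz ▸ habove b le_rfl hb0
    have hzmax : ∀ u, d.On u → u ≠ z → d.idx u < d.idx z := by
      rintro u ⟨i, hi, rfl⟩ hne
      rw [hzs] at hne ⊢
      refine h.sorted _ _ ?_ (by omega)
      rcases (show i ≤ d.top - 1 by omega).lt_or_eq with h' | h'
      · exact h'
      · exact absurd (by rw [h']) hne
    rw [← hz]
    have hzt := h.tree_on' hzA
    have hztH := h.on_vis _ hzt.1
    have hlz := (h.low_scan z hzA.1 _ (h.scan hzA hzt.2.2) hztH.1).2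
    obtain ⟨w₀, hw₀N, hw₀on, hw₀⟩ : ∃ u ∈ g.N z, d.On u ∧ d.idx u = d.low z := by
      rcases h.low_reach z hzA.1 with h1 | h1 | ⟨y, hyon, hyp, hyz, -⟩
      · omega
      · exact h1
      · have hyr : y ≠ r := by
          rintro rfl
          exact hyp (h.root_path z hzA.1).2.1
        have h2 := h.tree_on y hyon hyr
        rw [hyz] at h2
        have := hzmax y hyon (by rintro rfl; omega)
        omega
    have hB : ∀ u, u ∈ g.N z → d.On u → u = d.tree v ∨ d.Above v u := fun u hu huon => by
      rcases h.nbr hzA hu (h.on_vis u huon).1 with h2 | h2 | h2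
      · exact .inl h2
      · exact .inr h2
      · exact absurd h2 (h.not_out u huon)
    have hw₀B := hB w₀ hw₀N hw₀on
    obtain ⟨a, ha, has⟩ := h.walk hzA hw₀N (by omega) hw₀B (.inr hzA) (by omega) le_rfl
    have hdec : ∀ s s', s < s' → s' ≤ a → d.idx (d.tree^[s'] z) < d.idx (d.tree^[s] z) := by
      intro s s' hss' hs'
      induction s', hss' using Nat.le_induction with
      | base =>
        rw [Function.iterate_succ_apply']
        exact (h.tree_on' (has s (by omega)).2).2.1
      | succ s' hss' ih =>
        have h1 := ih (by omega)
        rw [Function.iterate_succ_apply']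
        have h2 := (h.tree_on' (has s' (by omega)).2).2.1
        omega
    refine ⟨a, fun s hs => ?_, fun s hs => ?_, by rw [ha, hw₀], fun s hs => ?_, by rw [ha]; exact hw₀N,
      fun w hw hwB => ?_, fun s hs s' hs' e => ?_⟩
    · rcases hs.lt_or_eq with h' | rfl
      · exact hmem.2 (.inr (has s h').2)
      · rw [ha]; exact hmem.2 hw₀B
    · rw [← hw₀]; exact (has s hs).1
    · rw [Function.iterate_succ_apply']
      exact (h.tree_on' (has s hs).2).2.2
    · have hwB' := hmem.1 hwB
      have hwon : d.On w := by
        rcases hwB' with rfl | h'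
        exacts [hx.1, h'.1]
      have hwz := hzmax w hwon (N_ne hw)
      obtain ⟨c, hc, hcs⟩ := h.walk hzA hw hwz hwB' (.inr hzA) hwz.le le_rfl
      refine ⟨c, ?_, hc⟩
      by_contra hcon
      have h1 := (hcs a (by omega)).1
      rw [ha, hw₀] at h1
      have h2 := (h.low_scan z hzA.1 w (h.scan hzA hw) (h.on_vis w hwon).1).2
      omega
    · rcases lt_trichotomy s s' with h' | h' | h'
      · have := hdec s s' h' hs'; rw [e] at this; omega
      · exact h'
      · have := hdec s' s h' hs; rw [e] at this; omega

end Dfs.Closing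

end block

end Net

namespace Net

variable {g : Net} {H : ℕ → Prop} {d : Dfs} {r : ℕ}

/-! ### Depth-first search: the steps -/

/-- The vertex `v` is the one that is being explored at the moment. -/
structure Dfs.Cur (d : Dfs) (v : ℕ) : Prop where
  mem : v ∈ d.path
  max : ∀ p ∈ d.path, d.idx p ≤ d.idx v

/-- The vertex `w` is discovered, with parent `v`. For the root of a search, `v = w`. -/
def Dfs.push (d : Dfs) (g : Net) (v w : ℕ) : Dfs :=
  { d with
    tree := Function.update d.tree w v
    idx := Function.update d.idx w (d.cnt + 1)
    low := Function.update d.low w (d.cnt + 1)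
    ptr := Function.update (Function.update d.ptr v (d.ptr v + 1)) w (g.off w)
    stk := Function.update d.stk d.top w
    cnt := d.cnt + 1
    top := d.top + 1
    path := insert w d.path }

/-- The next edge at `v` leads to the vertex `w`, which has been discovered before. -/
def Dfs.look (d : Dfs) (v w : ℕ) : Dfs :=
  { d with
    low := Function.update d.low v (min (d.low v) (d.idx w))
    ptr := Function.update d.ptr v (d.ptr v + 1) }

/-- The exploration of `v` ends, and the block that contains the edge to its parent is not yet
complete. -/
def Dfs.leave (d : Dfs) (v : ℕ) : Dfs :=
  { d with
    low := Function.update d.low (d.tree v) (min (d.low (d.tree v)) (d.low v))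
    path := d.path \ {v} }

/-- The exploration of `v` ends, and the vertices on the stack from place `t` on, which form a block
together with the parent of `v`, go to the list. -/
def Dfs.pop (d : Dfs) (v t : ℕ) (ord beg : ℕ → ℕ) : Dfs :=
  { d with ord := ord, beg := beg, m := d.m + 1, top := t, path := d.path \ {v} }

theorem IsPart.congr {tree idx low ord tree' idx' low' ord' : ℕ → ℕ} {i j : ℕ}
    (h : g.IsPart H tree idx low ord i j) (hord : ∀ l < j, ord' l = ord l)
    (htree : ∀ l < j, tree' (ord l) = tree (ord l) ∧ idx' (ord l) = idx (ord l) ∧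
      tree' (tree (ord l)) = tree (tree (ord l)) ∧ idx' (tree (ord l)) = idx (tree (ord l)))
    (hlow : low' (ord i) = low (ord i)) : g.IsPart H tree' idx' low' ord' i j := by
  have hlt := h.lt
  have hlast : tree' (ord' (j - 1)) = tree (ord (j - 1)) := by
    rw [hord _ (by omega), (htree _ (by omega)).1]
  have hset : ∀ x, blockSet ord' i j x = blockSet ord i j x := fun x => by
    ext u
    refine or_congr_right (exists_congr fun l => ?_)
    constructor
    · rintro ⟨h1, h2, h3⟩
      exact ⟨h1, h2, by rw [← hord l h2, h3]⟩
    · rintro ⟨h1, h2, h3⟩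
      exact ⟨h1, h2, by rw [hord l h2, h3]⟩
  refine ⟨hlt, ?_, ?_⟩
  · rw [hlast, hord _ (by omega), hord i hlt]
    intro e
    refine ⟨(h.root e).1, fun w hw hHw => ?_⟩
    obtain ⟨l, hl, e⟩ := (h.root e).2 w hw hHw
    exact ⟨l, hl, by rw [hord l (by omega), e]⟩
  · rw [hlast, hord _ (by omega)]
    intro e
    obtain ⟨h1, h2⟩ := h.block e
    have hon : ∀ u ∈ blockSet ord i j (tree (ord (j - 1))), tree' u = tree u ∧ idx' u = idx u := by
      rintro u (rfl | ⟨l, h3, h4, rfl⟩)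
      · exact (htree _ (by omega)).2.2
      · exact ⟨(htree l h4).1, (htree l h4).2.1⟩
    refine ⟨⟨h1.lt, fun l l' h3 h4 h5 h6 => ?_, fun l h3 h4 => ?_, hlast, fun l h3 h4 => ?_,
      fun l h3 h4 => ?_, by rw [hset]; exact h1.conn, by rw [hset]; exact h1.conn_diff, ?_⟩,
      fun l h3 h4 w hw hHw => ?_⟩
    · rw [hord l h4, hord l' h6]; exact h1.inj l l' h3 h4 h5 h6
    · rw [hord l h4]; exact h1.ne l h3 h4
    · obtain ⟨l', h5, h6, h7⟩ := h1.up l h3 h4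
      exact ⟨l', h5, h6, by rw [hord l (by omega), hord l' h6, (htree l (by omega)).1, h7]⟩
    · rw [hord l h4, (htree l h4).1]; exact h1.adj l h3 h4
    · obtain ⟨a, ha1, ha⟩ := h1.chain
      have hit : ∀ t ≤ a, tree'^[t] (ord i) = tree^[t] (ord i) := by
        intro t ht
        induction t with
        | zero => rfl
        | succ t ih =>
          rw [Function.iterate_succ_apply', Function.iterate_succ_apply', ih (by omega)]
          exact (hon _ (ha1 t (by omega))).1
      obtain ⟨ha2, ha3, ha4, ha5, ha6, ha7⟩ := ha
      rw [hset, hord i hlt, hlow]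
      refine ⟨a, fun t ht => by rw [hit t ht]; exact ha1 t ht, fun t ht => ?_, ?_, fun t ht => ?_, ?_,
        fun w hw hwB => ?_, fun t ht t' ht' => ?_⟩
      · rw [hit t ht.le, (hon _ (ha1 t ht.le)).2]; exact ha2 t ht
      · rw [hit a le_rfl, (hon _ (ha1 a le_rfl)).2]; exact ha3
      · rw [hit t ht.le, hit (t + 1) ht]; exact ha4 t ht
      · rw [hit a le_rfl]; exact ha5
      · obtain ⟨t, ht, e⟩ := ha6 w hw hwB
        exact ⟨t, ht, by rw [hit t ht, e]⟩
      · rw [hit t ht, hit t' ht']; exact ha7 t ht t' ht'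
    · rw [hord l h4] at hw
      rw [hset]
      refine (h2 l h3 h4 w hw hHw).imp_right ?_
      rintro ⟨l', h5, e⟩
      exact ⟨l', h5, by rw [hord l' (by omega), e]⟩

namespace Dfs.Ok

theorem cnt_le (h : d.Ok g H r) (hH : ∀ v, H v → v < g.n) : d.cnt ≤ g.n := by
  rw [← h.cnt_eq]
  calc _ ≤ (Finset.range g.n : Set ℕ).ncard :=
        Set.ncard_le_ncard (fun v hv => by simpa using hH v hv.1) (Finset.finite_toSet _)
    _ = g.n := by simp

theorem idx_le_n (h : d.Ok g H r) (hH : ∀ v, H v → v < g.n) (v : ℕ) : d.idx v ≤ g.n + 1 := by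
  by_cases hv : H v
  · have := h.idx_le v hv
    have := h.cnt_le hH
    omega
  · rcases lt_or_ge v g.n with h' | h'
    · rw [h.big v h' hv]
    · rw [h.idx_out v h']; omega

theorem part_congr (h : d.Ok g H r) {tree' idx' low' ord' : ℕ → ℕ}
    (hord : ∀ l < d.beg d.m, ord' l = d.ord l)
    (hvis : ∀ v, H v → d.idx v ≠ 0 → tree' v = d.tree v ∧ idx' v = d.idx v)
    (hlow : ∀ v, d.Out v → low' v = d.low v) {b : ℕ} (hb : b < d.m) :
    g.IsPart H tree' idx' low' ord' (d.beg b) (d.beg (b + 1)) := by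
  have hp := h.part b hb
  have hle := h.beg_le b hb
  refine hp.congr (fun l hl => hord l (by omega)) (fun l hl => ?_)
    (hlow _ ⟨_, by have := hp.lt; omega, rfl⟩)
  have h1 := h.out_vis _ ⟨l, by omega, rfl⟩
  have h2 := h.tree_vis _ h1.1 h1.2
  exact ⟨(hvis _ h1.1 h1.2).1, (hvis _ h1.1 h1.2).2, hvis _ h2.1 h2.2.1⟩

theorem init {r : ℕ} (hbig : ∀ v < g.n, ¬ H v → d.idx v = g.n + 1) (hH : ∀ v, H v → d.idx v = 0)
    (hout : ∀ v, g.n ≤ v → d.idx v = 0) (hc : d.cnt = 0) (ht : d.top = 0) (hm : d.m = 0)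
    (hb : d.beg 0 = 0) (hp : d.path = ∅) : d.Ok g H r := by
  have on : ∀ v, ¬ d.On v := fun v ⟨i, hi, _⟩ => by omega
  have out : ∀ v, ¬ d.Out v := fun v ⟨i, hi, _⟩ => by rw [hm, hb] at hi; omega
  refine ⟨hbig, hout, fun v hv => by simp [hH v hv], fun u v hu _ h => absurd (hH u hu) h, ?_,
    fun v h => absurd h (on v), fun i j _ h => by omega, fun v h => absurd h (out v),
    fun v hv h => absurd (hH v hv) h, fun v h => absurd h (on v), fun v hv h => absurd (hH v hv) h,
    fun v h => absurd h (on v), fun h => absurd h (on r), fun v h => absurd h (on v), by simp [hp],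
    by simp [hp], by simp [hp], by simp [hp], by simp [hp], fun v hv h => absurd (hH v hv) h,
    by simp [hp], fun v h => absurd h (on v), fun v h => absurd h (on v), fun v h => absurd h (on v),
    fun v h => absurd h (on v), fun v h => absurd h (on v), hb, fun l h => ?_, fun l h => ?_,
    fun b h => by omega, fun b h => by omega⟩
  · rw [hc, show {v | H v ∧ d.idx v ≠ 0} = ∅ from Set.eq_empty_of_forall_notMem fun v hv =>
      hv.2 (hH v hv.1), Set.ncard_empty]
  · rw [hm, hb] at h; omega
  · rw [hm, hb] at h; omega

/-- Between two searches there is no root. -/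
theorem reroot (h : d.Ok g H r) (ht : d.top = 0) (hp : d.path = ∅) (w : ℕ) : d.Ok g H w := by
  have on : ∀ v, ¬ d.On v := fun v ⟨i, hi, _⟩ => by omega
  exact { h with
    tree_on := fun v hv => absurd hv (on v)
    tree_root := fun hw => absurd hw (on w)
    root_path := fun v hv => absurd hv (on v)
    path_tree := by simp [hp]
    low_le := fun v hv => absurd hv (on v) }

theorem push (h : d.Ok g H r) (hH : ∀ v, H v → v < g.n) {v w : ℕ} (hHw : H w) (hw0 : d.idx w = 0)
    (hc : d.Cur v ∧ d.ptr v < g.off (v + 1) ∧ g.nb (d.ptr v) = w ∨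
      v = w ∧ w = r ∧ d.top = 0) :
    (d.push g v w).Ok g H r ∧ (d.push g v w).Cur w := by
  have hvis : ∀ u, d.idx u ≠ 0 → u ≠ w := by rintro u hu rfl; exact hu hw0
  have hmono := g.mono w (hH w hHw)
  have hD : (∃ u, d.On u) → d.Cur v ∧ g.nb (d.ptr v) = w ∧ v ≠ w ∧ d.On v ∧ w ∈ g.N v ∧
      d.ptr v < g.off (v + 1) := by
    rintro ⟨u, i, hi, -⟩
    obtain ⟨hv, h1, h2⟩ := hc.resolve_right (by rintro ⟨-, -, h0⟩; omega)
    have hvon := h.path_on v hv.mem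
    exact ⟨hv, h2, hvis v (h.on_vis v hvon).2, hvon, mem_N.2 ⟨_, (h.ptr_le v hv.mem).1, h1, h2⟩, h1⟩
  have hP : (∃ p, p ∈ d.path) → ∃ u, d.On u := fun ⟨p, hp⟩ => ⟨p, h.path_on p hp⟩
  have hS : v = w ∧ w = r ∨ ∃ u, d.On u := hc.symm.imp (fun h => ⟨h.1, h.2.1⟩)
    fun h => hP ⟨v, h.1.mem⟩
  have honw : ∀ u, d.On u → u ≠ w := fun u hu => hvis u (h.on_vis u hu).2
  have hpw : ∀ p ∈ d.path, p ≠ w := fun p hp => honw p (h.path_on p hp)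
  have htw : ∀ u, H u → d.idx u ≠ 0 → d.tree u ≠ w := fun u hu hu0 =>
    hvis _ (h.tree_vis u hu hu0).2.1
  have hout : ∀ u, d.Out u → u ≠ w := fun u hu => hvis u (h.out_vis u hu).2
  have hcnt : ∀ u, H u → d.idx u ≤ d.cnt := h.idx_le
  obtain ⟨d', hd'⟩ : ∃ d', d' = d.push g v w := ⟨_, rfl⟩
  have e2 : d'.idx = Function.update d.idx w (d.cnt + 1) := by rw [hd']; rfl
  have e4 : d'.ptr = Function.update (Function.update d.ptr v (d.ptr v + 1)) w (g.off w) := by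
    rw [hd']; rfl
  have e5 : d'.stk = Function.update d.stk d.top w := by rw [hd']; rfl
  have e6 : d'.cnt = d.cnt + 1 := by rw [hd']; rfl
  have e7 : d'.top = d.top + 1 := by rw [hd']; rfl
  have e8 : d'.path = insert w d.path := by rw [hd']; rfl
  have e9 : d'.ord = d.ord ∧ d'.beg = d.beg ∧ d'.m = d.m := by rw [hd']; exact ⟨rfl, rfl, rfl⟩
  have scan' : ∀ z u, z ≠ w → d'.Scan g z u → d.Scan g z u ∨ z = v ∧ u = w := by
    rintro z u hzw ⟨h1, h2⟩
    by_cases hzp : z ∈ d.path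
    swap; · exact .inl ⟨h1, fun h' => absurd h' hzp⟩
    obtain ⟨j, h3, h4, h5⟩ := h2 (e8 ▸ .inr hzp)
    rw [e4, Function.update_of_ne hzw] at h4
    by_cases hzv : z = v
    · subst hzv
      rw [Function.update_self] at h4
      rcases Nat.lt_succ_iff_lt_or_eq.1 h4 with h' | rfl
      · exact .inl ⟨h1, fun _ => ⟨j, h3, h', h5⟩⟩
      · exact .inr ⟨rfl, h5.symm.trans (hD (hP ⟨z, hzp⟩)).2.1⟩
    · rw [Function.update_of_ne hzv] at h4
      exact .inl ⟨h1, fun _ => ⟨j, h3, h4, h5⟩⟩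
  have scanw : ∀ u, ¬ d'.Scan g w u := by
    rintro u ⟨-, h1⟩
    obtain ⟨j, h3, h4, -⟩ := h1 (e8 ▸ .inl rfl)
    simp [e4] at h4; omega
  have hOn : ∀ {u}, d'.On u ↔ u = w ∨ d.On u := by
    intro u
    unfold Dfs.On
    rw [e7, e5]
    constructor
    · rintro ⟨i, hi, rfl⟩
      rcases Nat.lt_succ_iff_lt_or_eq.1 hi with h' | rfl
      · rw [Function.update_of_ne (by omega)]; exact .inr ⟨i, h', rfl⟩
      · simp
    · rintro (rfl | ⟨i, hi, rfl⟩)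
      · exact ⟨d.top, by omega, by simp⟩
      · exact ⟨i, by omega, Function.update_of_ne (by omega) _ _⟩
  have hOut : ∀ {u}, d'.Out u ↔ d.Out u := by
    intro u; unfold Dfs.Out; rw [e9.1, e9.2.1, e9.2.2]
  have iw : d'.idx w = d.cnt + 1 := by rw [e2, Function.update_self]
  have ine : ∀ u, u ≠ w → d'.idx u = d.idx u := fun u hu => by rw [e2, Function.update_of_ne hu]
  have tw : d'.tree w = v := by rw [hd']; exact Function.update_self ..
  have tne : ∀ u, u ≠ w → d'.tree u = d.tree u := fun u hu => by
    rw [hd']; exact Function.update_of_ne hu ..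
  have lw : d'.low w = d.cnt + 1 := by rw [hd']; exact Function.update_self ..
  have lne : ∀ u, u ≠ w → d'.low u = d.low u := fun u hu => by
    rw [hd']; exact Function.update_of_ne hu ..
  have tidx : ∀ u, H u → d.idx u ≠ 0 → d'.idx (d'.tree u) = d.idx (d.tree u) := fun u hu hu0 => by
    rw [tne u (hvis u hu0), ine _ (htw u hu hu0)]
  have split : ∀ {u}, u ∉ d'.path → u ≠ w ∧ u ∉ d.path := fun hu =>
    ⟨fun e => hu (e8 ▸ .inl e), fun e => hu (e8 ▸ .inr e)⟩
  rw [← hd']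
  refine ⟨⟨fun u hu hn => ?_, fun u hu => ?_, fun u hu => ?_, fun u u' hu hu' hu0 e => ?_, ?_,
    fun u hu => ?_, fun i j hij hj => ?_, fun u hu => ?_, fun u hu hu0 => ?_, fun u hu hu' => ?_,
    fun u hu hu0 => ?_, fun u hu hur => ?_, fun hr => ?_, fun u hu => ?_, fun p hp => ?_,
    fun p hp hpr => ?_, fun p hp p' hp' hlt => ?_, fun p hp u hu hlt => ?_,
    fun p hp z hz hz0 hzp hlt u hu hHu => ?_, fun z hz hz0 hzp u hu hHu => ?_, fun p hp => ?_,
    fun u hu => ?_, fun z hz u hu hHu => ?_, fun u hu hup => ?_, fun u hu => ?_,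
    fun z hz u hu hHu hlt y hy h1 h2 => ?_, ?_, ?_, ?_, ?_, fun b hb => ?_⟩,
    e8 ▸ .inl rfl, fun p hp => ?_⟩
  · rw [ine u (fun e => hn (e ▸ hHw))]; exact h.big u hu hn
  · rw [ine u (by have := hH w hHw; omega)]; exact h.idx_out u hu
  · have := hcnt u hu
    rw [e2, Function.update_apply, e6]
    split_ifs <;> omega
  · have h1 := hcnt u hu
    have h2 := hcnt u' hu'
    rw [e2] at hu0
    simp only [e2, Function.update_apply] at e hu0
    split_ifs at e hu0 with h3 h4 h4
    · rw [h3, h4]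
    · omega
    · omega
    · exact h.idx_inj u u' hu hu' hu0 e
  · rw [e6, ← h.cnt_eq]
    have hfin : {v | H v ∧ d.idx v ≠ 0}.Finite :=
      (Finset.finite_toSet (Finset.range g.n)).subset fun v hv => by simpa using hH v hv.1
    rw [← Set.ncard_insert_of_notMem (a := w) (by simp [hw0]) hfin]
    congr 1
    ext u
    by_cases huw : u = w
    · subst huw; simp [hHw, iw]
    · simp [huw, ine]
  · rcases hOn.1 hu with rfl | hu
    · exact ⟨hHw, by omega⟩
    · rw [ine u (honw u hu)]; exact h.on_vis u hu
  · rw [e7] at hj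
    have h1 : i < d.top := by omega
    rw [e5, Function.update_of_ne (show i ≠ d.top by omega)]
    have h2 : d.On (d.stk i) := ⟨i, h1, rfl⟩
    rw [ine _ (honw _ h2)]
    rcases Nat.lt_succ_iff_lt_or_eq.1 hj with h' | rfl
    · rw [Function.update_of_ne (by omega), ine _ (honw _ ⟨j, h', rfl⟩)]
      exact h.sorted i j hij h'
    · rw [Function.update_self, iw]
      have := hcnt _ (h.on_vis _ h2).1
      omega
  · have h1 := h.out_vis u (hOut.1 hu)
    exact ⟨h1.1, by rw [ine u (hvis u h1.2)]; exact h1.2⟩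
  · by_cases huw : u = w
    · exact .inl (hOn.2 (.inl huw))
    · rw [ine u huw] at hu0
      exact (h.on_or_out u hu hu0).imp (fun h' => hOn.2 (.inr h')) hOut.2
  · rcases hOn.1 hu with rfl | hu
    · exact hout u (hOut.1 hu') rfl
    · exact h.not_out u hu (hOut.1 hu')
  · by_cases huw : u = w
    · subst huw
      rw [tw]
      rcases hS with ⟨rfl, -⟩ | hS
      · exact ⟨hHw, by omega, .inl rfl⟩
      · obtain ⟨hv, -, hvw, hvon, hwN, -⟩ := hD hS
        rw [ine v hvw]
        exact ⟨(h.on_vis v hvon).1, (h.on_vis v hvon).2, .inr (N_symm hwN)⟩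
    · rw [ine u huw] at hu0
      rw [tidx u hu hu0, tne u huw]
      exact h.tree_vis u hu hu0
  · rcases hOn.1 hu with rfl | hu
    · obtain ⟨hv, -, hvw, hvon, -⟩ := hD (hS.resolve_left fun e => hur e.2)
      have := hcnt v (h.on_vis v hvon).1
      rw [tw, iw, ine v hvw]
      exact ⟨hOn.2 (.inr hvon), by omega⟩
    · have h1 := h.on_vis u hu
      have h2 := h.tree_on u hu hur
      rw [tidx u h1.1 h1.2, tne u (honw u hu), ine u (honw u hu)]
      exact ⟨hOn.2 (.inr h2.1), h2.2⟩
  · rcases hS with ⟨rfl, rfl⟩ | hS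
    · exact tw
    · have hr' := (h.root_path v (hD hS).2.2.2.1).1
      rw [tne r (honw r hr')]
      exact h.tree_root hr'
  · rcases hS with ⟨rfl, rfl⟩ | hS
    · rw [e8]
      refine ⟨hOn.2 (.inl rfl), .inl rfl, ?_⟩
      rcases hOn.1 hu with rfl | hu
      · exact le_rfl
      · exact absurd rfl (hD ⟨u, hu⟩).2.2.1
    · have hr' := h.root_path v (hD hS).2.2.2.1
      rw [ine r (honw r hr'.1), e8]
      refine ⟨hOn.2 (.inr hr'.1), .inr hr'.2.1, ?_⟩
      rcases hOn.1 hu with rfl | hu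
      · have := hcnt r (h.on_vis r hr'.1).1; omega
      · rw [ine u (honw u hu)]; exact (h.root_path u hu).2.2
  · rw [e8] at hp
    exact hOn.2 (hp.imp_right (h.path_on p))
  · rw [e8] at hp ⊢
    rcases hp with rfl | hp
    · rw [tw]; exact .inr (hD (hS.resolve_left fun e => hpr e.2)).1.mem
    · rw [tne p (hpw p hp)]; exact .inr (h.path_tree p hp hpr)
  · rw [e8] at hp hp'
    rcases hp with rfl | hp
    · rcases hp' with rfl | hp'
      · omega
      · obtain ⟨hv, -, hvw, -⟩ := hD (hP ⟨p', hp'⟩)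
        rw [tw, ine v hvw, ine p' (hpw p' hp')]
        exact hv.max p' hp'
    · have h1 := h.on_vis p (h.path_on p hp)
      rw [tidx p h1.1 h1.2]
      rcases hp' with rfl | hp'
      · have := hcnt p h1.1
        rw [iw, ine p (hpw p hp)] at hlt
        omega
      · rw [ine p (hpw p hp), ine p' (hpw p' hp')] at hlt
        rw [ine p' (hpw p' hp')]
        exact h.path_gap p hp p' hp' hlt
  · rw [e8] at hp
    rcases hp with rfl | hp
    · rw [iw] at hlt
      rcases hOn.1 hu with rfl | hu
      · omega
      · rw [ine u (honw u hu)] at hlt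
        have := hcnt u (h.on_vis u hu).1
        omega
    · rw [ine p (hpw p hp)] at hlt ⊢
      rcases hOn.1 hu with rfl | hu
      · obtain ⟨hv, -, hvw, -⟩ := hD (hP ⟨p, hp⟩)
        rw [tw, ine v hvw]; exact hv.max p hp
      · have h1 := h.on_vis u hu
        rw [ine u (honw u hu)] at hlt
        rw [tidx u h1.1 h1.2]
        exact h.descend p hp u hu hlt
  · obtain ⟨hzw, hzp'⟩ := split hzp
    rw [e8] at hp
    rw [ine z hzw] at hz0 hlt
    have h1 := h.finished z hz hz0 hzp' u hu hHu
    rw [ine u (hvis u h1)]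
    refine ⟨h1, ?_⟩
    rcases hp with rfl | hp
    · have := hcnt u hHu; omega
    · rw [ine p (hpw p hp)] at hlt ⊢
      exact (h.left p hp z hz hz0 hzp' hlt u hu hHu).2
  · obtain ⟨hzw, hzp'⟩ := split hzp
    rw [ine z hzw] at hz0
    have h1 := h.finished z hz hz0 hzp' u hu hHu
    rwa [ine u (hvis u h1)]
  · rw [e8] at hp
    rw [e4]
    rcases hp with rfl | hp
    · simp [hmono]
    · rw [Function.update_of_ne (hpw p hp)]
      have := h.ptr_le p hp
      by_cases hpv : p = v
      · have := hD (hP ⟨p, hp⟩)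
        subst hpv; simp; omega
      · rwa [Function.update_of_ne hpv]
  · rcases hOn.1 hu with rfl | hu
    · rw [lw, iw]
      rcases hS with ⟨rfl, rfl⟩ | hS
      · omega
      · have hr' := (h.root_path v (hD hS).2.2.2.1).1
        have := hcnt r (h.on_vis r hr').1
        rw [ine r (honw r hr')]; omega
    · rw [ine r (honw r (h.root_path u hu).1), lne u (honw u hu), ine u (honw u hu)]
      exact h.low_le u hu
  · rcases hOn.1 hz with rfl | hz
    · exact absurd hu (scanw u)
    rw [lne z (honw z hz)]
    rcases scan' z u (honw z hz) hu with h' | ⟨rfl, rfl⟩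
    · have h1 := h.low_scan z hz u h' hHu
      rwa [ine u (hvis u h1.1)]
    · rw [iw]
      have := h.low_le z hz
      have := hcnt z (h.on_vis z hz).1
      omega
  · obtain ⟨huw, hup'⟩ := split hup
    have hu' := (hOn.1 hu).resolve_left huw
    have h1 := h.on_vis u hu'
    rw [tidx u h1.1 h1.2, lne u huw, tne u huw, lne _ (htw u h1.1 h1.2)]
    exact h.low_tree u hu' hup'
  · rcases hOn.1 hu with rfl | hu
    · exact .inl (by rw [lw, iw])
    have huw := honw u hu
    rw [lne u huw, ine u huw]
    refine (h.low_reach u hu).imp_right (Or.imp ?_ ?_)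
    · rintro ⟨y, h1, h2, h3⟩
      exact ⟨y, h1, hOn.2 (.inr h2), by rw [ine y (honw y h2), h3]⟩
    · rintro ⟨y, h1, h2, h3, h4⟩
      have hyw := honw y h1
      exact ⟨y, hOn.2 (.inr h1), by rw [e8]; exact fun h' => h'.elim hyw h2,
        by rw [tne y hyw, h3], by rw [lne y hyw, h4]⟩
  · rcases hOn.1 hz with rfl | hz
    · exact absurd hu (scanw u)
    have hzw := honw z hz
    have hzc := hcnt z (h.on_vis z hz).1
    rw [ine z hzw] at hlt h2
    have hyw : y ≠ w := by rintro rfl; omega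
    have huw : u ≠ w := by rintro rfl; omega
    have hy' := (hOn.1 hy).resolve_left hyw
    have h3 := h.on_vis y hy'
    rw [ine u huw] at hlt h1 ⊢
    rw [ine y hyw] at h1 h2
    rw [tidx y h3.1 h3.2]
    exact h.ancestor z hz u ((scan' z u hzw hu).resolve_right fun e => huw e.2) hHu hlt y hy' h1 h2
  · rw [e9.2.1]; exact h.beg_zero
  · rw [e9.1, e9.2.1, e9.2.2]; exact h.ord_inj
  · rw [e9.1, e9.2.1, e9.2.2]
    intro l hl l' hl'
    rw [tne _ (hout _ ⟨l, hl, rfl⟩)]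
    exact h.tree_later l hl l' hl'
  · rw [e9.2.1, e9.2.2]; exact h.beg_le
  · rw [e9.2.2] at hb
    rw [e9.1, e9.2.1]
    exact h.part_congr (fun _ _ => rfl) (fun u hu hu0 => ⟨tne u (hvis u hu0), ine u (hvis u hu0)⟩)
      (fun u hu => lne u (hout u hu)) hb
  · rw [e8] at hp
    rcases hp with rfl | hp
    · exact le_rfl
    · have := hcnt p (h.on_vis p (h.path_on p hp)).1
      rw [iw, ine p (hpw p hp)]; omega

/-- The scanned neighbours which were discovered before the current vertex are on the path. -/
theorem mem_path (h : d.Ok g H r) {v w : ℕ} (hv : d.Cur v) (hw : w ∈ g.N v) (hHw : H w)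
    (hw0 : d.idx w ≠ 0) (hlt : d.idx w < d.idx v) : w ∈ d.path := by
  by_contra hcon
  have := (h.left v hv.mem w hHw hw0 hcon hlt v (N_symm hw) (h.on_vis v (h.path_on v hv.mem)).1).2
  omega

theorem look (h : d.Ok g H r) (hH : ∀ v, H v → v < g.n) {v w : ℕ} (hv : d.Cur v)
    (hptr : d.ptr v < g.off (v + 1)) (hw : g.nb (d.ptr v) = w) (hw0 : d.idx w ≠ 0) :
    (d.look v w).Ok g H r := by
  have hvon := h.path_on v hv.mem
  have hvvis := h.on_vis v hvon
  have hvp := h.ptr_le v hv.mem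
  have hwN : w ∈ g.N v := mem_N.2 ⟨_, hvp.1, hptr, hw⟩
  have hwn := N_lt hwN
  have hlow := h.low_le v hvon
  have hcnt := h.cnt_le hH
  have hvc := h.idx_le v hvvis.1
  have hHw : d.idx w < d.idx v → H w := fun hlt => by
    by_contra hcon
    have := h.big w hwn hcon
    omega
  have hwp : d.idx w < d.idx v → w ∈ d.path := fun hlt => h.mem_path hv hwN (hHw hlt) hw0 hlt
  have hle : ∀ u, (d.look v w).low u ≤ d.low u :=
    update_le_self_iff.2 (min_le_left _ _)
  have hne : ∀ u, u ≠ v → (d.look v w).low u = d.low u := fun u hu => Function.update_of_ne hu _ _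
  have hself : (d.look v w).low v = min (d.low v) (d.idx w) := Function.update_self ..
  have hptr' : (d.look v w).ptr v = d.ptr v + 1 := Function.update_self ..
  have hptrne : ∀ u, u ≠ v → (d.look v w).ptr u = d.ptr u := fun u hu => Function.update_of_ne hu _ _
  have scan' : ∀ z u, (d.look v w).Scan g z u → d.Scan g z u ∨ z = v ∧ u = w := by
    rintro z u ⟨h1, h2⟩
    by_cases hzp : z ∈ d.path
    swap; · exact .inl ⟨h1, fun h' => absurd h' hzp⟩
    obtain ⟨j, h3, h4, h5⟩ := h2 hzp
    by_cases hzv : z = v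
    · subst hzv
      rw [hptr'] at h4
      rcases Nat.lt_succ_iff_lt_or_eq.1 h4 with h' | rfl
      · exact .inl ⟨h1, fun _ => ⟨j, h3, h', h5⟩⟩
      · exact .inr ⟨rfl, h5.symm.trans hw⟩
    · rw [hptrne z hzv] at h4
      exact .inl ⟨h1, fun _ => ⟨j, h3, h4, h5⟩⟩
  refine { h with
    ptr_le := fun p hp => ?_
    low_le := fun u hu => ?_
    low_scan := fun z hz u hu hHu => ?_
    low_tree := fun u hu hup => ?_
    low_reach := fun u hu => ?_
    ancestor := fun z hz u hu hHu hlt y hy h1 h2 => ?_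
    part := fun b hb => ?_ }
  · by_cases hpv : p = v
    · subst hpv; rw [hptr']; omega
    · rw [hptrne p hpv]; exact h.ptr_le p hp
  · refine ⟨(hle u).trans (h.low_le u hu).1, ?_⟩
    by_cases huv : u = v
    · subst huv
      rw [hself]
      refine le_min hlow.2 ?_
      rcases lt_or_ge (d.idx w) (d.idx u) with h' | h'
      · exact (h.root_path w (h.path_on w (hwp h'))).2.2
      · exact (h.root_path u hvon).2.2.trans h'
    · rw [hne u huv]; exact (h.low_le u hu).2
  · rcases scan' z u hu with h' | ⟨rfl, rfl⟩
    · have := h.low_scan z hz u h' hHu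
      exact ⟨this.1, (hle z).trans this.2⟩
    · exact ⟨hw0, hself ▸ min_le_right _ _⟩
  · have huv : u ≠ v := fun e => hup (e ▸ hv.mem)
    have := h.low_tree u hu hup
    rw [hne u huv]
    exact ⟨(hle _).trans this.1, this.2⟩
  · have key : ∀ x, (∃ y, d.On y ∧ y ∉ d.path ∧ d.tree y = u ∧ d.low y = x) →
        ∃ y, d.On y ∧ y ∉ d.path ∧ d.tree y = u ∧ (d.look v w).low y = x := by
      rintro x ⟨y, h1, h2, h3, h4⟩
      exact ⟨y, h1, h2, h3, by rw [hne y (fun e => h2 (e ▸ hv.mem)), h4]⟩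
    by_cases huv : u = v
    · subst huv
      rw [hself]
      rcases le_total (d.low u) (d.idx w) with h' | h'
      · rw [min_eq_left h']
        exact (h.low_reach u hu).imp_right (Or.imp_right (key _))
      · rw [min_eq_right h']
        rcases (show d.idx w ≤ d.idx u by omega).lt_or_eq with h1 | h1
        · exact .inr (.inl ⟨w, hwN, h.path_on w (hwp h1), rfl⟩)
        · exact .inl h1
    · rw [hne u huv]
      exact (h.low_reach u hu).imp_right (Or.imp_right (key _))
  · rcases scan' z u hu with h' | ⟨rfl, rfl⟩
    · exact h.ancestor z hz u h' hHu hlt y hy h1 h2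
    · exact h.descend _ (hwp hlt) y hy h1
  · refine h.part_congr (fun _ _ => rfl) (fun _ _ _ => ⟨rfl, rfl⟩) (fun u hu => hne u ?_) hb
    rintro rfl
    exact h.not_out u hvon hu

section finish

variable {v : ℕ}

/-- All edges at the current vertex have been scanned. -/
theorem _root_.Net.Dfs.scan_end (hend : d.ptr v = g.off (v + 1)) {u : ℕ} (hu : u ∈ g.N v) :
    d.Scan g v u :=
  ⟨hu, fun _ => by rw [hend]; exact mem_N.1 hu⟩

theorem lt_cur (h : d.Ok g H r) (hv : d.Cur v) : ∀ p ∈ d.path \ {v}, d.idx p < d.idx v :=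
  fun p hp => (hv.max p hp.1).lt_of_ne fun e =>
    hp.2 (h.eq_of_idx (h.path_on p hp.1) (h.path_on v hv.mem) e)

theorem cur_tree (h : d.Ok g H r) (hv : d.Cur v) (hvr : v ≠ r) {d' : Dfs} (hi : d'.idx = d.idx)
    (hp : d'.path = d.path \ {v}) : d'.Cur (d.tree v) ∧ d.idx (d.tree v) < d.idx v := by
  have h1 := (h.tree_on v (h.path_on v hv.mem) hvr).2
  refine ⟨⟨hp ▸ ⟨h.path_tree v hv.mem hvr, fun e => ?_⟩, fun p hp' => ?_⟩, h1⟩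
  · rw [show d.tree v = v from e] at h1; omega
  · rw [hi]
    rw [hp] at hp'
    exact h.path_gap v hv.mem p hp'.1 (h.lt_cur hv p hp')

theorem path_tree_cur (h : d.Ok g H r) (hv : d.Cur v) :
    ∀ p ∈ d.path \ {v}, p ≠ r → d.tree p ∈ d.path \ {v} := by
  refine fun q hq hqr => ⟨h.path_tree q hq.1 hqr, fun e => ?_⟩
  have h1 := (h.tree_on q (h.path_on q hq.1) hqr).2
  have h2 := h.lt_cur hv q hq
  rw [show d.tree q = v from e] at h1
  omega

theorem left_cur (h : d.Ok g H r) (hv : d.Cur v) :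
    ∀ p ∈ d.path \ {v}, ∀ w, H w → d.idx w ≠ 0 → w ∉ d.path \ {v} → d.idx w < d.idx p →
      ∀ u ∈ g.N w, H u → d.idx u ≠ 0 ∧ d.idx u < d.idx p := by
  intro p hp w hw hw0 hwp hlt
  refine h.left p hp.1 w hw hw0 (fun hwp' => ?_) hlt
  obtain rfl : w = v := by
    by_contra hne
    exact hwp ⟨hwp', hne⟩
  have := hv.max p hp.1
  omega

theorem finished_cur (h : d.Ok g H r) (hv : d.Cur v) (hend : d.ptr v = g.off (v + 1)) :
    ∀ w, H w → d.idx w ≠ 0 → w ∉ d.path \ {v} → ∀ u ∈ g.N w, H u → d.idx u ≠ 0 := by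
  intro w hw hw0 hwp u hu hHu
  by_cases hwp' : w ∈ d.path
  · obtain rfl : w = v := by
      by_contra hne
      exact hwp ⟨hwp', hne⟩
    exact (h.low_scan w (h.path_on w hv.mem) u (d.scan_end hend hu) hHu).1
  · exact h.finished w hw hw0 hwp' u hu hHu

theorem leave (h : d.Ok g H r) (hv : d.Cur v) (hend : d.ptr v = g.off (v + 1))
    (hlow : d.low v < d.idx (d.tree v)) :
    v ≠ r ∧ (d.leave v).Ok g H r ∧ (d.leave v).Cur (d.tree v) := by
  have hvon := h.path_on v hv.mem
  have hvr : v ≠ r := by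
    rintro rfl
    have := (h.low_le v hvon).2
    rw [h.tree_root hvon] at hlow
    omega
  obtain ⟨hcur, hpv⟩ := h.cur_tree hv hvr (d' := d.leave v) rfl rfl
  refine ⟨hvr, ?_, hcur⟩
  obtain ⟨p, hpe⟩ : ∃ p, d.tree v = p := ⟨_, rfl⟩
  have hp : p ∈ d.path := hpe ▸ hcur.mem.1
  rw [hpe] at hpv hlow
  have hpon := h.path_on p hp
  have hpnv : p ≠ v := by rintro rfl; omega
  have hle : ∀ u, (d.leave v).low u ≤ d.low u := update_le_self_iff.2 (min_le_left _ _)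
  have hne : ∀ u, u ≠ p → (d.leave v).low u = d.low u := fun u hu =>
    Function.update_of_ne (hpe ▸ hu) _ _
  have hself : (d.leave v).low p = min (d.low p) (d.low v) := hpe ▸ Function.update_self ..
  have scan' : ∀ z u, (d.leave v).Scan g z u → d.Scan g z u := by
    rintro z u ⟨h1, h2⟩
    by_cases hzv : z = v
    · rw [hzv] at h1 ⊢; exact d.scan_end hend h1
    · exact ⟨h1, fun hzp => h2 ⟨hzp, hzv⟩⟩
  refine { h with
    root_path := fun u hu => ?_
    path_on := fun q hq => h.path_on q hq.1
    path_tree := h.path_tree_cur hv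
    path_gap := fun q hq q' hq' => h.path_gap q hq.1 q' hq'.1
    descend := fun q hq => h.descend q hq.1
    left := h.left_cur hv
    finished := h.finished_cur hv hend
    ptr_le := fun q hq => h.ptr_le q hq.1
    low_le := fun u hu => ⟨(hle u).trans (h.low_le u hu).1, ?_⟩
    low_scan := fun z hz u hu hHu => ?_
    low_tree := fun u hu hup => ?_
    low_reach := fun u hu => ?_
    ancestor := fun z hz u hu => h.ancestor z hz u (scan' z u hu)
    part := fun b hb => ?_ }
  · have h1 := h.root_path u hu
    exact ⟨h1.1, ⟨h1.2.1, fun e => hvr (Eq.symm e)⟩, h1.2.2⟩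
  · by_cases hup : u = p
    · subst hup
      rw [hself]
      exact le_min (h.low_le u hu).2 (h.low_le v hvon).2
    · rw [hne u hup]; exact (h.low_le u hu).2
  · have := h.low_scan z hz u (scan' z u hu) hHu
    exact ⟨this.1, (hle z).trans this.2⟩
  · by_cases huv : u = v
    · subst huv
      rw [hne u hpnv.symm, show (d.leave u).tree u = p from hpe, hself]
      exact ⟨min_le_right _ _, hlow⟩
    · have hup' : u ∉ d.path := fun e => hup ⟨e, huv⟩
      have h1 := h.low_tree u hu hup'
      rw [hne u (fun e => hup' (e ▸ hp))]
      exact ⟨(hle _).trans h1.1, h1.2⟩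
  · have key : ∀ x, (∃ y, d.On y ∧ y ∉ d.path ∧ d.tree y = u ∧ d.low y = x) →
        ∃ y, d.On y ∧ y ∉ d.path \ {v} ∧ d.tree y = u ∧ (d.leave v).low y = x := by
      rintro x ⟨y, h1, h2, h3, h4⟩
      exact ⟨y, h1, fun e => h2 e.1, h3, by rw [hne y (fun e => h2 (e ▸ hp)), h4]⟩
    by_cases hup : u = p
    · subst hup
      rw [hself]
      rcases le_total (d.low u) (d.low v) with h' | h'
      · rw [min_eq_left h']
        exact (h.low_reach u hu).imp_right (Or.imp_right (key _))
      · have h1 := hne v hpnv.symm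
        rw [min_eq_right h']
        exact .inr (.inr ⟨v, hvon, fun e => e.2 rfl, hpe, h1⟩)
    · rw [hne u hup]
      exact (h.low_reach u hu).imp_right (Or.imp_right (key _))
  · refine h.part_congr (fun _ _ => rfl) (fun _ _ _ => ⟨rfl, rfl⟩) (fun u hu => hne u ?_) hb
    rintro rfl
    exact h.not_out u hpon hu

/-- When the search is about to end, only the root is left on the stack. -/
theorem top_eq (h : d.Ok g H r) (hr : d.Cur r) : d.top = 1 ∧ d.stk 0 = r := by
  have hron := h.path_on r hr.mem
  have key : ∀ u, d.On u → u = r := by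
    intro u hu
    obtain ⟨i, hi⟩ : ∃ i, i = d.idx u := ⟨_, rfl⟩
    induction i using Nat.strong_induction_on generalizing u with
    | _ i ih =>
      by_contra hur
      have h1 := h.tree_on u hu hur
      have h2 := ih _ (hi ▸ h1.2) _ h1.1 rfl
      rw [h2] at h1
      have hup : u ∉ d.path := fun e => by
        have := hr.max u e
        omega
      have h3 := h.low_tree u hu hup
      rw [h2] at h3
      have := (h.low_le u hu).2
      omega
  obtain ⟨i, hi, -⟩ := id hron
  have h0 := key _ ⟨0, by omega, rfl⟩
  refine ⟨?_, h0⟩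
  by_contra hcon
  have h1 := key _ ⟨1, by omega, rfl⟩
  have := h.sorted 0 1 (by omega) (by omega)
  rw [h0, h1] at this
  omega

theorem pop (h : d.Ok g H r) (hv : d.Cur v) (hend : d.ptr v = g.off (v + 1))
    (hlow : d.idx (d.tree v) ≤ d.low v) {t : ℕ} (ht : t < d.top) (htv : d.stk t = v)
    {ord' beg' : ℕ → ℕ} (hold : ∀ l < d.beg d.m, ord' l = d.ord l)
    (hord : ∀ i < d.top - t, ord' (d.beg d.m + i) = d.stk (d.top - 1 - i))
    (hbeg : ∀ b ≤ d.m, beg' b = d.beg b) (hbeg' : beg' (d.m + 1) = d.beg d.m + (d.top - t)) :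
    (d.pop v t ord' beg').Ok g H r ∧ (v ≠ r → (d.pop v t ord' beg').Cur (d.tree v)) ∧
      (v = r → t = 0 ∧ d.path \ {v} = ∅) := by
  have hc : v ≠ r → d.Closing g H r v := fun hvr => ⟨h, hv.mem, hv.max, hend, hvr, hlow⟩
  have hvon := h.path_on v hv.mem
  have hroot : v = r → d.top = 1 ∧ t = 0 := by
    rintro rfl
    have := (h.top_eq hv).1
    omega
  have hpath := h.lt_cur hv
  obtain ⟨d', hd'⟩ : ∃ d', d' = d.pop v t ord' beg' := ⟨_, rfl⟩
  have hOn : ∀ {u}, d'.On u ↔ d.On u ∧ d.idx u < d.idx v := by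
    intro u
    subst hd'
    constructor
    · rintro ⟨i, hi, rfl⟩
      exact ⟨⟨i, hi.trans ht, rfl⟩, htv ▸ h.sorted i t hi ht⟩
    · rintro ⟨⟨i, hi, rfl⟩, hlt⟩
      refine ⟨i, ?_, rfl⟩
      by_contra hcon
      rcases (not_lt.1 hcon).lt_or_eq with h' | e
      · have := h.sorted t i h' hi
        rw [htv] at this; omega
      · rw [← htv, show t = i from e] at hlt; omega
  have hOnr : ∀ {u}, d'.On u → v ≠ r := by
    rintro u hu rfl
    have := (h.root_path u (hOn.1 hu).1).2.2
    have := (hOn.1 hu).2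
    omega
  have habove : ∀ l, d.beg d.m ≤ l → l < d.beg d.m + (d.top - t) → d.Above v (ord' l) := by
    intro l h1 h2
    obtain ⟨i, rfl⟩ := Nat.exists_eq_add_of_le h1
    rw [hord i (by omega)]
    refine ⟨⟨_, by omega, rfl⟩, ?_⟩
    rcases (show t ≤ d.top - 1 - i by omega).lt_or_eq with h' | h'
    · exact htv ▸ (h.sorted t _ h' (by omega)).le
    · rw [← h', htv]
  have hOut : ∀ u, d'.Out u ↔ d.Out u ∨ d.Above v u := by
    intro u
    have e : d'.Out u ↔ ∃ l < d.beg d.m + (d.top - t), ord' l = u := by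
      subst hd'; rw [← hbeg']; rfl
    rw [e]
    constructor
    · rintro ⟨l, hl, rfl⟩
      rcases lt_or_ge l (d.beg d.m) with h' | h'
      · exact .inl ⟨l, h', (hold l h').symm⟩
      · exact .inr (habove l h' hl)
    · rintro (⟨l, hl, rfl⟩ | ⟨⟨i, hi, rfl⟩, hu⟩)
      · exact ⟨l, by omega, hold l hl⟩
      · have hti : t ≤ i := by
          by_contra hcon
          have := h.sorted i t (by omega) ht
          rw [htv] at this; omega
        refine ⟨d.beg d.m + (d.top - 1 - i), by omega, ?_⟩
        rw [hord _ (by omega)]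
        congr 1; omega
  have hScan : ∀ z u, d'.Scan g z u → d.Scan g z u := by
    rintro z u ⟨h1, h2⟩
    subst hd'
    by_cases hzv : z = v
    · rw [hzv] at h1 ⊢; exact d.scan_end hend h1
    · exact ⟨h1, fun hzp => h2 ⟨hzp, hzv⟩⟩
  have hinj : ∀ l, d.beg d.m ≤ l → l < d.beg d.m + (d.top - t) → ∀ l' < l, d.beg d.m ≤ l' →
      d.idx (ord' l) < d.idx (ord' l') := by
    intro l h1 h2 l' h3 h4
    obtain ⟨i, rfl⟩ := Nat.exists_eq_add_of_le h1
    obtain ⟨i', rfl⟩ := Nat.exists_eq_add_of_le h4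
    rw [hord i (by omega), hord i' (by omega)]
    exact h.sorted _ _ (by omega) (by omega)
  refine ⟨?_, fun hvr => (h.cur_tree hv hvr (d' := d.pop v t ord' beg') rfl rfl).1, fun e => ⟨(hroot e).2, ?_⟩⟩
  swap
  · rw [Set.eq_empty_iff_forall_notMem]
    intro p hp
    have := (h.root_path p (h.path_on p hp.1)).2.2
    have := hpath p hp
    rw [e] at this; omega
  subst hd'
  refine { h with
    on_vis := fun u hu => h.on_vis u (hOn.1 hu).1
    sorted := fun i j hij hj => h.sorted i j hij (hj.trans ht)
    out_vis := fun u hu => ((hOut u).1 hu).elim (h.out_vis u) fun hu => h.on_vis u hu.1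
    on_or_out := fun u hu hu0 => ?_
    not_out := fun u hu hu' => ?_
    tree_on := fun u hu hur => ?_
    tree_root := fun hr => h.tree_root (hOn.1 hr).1
    root_path := fun u hu => ?_
    path_on := fun q hq => hOn.2 ⟨h.path_on q hq.1, hpath q hq⟩
    path_tree := h.path_tree_cur hv
    path_gap := fun q hq q' hq' => h.path_gap q hq.1 q' hq'.1
    descend := fun q hq u hu => h.descend q hq.1 u (hOn.1 hu).1
    left := h.left_cur hv
    finished := h.finished_cur hv hend
    ptr_le := fun q hq => h.ptr_le q hq.1
    low_le := fun u hu => h.low_le u (hOn.1 hu).1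
    low_scan := fun z hz u hu => h.low_scan z (hOn.1 hz).1 u (hScan z u hu)
    low_tree := fun u hu hup => h.low_tree u (hOn.1 hu).1 fun e => hup ⟨e, ?_⟩
    low_reach := fun u hu => ?_
    ancestor := fun z hz u hu hHu hlt y hy =>
      h.ancestor z (hOn.1 hz).1 u (hScan z u hu) hHu hlt y (hOn.1 hy).1
    beg_zero := (hbeg 0 (by omega)).trans h.beg_zero
    ord_inj := ?_
    tree_later := ?_
    beg_le := fun b hb => ?_
    part := fun b hb => ?_ }
  · rw [hOut]
    rcases h.on_or_out u hu hu0 with h' | h'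
    · rcases lt_or_ge (d.idx u) (d.idx v) with h1 | h1
      · exact .inl (hOn.2 ⟨h', h1⟩)
      · exact .inr (.inr ⟨h', h1⟩)
    · exact .inr (.inl h')
  · have hu := hOn.1 hu
    rcases (hOut u).1 hu' with h' | h'
    · exact h.not_out u hu.1 h'
    · have := h'.2; omega
  · have hu := hOn.1 hu
    have h1 := h.tree_on u hu.1 hur
    exact ⟨hOn.2 ⟨h1.1, h1.2.trans hu.2⟩, h1.2⟩
  · have h1 := h.root_path u (hOn.1 hu).1
    exact ⟨hOn.2 ⟨h1.1, h1.2.2.trans_lt (hOn.1 hu).2⟩, ⟨h1.2.1, fun e => hOnr hu (Eq.symm e)⟩, h1.2.2⟩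
  · rintro rfl
    exact lt_irrefl _ (hOn.1 hu).2
  · have hu' := hOn.1 hu
    have hul := h.low_le u hu'.1
    refine (h.low_reach u hu'.1).imp_right (Or.imp ?_ ?_)
    · rintro ⟨y, h1, h2, h3⟩
      exact ⟨y, h1, hOn.2 ⟨h2, by omega⟩, h3⟩
    · rintro ⟨y, h1, h2, h3, h4⟩
      refine ⟨y, hOn.2 ⟨h1, ?_⟩, fun e => h2 e.1, h3, h4⟩
      by_contra hcon
      have hyv : y ≠ v := by rintro rfl; exact h2 hv.mem
      have := ((hc (hOnr hu)).tree_above ⟨h1, by omega⟩ hyv).2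
      rw [h3] at this
      omega
  · intro l hl l' hl' e
    simp only [Dfs.pop, hbeg'] at hl hl' e
    rcases lt_or_ge l (d.beg d.m) with h1 | h1 <;> rcases lt_or_ge l' (d.beg d.m) with h2 | h2
    · rw [hold l h1, hold l' h2] at e
      exact h.ord_inj l h1 l' h2 e
    · exact absurd ⟨l, h1, by rw [← hold l h1, e]⟩ (h.not_out _ (habove l' h2 hl').1)
    · exact absurd ⟨l', h2, by rw [← hold l' h2, e]⟩ (h.not_out _ (habove l h1 hl).1)
    · rcases lt_trichotomy l l' with h3 | h3 | h3
      · have := hinj l' h2 hl' l h3 h1; rw [e] at this; omega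
      · exact h3
      · have := hinj l h1 hl l' h3 h2; rw [e] at this; omega
  · intro l hl l' hl' e
    simp only [Dfs.pop, hbeg'] at hl e
    rcases lt_or_ge l (d.beg d.m) with h1 | h1
    · rw [hold l h1, hold l' (by omega)] at e
      exact h.tree_later l h1 l' hl' e
    · have hA := habove l h1 hl
      have h4 : d.On (d.tree (ord' l)) ∧ d.idx (d.tree (ord' l)) ≤ d.idx (ord' l) := by
        by_cases hr : ord' l = r
        · rw [hr, h.tree_root (hr ▸ hA.1)]; exact ⟨hr ▸ hA.1, le_rfl⟩
        · exact (h.tree_on _ hA.1 hr).imp_right le_of_lt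
      rw [e] at h4
      rcases lt_or_ge l' (d.beg d.m) with h2 | h2
      · exact h.not_out _ h4.1 ⟨l', h2, by rw [← hold l' h2]⟩
      · have := hinj l h1 hl l' hl' h2
        omega
  · simp only [Dfs.pop, hbeg']
    rcases Nat.lt_succ_iff_lt_or_eq.1 hb with h' | rfl
    · rw [hbeg (b + 1) h']
      exact (h.beg_le b h').trans (by omega)
    · rw [hbeg']
  · simp only [Dfs.pop]
    rcases Nat.lt_succ_iff_lt_or_eq.1 hb with h' | rfl
    · rw [hbeg b (by omega), hbeg (b + 1) (by omega)]
      exact h.part_congr hold (fun _ _ _ => ⟨rfl, rfl⟩) (fun _ _ => rfl) h'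
    rw [hbeg d.m le_rfl, hbeg']
    have hlast : ord' (d.beg d.m + (d.top - t) - 1) = v := by
      rw [show d.beg d.m + (d.top - t) - 1 = d.beg d.m + (d.top - t - 1) by omega,
        hord _ (by omega), ← htv]
      congr 1; omega
    refine ⟨by omega, fun e => ?_, fun hne => ?_⟩
    · rw [hlast] at e
      obtain rfl : v = r := by
        by_contra hvr
        have := (h.tree_on v hvon hvr).2
        rw [e] at this; omega
      refine ⟨by omega, fun w hw hHw => ?_⟩
      rw [show d.beg d.m = d.beg d.m + (d.top - t) - 1 by omega, hlast] at hw
      have h1 := h.low_scan v hvon w (d.scan_end hend hw) hHw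
      rcases h.on_or_out w hHw h1.1 with ⟨i, hi, e'⟩ | ⟨l, hl, e'⟩
      · rw [show i = t by omega, htv] at e'
        exact absurd e'.symm (N_ne hw)
      · exact ⟨l, hl, by rw [hold l hl, e']⟩
    · rw [hlast] at hne ⊢
      have hc := hc (by rintro rfl; exact hne (h.tree_root hvon))
      refine ⟨hc.leafBlock ht htv hord, fun l h1 h2 w hw hHw => ?_⟩
      rw [hc.mem_blockSet_iff ht htv hord]
      rcases hc.nbr (habove l h1 h2) hw hHw with h3 | h3 | ⟨l', h3, h4⟩
      · exact .inl (.inl h3)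
      · exact .inl (.inr h3)
      · exact .inr ⟨l', h3, by rw [hold l' h3, h4]⟩

end finish

/-- When all vertices have been discovered, the parts form a decomposition. -/
theorem decomp (h : d.Ok g H r) (hH : ∀ v, H v → v < g.n) (ht : d.top = 0)
    (hall : ∀ v, H v → d.idx v ≠ 0) : g.Decomp H d.tree d.idx d.low d.ord d.beg d.m := by
  have on : ∀ v, ¬ d.On v := fun v ⟨i, hi, _⟩ => by omega
  refine ⟨h.beg_zero, fun b hb => (h.part b hb).lt, hH, h.ord_inj, fun l hl => (h.out_vis _ ⟨l, hl, rfl⟩).1,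
    fun v hv => (h.on_or_out v hv (hall v hv)).resolve_left (on v), h.tree_later,
    fun v hv => (h.tree_vis v hv (hall v hv)).2.2, fun v hv => (h.tree_vis v hv (hall v hv)).1,
    h.idx_le_n hH, fun b hb e => ((h.part b hb).root e).1, fun b hb e => ((h.part b hb).root e).2,
    fun b hb e => ((h.part b hb).block e).1, fun b hb e => ((h.part b hb).block e).2⟩

end Dfs.Ok

end Net

namespace Net

variable {g : Net} {H : ℕ → Prop} {d : Dfs} {r : ℕ}

open scoped Classical in
/-- The number of steps that a depth-first search still has to do at the vertex `v`, up to a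
constant factor. -/
noncomputable def Dfs.rest (d : Dfs) (g : Net) (v : ℕ) : ℕ :=
  if d.idx v = 0 then g.deg v + 3 else if v ∈ d.path then g.off (v + 1) - d.ptr v + 1 else 0

/-- The number of steps that a depth-first search still has to do, up to a constant factor. -/
noncomputable def Dfs.pot (d : Dfs) (g : Net) : ℕ := ∑ v ∈ Finset.range g.n, d.rest g v

theorem Dfs.pot_add_le {d' : Dfs} (h : ∀ u < g.n, d'.rest g u ≤ d.rest g u) {v a : ℕ}
    (hv : v < g.n) (ha : d'.rest g v + a ≤ d.rest g v) : d'.pot g + a ≤ d.pot g := by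
  have hv' := Finset.mem_range.2 hv
  unfold Dfs.pot
  rw [← Finset.add_sum_erase _ _ hv', ← Finset.add_sum_erase _ _ hv']
  have := Finset.sum_le_sum (s := (Finset.range g.n).erase v) (f := d'.rest g) (g := d.rest g)
    fun u hu => h u (Finset.mem_range.1 (Finset.mem_of_mem_erase hu))
  omega

theorem Dfs.pot_push {v w : ℕ} (hw : w < g.n) (hw0 : d.idx w = 0) :
    (d.push g v w).pot g + 2 ≤ d.pot g := by
  refine pot_add_le (fun u _ => ?_) hw (by simp [rest, push, hw0, deg])
  by_cases huw : u = w
  · subst huw; simp [rest, push, hw0, deg]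
  by_cases huv : u = v
  · subst huv
    rw [rest, rest, show (d.push g u w).path = insert w d.path from rfl, Set.mem_insert_iff,
      or_iff_right huw]
    simp only [push, Function.update_of_ne huw, Function.update_self]
    split_ifs <;> omega
  · rw [rest, rest, show (d.push g v w).path = insert w d.path from rfl, Set.mem_insert_iff,
      or_iff_right huw]
    simp [push, huw, huv]

theorem Dfs.pot_look {v w : ℕ} (hv : v < g.n) (hv0 : d.idx v ≠ 0) (hp : v ∈ d.path)
    (hptr : d.ptr v < g.off (v + 1)) : (d.look v w).pot g + 1 ≤ d.pot g := by
  refine pot_add_le (fun u _ => ?_) hv (by simp [rest, look, hv0, hp]; omega)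
  by_cases huv : u = v
  · subst huv; simp [rest, look, hv0, hp]; omega
  · rw [rest, rest, show (d.look v w).path = d.path from rfl]; simp [look, huv]

theorem Dfs.pot_sdiff {v : ℕ} {d' : Dfs} (h1 : d'.idx = d.idx) (h2 : d'.ptr = d.ptr)
    (h3 : d'.path = d.path \ {v}) (hv : v < g.n) (hv0 : d.idx v ≠ 0) (hp : v ∈ d.path) :
    d'.pot g + 1 ≤ d.pot g := by
  refine pot_add_le (fun u _ => ?_) hv (by simp [rest, h1, h3, hv0, hp])
  rw [rest, rest, h1, h2, h3, Set.mem_sdiff]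
  split_ifs <;> first | omega | simp_all

namespace Dfs.Ok

theorem le_beg (h : d.Ok g H r) {b : ℕ} (hb : b ≤ d.m) : b ≤ d.beg b := by
  induction b with
  | zero => omega
  | succ b ih =>
    have := ih (by omega)
    have := (h.part b (by omega)).lt
    omega

theorem beg_le_n (h : d.Ok g H r) (hH : ∀ v, H v → v < g.n) : d.beg d.m ≤ g.n := by
  have := Finset.card_le_card_of_injOn (s := Finset.range (d.beg d.m)) (t := Finset.range g.n) d.ord
    (fun l hl => by
      simp only [Finset.coe_range, Set.mem_Iio] at hl ⊢
      exact hH _ (h.out_vis _ ⟨l, hl, rfl⟩).1)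
    (fun l hl l' hl' => h.ord_inj l (by simpa using hl) l' (by simpa using hl'))
  simpa using this

theorem stk_inj (h : d.Ok g H r) {i j : ℕ} (hi : i < d.top) (hj : j < d.top)
    (e : d.stk i = d.stk j) : i = j := by
  rcases lt_trichotomy i j with h' | h' | h'
  · have := h.sorted i j h' hj; rw [e] at this; omega
  · exact h'
  · have := h.sorted j i h' hi; rw [e] at this; omega

theorem stk_lt (h : d.Ok g H r) (hH : ∀ v, H v → v < g.n) {i : ℕ} (hi : i < d.top) :
    d.stk i < g.n := hH _ (h.on_vis _ ⟨i, hi, rfl⟩).1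

theorem top_le_n (h : d.Ok g H r) (hH : ∀ v, H v → v < g.n) : d.top ≤ g.n := by
  have := Finset.card_le_card_of_injOn (s := Finset.range d.top) (t := Finset.range g.n) d.stk
    (fun l hl => by
      simp only [Finset.coe_range, Set.mem_Iio] at hl ⊢
      exact h.stk_lt hH hl)
    (fun l hl l' hl' => h.stk_inj (by simpa using hl) (by simpa using hl'))
  simpa using this

end Dfs.Ok

end Net

namespace WordRAM

variable {g : Net} {k B : ℕ} {s : State} {H : ℕ → Prop} {r v : ℕ} {path : Set ℕ}

/-! ### Depth-first search: the program -/

/-- The data of the search in the memory. The set of the vertices that are being explored is not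
stored. -/
def dfsOf (s : State) (path : Set ℕ) : Net.Dfs :=
  ⟨s.arrs aTree, s.arrs aIdx, s.arrs aLow, s.arrs aPtr, s.arrs aStk, s.arrs aOrd, s.arrs aBeg,
    s.vars 36, s.vars 37, s.vars 31, path⟩

/-- Goes from the current vertex in register 39 to its undiscovered neighbour in register 74. -/
def dfsDown : Prog :=
  .add 36 (.var 36) (.const 1) ;;
  .store aTree (.var 74) (.var 39) ;;
  .store aIdx (.var 74) (.var 36) ;;
  .store aLow (.var 74) (.var 36) ;;
  .load 72 aOff (.var 74) ;;
  .store aPtr (.var 74) (.var 72) ;;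
  .store aStk (.var 37) (.var 74) ;;
  .add 37 (.var 37) (.const 1) ;;
  .set 39 (.var 74)

/-- Starts a search at the vertex in register 33. -/
def dfsStart : Prog :=
  .set 39 (.var 33) ;;
  .set 74 (.var 33) ;;
  .set 58 (.const 1) ;;
  dfsDown

/-- Moves the vertices on the stack from the one in register 39 on to the list `aOrd`, where they
are a new part. -/
def dfsPop : Prog :=
  .set 76 (.var 0) ;;
  .loop (.ne (.var 76) (.var 39))
    (.sub 37 (.var 37) (.const 1) ;;
     .load 76 aStk (.var 37) ;;
     .store aOrd (.var 38) (.var 76) ;;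
     .add 38 (.var 38) (.const 1)) ;;
  .add 31 (.var 31) (.const 1) ;;
  .store aBeg (.var 31) (.var 38)

/-- Ends the exploration of the vertex in register 39. -/
def dfsUp : Prog :=
  .load 72 aTree (.var 39) ;;
  .load 73 aLow (.var 39) ;;
  .load 74 aIdx (.var 72) ;;
  .branch (.lt (.var 73) (.var 74))
    (.load 74 aLow (.var 72) ;;
     .branch (.lt (.var 73) (.var 74)) (.set 74 (.var 73)) .skip ;;
     .store aLow (.var 72) (.var 74))
    dfsPop ;;
  .branch (.eq (.var 72) (.var 39)) (.set 58 (.const 0)) (.set 39 (.var 72))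

/-- One step of the search: looks at the next edge of the vertex in register 39. -/
def dfsStep : Prog :=
  .load 72 aPtr (.var 39) ;;
  .add 73 (.var 39) (.const 1) ;;
  .load 73 aOff (.var 73) ;;
  .branch (.lt (.var 72) (.var 73))
    (.load 74 aNb (.var 72) ;;
     .add 72 (.var 72) (.const 1) ;;
     .store aPtr (.var 39) (.var 72) ;;
     .load 75 aIdx (.var 74) ;;
     .branch (.eq (.var 75) (.const 0))
       dfsDown
       (.load 76 aLow (.var 39) ;;
        .branch (.lt (.var 75) (.var 76)) (.set 76 (.var 75)) .skip ;;
        .store aLow (.var 39) (.var 76)))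
    dfsUp

/-- Depth-first search from all undiscovered vertices. -/
def dfsAll : Prog :=
  .set 33 (.const 0) ;;
  .loop (.lt (.var 33) (.var 0))
    (.load 72 aIdx (.var 33) ;;
     .branch (.eq (.var 72) (.const 0))
       (dfsStart ;; .loop (.eq (.var 58) (.const 1)) dfsStep)
       .skip ;;
     .add 33 (.var 33) (.const 1))

/-- The invariant between two steps of the search. -/
structure DfsInv (g : Net) (H : ℕ → Prop) (r : ℕ) (s : State) (path : Set ℕ) : Prop where
  ok : (dfsOf s path).Ok g H r
  len : s.vars 38 = s.arrs aBeg (s.vars 31)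

theorem dfsPop_spec (hB : bound g k ≤ B) (hs : Static g k s) (hH : ∀ v, H v → v < g.n)
    (hi : DfsInv g H r s path) (hcur : (dfsOf s path).Cur v) (h39 : s.vars 39 = v)
    (hend : s.arrs aPtr v = g.off (v + 1)) (hlow : s.arrs aIdx (s.arrs aTree v) ≤ s.arrs aLow v) :
    wp B dfsPop s fun t' s' => DfsInv g H r s' (path \ {v}) ∧
      (v ≠ r → (dfsOf s' (path \ {v})).Cur (s.arrs aTree v)) ∧
      (v = r → s'.vars 37 = 0 ∧ path \ {v} = ∅) ∧ s'.arrs aIdx = s.arrs aIdx ∧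
      (dfsOf s' (path \ {v})).pot g + 1 ≤ (dfsOf s path).pot g ∧
      t' + 5 * s'.vars 37 ≤ 5 * s.vars 37 + 4 := by
  have hok := hi.ok
  have hvon := hok.path_on v hcur.mem
  have hvvis := hok.on_vis v hvon
  have hvn := hH v hvvis.1
  obtain ⟨t, ht, htv⟩ := id hvon
  obtain ⟨top, h37⟩ : ∃ top, s.vars 37 = top := ⟨_, rfl⟩
  obtain ⟨N, h38⟩ : ∃ N, s.vars 38 = N := ⟨_, rfl⟩
  obtain ⟨m, h31⟩ : ∃ m, s.vars 31 = m := ⟨_, rfl⟩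
  have hNb : s.arrs aBeg m = N := by rw [← h38, hi.len, h31]
  have hN : N ≤ g.n := hNb ▸ h31 ▸ hok.beg_le_n hH
  have hm : m ≤ g.n := h31 ▸ (hok.le_beg le_rfl).trans (hok.beg_le_n hH)
  have htop : top ≤ g.n := h37 ▸ hok.top_le_n hH
  have hlt : ∀ i < top, s.arrs aStk i < g.n := fun i hi' => hok.stk_lt hH (hi'.trans_eq h37.symm)
  replace htv : s.arrs aStk t = v := htv
  have htop' : t < top := h37 ▸ ht
  have hinj : ∀ i < top, s.arrs aStk i = v → i = t := fun i hi' e =>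
    hok.stk_inj (hi'.trans_eq h37.symm) ht (e.trans htv.symm)
  refine step_set g.n (hv := by simp [hs.vn]) ?_
  refine wp_seq.2 (wp_loop (fun c s' => s'.vars 39 = v ∧ s'.vars 31 = m ∧ s'.arrs aBeg = s.arrs aBeg ∧
    ∃ i ≤ top - t, s'.vars 37 = top - i ∧ s'.vars 38 = N + i ∧
      s'.vars 76 = (if i = 0 then g.n else s.arrs aStk (top - i)) ∧
      (∀ l < N, s'.arrs aOrd l = s.arrs aOrd l) ∧
      (∀ i' < i, s'.arrs aOrd (N + i') = s.arrs aStk (top - 1 - i')) ∧ c = 5 * (top - t - i))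
    (c := 5 * (top - t)) ?_ ?_ ?_)
  · rintro c s' ⟨e39, e31, e18, i, hi, e37, e38, e76, ho, hn, rfl⟩ hf hb
    have f12 : s'.arrs aStk = s.arrs aStk := hf.arr
    simp [e39, e76] at hb
    have hit : i < top - t := by
      by_contra hcon
      obtain rfl : i = top - t := by omega
      rw [if_neg (by omega), show top - (top - t) = t by omega] at hb
      exact hb htv
    have := hlt (top - (i + 1)) (by omega)
    refine step_sub (top - (i + 1)) (hv := by simp [e37]; omega) ?_
    refine step_load (s.arrs aStk (top - (i + 1))) ?_
    refine step_store (N + i) (s.arrs aStk (top - (i + 1))) ?_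
    refine end_add (N + (i + 1)) (hv := by simp [e38]; omega) ⟨_, ⟨by simp [e39], by simp [e31], by simp [e18], i + 1, by omega, by simp, by simp,
      by simp, fun l hl => ?_, fun i' hi' => ?_, rfl⟩, by omega⟩
    · simp [Function.update_of_ne (show l ≠ N + i by omega), ho l hl]
    · rcases Nat.lt_succ_iff_lt_or_eq.1 hi' with h' | rfl
      · simp [Function.update_of_ne (show N + i' ≠ N + i by omega), hn i' h']
      · simp [show top - 1 - i' = top - (i' + 1) by omega]
  · exact ⟨by simp [h39], by simp [h31], by simp, 0, by omega, by simp [h37], by simp [h38], by simp,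
      fun l hl => by simp, fun i hi => by omega, by simp⟩
  · rintro t' s' c ⟨e39, e31, e18, i, hi, e37, e38, e76, ho, hn, rfl⟩ hf hb hc
    simp [e39, e76] at hb
    have hit : i = top - t := by
      split_ifs at hb with h0
      · omega
      · have := hinj _ (by omega) hb; omega
    subst hit
    refine step_add (m + 1) ?_
    refine end_store (m + 1) (N + (top - t)) ?_
    generalize hs₂ : State.setArr _ aBeg _ _ = s₂
    have ebeg : s₂.arrs aBeg = Function.update (s.arrs aBeg) (m + 1) (N + (top - t)) := by
      simp [← hs₂, e18]
    have e37' : s₂.vars 37 = t := by simp [← hs₂, e37]; omega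
    obtain ⟨h1, h2, h3⟩ := hok.pop (ord' := s₂.arrs aOrd) (beg' := s₂.arrs aBeg) hcur hend hlow
      ht htv (by simpa [← hs₂, dfsOf, h31, hNb] using ho)
      (by simpa [← hs₂, dfsOf, h31, hNb, h37] using hn)
      (fun b hb => by
        rw [ebeg, Function.update_of_ne (by have : b ≤ s.vars 31 := hb; omega)]; rfl)
      (by simp [ebeg, dfsOf, h31, h37, hNb])
    have e : dfsOf s₂ (path \ {v}) = (dfsOf s path).pop v t (s₂.arrs aOrd) (s₂.arrs aBeg) := by
      simp [dfsOf, Net.Dfs.pop, e37', h31]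
      simp [← hs₂, hf.a 19 rfl, hf.a 13 rfl, hf.a 15 rfl, hf.a 16 rfl, hf.a 12 rfl, hf.v 36 rfl]
    rw [e]
    exact ⟨⟨e ▸ h1, by simp [← hs₂, e38]⟩, h2, fun h => ⟨e37'.trans (h3 h).1, (h3 h).2⟩,
      congrArg Net.Dfs.idx e, Net.Dfs.pot_sdiff rfl rfl rfl hvn hvvis.2 hcur.mem, by omega⟩

/-- What a step of the search achieves. -/
def DfsPost (g : Net) (H : ℕ → Prop) (r : ℕ) (s : State) (path : Set ℕ) (t : ℕ) (s' : State) :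
    Prop :=
  ∃ path', DfsInv g H r s' path' ∧
    (s'.vars 58 = 1 ∧ (dfsOf s' path').Cur (s'.vars 39) ∨
      s'.vars 58 = 0 ∧ s'.vars 37 = 0 ∧ path' = ∅) ∧
    (∀ u, s.arrs aIdx u ≠ 0 → s'.arrs aIdx u ≠ 0) ∧
    40 * (dfsOf s' path').pot g + 10 * s'.vars 37 + t + 2 ≤
      40 * (dfsOf s path).pot g + 10 * s.vars 37

/-- Here `s₀` is the state before the edge to `w` has been looked at. -/
theorem dfsDown_spec (hB : bound g k ≤ B) (hs : Static g k s) (hH : ∀ v, H v → v < g.n) {s₀ : State}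
    {w : ℕ} (hi : DfsInv g H r s₀ path) (h39 : s.vars 39 = v) (h74 : s.vars 74 = w)
    (h38 : s.vars 38 = s₀.vars 38) (h58 : s.vars 58 = 1)
    (hd : { dfsOf s path with ptr := s₀.arrs aPtr } = dfsOf s₀ path)
    (hptr : Function.update (s.arrs aPtr) w (g.off w) =
      Function.update (Function.update (s₀.arrs aPtr) v (s₀.arrs aPtr v + 1)) w (g.off w))
    (hvn : v < g.n) (hHw : H w) (hw0 : s₀.arrs aIdx w = 0)
    (hc : (dfsOf s₀ path).Cur v ∧ s₀.arrs aPtr v < g.off (v + 1) ∧ g.nb (s₀.arrs aPtr v) = w ∨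
      v = w ∧ w = r ∧ s₀.vars 37 = 0) :
    wp B dfsDown s fun t s' => DfsPost g H r s₀ path (t + 40) s' ∧ s'.arrs aIdx w ≠ 0 := by
  obtain ⟨hok, hcur⟩ := hi.ok.push hH hHw hw0 hc
  have hwn := hH w hHw
  have hoff := off_le_n (g := g) (v := w) hwn.le
  have e36 : s.vars 36 = s₀.vars 36 := congrArg Net.Dfs.cnt hd
  have e37 : s.vars 37 = s₀.vars 37 := congrArg Net.Dfs.top hd
  have htop : s.vars 37 + 1 ≤ g.n := e37 ▸ hok.top_le_n hH
  have hcn : s.vars 36 + 1 ≤ g.n := e36 ▸ hok.cnt_le hH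
  refine step_add (s.vars 36 + 1) ?_
  refine step_store w v ?_
  refine step_store w (s.vars 36 + 1) ?_
  refine step_store w (s.vars 36 + 1) ?_
  refine step_load (g.off w) (hv := by simp [h74, hs.off]) ?_
  refine step_store w (g.off w) ?_
  refine step_store (s.vars 37) w ?_
  refine step_add (s.vars 37 + 1) ?_
  refine end_set w ?_
  generalize hs' : State.setVar _ 39 w = s'
  have e : dfsOf s' (insert w path) = (dfsOf s₀ path).push g v w := by
    rw [← hd]
    simp [dfsOf, Net.Dfs.push, ← hs', hptr]
  have e39 : s'.vars 39 = w := by simp [← hs']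
  have e37' : s'.vars 37 = s₀.vars 37 + 1 := congrArg Net.Dfs.top e
  have e13 : s'.arrs aIdx = Function.update (s₀.arrs aIdx) w (s₀.vars 36 + 1) :=
    congrArg Net.Dfs.idx e
  have hlen : s'.vars 38 = s'.arrs aBeg (s'.vars 31) := by
    rw [show s'.vars 38 = s.vars 38 by simp [← hs'], h38, hi.len]
    exact (congrArg (fun d => d.beg d.m) e).symm
  refine ⟨⟨insert w path, ⟨e ▸ hok, hlen⟩, .inl ⟨by simp [← hs', h58], by rw [e39, e]; exact hcur⟩,
    fun u hu => ?_, ?_⟩, by simp [e13]⟩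
  · rw [e13, Function.update_apply]; split_ifs <;> omega
  · have := (dfsOf s₀ path).pot_push (v := v) hwn hw0
    rw [e, e37']
    omega

theorem dfsUp_spec (hB : bound g k ≤ B) (hs : Static g k s) (hH : ∀ v, H v → v < g.n)
    (hi : DfsInv g H r s path) (hcur : (dfsOf s path).Cur v) (h39 : s.vars 39 = v)
    (h58 : s.vars 58 = 1) (hend : s.arrs aPtr v = g.off (v + 1)) :
    wp B dfsUp s fun t s' => DfsPost g H r s path (t + 4) s' := by
  have hok := hi.ok
  have hvon := hok.path_on v hcur.mem
  have hvvis := hok.on_vis v hvon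
  have hvn := hH v hvvis.1
  obtain ⟨p, hp⟩ : ∃ p, s.arrs aTree v = p := ⟨_, rfl⟩
  have htvis := hok.tree_vis v hvvis.1 hvvis.2
  have hpn : p < g.n := hp ▸ hH _ htvis.1
  have hpr : p = v ↔ v = r := by
    refine ⟨fun e => ?_, fun e => ?_⟩
    · by_contra hne
      have : s.arrs aIdx (s.arrs aTree v) < s.arrs aIdx v := (hok.tree_on v hvon hne).2
      rw [hp, e] at this
      omega
    · subst e; exact hp.symm.trans (hok.tree_root hvon)
  have hcn : s.vars 36 ≤ g.n := hok.cnt_le hH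
  have hpc : s.arrs aIdx p ≤ s.vars 36 := hp ▸ hok.idx_le _ htvis.1
  have hvc : s.arrs aIdx v ≤ s.vars 36 := hok.idx_le v hvvis.1
  have hlowv : s.arrs aLow v ≤ s.arrs aIdx v := (hok.low_le v hvon).1
  refine step_load p ?_
  refine step_load (s.arrs aLow v) ?_
  refine step_load (s.arrs aIdx p) ?_
  generalize hs₁ : State.setVar _ 74 (s.arrs aIdx p) = s₁
  have e₁ : dfsOf s₁ path = dfsOf s path := by subst hs₁; rfl
  refine wp_seq.2 (wp_mono (Q := fun t₁ s' => ∃ path', DfsInv g H r s' path' ∧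
    (v ≠ r → (dfsOf s' path').Cur p) ∧ (v = r → s'.vars 37 = 0 ∧ path' = ∅) ∧
    s'.arrs aIdx = s.arrs aIdx ∧
    40 * (dfsOf s' path').pot g + 10 * s'.vars 37 + t₁ + 20 ≤
      40 * (dfsOf s path).pot g + 10 * s.vars 37) ?_ ?_)
  · refine wp_branch.2 ⟨fun hb => ?_, fun hb => ?_⟩ <;>
      simp [← hs₁] at hb
    · obtain ⟨hvr, hok', hcur'⟩ := hok.leave hcur hend
        (show s.arrs aLow v < s.arrs aIdx (s.arrs aTree v) by rwa [hp])
      have hlowp : s.arrs aLow p ≤ s.arrs aIdx p :=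
        (hok.low_le p (hp ▸ hok.path_on _ hcur'.mem.1)).1
      refine step_load (s.arrs aLow p) (hv := by simp [← hs₁]) ?_
      refine step_min (a := s.arrs aLow v) (b := s.arrs aLow p) (by simp [← hs₁]) (by simp) ?_
      refine end_store p (min (s.arrs aLow p) (s.arrs aLow v)) (hi := by simp [← hs₁]) (hv := by simp [min_comm]) ?_
      generalize hs' : State.setArr _ aLow p _ = s'
      have e : dfsOf s' (path \ {v}) = (dfsOf s path).leave v := by
        simp [dfsOf, Net.Dfs.leave, ← hs', ← hs₁, hp]
      have := Net.Dfs.pot_sdiff (g := g) (d := dfsOf s path) (d' := (dfsOf s path).leave v) (v := v) rfl rfl rfl hvn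
        hvvis.2 hcur.mem
      refine ⟨path \ {v}, ⟨e ▸ hok', by simp [← hs', ← hs₁, hi.len]⟩, fun _ => by rw [e, ← hp]; exact hcur',
        fun h => absurd h hvr, by simp [← hs', ← hs₁], ?_⟩
      rw [e, show s'.vars 37 = s.vars 37 by simp [← hs', ← hs₁]]
      omega
    · refine wp_mono (dfsPop_spec (v := v) (path := path) hB (hs.of_eq (s' := s₁) (by simp [← hs₁])
        (by simp [← hs₁]) (by simp [← hs₁]) (by simp [← hs₁]) (by simp [← hs₁]) (by simp [← hs₁])) hH
        ⟨e₁ ▸ hok, by simp [← hs₁, hi.len]⟩ (e₁ ▸ hcur) (by simp [← hs₁, h39])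
        (by simp [← hs₁, hend]) (by simp [← hs₁, hp, hb])) ?_
      rintro t' s' - ⟨h1, h2, h3, h4, h5, h6⟩
      rw [e₁] at h5
      rw [show s₁.vars 37 = s.vars 37 from congrArg Net.Dfs.top e₁] at h6
      refine ⟨_, h1, fun h => ?_, h3, h4.trans (congrArg Net.Dfs.idx e₁), by omega⟩
      rw [← hp, ← show s₁.arrs aTree = s.arrs aTree from congrArg Net.Dfs.tree e₁]
      exact h2 h
  · rintro t₁ s' hf ⟨path', hi', h1, h2, h3, h4⟩
    have f72 : s'.vars 72 = p := (hf.v 72 rfl).trans (by simp [← hs₁])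
    have f39 : s'.vars 39 = v := (hf.v 39 rfl).trans (by simp [← hs₁, h39])
    have f58 : s'.vars 58 = 1 := (hf.v 58 rfl).trans (by simp [← hs₁, h58])
    refine wp_branch.2 ⟨fun hb => ?_, fun hb => ?_⟩ <;>
      simp [f72, f39, hpr] at hb
    · refine end_set 0 ⟨path', ⟨hi'.ok, hi'.len⟩, .inr ⟨by simp, h2 hb⟩, fun u hu => ?_, ?_⟩
      · simpa [h3] using hu
      · have e : dfsOf (s'.setVar 58 0) path' = dfsOf s' path' := rfl
        rw [e]; simp; omega
    · refine end_set p ⟨path', ⟨hi'.ok, hi'.len⟩, .inl ⟨by simp [f58], h1 hb⟩, fun u hu => ?_, ?_⟩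
      · simpa [h3] using hu
      · have e : dfsOf (s'.setVar 39 p) path' = dfsOf s' path' := rfl
        rw [e]; simp; omega

theorem dfsStep_spec (hB : bound g k ≤ B) (hs : Static g k s) (hH : ∀ v, H v → v < g.n)
    (hi : DfsInv g H r s path) (hcur : (dfsOf s path).Cur (s.vars 39)) (h58 : s.vars 58 = 1) :
    wp B dfsStep s fun t s' => DfsPost g H r s path t s' := by
  obtain ⟨v, h39⟩ : ∃ v, s.vars 39 = v := ⟨_, rfl⟩
  rw [h39] at hcur
  have hok := hi.ok
  have hvon := hok.path_on v hcur.mem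
  have hvvis := hok.on_vis v hvon
  have hvn := hH v hvvis.1
  have hptr : g.off v ≤ s.arrs aPtr v ∧ s.arrs aPtr v ≤ g.off (v + 1) := hok.ptr_le v hcur.mem
  have hoff := off_le_n (g := g) (v := v + 1) (by omega)
  refine step_load (s.arrs aPtr v) ?_
  refine step_add (v + 1) ?_
  refine step_load (g.off (v + 1)) (hv := by simp [hs.off]) ?_
  refine wp_branch.2 ⟨fun hb => ?_, fun hb => ?_⟩ <;> simp at hb
  swap
  · have hend : s.arrs aPtr v = g.off (v + 1) := by omega
    refine wp_mono (dfsUp_spec (s := ((s.setVar 72 (s.arrs aPtr v)).setVar 73 (v + 1)).setVar 73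
      (g.off (v + 1))) (r := r) (path := path) hB hs.of_eq hH
      ⟨hi.ok, hi.len⟩ hcur (by simp [h39]) (by simp [h58]) hend) ?_
    rintro t s' - ⟨path', h1, h2, h3, h4⟩
    have e : dfsOf (((s.setVar 72 (s.arrs aPtr v)).setVar 73 (v + 1)).setVar 73 (g.off (v + 1))) path =
      dfsOf s path := rfl
    rw [e] at h4
    simp only [setVar_vars, Nat.reduceEqDiff, if_false] at h4
    exact ⟨path', h1, h2, h3, by omega⟩
  obtain ⟨w, hw⟩ : ∃ w, g.nb (s.arrs aPtr v) = w := ⟨_, rfl⟩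
  have hwn : w < g.n := hw ▸ g.lt v hvn _ hptr.1 hb
  have hcn : s.vars 36 ≤ g.n := hok.cnt_le hH
  have hwi : s.arrs aIdx w ≤ g.n + 1 := hok.idx_le_n hH w
  refine step_load w (hv := by simp [hs.nb, hw]) ?_
  refine step_add (s.arrs aPtr v + 1) ?_
  refine step_store v (s.arrs aPtr v + 1) ?_
  refine step_load (s.arrs aIdx w) ?_
  refine wp_branch.2 ⟨fun hb' => ?_, fun hb' => ?_⟩ <;> simp at hb'
  · have hHw : H w := by
      by_contra hcon
      have : s.arrs aIdx w = g.n + 1 := hok.big w hwn hcon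
      omega
    refine wp_mono (dfsDown_spec (v := v) (w := w) hB (by exact hs.of_eq) hH
      hi (by simp [h39]) (by simp) (by simp) (by simp [h58]) (by simp [dfsOf]) (by simp) hvn hHw
      hb' (.inl ⟨hcur, hb, hw⟩)) ?_
    rintro t s' - ⟨⟨path', h1, h2, h3, h4⟩, -⟩
    exact ⟨path', h1, h2, h3, by omega⟩
  · have hok' := hok.look hH (w := w) hcur hb hw hb'
    have hlow : s.arrs aLow v ≤ s.arrs aIdx v := (hok.low_le v hvon).1
    have hvc : s.arrs aIdx v ≤ s.vars 36 := hok.idx_le v hvvis.1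
    refine step_load (s.arrs aLow v) ?_
    refine step_min (a := s.arrs aIdx w) (b := s.arrs aLow v) (by simp) (by simp) ?_
    refine end_store v (min (s.arrs aLow v) (s.arrs aIdx w)) (hv := by simp [min_comm]) ?_
    generalize hs' : State.setArr _ aLow v _ = s'
    have e : dfsOf s' path = (dfsOf s path).look v w := by
      simp [dfsOf, Net.Dfs.look, ← hs']
    have := (dfsOf s path).pot_look (w := w) hvn hvvis.2 hcur.mem hb
    refine ⟨path, ⟨e ▸ hok', by simp [← hs', hi.len]⟩, .inl ⟨by simp [← hs', h58], ?_, ?_⟩,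
      fun u hu => by simpa [← hs'] using hu, ?_⟩
    · rw [show s'.vars 39 = v by simp [← hs', h39]]; exact hcur.mem
    · rw [e, show s'.vars 39 = v by simp [← hs', h39]]; exact hcur.max
    · rw [e, show s'.vars 37 = s.vars 37 by simp [← hs']]
      omega

theorem dfsAll_spec (hB : bound g k ≤ B) (hs : Static g k s) (hH : ∀ v, H v → v < g.n)
    (hbig : ∀ v < g.n, ¬ H v → s.arrs aIdx v = g.n + 1) (h0 : ∀ v, H v → s.arrs aIdx v = 0)
    (hout : ∀ v, g.n ≤ v → s.arrs aIdx v = 0) (h36 : s.vars 36 = 0) (h37 : s.vars 37 = 0)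
    (h38 : s.vars 38 = 0) (h31 : s.vars 31 = 0) (hbeg : s.arrs aBeg 0 = 0) :
    wp B dfsAll s fun t s' => g.Decomp H (s'.arrs aTree) (s'.arrs aIdx) (s'.arrs aLow)
      (s'.arrs aOrd) (s'.arrs aBeg) (s'.vars 31) ∧ t ≤ 200 * (g.off g.n + g.n) + 10 := by
  have hok0 : (dfsOf s ∅).Ok g H 0 := Net.Dfs.Ok.init hbig h0 hout h36 h37 h31 hbeg rfl
  have hpot : (dfsOf s ∅).pot g ≤ g.off g.n + 3 * g.n := by
    rw [← Net.sum_deg g.n le_rfl, Net.Dfs.pot]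
    calc _ ≤ ∑ v ∈ Finset.range g.n, (g.deg v + 3) := Finset.sum_le_sum fun v _ => by
          simp only [Net.Dfs.rest, dfsOf, Set.mem_empty_iff_false, if_false]
          split_ifs <;> omega
      _ = _ := by simp [Finset.sum_add_distrib, mul_comm]
  refine step_set 0 ?_
  refine wp_loop (fun c s' => ∃ i, s'.vars 33 = i ∧ i ≤ g.n ∧ s'.vars 37 = 0 ∧
    (∃ r, DfsInv g H r s' ∅) ∧ (∀ v < i, H v → s'.arrs aIdx v ≠ 0) ∧
    c = 40 * (dfsOf s' ∅).pot g + 10 * (g.n - i)) (c := 40 * (dfsOf s ∅).pot g + 10 * g.n) ?_ ?_ ?_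
  · rintro c s₁ ⟨i, e33, hin, e37, ⟨r, hi⟩, hvis, rfl⟩ hf hb
    have hs₁ : Static g k s₁ := hs.of_eq.frame hf
    simp [e33, hs₁.vn] at hb
    have hcn : s₁.vars 36 ≤ g.n := hi.ok.cnt_le hH
    have hiidx : s₁.arrs aIdx i ≤ g.n + 1 := hi.ok.idx_le_n hH i
    refine step_load (s₁.arrs aIdx i) ?_
    refine wp_seq.2 (wp_branch.2 ⟨fun hb' => ?_, fun hb' => ?_⟩) <;>
      simp at hb'
    · have hHi : H i := by
        by_contra hcon
        have : s₁.arrs aIdx i = g.n + 1 := hi.ok.big i hb hcon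
        omega
      have e' : dfsOf (s₁.setVar 72 (s₁.arrs aIdx i)) ∅ = dfsOf s₁ ∅ := rfl
      refine wp_seq.2 (wp_mono (P := dfsStart) (Q := fun t s' =>
        DfsPost g H i (s₁.setVar 72 (s₁.arrs aIdx i)) ∅ (t + 20) s' ∧ s'.arrs aIdx i ≠ 0) ?_ ?_)
      · refine step_set i ?_
        refine step_set i ?_
        refine step_set 1 ?_
        refine wp_mono (dfsDown_spec (v := i) (w := i) hB (by exact hs₁.of_eq)
          hH (s₀ := s₁.setVar 72 (s₁.arrs aIdx i)) ⟨hi.ok.reroot e37 rfl i, hi.len⟩ (by simp) (by simp) rfl (by simp) rfl (by simp) hb hHi hb'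
          (.inr ⟨rfl, rfl, e37⟩)) ?_
        rintro t s' - ⟨⟨path', h1, h2, h3, h4⟩, h5⟩
        exact ⟨⟨path', h1, h2, h3, by omega⟩, h5⟩
      rintro t₂ s₂ hf₂ ⟨⟨path₂, hi₂, hcur₂, hvis₂, hpot₂⟩, hvi⟩
      have hs₂ : Static g k s₂ := hs₁.of_eq.frame hf₂
      have e33' : s₂.vars 33 = i := hf₂.var
      refine wp_loop (fun c s' => ∃ path, DfsInv g H i s' path ∧
        (s'.vars 58 = 1 ∧ (dfsOf s' path).Cur (s'.vars 39) ∨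
          s'.vars 58 = 0 ∧ s'.vars 37 = 0 ∧ path = ∅) ∧
        (∀ u, s₂.arrs aIdx u ≠ 0 → s'.arrs aIdx u ≠ 0) ∧
        c = 40 * (dfsOf s' path).pot g + 10 * s'.vars 37)
        (c := 40 * (dfsOf s₂ path₂).pot g + 10 * s₂.vars 37) ?_ ?_ ?_
      · rintro c s₃ ⟨path, hi₃, h3, hvis₃, rfl⟩ hf₃ hb₃
        simp at hb₃
        have hs₃ : Static g k s₃ := hs₂.of_eq.frame hf₃
        refine wp_mono (dfsStep_spec hB hs₃ hH hi₃ (h3.resolve_right (by omega)).2 hb₃) ?_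
        rintro t₄ s₄ - ⟨path', hi₄, h4, hvis₄, hpot₄⟩
        exact ⟨_, ⟨path', hi₄, h4, fun u hu => hvis₄ u (hvis₃ u hu), rfl⟩, by omega⟩
      · exact ⟨path₂, hi₂, hcur₂, fun u hu => hu, rfl⟩
      · rintro t₃ s₃ c ⟨path, hi₃, h3, hvis₃, rfl⟩ hf₃ hb₃ hc
        simp at hb₃
        obtain ⟨-, h37', rfl⟩ := h3.resolve_left (fun h => hb₃ h.1)
        have e33₃ : s₃.vars 33 = i := hf₃.var
        refine end_add (i + 1) ?_
        have e : dfsOf (s₃.setVar 33 (i + 1)) ∅ = dfsOf s₃ ∅ := rfl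
        rw [e', show (s₁.setVar 72 _).vars 37 = 0 from e37] at hpot₂
        refine ⟨_, ⟨i + 1, by simp, by omega, by simp [h37'], ⟨i, ⟨hi₃.ok, hi₃.len⟩⟩,
          fun v hv hHv => ?_, rfl⟩, by rw [e]; omega⟩
        rcases Nat.lt_succ_iff_lt_or_eq.1 hv with h' | rfl
        · exact hvis₃ v (hvis₂ v (hvis v h' hHv))
        · exact hvis₃ v hvi
    · refine wp_skip.2 ?_
      refine end_add (i + 1) ?_
      have e : dfsOf ((s₁.setVar 72 (s₁.arrs aIdx i)).setVar 33 (i + 1)) ∅ = dfsOf s₁ ∅ := rfl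
      refine ⟨_, ⟨i + 1, by simp, by omega, by simp [e37], ⟨r, ⟨hi.ok, hi.len⟩⟩,
        fun v hv hHv => ?_, rfl⟩, by rw [e]; omega⟩
      rcases Nat.lt_succ_iff_lt_or_eq.1 hv with h' | rfl
      · exact hvis v h' hHv
      · exact hb'
  · exact ⟨0, by simp, by omega, by simp [h37], ⟨0, ⟨hok0, by simp [h38, h31, hbeg]⟩⟩,
      fun v hv => by omega, rfl⟩
  · rintro t s₁ c ⟨i, e33, hin, e37, ⟨r, hi⟩, hvis, rfl⟩ hf hb hc
    have hn : s₁.vars 0 = g.n := (hf.v 0 rfl).trans (by simp [hs.vn])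
    simp [e33, hn] at hb
    refine ⟨hi.ok.decomp hH e37 fun v hv => hvis v ?_ hv, by omega⟩
    have := hH v hv
    omega


variable {g : Net} {k B : ℕ} {s : State}

/-! ### Preparing the data -/

/-- The input is the graph `g` and the number `k`. -/
structure Input (g : Net) (k : ℕ) (s : State) : Prop where
  vn : s.vars 0 = g.n
  vk : s.vars 1 = k
  off : s.arrs aOff = g.off
  nb : s.arrs aNb = g.nb

theorem Input.of_eq {s' : State} (h : Input g k s) (v0 : s'.vars 0 = s.vars 0)
    (v1 : s'.vars 1 = s.vars 1) (a0 : s'.arrs 0 = s.arrs 0) (a1 : s'.arrs 1 = s.arrs 1) :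
    Input g k s' :=
  ⟨v0.trans h.vn, v1.trans h.vk, a0.trans h.off, a1.trans h.nb⟩

/-- Fills the table of the starting points of rows. -/
def initBase : Prog :=
  .set 80 (.const 0) ;;
  .set 81 (.const 0) ;;
  .loop (.lt (.var 80) (.var 0))
    (.store aBase (.var 80) (.var 81) ;;
     .add 81 (.var 81) (.var 0) ;;
     .add 81 (.var 81) (.const 1) ;;
     .add 80 (.var 80) (.const 1))

theorem initBase_spec (hB : bound g k ≤ B) (hs : Input g k s) :
    wp B initBase s fun t s' => (∀ v < g.n, s'.arrs aBase v = v * (g.n + 1)) ∧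
      t ≤ 5 * g.n + 10 := by
  refine step_set 0 ?_
  refine step_set 0 ?_
  refine wp_for (fun i s' => s'.vars 81 = i * (g.n + 1) ∧ ∀ v < i, s'.arrs aBase v = v * (g.n + 1))
    (fun i => 5 * (g.n - i)) 0 rfl (Nat.zero_le _) (fun s' hf => (hf.v 0 rfl).trans hs.vn)
    ⟨by simp, fun v hv => by omega⟩ ?_ ?_
  · rintro i s' - hb e80 ⟨e81, h⟩ hf
    have f0 : s'.vars 0 = g.n := (hf.v 0 rfl).trans hs.vn
    have h1 := row_lt_bound hB hb (le_refl g.n)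
    have h2 : (i + 1) * (g.n + 1) < B := by
      unfold bound at hB; nlinarith
    refine step_store i (i * (g.n + 1)) ?_
    refine step_add (i * (g.n + 1) + g.n) ?_ h1
    refine step_add ((i + 1) * (g.n + 1)) (hv := by simp; ring) ?_ h2
    refine end_add (i + 1) ⟨by simp, ⟨by simp, fun v hv => ?_⟩, by omega⟩
    rcases Nat.lt_succ_iff_lt_or_eq.1 hv with h' | rfl
    · simp [Function.update_of_ne h'.ne, h v h']
    · simp
  · exact fun t s' _ h _ ht => ⟨h.2, by omega⟩

/-- Fills the adjacency matrix. -/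
def initAdj : Prog :=
  .set 80 (.const 0) ;;
  .loop (.lt (.var 80) (.var 0))
    (.load 82 aOff (.var 80) ;;
     .add 83 (.var 80) (.const 1) ;;
     .load 83 aOff (.var 83) ;;
     .load 86 aBase (.var 80) ;;
     .loop (.lt (.var 82) (.var 83))
       (.load 84 aNb (.var 82) ;;
        .add 84 (.var 86) (.var 84) ;;
        .store aAdj (.var 84) (.const 1) ;;
        .add 82 (.var 82) (.const 1)) ;;
     .add 80 (.var 80) (.const 1))

theorem initAdj_spec (hB : bound g k ≤ B) (hs : Input g k s)
    (hbase : ∀ v < g.n, s.arrs aBase v = v * (g.n + 1)) (h0 : ∀ j, s.arrs aAdj j = 0) :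
    wp B initAdj s fun t s' => Static g k s' ∧ t ≤ 10 * (g.off g.n + g.n) + 10 := by
  refine step_set 0 ?_
  refine wp_for (fun i s' => ∀ u < g.n, ∀ v < g.n,
    s'.arrs aAdj (u * (g.n + 1) + v) = if u < i ∧ v ∈ g.N u then 1 else 0)
    (fun i => 5 * (g.off g.n - g.off i) + 10 * (g.n - i)) 0 rfl (Nat.zero_le _)
    (fun s' hf => (hf.v 0 rfl).trans hs.vn) (fun u hu v hv => by simp [h0]) ?_ ?_
  · rintro i s' - hb e80 h hf
    have fo : s'.arrs aOff = g.off := (hf.a 0 rfl).trans (by simp [hs.off])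
    have fn : s'.arrs aNb = g.nb := (hf.a 1 rfl).trans (by simp [hs.nb])
    have fb : s'.arrs aBase = s.arrs aBase := hf.arr
    have hmono := g.mono i hb
    have ho1 := off_le_n (g := g) (v := i + 1) hb
    have hrow := row_lt_bound hB hb (Nat.zero_le g.n)
    refine step_load (g.off i) ?_
    refine step_add (i + 1) ?_
    refine step_load (g.off (i + 1)) ?_
    refine step_load (i * (g.n + 1)) ?_
    refine wp_seq.2 (wp_for (fun j s₁ => ∀ u < g.n, ∀ v < g.n, s₁.arrs aAdj (u * (g.n + 1) + v) =
        if u < i ∧ v ∈ g.N u ∨ u = i ∧ v ∈ (Finset.Ico (g.off i) j).image g.nb then 1 else 0)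
      (fun j => 5 * (g.off (i + 1) - j)) (g.off i) rfl hmono (fun s' hf => hf.v 83 rfl)
      (fun u hu v hv => by simp [h u hu v hv]) ?_ ?_)
    · rintro j s₁ hj1 hb₁ e82 h' hf₁
      have f86 : s₁.vars 86 = i * (g.n + 1) := hf₁.var
      have fn₁ : s₁.arrs aNb = g.nb := hf₁.arr
      have hw := g.lt i hb j hj1 hb₁
      have hrow₁ := row_lt_bound hB hb hw.le
      refine step_load (g.nb j) ?_
      refine step_add (i * (g.n + 1) + g.nb j) ?_ hrow₁
      refine step_store (i * (g.n + 1) + g.nb j) 1 ?_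
      refine end_add (j + 1) ⟨by simp, fun u hu v hv => ?_, by omega⟩
      simp only [setVar_arrs, setArr_arrs, reduceIte]
      rw [← Finset.insert_Ico_right_eq_Ico_add_one hj1, Finset.image_insert]
      by_cases huv : u = i ∧ v = g.nb j
      · obtain ⟨rfl, rfl⟩ := huv
        simp
      · rw [Function.update_of_ne, h' u hu v hv]
        · congr 1
          simp only [Finset.mem_insert, eq_iff_iff]
          refine or_congr_right (and_congr_right fun e => ?_)
          rw [or_iff_right fun e' => huv ⟨e, e'⟩]
        · exact fun e => huv (row_inj hv.le hw.le e)
    · rintro t₁ s₁ - h' hf₁ ht₁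
      refine end_add (i + 1) (hv := by simp [hf₁.v 80 rfl, e80]) ⟨by simp, fun u hu v hv => ?_, by omega⟩
      simp only [setVar_arrs]
      rw [h' u hu v hv]
      congr 1
      simp only [eq_iff_iff]
      constructor
      · rintro (h1 | ⟨rfl, h1⟩)
        exacts [⟨by omega, h1.2⟩, ⟨by omega, h1⟩]
      · rintro ⟨h1, h2⟩
        rcases Nat.lt_succ_iff_lt_or_eq.1 h1 with h3 | rfl
        exacts [.inl ⟨h3, h2⟩, .inr ⟨rfl, h2⟩]
  · refine fun t s' _ h hf ht => ⟨⟨(hf.v 0 rfl).trans hs.vn, (hf.v 1 rfl).trans hs.vk,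
      (hf.a 0 rfl).trans hs.off, (hf.a 1 rfl).trans hs.nb, by rw [hf.a 2 rfl]; exact hbase,
      fun u hu v hv => by simp [h u hu v hv, hu]⟩, ?_⟩
    rw [g.off_zero] at ht
    omega

/-- Lists the vertices of large degree, and hides them from depth-first search. -/
def initBig : Prog :=
  .set 30 (.const 0) ;;
  .set 80 (.const 0) ;;
  .loop (.lt (.var 80) (.var 0))
    (.load 82 aOff (.var 80) ;;
     .add 83 (.var 80) (.const 1) ;;
     .load 83 aOff (.var 83) ;;
     .sub 83 (.var 83) (.var 82) ;;
     .branch (.lt (.var 1) (.var 83))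
       (.store aBig (.var 30) (.var 80) ;;
        .add 30 (.var 30) (.const 1) ;;
        .add 84 (.var 0) (.const 1) ;;
        .store aIdx (.var 80) (.var 84))
       .skip ;;
     .add 80 (.var 80) (.const 1))

/-- The vertices of degree more than `k`. -/
def bigSet (g : Net) (k : ℕ) : Finset ℕ := (Finset.range g.n).filter (k < g.deg ·)

theorem initBig_spec (hB : bound g k ≤ B) (hs : Static g k s) (h0 : ∀ v, s.arrs aIdx v = 0) :
    wp B initBig s fun t s' =>
      (∀ v, s'.arrs aIdx v = if v < g.n ∧ k < g.deg v then g.n + 1 else 0) ∧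
      s'.vars 30 = (bigSet g k).card ∧
      (∀ l < (bigSet g k).card, s'.arrs aBig l < g.n) ∧
      (∀ l < (bigSet g k).card, ∀ l' < (bigSet g k).card,
        s'.arrs aBig l = s'.arrs aBig l' → l = l') ∧
      (∀ v < g.n, (∃ l < (bigSet g k).card, s'.arrs aBig l = v) ↔ k < g.deg v) ∧
      t ≤ 15 * g.n + 10 := by
  refine step_set 0 ?_
  refine step_set 0 ?_
  let S (i : ℕ) : Finset ℕ := (Finset.range i).filter (k < g.deg ·)
  have hSs : ∀ i, S (i + 1) = if k < g.deg i then insert i (S i) else S i := fun i => by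
    simp only [S, Finset.range_add_one, Finset.filter_insert]
  have hSn : ∀ i, i ∉ S i := fun i hi => by simp [S] at hi
  have hSc : ∀ i, (S i).card ≤ i := fun i => by
    simpa using Finset.card_filter_le (Finset.range i) (k < g.deg ·)
  refine wp_for (fun i s' => s'.vars 30 = (S i).card ∧
    (∀ v, s'.arrs aIdx v = if v < i ∧ k < g.deg v then g.n + 1 else 0) ∧
    (∀ l < (S i).card, s'.arrs aBig l < i) ∧
    (∀ l < (S i).card, ∀ l' < (S i).card, s'.arrs aBig l = s'.arrs aBig l' → l = l') ∧
    (∀ v < i, (∃ l < (S i).card, s'.arrs aBig l = v) ↔ k < g.deg v)) (fun i => 15 * (g.n - i)) 0 rfl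
    (Nat.zero_le _) (fun s' hf => (hf.v 0 rfl).trans hs.vn) ⟨by simp [S], by simp [h0], by simp [S],
      by simp [S], fun v hv => by omega⟩ ?_ fun t s' _ ⟨h1, h2, h3, h4, h5⟩ _ _ =>
      ⟨h2, h1, h3, h4, h5, by omega⟩
  · rintro i s' - hb e80 ⟨e30, hidx, hlt, hinj, hmem⟩ hf
    have f0 : s'.vars 0 = g.n := (hf.v 0 rfl).trans hs.vn
    have f1 : s'.vars 1 = k := (hf.v 1 rfl).trans (by simp [hs.vk])
    have fo : s'.arrs aOff = g.off := (hf.a 0 rfl).trans (by simp [hs.off])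
    have hmono := g.mono i hb
    have ho1 := off_le_n (g := g) (v := i + 1) hb
    have hdeg : g.off (i + 1) - g.off i = g.deg i := rfl
    have hci := hSc i
    have hdn := g.deg_lt hb
    refine step_load (g.off i) ?_
    refine step_add (i + 1) ?_
    refine step_load (g.off (i + 1)) ?_
    refine step_sub (g.deg i) ?_
    refine wp_seq.2 (wp_branch.2 ⟨fun hb' => ?_, fun hb' => ?_⟩) <;>
      simp only [holds_lt, val_var, setVar_vars, reduceIte, Nat.reduceEqDiff, f1] at hb'
    · have hS : S (i + 1) = insert i (S i) := by rw [hSs, if_pos hb']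
      have hcard : (S (i + 1)).card = (S i).card + 1 := by
        rw [hS, Finset.card_insert_of_notMem (hSn i)]
      refine step_store (S i).card i ?_
      refine step_add ((S i).card + 1) ?_
      refine step_add (g.n + 1) ?_
      refine end_store i (g.n + 1) ?_
      refine end_add (i + 1) ⟨by simp, ⟨by simp [hcard], fun v => ?_, fun l hl => ?_, fun l hl l' hl' e => ?_,
        fun v hv => ?_⟩, by omega⟩
      · simp only [setVar_arrs, setArr_arrs, reduceIte, Nat.reduceEqDiff, Function.update_apply]
        by_cases hvi : v = i
        · subst hvi; simp [hb']
        · rw [if_neg hvi, hidx v]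
          congr 1
          simp only [eq_iff_iff]
          exact and_congr_left fun _ => by omega
      · rw [hcard] at hl
        simp only [setVar_arrs, setArr_arrs, reduceIte, Nat.reduceEqDiff, Function.update_apply]
        split_ifs with h'
        · omega
        · have := hlt l (by omega); omega
      · rw [hcard] at hl hl'
        simp only [setVar_arrs, setArr_arrs, reduceIte, Nat.reduceEqDiff, Function.update_apply] at e
        split_ifs at e with h1 h2 h2
        · omega
        · have := hlt l' (by omega); omega
        · have := hlt l (by omega); omega
        · exact hinj l (by omega) l' (by omega) e
      · rw [hcard]
        simp only [setVar_arrs, setArr_arrs, reduceIte, Nat.reduceEqDiff, Function.update_apply]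
        rcases Nat.lt_succ_iff_lt_or_eq.1 hv with h' | rfl
        · rw [← hmem v h']
          constructor
          · rintro ⟨l, hl, e⟩
            split_ifs at e with h1
            · omega
            · exact ⟨l, by omega, e⟩
          · rintro ⟨l, hl, e⟩
            exact ⟨l, by omega, by rw [if_neg (by omega), e]⟩
        · exact ⟨fun _ => hb', fun _ => ⟨_, by omega, if_pos rfl⟩⟩
    · have hS : S (i + 1) = S i := by rw [hSs, if_neg hb']
      refine wp_skip.2 ?_
      refine end_add (i + 1) ?_
      refine ⟨by simp, ⟨by simp [hS, e30], fun v => ?_, fun l hl => ?_, fun l hl l' hl' e => ?_,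
        fun v hv => ?_⟩, by omega⟩
      · simp only [setVar_arrs]
        rw [hidx v]
        congr 1
        simp only [eq_iff_iff]
        refine and_congr_left fun h' => ⟨fun _ => by omega, fun h1 => ?_⟩
        rcases Nat.lt_succ_iff_lt_or_eq.1 h1 with h2 | rfl
        exacts [h2, absurd h' hb']
      · rw [hS] at hl
        have := hlt l hl
        simp only [setVar_arrs]; omega
      · rw [hS] at hl hl'
        exact hinj l hl l' hl' e
      · rw [hS]
        simp only [setVar_arrs]
        rcases Nat.lt_succ_iff_lt_or_eq.1 hv with h' | rfl
        · exact hmem v h'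
        · refine ⟨fun ⟨l, hl, e⟩ => ?_, fun h => absurd h hb'⟩
          have := hlt l hl; omega

/-- What is computed before the vertices of large degree are coloured. -/
structure Ready (g : Net) (k q m : ℕ) (s : State) : Prop where
  static : Static g k s
  vq : s.vars 30 = q
  vm : s.vars 31 = m
  q_eq : q = (bigSet g k).card
  lt : ∀ l < q, s.arrs aBig l < g.n
  inj : ∀ l < q, ∀ l' < q, s.arrs aBig l = s.arrs aBig l' → l = l'
  big : ∀ v < g.n, (∃ l < q, s.arrs aBig l = v) ↔ k < g.deg v
  decomp : g.Decomp (fun v => v < g.n ∧ g.deg v ≤ k) (s.arrs aTree) (s.arrs aIdx) (s.arrs aLow)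
    (s.arrs aOrd) (s.arrs aBeg) m

theorem bigSet_card_le (g : Net) (k : ℕ) : (bigSet g k).card ≤ g.n := by
  unfold bigSet
  simpa using Finset.card_filter_le (Finset.range g.n) (k < g.deg ·)

/-- Prepares all data that depend only on the input. -/
def prepare : Prog := initBase ;; initAdj ;; initBig ;; dfsAll

theorem prepare_spec (hB : bound g k ≤ B) (hs : Input g k s) (hv : ∀ x, 2 ≤ x → s.vars x = 0)
    (ha : ∀ a, 2 ≤ a → ∀ j, s.arrs a j = 0) :
    wp B prepare s fun t s' => (∃ m, Ready g k (bigSet g k).card m s') ∧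
      t ≤ 300 * (g.off g.n + g.n) + 60 := by
  refine wp_seq.2 (wp_mono (initBase_spec hB hs) ?_)
  rintro t₁ s₁ hf₁ ⟨h₁, ht₁⟩
  have hs₁ : Input g k s₁ := hs.of_eq (hf₁.v 0 rfl) (hf₁.v 1 rfl) (hf₁.a 0 rfl) (hf₁.a 1 rfl)
  refine wp_seq.2 (wp_mono (initAdj_spec hB hs₁ h₁ fun j => by
    rw [hf₁.a 3 rfl]; exact ha 3 (by omega) j) ?_)
  rintro t₂ s₂ hf₂ ⟨hs₂, ht₂⟩
  refine wp_seq.2 (wp_mono (initBig_spec hB hs₂ fun v => by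
    rw [hf₂.a 13 rfl, hf₁.a 13 rfl]; exact ha 13 (by omega) v) ?_)
  rintro t₃ s₃ hf₃ ⟨hidx, e30, hlt, hinj, hbig, ht₃⟩
  have hs₃ : Static g k s₃ := hs₂.frame hf₃
  have hz : ∀ x, 2 ≤ x → initBase.writesVar x = false → initAdj.writesVar x = false →
      initBig.writesVar x = false → s₃.vars x = 0 := fun x h2 h3 h4 h5 => by
    rw [hf₃.v x h5, hf₂.v x h4, hf₁.v x h3]; exact hv x h2
  refine wp_mono (dfsAll_spec (H := fun v => v < g.n ∧ g.deg v ≤ k) hB hs₃ (fun v hv => hv.1)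
    (fun v hv hn => ?_) (fun v hv => ?_) (fun v hv => ?_) (hz 36 (by omega) rfl rfl rfl)
    (hz 37 (by omega) rfl rfl rfl) (hz 38 (by omega) rfl rfl rfl) (hz 31 (by omega) rfl rfl rfl) ?_) ?_
  · rw [hidx, if_pos ⟨hv, by by_contra h; exact hn ⟨hv, by omega⟩⟩]
  · rw [hidx, if_neg (by omega)]
  · rw [hidx, if_neg (by omega)]
  · rw [hf₃.a 18 rfl, hf₂.a 18 rfl, hf₁.a 18 rfl]; exact ha 18 (by omega) 0
  rintro t₄ s₄ hf₄ ⟨hD, ht₄⟩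
  have e8 : s₄.arrs aBig = s₃.arrs aBig := hf₄.a 8 rfl
  refine ⟨⟨_, hs₃.frame hf₄, (hf₄.v 30 rfl).trans e30, rfl, rfl, by rwa [e8], by rwa [e8],
    by rwa [e8], hD⟩, by omega⟩


variable {g : Net} {k B : ℕ} {s : State}

/-! ### Counting through the colourings of the vertices of large degree -/

/-- The number with the digits `D l - 1`, for `l < q`, in base `b`. -/
def digitsVal (b q : ℕ) (D : ℕ → ℕ) : ℕ := ∑ l ∈ Finset.range q, (D l - 1) * b ^ l

theorem digitsVal_succ (b q : ℕ) (D : ℕ → ℕ) :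
    digitsVal b (q + 1) D = digitsVal b q D + (D q - 1) * b ^ q :=
  Finset.sum_range_succ _ _

theorem digitsVal_lt {b q : ℕ} {D : ℕ → ℕ} (h : ∀ l < q, 1 ≤ D l ∧ D l ≤ b) :
    digitsVal b q D < b ^ q := by
  induction q with
  | zero => simp [digitsVal]
  | succ q ih =>
    rw [digitsVal_succ, pow_succ]
    have h1 := ih fun l hl => h l (by omega)
    have h2 := h q (by omega)
    have h3 : D q - 1 + 1 ≤ b := by omega
    nlinarith [Nat.mul_le_mul_right (b ^ q) h3]

theorem digitsVal_inj {b q : ℕ} {D D' : ℕ → ℕ} (h : ∀ l < q, 1 ≤ D l ∧ D l ≤ b)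
    (h' : ∀ l < q, 1 ≤ D' l ∧ D' l ≤ b) (e : digitsVal b q D = digitsVal b q D') :
    ∀ l < q, D l = D' l := by
  induction q with
  | zero => intro l hl; omega
  | succ q ih =>
    rw [digitsVal_succ, digitsVal_succ] at e
    have h1 := digitsVal_lt fun l hl => h l (Nat.lt_succ_of_lt hl)
    have h2 := digitsVal_lt fun l hl => h' l (Nat.lt_succ_of_lt hl)
    have h3 := h q (by omega)
    have h4 := h' q (by omega)
    have h5 : D q - 1 = D' q - 1 := by
      have h6 : (digitsVal b q D + (D q - 1) * b ^ q) / b ^ q =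
          (digitsVal b q D' + (D' q - 1) * b ^ q) / b ^ q := by rw [e]
      have hpos : 0 < b ^ q := by omega
      rwa [Nat.add_mul_div_right _ _ hpos, Nat.add_mul_div_right _ _ hpos, Nat.div_eq_of_lt h1,
        Nat.div_eq_of_lt h2, zero_add, zero_add] at h6
    rw [h5] at e
    intro l hl
    rcases Nat.lt_succ_iff_lt_or_eq.1 hl with h' | rfl
    · exact ih (fun l hl => h l (by omega)) (fun l hl => ‹∀ l < q + 1, 1 ≤ D' l ∧ D' l ≤ b› l (by omega))
        (by omega) l h'
    · omega

theorem digitsVal_update {b q : ℕ} {D : ℕ → ℕ} {i x : ℕ} (hi : i < q) :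
    digitsVal b q (Function.update D i x) + (D i - 1) * b ^ i =
      digitsVal b q D + (x - 1) * b ^ i := by
  have hi' := Finset.mem_range.2 hi
  unfold digitsVal
  rw [← Finset.add_sum_erase _ _ hi', ← Finset.add_sum_erase _ (fun l => (D l - 1) * b ^ l) hi',
    Finset.sum_congr rfl (g := fun l => (D l - 1) * b ^ l) fun l hl => by
      rw [Function.update_of_ne (Finset.ne_of_mem_erase hl)]]
  simp only [Function.update_self]
  omega

/-- Goes to the next colouring of the vertices of large degree; their number is in register 30,
and register 87 holds the largest colour. Register 88 becomes `0` if there is no next one. -/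
def nextDigits : Prog :=
  .set 80 (.const 0) ;;
  .set 89 (.const 1) ;;
  .loop (.eq (.var 89) (.const 1))
    (.branch (.lt (.var 80) (.var 30))
      (.load 81 aDig (.var 80) ;;
       .branch (.lt (.var 81) (.var 87))
         (.add 81 (.var 81) (.const 1) ;;
          .store aDig (.var 80) (.var 81) ;;
          .set 89 (.const 0))
         (.store aDig (.var 80) (.const 1) ;;
          .add 80 (.var 80) (.const 1)))
      (.set 89 (.const 0) ;; .set 88 (.const 0)))

theorem nextDigits_spec (hB : bound g k ≤ B) {q b : ℕ} (hq : q ≤ g.n) (hb : b ≤ g.n)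
    (e30 : s.vars 30 = q) (e87 : s.vars 87 = b) (e88 : s.vars 88 = 1)
    (hdig : ∀ l < q, 1 ≤ s.arrs aDig l ∧ s.arrs aDig l ≤ b) :
    wp B nextDigits s fun t s' =>
      (∀ l < q, 1 ≤ s'.arrs aDig l ∧ s'.arrs aDig l ≤ b) ∧
      (s'.vars 88 = 1 ∧ digitsVal b q (s'.arrs aDig) = digitsVal b q (s.arrs aDig) + 1 ∨
        s'.vars 88 = 0 ∧ b ^ q ≤ digitsVal b q (s.arrs aDig) + 1) ∧
      t ≤ 10 * q + 20 := by
  set D := s.arrs aDig with hD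
  refine step_set 0 ?_
  refine step_set 1 ?_
  refine wp_loop (fun c s' => (∀ l < q, 1 ≤ s'.arrs aDig l ∧ s'.arrs aDig l ≤ b) ∧
    (s'.vars 89 = 1 ∧ s'.vars 88 = 1 ∧ (∃ i ≤ q, s'.vars 80 = i ∧
        digitsVal b q (s'.arrs aDig) + b ^ i = digitsVal b q D + 1 ∧ c = 10 * (q - i) + 10) ∨
      s'.vars 89 = 0 ∧ c = 0 ∧ (s'.vars 88 = 1 ∧ digitsVal b q (s'.arrs aDig) = digitsVal b q D + 1 ∨
        s'.vars 88 = 0 ∧ b ^ q ≤ digitsVal b q D + 1))) (c := 10 * q + 10) ?_ ?_ ?_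
  · rintro c s' ⟨hdig', h⟩ hf hb'
    simp at hb'
    obtain ⟨e89, e88', i, hi, e80, hval, rfl⟩ := h.resolve_right (by omega)
    have f30 : s'.vars 30 = q := hf.var
    have f87 : s'.vars 87 = b := hf.var
    refine wp_branch.2 ⟨fun hb₁ => ?_, fun hb₁ => ?_⟩ <;>
      simp [e80, f30] at hb₁
    · have hi1 := hdig' i hb₁
      refine step_load (s'.arrs aDig i) ?_
      refine wp_branch.2 ⟨fun hb₂ => ?_, fun hb₂ => ?_⟩ <;>
        simp [f87] at hb₂
      · have hu := digitsVal_update (b := b) (D := s'.arrs aDig) (x := s'.arrs aDig i + 1) hb₁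
        have h1 : s'.arrs aDig i + 1 - 1 = s'.arrs aDig i - 1 + 1 := by omega
        rw [h1, Nat.succ_mul] at hu
        refine step_add (s'.arrs aDig i + 1) ?_
        refine step_store i (s'.arrs aDig i + 1) ?_
        refine end_set 0 ⟨0, ⟨fun l hl => ?_, .inr ⟨by simp, rfl, .inl ⟨by simp [e88'], ?_⟩⟩⟩, by omega⟩
        · simp only [setVar_arrs, setArr_arrs, reduceIte, Function.update_apply]
          split_ifs
          · omega
          · exact hdig' l hl
        · simp only [setVar_arrs, setArr_arrs, reduceIte]
          omega
      · have hu := digitsVal_update (b := b) (D := s'.arrs aDig) (x := 1) hb₁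
        have h1 : s'.arrs aDig i - 1 + 1 = b := by omega
        have h2 : b ^ (i + 1) = (s'.arrs aDig i - 1) * b ^ i + b ^ i := by
          rw [pow_succ, mul_comm, ← Nat.succ_mul, Nat.succ_eq_add_one, h1]
        refine step_store i 1 ?_
        refine end_add (i + 1) ⟨10 * (q - (i + 1)) + 10, ⟨fun l hl => ?_, .inl ⟨by simp [e89], by simp [e88'], i + 1,
          hb₁, by simp, ?_, rfl⟩⟩, by omega⟩
        · simp only [setVar_arrs, setArr_arrs, reduceIte, Function.update_apply]
          split_ifs
          · omega
          · exact hdig' l hl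
        · simp only [setVar_arrs, setArr_arrs, reduceIte]
          omega
    · obtain rfl : i = q := by omega
      refine step_set 0 ?_
      refine end_set 0 ⟨0, ⟨by simpa using hdig', .inr ⟨by simp, rfl, .inr ⟨by simp, by omega⟩⟩⟩, by omega⟩
  · exact ⟨by simpa [← hD] using hdig, .inl ⟨by simp, by simp [e88], 0, by omega, by simp,
      by simp [← hD], by omega⟩⟩
  · rintro t s' c ⟨hdig', h⟩ hf hb' hc
    simp at hb'
    obtain ⟨-, rfl, h'⟩ := h.resolve_left (fun h => hb' h.1)
    exact ⟨hdig', h', by omega⟩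

/-- If there is a proper colouring, then there is one in which the vertices in a list of length `q`
have colours up to `q` only: permute the colours. -/
theorem exists_colours_le {q : ℕ} {big : ℕ → ℕ} (hbig : ∀ l < q, big l < g.n) {ψ : ℕ → ℕ}
    (h1 : ∀ v < g.n, 1 ≤ ψ v ∧ ψ v ≤ k) (h2 : ∀ u v, v ∈ g.N u → ψ u ≠ ψ v) :
    ∃ ψ' : ℕ → ℕ, (∀ v < g.n, 1 ≤ ψ' v ∧ ψ' v ≤ k) ∧ (∀ u v, v ∈ g.N u → ψ' u ≠ ψ' v) ∧
      ∀ l < q, 1 ≤ ψ' (big l) ∧ ψ' (big l) ≤ min k q := by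
  rcases le_total k q with hkq | hkq
  · exact ⟨ψ, h1, h2, fun l hl => by rw [min_eq_left hkq]; exact h1 _ (hbig l hl)⟩
  have hex : ∀ c : ℕ, ∃ l, c ∈ (Finset.range q).image (fun l => ψ (big l)) → l < q ∧ ψ (big l) = c := by
    intro c
    by_cases hc : c ∈ (Finset.range q).image (fun l => ψ (big l))
    · obtain ⟨l, hl, e⟩ := Finset.mem_image.1 hc
      exact ⟨l, fun _ => ⟨Finset.mem_range.1 hl, e⟩⟩
    · exact ⟨0, fun h => absurd h hc⟩
  choose f hf using hex
  obtain ⟨e, he⟩ := Finset.exists_equiv_extend_of_card_eq (α := Finset.Icc 1 k) (t := Finset.Icc 1 k)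
    (by simp) (s := Finset.univ.filter fun c : Finset.Icc 1 k =>
      (c : ℕ) ∈ (Finset.range q).image (fun l => ψ (big l))) (f := fun c => f c + 1)
    (fun x hx => by
      obtain ⟨c, hc, rfl⟩ := Finset.mem_image.1 hx
      have := (hf c (Finset.mem_filter.1 hc).2).1
      rw [Finset.mem_Icc]; omega)
    (fun c hc c' hc' h => by
      simp only [Finset.coe_filter, Finset.mem_univ, true_and, Set.mem_ofPred_eq] at hc hc'
      have h3 := (hf c hc).2
      have h4 := (hf c' hc').2
      have h5 : f c = f c' := by simpa using h
      rw [h5] at h3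
      exact Subtype.ext (h3.symm.trans h4))
  refine ⟨fun v => if h : ψ v ∈ Finset.Icc 1 k then e ⟨ψ v, h⟩ else 0, fun v hv => ?_,
    fun u v huv => ?_, fun l hl => ?_⟩
  · have h := Finset.mem_Icc.2 (h1 v hv)
    simp only [h, dif_pos]
    exact Finset.mem_Icc.1 (e ⟨ψ v, h⟩).2
  · have hu := Finset.mem_Icc.2 (h1 u (Net.N_lt_left huv))
    have hv := Finset.mem_Icc.2 (h1 v (Net.N_lt huv))
    simp only [hu, hv, dif_pos]
    intro h
    have := e.injective (Subtype.ext h)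
    simp only [Subtype.mk.injEq] at this
    exact h2 u v huv this
  · have h := Finset.mem_Icc.2 (h1 _ (hbig l hl))
    have hmem : ψ (big l) ∈ (Finset.range q).image (fun l => ψ (big l)) :=
      Finset.mem_image_of_mem _ (Finset.mem_range.2 hl)
    have h3 := he ⟨ψ (big l), h⟩ (by simpa using hmem)
    simp only [h, dif_pos, h3, min_eq_right hkq]
    have := (hf _ hmem).1
    omega

/-- Sets register 87 to the smaller one of the number of colours and the number of vertices of
large degree, and gives the first colour to all these vertices. -/
def initDigits : Prog :=
  .set 87 (.var 1) ;;
  .branch (.lt (.var 30) (.var 87)) (.set 87 (.var 30)) .skip ;;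
  .set 80 (.const 0) ;;
  .loop (.lt (.var 80) (.var 30))
    (.store aDig (.var 80) (.const 1) ;;
     .add 80 (.var 80) (.const 1))

theorem initDigits_spec (hB : bound g k ≤ B) {q : ℕ} (hq : q ≤ g.n) (e30 : s.vars 30 = q)
    (e1 : s.vars 1 = k) :
    wp B initDigits s fun t s' => s'.vars 87 = min k q ∧ (∀ l < q, s'.arrs aDig l = 1) ∧
      t ≤ 3 * q + 10 := by
  refine step_set k ?_
  refine step_min (a := q) (b := k) (by simp [e30]) (by simp) ?_
  refine step_set 0 ?_
  refine wp_for (fun i s₁ => ∀ l < i, s₁.arrs aDig l = 1) (fun i => 3 * (q - i)) 0 rfl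
    (Nat.zero_le _) (fun s' hf => (hf.v 30 rfl).trans (by simp [e30])) (fun l hl => by omega) ?_
    fun t s₁ _ h hf _ => ⟨(hf.v 87 rfl).trans (by simp [min_comm]), h, by omega⟩
  rintro i s₁ - hb e80 h hf
  refine step_store i 1 ?_
  refine end_add (i + 1) ⟨by simp, fun l hl => ?_, by omega⟩
  simp only [setVar_arrs, setArr_arrs, reduceIte, Function.update_apply]
  split_ifs
  · rfl
  · exact h l (by omega)

/-- Tries all colourings of the vertices of large degree. -/
def search : Prog :=
  initDigits ;;
  .set 88 (.const 1) ;;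
  .loop (.eq (.var 88) (.const 1))
    (trial ;;
     .branch (.eq (.var 32) (.const 1)) (.set 88 (.const 0)) nextDigits)

theorem Ready.frame {P : Prog} {s' : State} {q m : ℕ} (h : Ready g k q m s) (hf : Frame P s s')
    (h1 : P.safe = true := by rfl) (h2 : P.writesVar 30 = false := by rfl)
    (h3 : P.writesVar 31 = false := by rfl) (h4 : P.writesArr aBig = false := by rfl)
    (h5 : P.writesArr aTree = false := by rfl) (h6 : P.writesArr aIdx = false := by rfl)
    (h7 : P.writesArr aLow = false := by rfl) (h8 : P.writesArr aOrd = false := by rfl)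
    (h9 : P.writesArr aBeg = false := by rfl) : Ready g k q m s' := by
  have e4 := hf.a _ h4
  have e5 := hf.a _ h5
  have e6 := hf.a _ h6
  have e7 := hf.a _ h7
  have e8 := hf.a _ h8
  have e9 := hf.a _ h9
  exact ⟨h.static.frame hf h1, (hf.v _ h2).trans h.vq, (hf.v _ h3).trans h.vm, h.q_eq,
    by rw [e4]; exact h.lt, by rw [e4]; exact h.inj, by rw [e4]; exact h.big,
    by rw [e5, e6, e7, e8, e9]; exact h.decomp⟩

theorem search_spec (hB : bound g k ≤ B) (hk : 1 ≤ k) {q m : ℕ} (hR : Ready g k q m s) (hr : Rep g s)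
    (hn : ∀ v < g.n, s.arrs aCol v ≤ g.n) (hin : ∀ v < g.n, s.arrs aIn v = 0) :
    wp B search s fun t s' => Static g k s' ∧
      (s'.vars 32 = 1 ∧ g.Good k (s'.arrs aCol) ∧ (∀ v < g.n, s'.arrs aCol v ≠ 0) ∨
       s'.vars 32 = 0 ∧ ¬ ∃ ψ : ℕ → ℕ, (∀ v < g.n, 1 ≤ ψ v ∧ ψ v ≤ k) ∧
        (∀ u v, v ∈ g.N u → ψ u ≠ ψ v)) ∧
      t ≤ (min k q) ^ q * (1020 * (g.off g.n + g.n) + 100) + 3 * g.n + 30 := by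
  have hq : q ≤ g.n := hR.q_eq ▸ bigSet_card_le g k
  obtain ⟨b, hb⟩ : ∃ b, b = min k q := ⟨_, rfl⟩
  have hbq : b ≤ q := hb ▸ min_le_right _ _
  have hb1 : ∀ l < q, 1 ≤ b := fun l hl => by rw [hb]; exact le_min hk (by omega)
  rw [← hb]
  obtain ⟨big, hbig⟩ : ∃ big, big = s.arrs aBig := ⟨_, rfl⟩
  obtain ⟨K, hK⟩ : ∃ K, K = 1020 * (g.off g.n + g.n) + 100 := ⟨_, rfl⟩
  rw [← hK]
  refine wp_seq.2 (wp_mono (initDigits_spec hB hq hR.vq hR.static.vk) ?_)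
  rintro t₁ s₁ hf₁ ⟨e87, hdig₁, ht₁⟩
  rw [← hb] at e87
  have hR₁ : Ready g k q m s₁ := hR.frame hf₁
  refine step_set 1 ?_
  -- no colouring of the large vertices that comes before `D` extends
  let Fail (N : ℕ) : Prop := ∀ D : ℕ → ℕ, (∀ l < q, 1 ≤ D l ∧ D l ≤ b) → digitsVal b q D < N →
    ¬ ∃ ψ : ℕ → ℕ, (∀ v < g.n, 1 ≤ ψ v ∧ ψ v ≤ k) ∧ (∀ u v, v ∈ g.N u → ψ u ≠ ψ v) ∧
      ∀ l < q, ψ (big l) = D l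
  have hdone : Fail (b ^ q) → ¬ ∃ ψ : ℕ → ℕ, (∀ v < g.n, 1 ≤ ψ v ∧ ψ v ≤ k) ∧
      (∀ u v, v ∈ g.N u → ψ u ≠ ψ v) := by
    rintro hF ⟨ψ, h1, h2⟩
    obtain ⟨ψ', h1, h2, h3⟩ := exists_colours_le (q := q) (big := big) (hbig ▸ hR.lt) h1 h2
    rw [← hb] at h3
    exact hF (fun l => ψ' (big l)) h3 (digitsVal_lt h3) ⟨ψ', h1, h2, fun l _ => rfl⟩
  refine wp_loop (fun c s' => s'.vars 87 = b ∧ Ready g k q m s' ∧ Rep g s' ∧ s'.arrs aBig = big ∧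
    (∀ v < g.n, s'.arrs aCol v ≤ g.n) ∧ (∀ v < g.n, s'.arrs aIn v = 0) ∧
    (∀ l < q, 1 ≤ s'.arrs aDig l ∧ s'.arrs aDig l ≤ b) ∧
    (s'.vars 88 = 1 ∧ Fail (digitsVal b q (s'.arrs aDig)) ∧
        c = (b ^ q - digitsVal b q (s'.arrs aDig)) * K ∨
      s'.vars 88 = 0 ∧ c = 0 ∧
        (s'.vars 32 = 1 ∧ g.Good k (s'.arrs aCol) ∧ (∀ v < g.n, s'.arrs aCol v ≠ 0) ∨
         s'.vars 32 = 0 ∧ Fail (b ^ q)))) (c := b ^ q * K) ?_ ?_ ?_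
  · rintro c s₂ ⟨f87, hR₂, hr₂, fbig, hn₂, hin₂, hdig₂, h⟩ hf₂ hb₂
    simp at hb₂
    obtain ⟨-, hF, rfl⟩ := h.resolve_right (by omega)
    have hlt := digitsVal_lt hdig₂
    have hpay : (b ^ q - (digitsVal b q (s₂.arrs aDig) + 1)) * K + K =
        (b ^ q - digitsVal b q (s₂.arrs aDig)) * K := by
      rw [← Nat.succ_mul]; congr 1; omega
    refine wp_seq.2 (wp_mono (trial_spec hB hR₂.static hr₂ hn₂ hin₂ hR₂.vq hR₂.vm hq hR₂.lt hR₂.inj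
      hR₂.big (fun l hl => by have := hdig₂ l hl; omega) hR₂.decomp) ?_)
    rintro t₃ s₃ hf₃ ⟨hr₃, hn₃, hin₃, h₃, ht₃⟩
    have hR₃ : Ready g k q m s₃ := hR₂.frame hf₃
    have e9 : s₃.arrs aDig = s₂.arrs aDig := hf₃.a 9 rfl
    have e8 : s₃.arrs aBig = big := hf₃.arr
    have e87₃ : s₃.vars 87 = b := hf₃.var
    have e88₃ : s₃.vars 88 = 1 := hf₃.var
    refine wp_branch.2 ⟨fun hb₃ => ?_, fun hb₃ => ?_⟩ <;>
      simp at hb₃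
    · obtain ⟨-, hg₃, hall₃⟩ := h₃.resolve_right (by omega)
      refine end_set 0 ⟨0, ⟨by simp [e87₃], ?_, hr₃.of_eq, e8, hn₃, hin₃, by
        simpa [e9] using hdig₂, .inr ⟨by simp, rfl, .inl ⟨by simp [hb₃], hg₃, hall₃⟩⟩⟩, by omega⟩
      exact ⟨hR₃.static.of_eq, hR₃.vq, hR₃.vm, hR₃.q_eq, hR₃.lt, hR₃.inj,
        hR₃.big, hR₃.decomp⟩
    · obtain ⟨e32, hno⟩ := h₃.resolve_left (fun h => hb₃ h.1)
      rw [fbig] at hno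
      have hF' : Fail (digitsVal b q (s₂.arrs aDig) + 1) := by
        intro D hD hlt hψ
        rcases Nat.lt_succ_iff_lt_or_eq.1 hlt with h' | h'
        · exact hF D hD h' hψ
        · obtain ⟨ψ, h1, h2, h3⟩ := hψ
          exact hno ⟨ψ, h1, h2, fun l hl => (h3 l hl).trans (digitsVal_inj hD hdig₂ h' l hl)⟩
      refine wp_mono (nextDigits_spec hB hq (hbq.trans hq) hR₃.vq e87₃ e88₃ (by rwa [e9])) ?_
      rintro t₄ s₄ hf₄ ⟨hdig₄, h₄, ht₄⟩
      rw [e9] at h₄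
      refine ⟨(b ^ q - (digitsVal b q (s₂.arrs aDig) + 1)) * K * (s₄.vars 88), ⟨(hf₄.v 87 rfl).trans e87₃,
        hR₃.frame hf₄, hr₃.frame hf₄, (hf₄.a 8 rfl).trans e8, by rwa [hf₄.a 4 rfl],
        by rwa [hf₄.a 11 rfl], hdig₄, ?_⟩, ?_⟩
      · rcases h₄ with ⟨e88, hval⟩ | ⟨e88, hval⟩
        · exact .inl ⟨e88, by rwa [hval], by rw [hval, e88, mul_one]⟩
        · refine .inr ⟨e88, by rw [e88, mul_zero], .inr ⟨(hf₄.v 32 rfl).trans e32, fun D hD hlt => ?_⟩⟩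
          exact hF' D hD (by omega)
      · have : (b ^ q - (digitsVal b q (s₂.arrs aDig) + 1)) * K * (s₄.vars 88) ≤
            (b ^ q - (digitsVal b q (s₂.arrs aDig) + 1)) * K := by
          rcases h₄ with ⟨e88, -⟩ | ⟨e88, -⟩ <;> simp [e88]
        omega
  · have hr₁ : Rep g s₁ := hr.frame hf₁
    refine ⟨by simp [e87], ⟨hR₁.static.of_eq, hR₁.vq, hR₁.vm, hR₁.q_eq, hR₁.lt,
        hR₁.inj, hR₁.big, hR₁.decomp⟩, hr₁.of_eq, (hf₁.a 8 rfl).trans hbig.symm,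
      by simpa [hf₁.a 4 rfl] using hn, by simpa [hf₁.a 11 rfl] using hin, fun l hl => ?_, .inl ⟨by simp,
        ?_, ?_⟩⟩
    · simp only [setVar_arrs, hdig₁ l hl]
      exact ⟨le_rfl, hb1 l hl⟩
    · have : digitsVal b q (s₁.arrs aDig) = 0 := Finset.sum_eq_zero fun l hl => by
        rw [hdig₁ l (Finset.mem_range.1 hl)]; simp
      simp only [setVar_arrs, this]
      exact fun D hD h => absurd h (Nat.not_lt_zero _)
    · have : digitsVal b q (s₁.arrs aDig) = 0 := Finset.sum_eq_zero fun l hl => by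
        rw [hdig₁ l (Finset.mem_range.1 hl)]; simp
      simp [this]
  · rintro t s₂ c ⟨f87, hR₂, hr₂, fbig, hn₂, hin₂, hdig₂, h⟩ hf₂ hb₂ hc
    simp at hb₂
    obtain ⟨-, rfl, h'⟩ := h.resolve_left (fun h => hb₂ h.1)
    exact ⟨hR₂.static, h'.imp_right fun h => ⟨h.1, hdone h.2⟩, by omega⟩


variable {g : Net} {k B : ℕ} {s : State}

/-! ### The whole program -/

/-- Writes the answer. -/
def output : Prog :=
  .branch (.eq (.var 32) (.const 1))
    (.set 80 (.const 0) ;;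
     .loop (.lt (.var 80) (.var 0))
       (.load 81 aCol (.var 80) ;;
        .store aOff (.var 80) (.var 81) ;;
        .add 80 (.var 80) (.const 1)) ;;
     .set 0 (.const 1))
    (.set 0 (.const 0))

theorem output_spec (hB : bound g k ≤ B) (hs : Static g k s)
    (hcol : s.vars 32 = 1 → ∀ v < g.n, s.arrs aCol v ≤ k) :
    wp B output s fun t s' =>
      (s.vars 32 = 1 → s'.vars 0 = 1 ∧ ∀ v < g.n, s'.arrs 0 v = s.arrs aCol v) ∧
      (s.vars 32 ≠ 1 → s'.vars 0 = 0) ∧ t ≤ 5 * g.n + 10 := by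
  refine wp_branch.2 ⟨fun hb => ?_, fun hb => ?_⟩ <;>
    simp at hb
  · have hcol := hcol hb
    refine step_set 0 ?_
    refine wp_seq.2 (wp_for (fun i s' => ∀ v < i, s'.arrs 0 v = s.arrs aCol v)
      (fun i => 4 * (g.n - i)) 0 rfl (Nat.zero_le _) (fun s' hf => (hf.v 0 rfl).trans hs.vn)
      (fun v hv => by omega) ?_ ?_)
    · rintro i s' - hb' e80 h hf
      have f4 : s'.arrs aCol = s.arrs aCol := hf.arr
      have := hcol i hb'
      refine step_load (s.arrs aCol i) ?_
      refine step_store i (s.arrs aCol i) ?_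
      refine end_add (i + 1) ⟨by simp, fun v hv => ?_, by omega⟩
      simp only [setVar_arrs, setArr_arrs, reduceIte, Function.update_apply]
      split_ifs with hvi
      · rw [hvi]
      · exact h v (by omega)
    · rintro t s' - h hf hc
      exact end_set 1 ⟨fun _ => ⟨by simp, fun v hv => by simp [h v hv]⟩, fun h' => absurd hb h',
        by omega⟩
  · exact end_set 0 ⟨fun h => absurd h hb, fun _ => by simp, by omega⟩

/-- Looks for a proper colouring. -/
def solve : Prog :=
  .branch (.eq (.var 0) (.const 0)) (.set 0 (.const 1))
    (.branch (.eq (.var 1) (.const 0)) (.set 0 (.const 0))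
      (prepare ;; search ;; output))

theorem solve_spec (hB : bound g k ≤ B) (hs : Input g k s) (hv : ∀ x, 2 ≤ x → s.vars x = 0)
    (ha : ∀ a, 2 ≤ a → ∀ j, s.arrs a j = 0) :
    wp B solve s fun t s' =>
      (s'.vars 0 = 1 ∧ (∀ v < g.n, 1 ≤ s'.arrs 0 v ∧ s'.arrs 0 v ≤ k) ∧
          (∀ u v, v ∈ g.N u → s'.arrs 0 u ≠ s'.arrs 0 v) ∨
        s'.vars 0 = 0 ∧ ¬ ∃ ψ : ℕ → ℕ, (∀ v < g.n, 1 ≤ ψ v ∧ ψ v ≤ k) ∧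
          (∀ u v, v ∈ g.N u → ψ u ≠ ψ v)) ∧
      t ≤ max 1 (min k (bigSet g k).card ^ (bigSet g k).card) * (2000 * (g.off g.n + g.n) + 300) := by
  obtain ⟨q, hq⟩ : ∃ q, q = (bigSet g k).card := ⟨_, rfl⟩
  have hqn : q ≤ g.n := hq ▸ bigSet_card_le g k
  rw [← hq]
  refine wp_branch.2 ⟨fun hb => ?_, fun hb => ?_⟩ <;>
    simp [hs.vn] at hb
  · obtain rfl : q = 0 := by omega
    refine end_set 1 ⟨.inl ⟨by simp, fun v hv => by omega, fun u v huv => ?_⟩, by simp⟩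
    have := Net.N_lt huv
    omega
  refine wp_branch.2 ⟨fun hb' => ?_, fun hb' => ?_⟩ <;>
    simp [hs.vk] at hb'
  · subst hb'
    refine end_set 0 ⟨.inr ⟨by simp, fun ⟨ψ, h, _⟩ => ?_⟩, ?_⟩
    · have := h 0 (by omega)
      omega
    · exact Nat.le_trans (by omega) (Nat.mul_le_mul_right _ (le_max_left 1 _))
  · have hk : 1 ≤ k := by omega
    have hX : 1 ≤ min k q ^ q := by
      rcases Nat.eq_zero_or_pos q with rfl | h0
      · simp
      · exact Nat.one_le_pow _ _ (by omega)
    refine wp_seq.2 (wp_mono (prepare_spec hB hs hv ha) ?_)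
    rintro t₁ s₁ hf₁ ⟨⟨m, hR⟩, ht₁⟩
    rw [← hq] at hR
    have hz : ∀ a, 2 ≤ a → prepare.writesArr a = false → ∀ j, s₁.arrs a j = 0 := fun a h2 h3 j => by
      rw [hf₁.a a h3]; exact ha a h2 j
    have h4 := hz 4 (by omega) rfl
    have hr₁ : Rep g s₁ := by
      have hused : ∀ v, g.used (s₁.arrs aCol) v = ∅ := fun v => by
        refine Finset.eq_empty_of_forall_notMem fun c hc => ?_
        obtain ⟨h1, w, -, h2⟩ := Net.mem_used.1 hc
        exact h1 (h2.symm.trans (h4 w))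
      refine ⟨fun v hv c _ _ => ?_, fun v hv => ?_, fun v hv => ?_⟩
      · rw [hused]; simpa using hz 5 (by omega) rfl _
      · rw [hused]; simpa using hz 6 (by omega) rfl v
      · rw [hz 7 (by omega) rfl v]
        simp [Net.done, h4]
    refine wp_seq.2 (wp_mono (search_spec hB hk hR hr₁ (fun v _ => by rw [h4]; omega)
      fun v _ => hz 11 (by omega) rfl v) ?_)
    rintro t₂ s₂ hf₂ ⟨hs₂, h₂, ht₂⟩
    refine wp_mono (output_spec hB hs₂ fun h => ?_) ?_
    · exact (h₂.resolve_right (by omega)).2.1.le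
    rintro t₃ s₃ hf₃ ⟨h₃, h₃', ht₃⟩
    refine ⟨?_, ?_⟩
    · rcases h₂ with ⟨e, hg, hall⟩ | ⟨e, hno⟩
      · obtain ⟨e0, ecol⟩ := h₃ e
        refine .inl ⟨e0, fun v hv => ?_, fun u v huv => ?_⟩
        · rw [ecol v hv]
          exact ⟨Nat.one_le_iff_ne_zero.2 (hall v hv), hg.le v hv⟩
        · rw [ecol u (Net.N_lt_left huv), ecol v (Net.N_lt huv)]
          exact hg.proper u v huv (hall u (Net.N_lt_left huv))
      · exact .inr ⟨h₃' (by omega), hno⟩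
    · rw [max_eq_right hX]
      nlinarith [Nat.mul_le_mul_right (900 * (g.off g.n + g.n) + 200) hX]

end WordRAM

open WordRAM

section final

variable {n : ℕ} {G : SimpleGraph (Fin n)} {k : ℕ} {s : State}

/-- The adjacency lists that the initial state presents. -/
def netOf (h : IsInput G k s) : Net where
  n := n
  off := s.arrs 0
  nb := s.arrs 1
  off_zero := h.off_zero
  mono v hv := h.off_mono ⟨v, hv⟩
  out v hv := h.off_rest _ (by omega)
  inj v hv i j h1 h2 h3 h4 e := (h.nbrs ⟨v, hv⟩).injOn ⟨h1, h2⟩ ⟨h3, h4⟩ e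
  lt v hv j h1 h2 := by
    obtain ⟨w, -, e⟩ := (h.nbrs ⟨v, hv⟩).mapsTo ⟨h1, h2⟩
    rw [← e]; exact w.2
  symm v hv j h1 h2 := by
    obtain ⟨w, hw, e⟩ := (h.nbrs ⟨v, hv⟩).mapsTo ⟨h1, h2⟩
    obtain ⟨i, hi, e'⟩ := (h.nbrs w).surjOn ⟨⟨v, hv⟩, SimpleGraph.Adj.symm hw, rfl⟩
    simp only at e
    rw [← e]
    exact ⟨i, hi.1, hi.2, e'⟩
  irrefl v hv j h1 h2 e := by
    obtain ⟨w, hw, e'⟩ := (h.nbrs ⟨v, hv⟩).mapsTo ⟨h1, h2⟩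
    have : w = ⟨v, hv⟩ := Fin.ext (e'.trans e)
    rw [this] at hw
    exact G.loopless.irrefl _ hw

theorem mem_netOf (h : IsInput G k s) (v w : Fin n) : (w : ℕ) ∈ (netOf h).N v ↔ G.Adj v w := by
  rw [Net.mem_N]
  constructor
  · rintro ⟨j, h1, h2, e⟩
    obtain ⟨w', hw', e'⟩ := (h.nbrs v).mapsTo ⟨h1, h2⟩
    have : w' = w := Fin.ext (e'.trans e)
    exact this ▸ hw'
  · intro hw
    obtain ⟨j, hj, e⟩ := (h.nbrs v).surjOn ⟨w, hw, rfl⟩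
    exact ⟨j, hj.1, hj.2, e⟩

open scoped Classical in
theorem degree_netOf (h : IsInput G k s) (v : Fin n) : G.degree v = (netOf h).deg v := by
  rw [← Net.card_N, ← SimpleGraph.card_neighborFinset_eq_degree,
    ← Finset.card_map Fin.valEmbedding]
  congr 1
  ext w
  simp only [Finset.mem_map, SimpleGraph.mem_neighborFinset, Fin.valEmbedding_apply]
  constructor
  · rintro ⟨w', hw', rfl⟩
    exact (mem_netOf h v w').2 hw'
  · intro hw
    have hwn : w < n := Net.N_lt hw
    exact ⟨⟨w, hwn⟩, (mem_netOf h v ⟨w, hwn⟩).1 hw, rfl⟩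

theorem off_netOf (h : IsInput G k s) : (netOf h).off (netOf h).n = 2 * numEdges G := by
  classical
  rw [← Net.sum_deg _ le_rfl, show (netOf h).n = n from rfl, Finset.sum_range]
  have := G.sum_degrees_eq_twice_card_edges
  simp only [degree_netOf h] at this
  rw [this, numEdges]

theorem card_bigSet_netOf (h : IsInput G k s) :
    (bigSet (netOf h) k).card = numBigVertices G k := by
  classical
  rw [numBigVertices, ← Finset.card_map Fin.valEmbedding]
  congr 1
  ext w
  simp only [bigSet, Finset.mem_filter, Finset.mem_range, Finset.mem_map, Finset.mem_univ, true_and,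
    Fin.valEmbedding_apply]
  constructor
  · rintro ⟨h1, h2⟩
    exact ⟨⟨w, h1⟩, by rw [← degree_netOf h ⟨w, h1⟩] at h2; convert h2, rfl⟩
  · rintro ⟨w', hw', rfl⟩
    refine ⟨w'.2, ?_⟩
    rw [← degree_netOf h w']
    convert hw'

/-- The program is correct, and its running time is linear for each colouring of the vertices of
large degree that is tried. -/
theorem solve_correct (h : IsInput G k s) {B : ℕ} (hB : bound (netOf h) k ≤ B) :
    ∃ t s', Runs B solve s t s' ∧ OutputsColouring G k s' ∧
      t ≤ max 1 (min k (numBigVertices G k) ^ numBigVertices G k) *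
        (4000 * (n + numEdges G) + 300) := by
  obtain ⟨t, s', hrun, hout, ht⟩ := solve_spec hB ⟨h.order, h.colours, rfl, rfl⟩ h.vars_rest
    h.arrs_rest
  refine ⟨t, s', hrun, ?_, ht.trans ?_⟩
  · rcases hout with ⟨e, h1, h2⟩ | ⟨e, h1⟩
    · have hlt : ∀ v : Fin n, s'.arrs 0 v - 1 < k := fun v => by
        have := h1 v v.2; omega
      refine .inl ⟨e, SimpleGraph.Coloring.mk (fun v => ⟨s'.arrs 0 v - 1, hlt v⟩) ?_, fun v => ?_⟩
      · intro v w hvw e'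
        have h3 := h1 v v.2
        have h4 := h1 w w.2
        have h5 := h2 v w ((mem_netOf h v w).2 hvw)
        have h6 : s'.arrs 0 v - 1 = s'.arrs 0 w - 1 := by simpa using e'
        omega
      · have := h1 v v.2
        change _ = s'.arrs 0 v - 1 + 1
        omega
    · refine .inr ⟨e, fun ⟨φ⟩ => h1 ⟨fun v => if hv : v < n then φ ⟨v, hv⟩ + 1 else 0,
        fun v hv => ?_, fun u v huv => ?_⟩⟩
      · have hv' : v < n := hv
        have := (φ ⟨v, hv'⟩).2
        simp only [hv', dif_pos]
        omega
      · have hu : u < n := Net.N_lt_left huv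
        have hv : v < n := Net.N_lt huv
        simp only [hu, hv, dif_pos]
        have := φ.valid ((mem_netOf h ⟨u, hu⟩ ⟨v, hv⟩).1 huv)
        intro e'
        exact this (Fin.ext (by omega))
  · rw [card_bigSet_netOf, off_netOf]
    refine Nat.mul_le_mul_left _ ?_
    change 2000 * (2 * numEdges G + n) + 300 ≤ _
    omega

theorem bound_netOf_le (h : IsInput G k s) {y c : ℕ} (hy : 2 ≤ y) (hn : n + 2 ≤ 2 * y)
    (hnk : numEdges G + k ≤ y) (hc : 5 ≤ c) : bound (netOf h) k ≤ y ^ c := by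
  have h1 : bound (netOf h) k = (n + 2) ^ 2 + 2 * numEdges G + k + 10 := by
    unfold bound; rw [off_netOf]; rfl
  rw [h1]
  have h2 : 8 ≤ y ^ 3 := by
    calc 8 = 2 ^ 3 := by norm_num
      _ ≤ y ^ 3 := Nat.pow_le_pow_left hy 3
  have h3 : (n + 2) ^ 2 ≤ 4 * y ^ 2 := by
    calc (n + 2) ^ 2 ≤ (2 * y) ^ 2 := Nat.pow_le_pow_left hn 2
      _ = 4 * y ^ 2 := by ring
  calc (n + 2) ^ 2 + 2 * numEdges G + k + 10 ≤ 8 * y ^ 2 := by nlinarith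
    _ ≤ y ^ 3 * y ^ 2 := Nat.mul_le_mul_right _ h2
    _ = y ^ 5 := by ring
    _ ≤ y ^ c := Nat.pow_le_pow_right (by omega) hc

end final

theorem theorem6 :
    (∃ (P : WordRAM.Prog) (C : ℕ),
      ∀ (n : ℕ) (G : SimpleGraph (Fin n)) (k p : ℕ), 0 < n → 0 < k → numBigVertices G k ≤ p →
        ∀ s : WordRAM.State, WordRAM.IsInput G k s →
          ∃ (t : ℕ) (s' : WordRAM.State),
            WordRAM.Runs ((n + numEdges G + k) ^ C) P s t s' ∧
            t ≤ min (k ^ p) (p ^ p) * (C * (n + numEdges G)) ∧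
            WordRAM.OutputsColouring G k s') ∧
    IsFPT (fun _ G k => G.Colorable k) (fun _ G k => numBigVertices G k) := by
  constructor
  · obtain ⟨C, hC⟩ : ∃ C, C = 4300 := ⟨_, rfl⟩
    refine ⟨solve, C, fun n G k p hn hk hq s h => ?_⟩
    obtain ⟨t, s', hrun, hout, ht⟩ := solve_correct h (bound_netOf_le h
      (y := n + numEdges G + k) (c := C) (by omega) (by omega) (by omega) (by omega))
    refine ⟨t, s', hrun, ht.trans (Nat.mul_le_mul (max_le ?_ (le_min ?_ ?_)) (by rw [hC]; omega)), hout⟩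
    · refine Nat.one_le_iff_ne_zero.2 fun h0 => ?_
      rcases min_choice (k ^ p) (p ^ p) with e | e <;> rw [e] at h0
      · exact absurd (Nat.pow_eq_zero.1 h0).1 hk.ne'
      · exact (Nat.pow_eq_zero.1 h0).2 (Nat.pow_eq_zero.1 h0).1
    · exact (Nat.pow_le_pow_left (min_le_left _ _) _).trans (Nat.pow_le_pow_right hk hq)
    · rcases Nat.eq_zero_or_pos p with rfl | hp
      · simp [Nat.le_zero.1 hq]
      · exact (Nat.pow_le_pow_left ((min_le_right _ _).trans hq) _).trans
          (Nat.pow_le_pow_right hp hq)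
  · refine ⟨solve, fun q => 4300 * q ^ q, 5, ?_, fun n G k s h => ?_⟩
    · have : Primrec₂ ((· ^ ·) : ℕ → ℕ → ℕ) := Primrec₂.unpaired'.1 Nat.Primrec.pow
      exact (Primrec.nat_mul.comp (.const 4300) (this.comp .id .id)).to_comp
    · obtain ⟨q, hq⟩ : ∃ q, q = numBigVertices G k := ⟨_, rfl⟩
      have hpos : 1 ≤ q ^ q := by
        rcases Nat.eq_zero_or_pos q with rfl | h0
        · simp
        · exact Nat.one_le_pow _ _ h0
      obtain ⟨t, s', hrun, hout, ht⟩ := solve_correct h (bound_netOf_le h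
        (y := n + numEdges G + k + 2) (c := 5) (by omega) (by omega) (by omega) le_rfl)
      refine ⟨t, s', hrun.mono ?_, ?_, ?_⟩
      · simp only [← hq]
        exact Nat.le_mul_of_pos_left _ (by omega)
      · simp only [← hq] at ht ⊢
        obtain ⟨z, hz⟩ : ∃ z, z = n + numEdges G + Nat.size k + 1 := ⟨_, rfl⟩
        rw [← hz]
        calc t ≤ max 1 (min k q ^ q) * (4000 * (n + numEdges G) + 300) := ht
          _ ≤ q ^ q * (4300 * z) :=
            Nat.mul_le_mul (max_le hpos (Nat.pow_le_pow_left (min_le_right _ _) _)) (by omega)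
          _ = 4300 * q ^ q * z := by ring
          _ ≤ 4300 * q ^ q * z ^ 5 := Nat.mul_le_mul_left _ (Nat.le_self_pow (by omega) z)
      · rcases hout with ⟨e, φ, -⟩ | ⟨e, hno⟩
        · exact .inl ⟨e, ⟨φ⟩⟩
        · exact .inr ⟨e, hno⟩
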